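/- Let $d\ge 1$, $p\ge 2$, $T>0$, $Q=(0,1)^d$ and $Q_T=(0,T)\times Q$; all functions of $x$ are $Q$-periodic, so that $Q$ is the flat torus, and $W^{1,q}(Q)$ denotes the periodic Sobolev spaces. $H^1_0(Q)$ is the space of functions in $W^{1,2}(Q)$ with zero average, and $H^{-1}(Q)$ is its dual. For a vector or a matrix $\xi$ put $V(\xi)=(|\xi|^2+|\xi|^p)^{1/2}$. Let $W\in C^2(\mathbb{R}^{d\times d})$ be strongly quasiconvex, i.e. there is $c_0>0$ such that $$\int_Q \big[W(\xi+\nabla\varphi)-W(\xi)\big]\,dx\ \ge\ c_0\int_Q|V(\nabla\varphi)|^2\,dx\qquad\text{for all }\xi\in\mathbb{R}^{d\times d},\ \varphi\in W^{1,\infty}(Q;\mathbb{R}^d),$$ and let $|W(\xi)|\le c(1+|\xi|^p)$ for some constant $c$ and all $\xi\in\mathbb{R}^{d\times d}$. Let $\bar F=\nabla\bar y\in C^0(\overline{Q}_T;\mathbb{R}^{d\times d})$, where $\bar y(t,\cdot)$ has zero average over $Q$ for each $t\in[0,T]$, and let $$G(t,x,\xi)=W(\bar F(t,x)+\xi)-W(\bar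 F(t,x))-DW(\bar F(t,x))\cdot\xi .$$ Then there are constants $C_0,C_1>0$, depending only on $d,p,T,W$ and $\bar y$ (so neither on $\nu^F$ nor on $t_0$), with the following property. Let $\nu^F=(\nu^F_{t,x})_{(t,x)\in Q_T}$ be a weakly-$*$ measurable family of probability measures on $\mathbb{R}^{d\times d}$ generated by a sequence of spatial gradients $(\nabla y^k)$, in the sense that $g(\nabla y^k)\rightharpoonup\langle\nu^F,g\rangle$ weakly in $L^1(Q_T)$ for every continuous $g$ with $g(\xi)/|\xi|^p\to0$ as $|\xi|\to\infty$, where - $(y^k)$ is bounded in $L^\infty(0,T;W^{1,p}(Q))\cap L^\infty(0,T;H^1_0(Q))$, and - $(\partial_t\nabla y^k)$ is bounded in $L^\infty(0,T;H^{-1}(Q))$. Then the centre of mass of $\nu^F$ is a spatial gradient, $\langle\nu^F,\mathrm{id}\rangle=\nabla y$, with $y(t,\cdot)\in W^{1,p}(Q)$ of zero average for a.e. $t$, and for this $y$ and almost every $t_0\in(0,T)$ $$\int_Q\big\langle\nu^F_{t_0,x},|V(\xi-\bar F(t_0,x))|^2\big\rangle\,dx\ \le\ C_1\int_Q\big\langle\nu^F_{t_0,x},G(t_0,x,\xi-\bar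 F(t_0,x))\big\rangle\,dx+C_0\int_Q|V(y(t_0,x)-\bar y(t_0,x))|^2\,dx ,$$ where all integrals converge. -/

import Mathlib

open MeasureTheory Filter Topology Set
open scoped NNReal ENNReal ContDiff

noncomputable section

namespace QCGarding

/-- Vectors of `ℝ^d` with the Euclidean norm. -/
abbrev Vec (d : ℕ) := EuclideanSpace ℝ (Fin d)

/-- Real `d × d` matrices with the Frobenius norm; `ξ (i, j)` is the entry in row `i`, column `j`. -/
abbrev Mat (d : ℕ) := EuclideanSpace ℝ (Fin d × Fin d)

/-- The unit cube `(0,1)^d`, the fundamental cell of the flat torus. -/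
def Q (d : ℕ) : Set (Vec d) := {x | ∀ i, x i ∈ Ioo (0 : ℝ) 1}

/-- Lebesgue measure on the cell `Q`. -/
def volQ (d : ℕ) : Measure (Vec d) := volume.restrict (Q d)

/-- Lebesgue measure on the time interval `(0,T)`. -/
def volT (T : ℝ) : Measure ℝ := volume.restrict (Ioo 0 T)

/-- Lebesgue measure on the space-time cylinder `Q_T = (0,T) × Q`. -/
def volQT (d : ℕ) (T : ℝ) : Measure (ℝ × Vec d) := (volT T).prod (volQ d)

/-- `Q`-periodicity: period `1` in each coordinate direction. -/
def IsPeriodic {d : ℕ} {α : Type*} (f : Vec d → α) : Prop :=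
  ∀ (i : Fin d) (x : Vec d), f (x + EuclideanSpace.single i 1) = f x

/-- Smooth `Q`-periodic functions. -/
def IsTest {d : ℕ} (φ : Vec d → ℝ) : Prop := ContDiff ℝ ∞ φ ∧ IsPeriodic φ

/-- The classical partial derivative `∂_j φ`. -/
def partialD {d : ℕ} (j : Fin d) (φ : Vec d → ℝ) (x : Vec d) : ℝ :=
  fderiv ℝ φ x (EuclideanSpace.single j 1)

/-- `g` is the weak derivative `∂_j u` on the torus. A periodic function is given by its values on
the cell; testing against all smooth periodic functions, not only those with compact support
in `Q`, makes `g` the distributional derivative of the periodic extension of `u`. -/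
def IsWeakDeriv {d : ℕ} (j : Fin d) (u g : Vec d → ℝ) : Prop :=
  ∀ φ : Vec d → ℝ, IsTest φ →
    ∫ x, u x * partialD j φ x ∂(volQ d) = -∫ x, g x * φ x ∂(volQ d)

/-- `u ∈ W^{1,q}(Q; ℝ^d)` (periodic), with weak gradient `g`, `g_{ij} = ∂_j u_i`. -/
structure IsSobolev {d : ℕ} (q : ℝ≥0∞) (u : Vec d → Vec d) (g : Vec d → Mat d) : Prop where
  memLp : MemLp u q (volQ d)
  memLp_grad : MemLp g q (volQ d)
  weak_deriv : ∀ i j, IsWeakDeriv j (fun x => u x i) (fun x => g x (i, j))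

/-- `V(ξ) = (|ξ|² + |ξ|^p)^{1/2}`. -/
def V {E : Type*} [NormedAddCommGroup E] (p : ℝ) (ξ : E) : ℝ :=
  Real.sqrt (‖ξ‖ ^ 2 + ‖ξ‖ ^ p)

/-- Strong quasiconvexity with exponent `p`. -/
def StronglyQuasiconvex {d : ℕ} (p : ℝ) (W : Mat d → ℝ) : Prop :=
  ∃ c₀ : ℝ, 0 < c₀ ∧ ∀ (ξ : Mat d) (φ : Vec d → Vec d) (g : Vec d → Mat d), IsSobolev ∞ φ g →
    c₀ * ∫ x, V p (g x) ^ 2 ∂(volQ d) ≤ ∫ x, (W (ξ + g x) - W ξ) ∂(volQ d)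

/-- The second-order Taylor remainder `W(F + ξ) - W(F) - DW(F) · ξ`. -/
def G {d : ℕ} (W : Mat d → ℝ) (F ξ : Mat d) : ℝ := W (F + ξ) - W F - fderiv ℝ W F ξ

section TestHelpers

theorem memLp_top_of_continuous {d : ℕ} {f : Vec d → ℝ} (hf : Continuous f) : MemLp f ∞ (volQ d) := by
  have hb : Bornology.IsBounded (Q d) := by
    refine Metric.isBounded_iff_subset_closedBall 0 |>.2 ⟨Real.sqrt d, fun x hx => ?_⟩
    rw [mem_closedBall_zero_iff, EuclideanSpace.norm_eq]
    refine Real.sqrt_le_sqrt ?_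
    calc ∑ i, ‖x i‖ ^ 2 ≤ ∑ _i : Fin d, (1 : ℝ) := Finset.sum_le_sum fun i _ => by
          have h := hx i
          rw [Real.norm_eq_abs, sq_abs]
          nlinarith [h.1, h.2]
      _ = d := by simp
  obtain ⟨C, hC⟩ := hb.isCompact_closure.exists_bound_of_continuousOn hf.continuousOn
  have hm : MeasurableSet (Q d) := by
    have : Q d = ⋂ i, (fun x : Vec d => x i) ⁻¹' Ioo 0 1 := by ext; simp [Q]
    rw [this]
    exact MeasurableSet.iInter fun i => (by fun_prop : Continuous fun x : Vec d => x i).measurable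
      measurableSet_Ioo
  exact memLp_top_of_bound hf.aestronglyMeasurable C
    ((ae_restrict_iff' hm).2 (ae_of_all _ fun x hx => hC x (subset_closure hx)))

instance finiteVolQ (d : ℕ) : IsFiniteMeasure (volQ d) := by
  have hb : Bornology.IsBounded (Q d) := by
    refine Metric.isBounded_iff_subset_closedBall 0 |>.2 ⟨Real.sqrt d, fun x hx => ?_⟩
    rw [mem_closedBall_zero_iff, EuclideanSpace.norm_eq]
    refine Real.sqrt_le_sqrt ?_
    calc ∑ i, ‖x i‖ ^ 2 ≤ ∑ _i : Fin d, (1 : ℝ) := Finset.sum_le_sum fun i _ => by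
          have h := hx i
          rw [Real.norm_eq_abs, sq_abs]
          nlinarith [h.1, h.2]
      _ = d := by simp
  exact ⟨by rw [volQ, Measure.restrict_apply_univ]; exact hb.measure_lt_top⟩

theorem IsTest.partialD_continuous {d : ℕ} {φ : Vec d → ℝ} (hφ : IsTest φ) (j : Fin d) :
    Continuous (partialD j φ) :=
  (hφ.1.continuous_fderiv (by simp)).clm_apply continuous_const

theorem integrable_mul_cont {d : ℕ} {u f : Vec d → ℝ} (hu : MemLp u 2 (volQ d))
    (hf : Continuous f) : Integrable (fun x => u x * f x) (volQ d) :=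
  (hu.integrable (by norm_num)).mul_of_top_left (memLp_top_of_continuous hf)

theorem memLp_coord {d : ℕ} {g : Vec d → Vec d} (hg : MemLp g 2 (volQ d)) (j : Fin d) :
    MemLp (fun x => g x j) 2 (volQ d) :=
  (EuclideanSpace.proj (𝕜 := ℝ) j).comp_memLp' hg

end TestHelpers

/-- The Hilbert space `H¹₀(Q)` of scalar periodic functions in `W^{1,2}(Q)` with zero average, as the
(graph) space of pairs `(u, ∇u) ∈ L² × L²`, with norm `(‖u‖² + ‖∇u‖²)^{1/2}`. -/
def H10 (d : ℕ) : Submodule ℝ (WithLp 2 (Lp ℝ 2 (volQ d) × Lp (Vec d) 2 (volQ d))) where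
  carrier := {w | ∫ x, w.fst x ∂(volQ d) = 0 ∧
    ∀ j, IsWeakDeriv j (fun x => w.fst x) (fun x => w.snd x j)}
  zero_mem' := by
    have h1 : (fun x => (0 : Lp ℝ 2 (volQ d)) x) =ᵐ[volQ d] 0 := Lp.coeFn_zero _ _ _
    have h2 : (fun x => (0 : Lp (Vec d) 2 (volQ d)) x) =ᵐ[volQ d] 0 := Lp.coeFn_zero _ _ _
    refine ⟨?_, fun j φ _ => ?_⟩
    · exact (integral_congr_ae h1).trans (by simp)
    · have e1 : ∫ x, (0 : Lp ℝ 2 (volQ d)) x * partialD j φ x ∂(volQ d) = 0 := by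
        refine integral_eq_zero_of_ae ?_
        filter_upwards [h1] with x hx
        simp only [hx, Pi.zero_apply, zero_mul]
      have e2 : ∫ x, (0 : Lp (Vec d) 2 (volQ d)) x j * φ x ∂(volQ d) = 0 := by
        refine integral_eq_zero_of_ae ?_
        filter_upwards [h2] with x hx
        simp only [hx, Pi.zero_apply, PiLp.zero_apply, zero_mul]
      exact e1.trans (by rw [← neg_zero, ← e2]; rfl)
  add_mem' := by
    rintro a b ⟨ha, ha'⟩ ⟨hb, hb'⟩
    have h1 := Lp.coeFn_add a.fst b.fst
    have h2 := Lp.coeFn_add a.snd b.snd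
    refine ⟨?_, fun j φ hφ => ?_⟩
    · have e : ∫ x, (a + b).fst x ∂(volQ d) = ∫ x, (a.fst x + b.fst x) ∂(volQ d) :=
        integral_congr_ae h1
      rw [e, integral_add ((Lp.memLp a.fst).integrable (by norm_num))
        ((Lp.memLp b.fst).integrable (by norm_num)), ha, hb, add_zero]
    · have e1 : ∫ x, (a + b).fst x * partialD j φ x ∂(volQ d)
          = ∫ x, (a.fst x * partialD j φ x + b.fst x * partialD j φ x) ∂(volQ d) := by
        refine integral_congr_ae ?_
        filter_upwards [h1] with x hx
        rw [WithLp.add_fst, hx, Pi.add_apply, add_mul]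
      have e2 : ∫ x, (a + b).snd x j * φ x ∂(volQ d)
          = ∫ x, (a.snd x j * φ x + b.snd x j * φ x) ∂(volQ d) := by
        refine integral_congr_ae ?_
        filter_upwards [h2] with x hx
        rw [WithLp.add_snd, hx, Pi.add_apply, PiLp.add_apply, add_mul]
      rw [e1, e2, integral_add (integrable_mul_cont (Lp.memLp _) (hφ.partialD_continuous j))
        (integrable_mul_cont (Lp.memLp _) (hφ.partialD_continuous j)),
        integral_add (integrable_mul_cont (memLp_coord (Lp.memLp _) j) hφ.1.continuous)
        (integrable_mul_cont (memLp_coord (Lp.memLp _) j) hφ.1.continuous),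
        ha' j φ hφ, hb' j φ hφ]
      ring
  smul_mem' := by
    rintro c a ⟨ha, ha'⟩
    have h1 := Lp.coeFn_smul c a.fst
    have h2 := Lp.coeFn_smul c a.snd
    refine ⟨?_, fun j φ hφ => ?_⟩
    · have e : ∫ x, (c • a).fst x ∂(volQ d) = ∫ x, c * a.fst x ∂(volQ d) :=
        integral_congr_ae h1
      rw [e, integral_const_mul, ha, mul_zero]
    · have e1 : ∫ x, (c • a).fst x * partialD j φ x ∂(volQ d)
          = ∫ x, c * (a.fst x * partialD j φ x) ∂(volQ d) := by
        refine integral_congr_ae ?_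
        filter_upwards [h1] with x hx
        rw [WithLp.smul_fst, hx, Pi.smul_apply, smul_eq_mul, mul_assoc]
      have e2 : ∫ x, (c • a).snd x j * φ x ∂(volQ d)
          = ∫ x, c * (a.snd x j * φ x) ∂(volQ d) := by
        refine integral_congr_ae ?_
        filter_upwards [h2] with x hx
        rw [WithLp.smul_snd, hx, Pi.smul_apply, PiLp.smul_apply, smul_eq_mul, mul_assoc]
      rw [e1, e2, integral_const_mul, integral_const_mul, ha' j φ hφ]
      ring

/-- `H^{-1}(Q) = (H¹₀(Q))'`. -/
abbrev HMinusOne (d : ℕ) := StrongDual ℝ (H10 d)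

/-- `h ∈ L^∞(0,T; H^{-1}(Q))`, with essential supremum at most `M`, is the distributional time
derivative on `(0,T)` of the scalar function `f`, where `f(t) ∈ L²(Q)` acts on `H¹₀(Q)` through the
`L²(Q)` pairing. -/
structure IsTimeDeriv {d : ℕ} (T M : ℝ) (f : ℝ → Vec d → ℝ) (h : ℝ → HMinusOne d) : Prop where
  meas : AEStronglyMeasurable h (volT T)
  bound : ∀ᵐ t ∂(volT T), ‖h t‖ ≤ M
  eq : ∀ η : ℝ → ℝ, ContDiff ℝ ∞ η → HasCompactSupport η → tsupport η ⊆ Ioo 0 T →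
    ∀ ψ : H10 d,
      ∫ t, deriv η t * ∫ x, f t x * ψ.1.fst x ∂(volQ d) ∂(volT T)
        = -∫ t, η t * h t ψ ∂(volT T)

/-- `(y^k)` is bounded in `L^∞(0,T; W^{1,p}(Q)) ∩ L^∞(0,T; H¹₀(Q))`, with spatial gradients
`∇y^k = F^k` such that `(∂_t ∇y^k)` is bounded in `L^∞(0,T; H^{-1}(Q))`. -/
structure IsBddGradientSeq {d : ℕ} (p T : ℝ) (y : ℕ → ℝ → Vec d → Vec d)
    (F : ℕ → ℝ → Vec d → Mat d) : Prop where
  meas : ∀ k, AEStronglyMeasurable (Function.uncurry (y k)) (volQT d T)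
  meas_grad : ∀ k, AEStronglyMeasurable (Function.uncurry (F k)) (volQT d T)
  sobolev : ∀ k, ∀ᵐ t ∂(volT T), IsSobolev (ENNReal.ofReal p) (y k t) (F k t)
  zero_mean : ∀ k, ∀ᵐ t ∂(volT T), ∫ x, y k t x ∂(volQ d) = 0
  bound_W1p : ∃ M : ℝ≥0, ∀ k, ∀ᵐ t ∂(volT T),
    eLpNorm (y k t) (ENNReal.ofReal p) (volQ d) + eLpNorm (F k t) (ENNReal.ofReal p) (volQ d) ≤ M
  bound_H10 : ∃ M : ℝ≥0, ∀ k, ∀ᵐ t ∂(volT T),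
    eLpNorm (y k t) 2 (volQ d) + eLpNorm (F k t) 2 (volQ d) ≤ M
  bound_dt : ∃ M : ℝ, ∀ k i j, ∃ h : ℝ → HMinusOne d, IsTimeDeriv T M (fun t x => F k t x (i, j)) h

/-- The space `C_q`: continuous functions `g` with `g(ξ)/|ξ|^q → 0` as `|ξ| → ∞`. -/
def IsCq {d : ℕ} (q : ℝ) (g : Mat d → ℝ) : Prop :=
  Continuous g ∧ Tendsto (fun ξ => g ξ / ‖ξ‖ ^ q) (cocompact (Mat d)) (𝓝 0)

/-- Young measures on `Q_T`: weakly-* measurable families of probability measures on matrices. -/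
structure IsYoungMeasure {d : ℕ} (T : ℝ) (ν : ℝ → Vec d → Measure (Mat d)) : Prop where
  prob : ∀ᵐ z ∂(volQT d T), IsProbabilityMeasure (ν z.1 z.2)
  meas : ∀ g : Mat d → ℝ, IsCq 0 g →
    AEStronglyMeasurable (fun z : ℝ × Vec d => ∫ ξ, g ξ ∂(ν z.1 z.2)) (volQT d T)

/-- `(F^k)` generates `ν` as a `p`-Young measure: for all `g ∈ C_p`, `⟨ν, g⟩` is a (well-defined)
element of `L¹(Q_T)` and `g(F^k) ⇀ ⟨ν, g⟩` weakly in `L¹(Q_T)`. -/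
def Generates {d : ℕ} (p T : ℝ) (F : ℕ → ℝ → Vec d → Mat d)
    (ν : ℝ → Vec d → Measure (Mat d)) : Prop :=
  ∀ g : Mat d → ℝ, IsCq p g →
    (∀ᵐ z ∂(volQT d T), Integrable g (ν z.1 z.2)) ∧
    Integrable (fun z : ℝ × Vec d => ∫ ξ, g ξ ∂(ν z.1 z.2)) (volQT d T) ∧
    ∀ b : ℝ × Vec d → ℝ, MemLp b ∞ (volQT d T) →
      Tendsto (fun k => ∫ z, g (F k z.1 z.2) * b z ∂(volQT d T)) atTop
        (𝓝 (∫ z, (∫ ξ, g ξ ∂(ν z.1 z.2)) * b z ∂(volQT d T)))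

/-- `y` is the map of zero spatial average, `y(t) ∈ W^{1,p}(Q)`, whose spatial gradient is the centre
of mass of `ν`: `∇y = ⟨ν, id⟩`. -/
structure IsCentreOfMassPotential {d : ℕ} (p T : ℝ) (ν : ℝ → Vec d → Measure (Mat d))
    (y : ℝ → Vec d → Vec d) : Prop where
  meas : AEStronglyMeasurable (Function.uncurry y) (volQT d T)
  sobolev : ∀ᵐ t ∂(volT T),
    IsSobolev (ENNReal.ofReal p) (y t) (fun x => ∫ ξ, ξ ∂(ν t x))
  zero_mean : ∀ᵐ t ∂(volT T), ∫ x, y t x ∂(volQ d) = 0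

/-- `F̄ = ∇ȳ` is continuous on `[0,T]` times the torus, with `ȳ` of zero spatial average. -/
structure IsContinuousGradient {d : ℕ} (p T : ℝ) (ybar : ℝ → Vec d → Vec d)
    (Fbar : ℝ → Vec d → Mat d) : Prop where
  continuous : ContinuousOn (Function.uncurry Fbar) (Icc 0 T ×ˢ univ)
  periodic : ∀ t ∈ Icc 0 T, IsPeriodic (Fbar t)
  sobolev : ∀ t ∈ Icc 0 T, IsSobolev (ENNReal.ofReal p) (ybar t) (Fbar t)
  zero_mean : ∀ t ∈ Icc 0 T, ∫ x, ybar t x ∂(volQ d) = 0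

/-- The averaged convexity bound at a time `t₀`; every integral in it is a convergent one. -/
structure GardingBoundAt {d : ℕ} (p : ℝ) (W : Mat d → ℝ) (ybar : ℝ → Vec d → Vec d)
    (Fbar : ℝ → Vec d → Mat d) (ν : ℝ → Vec d → Measure (Mat d)) (y : ℝ → Vec d → Vec d)
    (C₁ C₀ t₀ : ℝ) : Prop where
  integrable_V_fibre : ∀ᵐ x ∂(volQ d), Integrable (fun ξ => V p (ξ - Fbar t₀ x) ^ 2) (ν t₀ x)
  integrable_V : Integrable (fun x => ∫ ξ, V p (ξ - Fbar t₀ x) ^ 2 ∂(ν t₀ x)) (volQ d)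
  integrable_G_fibre : ∀ᵐ x ∂(volQ d),
    Integrable (fun ξ => G W (Fbar t₀ x) (ξ - Fbar t₀ x)) (ν t₀ x)
  integrable_G : Integrable (fun x => ∫ ξ, G W (Fbar t₀ x) (ξ - Fbar t₀ x) ∂(ν t₀ x)) (volQ d)
  integrable_y : Integrable (fun x => V p (y t₀ x - ybar t₀ x) ^ 2) (volQ d)
  bound :
    ∫ x, ∫ ξ, V p (ξ - Fbar t₀ x) ^ 2 ∂(ν t₀ x) ∂(volQ d)
      ≤ C₁ * ∫ x, ∫ ξ, G W (Fbar t₀ x) (ξ - Fbar t₀ x) ∂(ν t₀ x) ∂(volQ d)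
        + C₀ * ∫ x, V p (y t₀ x - ybar t₀ x) ^ 2 ∂(volQ d)

end QCGarding

end

/-! The inequality for the Young measure is obtained by testing the generating sequence, time by
time, with bounded integrands that do not see concentrations, and then removing the truncation.

**The integrand.** Testing strong quasiconvexity with plane waves shows that `W` is convex in every
matrix entry (`QuasiconvexWith.convexOn_line`). With the growth of `W` this makes `W` locally
Lipschitz with a constant of order `|ξ|^p`, so the Taylor remainder `G(F, ξ)` is bounded by `V(ξ)²`
and depends on `F`, on bounded sets, uniformly continuously relative to `V(ξ)²`
(`IsIntegrand.abs_G_le`, `IsIntegrand.abs_G_sub_le`).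

**Gårding's inequality** for periodic Lipschitz maps `φ` (`garding_lipschitz`) reads
`c₀/2 ∫ V(∇φ)² ≤ ∫ G(F̄, ∇φ) + C₀ ∫ V(φ)²`. Strong quasiconvexity at the matrix `F̄(z)` is tested with
`φ` times a bump function around `z` at a scale where `F̄` is almost constant; averaging over `z`
turns the local inequalities into a global one, and the transition shells of the bumps are so thin
that their contribution is absorbed on the left.

**Truncation.** Put `excess = (2/c₀) G - V²`. A Sobolev map `u` is mollified and replaced by its
Lipschitz truncation at level `l` (`exists_lipschitz_truncation`), which agrees with it off a small
set by the weak `(1,1)` estimate for the maximal function. The result is a lower bound for the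
integral of the excess restricted to `|∇u| ≤ 2 l`, with an error of the form
`l^(p-1) ∫ (|u| - l/8)₊ + (|∇u| - l/8)₊` (`truncated_garding`). For a single `l` this error need not
be small, because `|∇u|^p` may concentrate along the sequence. But the sum of `l^(p-1) (s - l/8)₊`
over all `l = 2^j` is at most a multiple of `s^p` (`sum_dyadic_tail_le`), so that the average over
`N` dyadic levels has an error of order `1/N`, with a constant given by the energy bound alone
(`averaged_garding`). No decomposition of the sequence into oscillating and concentrating parts is
needed.

**Compactness.** By the bound on the time derivatives, the gradients converge weakly for almost
every time (`tendsto_ae_of_hasBddTimeDeriv`, `ae_tendsto_conv`), and a Rellich type argument gives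
strong convergence of the maps (`tendsto_integral_V_sq_sub`). Hence the centre of mass is a gradient
(`exists_potential`), and the lower order term converges (`ae_tendsto_of_potential`).

**The limit.** Truncated integrands are admissible test functions for the Young measure
(`tendsto_integral_truncated`), and a lower bound valid for the whole sequence at almost every time
passes to the weak limit (`ae_le_of_tendsto_setIntegral`). Since the Young measure has finite
`p`-th moments, the number of levels can be sent to infinity by dominated convergence
(`integrable_and_tendsto_truncated`). The constant `C₁` is `2/c₀`, and `C₀` comes from Gårding's
inequality, hence depends only on `d`, `p`, `W` and the bound and modulus of continuity of `F̄`. -/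

open MeasureTheory Filter Topology Set
open scoped NNReal ENNReal ContDiff

noncomputable section

namespace QCGarding

/-! ### The unit cell and periodic functions -/

theorem measurableSet_Q (d : ℕ) : MeasurableSet (Q d) := by
  have : Q d = ⋂ i, (fun x : Vec d => x i) ⁻¹' Ioo 0 1 := by ext; simp [Q]
  rw [this]
  exact MeasurableSet.iInter fun i => (by fun_prop : Continuous fun x : Vec d => x i).measurable
    measurableSet_Ioo

theorem isOpen_Q (d : ℕ) : IsOpen (Q d) := by
  have : Q d = ⋂ i, (fun x : Vec d => x i) ⁻¹' Ioo 0 1 := by ext; simp [Q]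
  rw [this]
  exact isOpen_iInter_of_finite fun i =>
    isOpen_Ioo.preimage (by fun_prop : Continuous fun x : Vec d => x i)

theorem convex_Q (d : ℕ) : Convex ℝ (Q d) := by
  intro x hx y hy a b ha hb hab i
  have := (convex_Ioo (0 : ℝ) 1) (hx i) (hy i) ha hb hab
  simpa using this

theorem norm_le_sqrt_of_abs_le {d : ℕ} {x : Vec d} (hx : ∀ i, |x i| ≤ 1) :
    ‖x‖ ≤ Real.sqrt d := by
  rw [EuclideanSpace.norm_eq]
  refine Real.sqrt_le_sqrt ?_
  calc ∑ i, ‖x i‖ ^ 2 ≤ ∑ _i : Fin d, (1 : ℝ) := Finset.sum_le_sum fun i _ => by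
        have h := hx i
        rw [Real.norm_eq_abs]
        nlinarith [abs_nonneg (x i)]
    _ = d := by simp

theorem norm_sub_le_of_mem_Q {d : ℕ} {x y : Vec d} (hx : x ∈ Q d) (hy : y ∈ Q d) :
    ‖x - y‖ ≤ Real.sqrt d := by
  refine norm_le_sqrt_of_abs_le fun i => ?_
  have h1 := hx i
  have h2 := hy i
  rw [PiLp.sub_apply, abs_le]
  constructor <;> linarith [h1.1, h1.2, h2.1, h2.2]

theorem isBounded_Q (d : ℕ) : Bornology.IsBounded (Q d) :=
  Metric.isBounded_iff.2 ⟨Real.sqrt d, fun x hx y hy => by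
    rw [dist_eq_norm]; exact norm_sub_le_of_mem_Q hx hy⟩

theorem volume_Q (d : ℕ) : volume (Q d) = 1 := by
  have h : Q d = (WithLp.ofLp : Vec d → (Fin d → ℝ)) ⁻¹' (univ.pi fun _ => Ioo (0 : ℝ) 1) := by
    ext x; simp [Q]
  rw [h, (PiLp.volume_preserving_ofLp (Fin d)).measure_preimage
    (MeasurableSet.univ_pi fun _ => measurableSet_Ioo).nullMeasurableSet]
  simp [volume_pi_pi]

instance probVolQ (d : ℕ) : IsProbabilityMeasure (volQ d) :=
  ⟨by rw [volQ, Measure.restrict_apply_univ, volume_Q]⟩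

/-- The standard basis of `ℝ^d`, which spans the period lattice `ℤ^d`. -/
def stdBasis (d : ℕ) : Module.Basis (Fin d) ℝ (Vec d) := (EuclideanSpace.basisFun (Fin d) ℝ).toBasis

theorem fundamentalDomain_ae_eq_Q (d : ℕ) :
    ZSpan.fundamentalDomain (stdBasis d) =ᵐ[volume] Q d := by
  have h1 : Q d = (WithLp.ofLp : Vec d → (Fin d → ℝ)) ⁻¹' (univ.pi fun _ => Ioo (0 : ℝ) 1) := by
    ext x; simp [Q]
  have h2 : ZSpan.fundamentalDomain (stdBasis d)
      = (WithLp.ofLp : Vec d → (Fin d → ℝ)) ⁻¹' (univ.pi fun _ => Ico (0 : ℝ) 1) := by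
    ext x
    simp only [ZSpan.mem_fundamentalDomain, stdBasis, OrthonormalBasis.coe_toBasis_repr_apply,
      mem_preimage, Set.mem_pi, mem_univ, forall_true_left]
    rfl
  rw [h1, h2]
  refine (PiLp.volume_preserving_ofLp (Fin d)).quasiMeasurePreserving.preimage_ae_eq ?_
  exact Measure.univ_pi_Ico_ae_eq_Icc.trans Measure.univ_pi_Ioo_ae_eq_Icc.symm

theorem IsPeriodic.sub_single {d : ℕ} {α : Type*} {f : Vec d → α} (hf : IsPeriodic f) (i : Fin d)
    (x : Vec d) : f (x - EuclideanSpace.single i 1) = f x := by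
  have := hf i (x - EuclideanSpace.single i 1)
  rw [sub_add_cancel] at this
  exact this.symm

theorem IsPeriodic.lattice {d : ℕ} {α : Type*} {f : Vec d → α} (hf : IsPeriodic f)
    {v : Vec d} (hv : v ∈ Submodule.span ℤ (Set.range (stdBasis d))) (x : Vec d) :
    f (x + v) = f x := by
  induction hv using Submodule.span_induction generalizing x with
  | mem w hw =>
    obtain ⟨i, rfl⟩ := hw
    simpa [stdBasis] using hf i x
  | zero => simp
  | add a b _ _ ha hb => rw [← add_assoc, hb, ha]
  | smul n a _ ha =>
    induction n using Int.induction_on generalizing x with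
    | zero => simp
    | succ k ih => rw [add_smul, one_smul, ← add_assoc, ha, ih]
    | pred k ih =>
      have := ha (x + (-(k : ℤ) - 1) • a)
      rw [← this, ← ih x, sub_smul, one_smul]
      congr 1
      abel

theorem IsPeriodic.comp_const_sub {d : ℕ} {α : Type*} {f : Vec d → α} (hf : IsPeriodic f)
    (a : Vec d) : IsPeriodic fun x => f (a - x) := fun i x => by
  simp only [← sub_sub, hf.sub_single i]

theorem IsPeriodic.comp {d : ℕ} {α β : Type*} {f : Vec d → α} (hf : IsPeriodic f) (g : α → β) :
    IsPeriodic fun x => g (f x) := fun i x => by simp only [hf i]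

theorem exists_mem_fundamentalDomain {d : ℕ} (x : Vec d) :
    ∃ v ∈ Submodule.span ℤ (Set.range (stdBasis d)),
      ∀ i, (x + v) i ∈ Ico (0 : ℝ) 1 := by
  obtain ⟨v, hv, -⟩ := ZSpan.exist_unique_vadd_mem_fundamentalDomain (stdBasis d) x
  refine ⟨v, v.2, fun i => ?_⟩
  have := (ZSpan.mem_fundamentalDomain (stdBasis d)).1 hv i
  rw [Submodule.vadd_def, vadd_eq_add, add_comm] at this
  exact this

open scoped Pointwise in
/-- The integral of a periodic function over the cell is translation invariant. -/
theorem IsPeriodic.integral_add {d : ℕ} {E : Type*} [NormedAddCommGroup E] [NormedSpace ℝ E]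
    {f : Vec d → E} (hf : IsPeriodic f) (a : Vec d) :
    ∫ x, f (x + a) ∂(volQ d) = ∫ x, f x ∂(volQ d) := by
  have : Countable (Submodule.span ℤ (Set.range (stdBasis d))).toAddSubgroup :=
    inferInstanceAs (Countable (Submodule.span ℤ (Set.range (stdBasis d))))
  have hD := ZSpan.isAddFundamentalDomain' (stdBasis d) (volume : Measure (Vec d))
  have hD' := hD.vadd_of_comm a
  have key := hD'.setIntegral_eq hD (f := f) fun v x => by
    rw [AddSubgroup.vadd_def, vadd_eq_add, add_comm]; exact hf.lattice v.2 x
  rw [volQ, ← Measure.restrict_congr_set (fundamentalDomain_ae_eq_Q d), ← key]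
  have hmp : MeasurePreserving (fun x : Vec d => x + a) volume volume :=
    measurePreserving_add_right volume a
  have himg : (a +ᵥ ZSpan.fundamentalDomain (stdBasis d))
      = (fun x : Vec d => x + a) '' ZSpan.fundamentalDomain (stdBasis d) := by
    ext y; simp only [Set.mem_vadd_set, Set.mem_image, vadd_eq_add, add_comm]
  rw [himg, hmp.setIntegral_image_emb (measurableEmbedding_addRight a)]

theorem IsPeriodic.integral_sub_left {d : ℕ} {E : Type*} [NormedAddCommGroup E] [NormedSpace ℝ E]
    {f : Vec d → E} (hf : IsPeriodic f) (c : Vec d) :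
    ∫ x, f (c - x) ∂(volQ d) = ∫ x, f x ∂(volQ d) := by
  set o : Vec d := WithLp.toLp 2 fun _ => 1 with ho
  have hmp : MeasurePreserving (fun x : Vec d => o - x) volume volume :=
    MeasureTheory.Measure.measurePreserving_sub_left volume o
  have hemb : MeasurableEmbedding (fun x : Vec d => o - x) :=
    (Homeomorph.subLeft o).measurableEmbedding
  have hpre : (fun x : Vec d => o - x) ⁻¹' Q d = Q d := by
    ext x
    simp only [Q, mem_preimage, mem_ofPred_eq, PiLp.sub_apply, ho, mem_Ioo]
    refine forall_congr' fun i => ?_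
    constructor <;> rintro ⟨h1, h2⟩ <;> constructor <;> linarith
  have h1 := hmp.setIntegral_preimage_emb hemb f (Q d)
  rw [hpre] at h1
  rw [volQ, ← h1]
  have h2 := (hf.comp_const_sub o).integral_add (o - c)
  rw [volQ] at h2
  rw [← h2]
  refine integral_congr_ae (ae_of_all _ fun x => ?_)
  change f (c - x) = f (o - (x + (o - c)))
  congr 1
  abel

/-- A continuous function on the torus is bounded. -/
theorem IsPeriodic.exists_bound {d : ℕ} {E : Type*} [NormedAddCommGroup E]
    {f : Vec d → E} (hf : IsPeriodic f) (hc : Continuous f) : ∃ C, 0 ≤ C ∧ ∀ x, ‖f x‖ ≤ C := by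
  obtain ⟨C, hC⟩ := (isCompact_closedBall (0 : Vec d) (Real.sqrt d)).exists_bound_of_continuousOn
    hc.continuousOn
  have key : ∀ x, ‖f x‖ ≤ C := fun x => by
    obtain ⟨v, hv, hx⟩ := exists_mem_fundamentalDomain x
    rw [← hf.lattice hv]
    refine hC _ ?_
    rw [mem_closedBall_zero_iff]
    refine norm_le_sqrt_of_abs_le fun i => ?_
    rw [abs_of_nonneg (hx i).1]
    exact (hx i).2.le
  exact ⟨C, (norm_nonneg _).trans (key 0), key⟩

theorem integrable_of_norm_le {d : ℕ} {E : Type*} [NormedAddCommGroup E] {f : Vec d → E}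
    (hf : AEStronglyMeasurable f (volQ d)) {C : ℝ} (hC : ∀ x, ‖f x‖ ≤ C) :
    Integrable f (volQ d) :=
  Integrable.of_bound hf C (ae_of_all _ hC)

theorem IsPeriodic.integrable {d : ℕ} {E : Type*} [NormedAddCommGroup E]
    {f : Vec d → E} (hf : IsPeriodic f) (hc : Continuous f) : Integrable f (volQ d) := by
  obtain ⟨C, -, hC⟩ := hf.exists_bound hc
  exact integrable_of_norm_le hc.aestronglyMeasurable hC

/-! ### The function `V` -/

section V

variable {E : Type*} [NormedAddCommGroup E] {p : ℝ}

theorem V_sq (p : ℝ) (ξ : E) : V p ξ ^ 2 = ‖ξ‖ ^ 2 + ‖ξ‖ ^ p := by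
  rw [V, Real.sq_sqrt]
  positivity

theorem V_sq_nonneg (p : ℝ) (ξ : E) : 0 ≤ V p ξ ^ 2 := sq_nonneg _

theorem V_sq_zero (hp : 2 ≤ p) : V p (0 : E) ^ 2 = 0 := by
  rw [V_sq, norm_zero, Real.zero_rpow (by linarith)]
  simp

theorem continuous_V_sq (hp : 2 ≤ p) : Continuous fun ξ : E => V p ξ ^ 2 := by
  simp only [V_sq]
  exact (continuous_norm.pow 2).add (continuous_norm.rpow_const fun _ => Or.inr (by linarith))

theorem V_sq_mono {F : Type*} [NormedAddCommGroup F] (hp : 2 ≤ p) {a : E} {b : F}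
    (h : ‖a‖ ≤ ‖b‖) : V p a ^ 2 ≤ V p b ^ 2 := by
  rw [V_sq, V_sq]
  gcongr

theorem V_sq_neg (p : ℝ) (a : E) : V p (-a) ^ 2 = V p a ^ 2 := by
  rw [V_sq, V_sq, norm_neg]

theorem V_sq_le_mul {F : Type*} [NormedAddCommGroup F] (hp : 2 ≤ p) {a : E} {b : F} {s : ℝ}
    (hs : 0 ≤ s) (h : ‖a‖ ≤ s * ‖b‖) : V p a ^ 2 ≤ V p s ^ 2 * V p b ^ 2 := by
  rw [V_sq, V_sq, V_sq, Real.norm_of_nonneg hs]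
  have h1 : ‖a‖ ^ 2 ≤ s ^ 2 * ‖b‖ ^ 2 := by rw [← mul_pow]; gcongr
  have h2 : ‖a‖ ^ p ≤ s ^ p * ‖b‖ ^ p := by
    rw [← Real.mul_rpow hs (norm_nonneg _)]; gcongr
  have h3 : 0 ≤ s ^ 2 * ‖b‖ ^ p := by positivity
  have h4 : 0 ≤ s ^ p * ‖b‖ ^ 2 := by positivity
  nlinarith

theorem V_sq_add_le (hp : 2 ≤ p) (a b : E) :
    V p (a + b) ^ 2 ≤ 2 ^ p * (V p a ^ 2 + V p b ^ 2) := by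
  rw [V_sq, V_sq, V_sq]
  have hn := norm_add_le a b
  have ha := norm_nonneg a
  have hb := norm_nonneg b
  have h2p : (2 : ℝ) ^ (2 : ℝ) ≤ 2 ^ p := Real.rpow_le_rpow_of_exponent_le (by norm_num) hp
  norm_num at h2p
  have h1 : ‖a + b‖ ^ 2 ≤ 2 ^ p * (‖a‖ ^ 2 + ‖b‖ ^ 2) := by
    have : ‖a + b‖ ^ 2 ≤ (‖a‖ + ‖b‖) ^ 2 := by gcongr
    nlinarith [sq_nonneg (‖a‖ - ‖b‖), sq_nonneg ‖a‖, sq_nonneg ‖b‖]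
  have h2 : ‖a + b‖ ^ p ≤ 2 ^ p * (‖a‖ ^ p + ‖b‖ ^ p) := by
    have h3 : ‖a + b‖ ^ p ≤ (2 * max ‖a‖ ‖b‖) ^ p := by
      gcongr
      linarith [le_max_left ‖a‖ ‖b‖, le_max_right ‖a‖ ‖b‖]
    rw [Real.mul_rpow (by norm_num) (le_max_of_le_left ha)] at h3
    refine h3.trans ?_
    gcongr
    have := Real.rpow_nonneg ha p
    have := Real.rpow_nonneg hb p
    rcases le_total ‖a‖ ‖b‖ with h | h
    · rw [max_eq_right h]; linarith
    · rw [max_eq_left h]; linarith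
  nlinarith

theorem V_sq_sub_le (hp : 2 ≤ p) (a b : E) :
    V p (a - b) ^ 2 ≤ 2 ^ p * (V p a ^ 2 + V p b ^ 2) := by
  have := V_sq_add_le hp a (-b)
  rwa [V_sq_neg, ← sub_eq_add_neg] at this

theorem norm_sq_le_V_sq (p : ℝ) (a : E) : ‖a‖ ^ 2 ≤ V p a ^ 2 := by
  rw [V_sq]; have := Real.rpow_nonneg (norm_nonneg a) p; linarith

theorem norm_rpow_le_V_sq (p : ℝ) (a : E) : ‖a‖ ^ p ≤ V p a ^ 2 := by
  rw [V_sq]; have := sq_nonneg ‖a‖; linarith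

theorem V_sq_le (hp : 2 ≤ p) (a : E) : V p a ^ 2 ≤ 2 * (1 + ‖a‖ ^ p) := by
  rw [V_sq]
  have h0 := Real.rpow_nonneg (norm_nonneg a) p
  rcases le_total ‖a‖ 1 with h | h
  · have : ‖a‖ ^ 2 ≤ 1 := pow_le_one₀ (norm_nonneg a) h
    linarith
  · have : ‖a‖ ^ (2 : ℝ) ≤ ‖a‖ ^ p := Real.rpow_le_rpow_of_exponent_le h hp
    rw [Real.rpow_two] at this
    linarith

theorem convexOn_V_sq [NormedSpace ℝ E] (hp : 2 ≤ p) :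
    ConvexOn ℝ univ fun ξ : E => V p ξ ^ 2 := by
  simp only [V_sq]
  have hmono : ∀ q : ℝ, 1 ≤ q → ConvexOn ℝ univ fun ξ : E => ‖ξ‖ ^ q := fun q hq => by
    have h1 : ConvexOn ℝ (norm '' (univ : Set E)) fun s : ℝ => s ^ q := by
      refine (convexOn_rpow hq).subset ?_ ?_
      · rintro _ ⟨x, -, rfl⟩; exact norm_nonneg x
      · have : norm '' (univ : Set E) = Set.range (norm : E → ℝ) := image_univ
        rw [this]
        exact (isPreconnected_range continuous_norm).ordConnected.convex
    exact ConvexOn.comp h1 (convexOn_norm convex_univ) (by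
      rintro _ ⟨x, -, rfl⟩ _ ⟨y, -, rfl⟩ hxy
      exact Real.rpow_le_rpow (norm_nonneg x) hxy (by linarith))
  have h2 := hmono 2 (by norm_num)
  simp only [Real.rpow_two] at h2
  exact h2.add (hmono p (by linarith))

end V

/-! ### Convolution on the torus -/

section Jensen

variable {α E : Type*} [MeasurableSpace α] [NormedAddCommGroup E] [NormedSpace ℝ E]
  [CompleteSpace E]

/-- Jensen's inequality for the probability measure with density `k`. -/
theorem jensen_density {μ : Measure α} {k : α → ℝ} (hk : ∀ x, 0 ≤ k x) (hkm : Measurable k)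
    (hki : ∫ x, k x ∂μ = 1) {Φ : E → ℝ} (hΦ : ConvexOn ℝ univ Φ) (hΦc : Continuous Φ)
    {f : α → E} (hf : Integrable (fun x => k x • f x) μ)
    (hΦf : Integrable (fun x => k x * Φ (f x)) μ) :
    Φ (∫ x, k x • f x ∂μ) ≤ ∫ x, k x * Φ (f x) ∂μ := by
  have hkint : Integrable k μ := by
    by_contra h
    rw [integral_undef h] at hki
    exact zero_ne_one hki
  set ν := μ.withDensity fun x => ((k x).toNNReal : ℝ≥0∞) with hν
  have hkn : Measurable fun x => (k x).toNNReal := hkm.real_toNNReal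
  have hp : IsProbabilityMeasure ν := by
    constructor
    rw [hν, withDensity_apply _ MeasurableSet.univ, Measure.restrict_univ]
    have := ofReal_integral_eq_lintegral_ofReal hkint (ae_of_all _ hk)
    rw [hki, ENNReal.ofReal_one] at this
    exact this.symm
  have e : ∀ x, (((k x).toNNReal : ℝ≥0) : ℝ) = k x := fun x => Real.coe_toNNReal _ (hk x)
  have e1 : ∫ x, f x ∂ν = ∫ x, k x • f x ∂μ := by
    rw [hν, integral_withDensity_eq_integral_smul hkn]
    simp only [NNReal.smul_def, e]
  have e2 : ∫ x, Φ (f x) ∂ν = ∫ x, k x * Φ (f x) ∂μ := by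
    rw [hν, integral_withDensity_eq_integral_smul hkn]
    simp only [NNReal.smul_def, e, smul_eq_mul]
  rw [← e1, ← e2]
  refine hΦ.map_integral_le hΦc.continuousOn isClosed_univ (by simp) ?_ ?_
  · rw [hν, integrable_withDensity_iff_integrable_smul hkn]
    simpa only [NNReal.smul_def, e] using hf
  · rw [hν, integrable_withDensity_iff_integrable_smul hkn]
    simpa only [NNReal.smul_def, e, smul_eq_mul, Function.comp_apply] using hΦf

/-- Fatou's lemma for real-valued functions with bounded integrals. -/
theorem integrable_and_integral_le_of_tendsto {μ : Measure α} {f : ℕ → α → ℝ} {g : α → ℝ} {C : ℝ}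
    (hf : ∀ n, Integrable (f n) μ) (hf0 : ∀ n, ∀ᵐ x ∂μ, 0 ≤ f n x)
    (hg : ∀ᵐ x ∂μ, Tendsto (fun n => f n x) atTop (𝓝 (g x))) (hC : ∀ n, ∫ x, f n x ∂μ ≤ C) :
    Integrable g μ ∧ ∫ x, g x ∂μ ≤ C := by
  have hgm : AEStronglyMeasurable g μ :=
    aestronglyMeasurable_of_tendsto_ae atTop (fun n => (hf n).1) hg
  have hg0 : ∀ᵐ x ∂μ, 0 ≤ g x := by
    filter_upwards [hg, ae_all_iff.2 hf0] with x h1 h2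
    exact ge_of_tendsto' h1 h2
  have hC0 : 0 ≤ C := (integral_nonneg_of_ae (hf0 0)).trans (hC 0)
  have key : ∫⁻ x, ENNReal.ofReal (g x) ∂μ ≤ ENNReal.ofReal C := by
    calc ∫⁻ x, ENNReal.ofReal (g x) ∂μ
        ≤ ∫⁻ x, liminf (fun n => ENNReal.ofReal (f n x)) atTop ∂μ := by
          refine lintegral_mono_ae ?_
          filter_upwards [hg] with x hx
          exact ((ENNReal.continuous_ofReal.tendsto _).comp hx).liminf_eq.ge
      _ ≤ liminf (fun n => ∫⁻ x, ENNReal.ofReal (f n x) ∂μ) atTop :=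
          lintegral_liminf_le' fun n => (hf n).1.aemeasurable.ennreal_ofReal
      _ ≤ ENNReal.ofReal C := by
          refine liminf_le_of_le (by isBoundedDefault) fun b hb => ?_
          obtain ⟨n, hn⟩ := hb.exists
          refine hn.trans ?_
          rw [← ofReal_integral_eq_lintegral_ofReal (hf n) (hf0 n)]
          exact ENNReal.ofReal_le_ofReal (hC n)
  have hgi : Integrable g μ := by
    refine ⟨hgm, ?_⟩
    rw [hasFiniteIntegral_iff_ofReal hg0]
    exact key.trans_lt ENNReal.ofReal_lt_top
  refine ⟨hgi, ?_⟩
  rw [← ofReal_integral_eq_lintegral_ofReal hgi hg0] at key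
  exact (ENNReal.ofReal_le_ofReal_iff hC0).1 key

theorem exists_subseq_tendsto_ae {F : Type*} [NormedAddCommGroup F] {μ : Measure α}
    {f : ℕ → α → F} {g : α → F}
    (hf : ∀ n, Integrable (f n) μ) (hg : Integrable g μ)
    (h : Tendsto (fun n => ∫ x, ‖f n x - g x‖ ∂μ) atTop (𝓝 0)) :
    ∃ ns : ℕ → ℕ, StrictMono ns ∧
      ∀ᵐ x ∂μ, Tendsto (fun n => f (ns n) x) atTop (𝓝 (g x)) := by
  refine TendstoInMeasure.exists_seq_tendsto_ae (tendstoInMeasure_of_tendsto_eLpNorm one_ne_zero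
    (fun n => (hf n).1) hg.1 ?_)
  have : ∀ n, eLpNorm (f n - g) 1 μ = ENNReal.ofReal (∫ x, ‖f n x - g x‖ ∂μ) := fun n => by
    rw [eLpNorm_one_eq_lintegral_enorm]
    exact (ofReal_integral_norm_eq_lintegral_enorm ((hf n).sub hg)).symm
  simp only [this]
  simpa using ENNReal.tendsto_ofReal h

end Jensen

/-- A convolution kernel on the torus: a smooth periodic probability density. -/
structure IsKernel {d : ℕ} (K : Vec d → ℝ) : Prop where
  test : IsTest K
  nonneg : ∀ x, 0 ≤ K x
  integral_eq : ∫ x, K x ∂(volQ d) = 1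

/-- Convolution on the torus, `(K * f)(x) = ∫_Q K(x - y) f(y) dy`; only the values of `f` on the
cell matter. -/
def conv {d : ℕ} {E : Type*} [NormedAddCommGroup E] [NormedSpace ℝ E] (K : Vec d → ℝ)
    (f : Vec d → E) (x : Vec d) : E := ∫ y, K (x - y) • f y ∂(volQ d)

section Conv

variable {d : ℕ} {E : Type*} [NormedAddCommGroup E] [NormedSpace ℝ E] {K : Vec d → ℝ}

theorem IsTest.continuous (hK : IsTest K) : Continuous K := hK.1.continuous

theorem IsTest.exists_bound (hK : IsTest K) : ∃ C, 0 ≤ C ∧ ∀ x, |K x| ≤ C :=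
  hK.2.exists_bound hK.continuous

theorem IsTest.comp_const_sub (hK : IsTest K) (x : Vec d) : IsTest fun y => K (x - y) :=
  ⟨hK.1.comp (contDiff_const.sub contDiff_id), hK.2.comp_const_sub x⟩

theorem IsTest.integrable_smul (hK : IsTest K) {f : Vec d → E} (hf : Integrable f (volQ d))
    (x : Vec d) : Integrable (fun y => K (x - y) • f y) (volQ d) := by
  obtain ⟨C, -, hC⟩ := hK.exists_bound
  exact hf.bdd_smul C (hK.comp_const_sub x).continuous.aestronglyMeasurable
    (ae_of_all _ fun y => hC _)

theorem conv_periodic (hK : IsPeriodic K) (f : Vec d → E) : IsPeriodic (conv K f) := fun i x => by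
  refine integral_congr_ae (ae_of_all _ fun y => ?_)
  change K (x + EuclideanSpace.single i 1 - y) • f y = K (x - y) • f y
  rw [add_sub_right_comm, hK i]

theorem conv_continuous (hK : IsTest K) {f : Vec d → E} (hf : Integrable f (volQ d)) :
    Continuous (conv K f) := by
  obtain ⟨C, -, hC⟩ := hK.exists_bound
  refine continuous_of_dominated (bound := fun y => C * ‖f y‖)
    (fun x => (hK.integrable_smul hf x).1) (fun x => ae_of_all _ fun y => ?_) (hf.norm.const_mul C)
    (ae_of_all _ fun y => ?_)
  · rw [norm_smul]
    exact mul_le_mul_of_nonneg_right (hC _) (norm_nonneg _)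
  · exact (hK.continuous.comp (continuous_id.sub continuous_const)).smul continuous_const

theorem conv_integrable (hK : IsTest K) {f : Vec d → E} (hf : Integrable f (volQ d)) :
    Integrable (conv K f) (volQ d) :=
  (conv_periodic hK.2 f).integrable (conv_continuous hK hf)

theorem conv_sub (hK : IsTest K) {f g : Vec d → E} (hf : Integrable f (volQ d))
    (hg : Integrable g (volQ d)) (x : Vec d) :
    conv K (fun y => f y - g y) x = conv K f x - conv K g x := by
  simp only [conv, smul_sub]
  exact integral_sub (hK.integrable_smul hf x) (hK.integrable_smul hg x)

theorem IsKernel.integral_sub_left (hK : IsKernel K) (x : Vec d) :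
    ∫ y, K (x - y) ∂(volQ d) = 1 := by
  rw [hK.test.2.integral_sub_left, hK.integral_eq]

theorem conv_const [CompleteSpace E] (hK : IsKernel K) (c : E) (x : Vec d) :
    conv K (fun _ => c) x = c := by
  rw [conv, integral_smul_const, hK.integral_sub_left, one_smul]

theorem IsKernel.integral_sub_right (hK : IsKernel K) (y : Vec d) :
    ∫ x, K (x - y) ∂(volQ d) = 1 := by
  have := hK.test.2.integral_add (-y)
  simp only [← sub_eq_add_neg] at this
  rw [this, hK.integral_eq]

theorem integrable_conv_prod (hK : IsTest K) {f : Vec d → E} (hf : Integrable f (volQ d)) :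
    Integrable (fun z : Vec d × Vec d => K (z.1 - z.2) • f z.2) ((volQ d).prod (volQ d)) := by
  obtain ⟨C, -, hC⟩ := hK.exists_bound
  exact (hf.comp_snd (volQ d)).bdd_smul C
    (hK.continuous.comp (continuous_fst.sub continuous_snd)).aestronglyMeasurable
    (ae_of_all _ fun z => hC _)

theorem integral_conv [CompleteSpace E] (hK : IsKernel K) {f : Vec d → E}
    (hf : Integrable f (volQ d)) :
    ∫ x, conv K f x ∂(volQ d) = ∫ x, f x ∂(volQ d) := by
  unfold conv
  rw [integral_integral_swap (integrable_conv_prod hK.test hf)]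
  simp only [integral_smul_const, hK.integral_sub_right, one_smul]

theorem IsKernel.map_conv_le [CompleteSpace E] (hK : IsKernel K) {Φ : E → ℝ}
    (hΦ : ConvexOn ℝ univ Φ)
    (hΦc : Continuous Φ) {f : Vec d → E} (hf : Integrable f (volQ d))
    (hΦf : Integrable (fun x => Φ (f x)) (volQ d)) (x : Vec d) :
    Φ (conv K f x) ≤ conv K (fun y => Φ (f y)) x :=
  jensen_density (fun _ => hK.nonneg _) (hK.test.comp_const_sub x).continuous.measurable
    (hK.integral_sub_left x) hΦ hΦc (hK.test.integrable_smul hf x)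
    (hK.test.integrable_smul hΦf x)

/-- Averaging does not increase the integral of a convex function. -/
theorem IsKernel.integral_map_conv_le [CompleteSpace E] (hK : IsKernel K) {Φ : E → ℝ}
    (hΦ : ConvexOn ℝ univ Φ)
    (hΦc : Continuous Φ) {f : Vec d → E} (hf : Integrable f (volQ d))
    (hΦf : Integrable (fun x => Φ (f x)) (volQ d)) :
    ∫ x, Φ (conv K f x) ∂(volQ d) ≤ ∫ x, Φ (f x) ∂(volQ d) := by
  rw [← integral_conv hK hΦf]
  exact integral_mono (((conv_periodic hK.test.2 f).comp Φ).integrable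
    (hΦc.comp (conv_continuous hK.test hf))) (conv_integrable hK.test hΦf)
    fun x => hK.map_conv_le hΦ hΦc hf hΦf x

theorem IsKernel.norm_conv_le [CompleteSpace E] (hK : IsKernel K) {f : Vec d → E}
    (hf : Integrable f (volQ d)) {C : ℝ} (hC : ∀ x, ‖f x‖ ≤ C) (x : Vec d) : ‖conv K f x‖ ≤ C := by
  have h1 := hK.map_conv_le (convexOn_norm convex_univ) continuous_norm hf hf.norm x
  refine h1.trans ?_
  rw [← conv_const hK C x]
  exact integral_mono (hK.test.integrable_smul hf.norm x)
    (hK.test.integrable_smul (integrable_const C) x)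
    fun y => mul_le_mul_of_nonneg_left (hC y) (hK.nonneg _)

theorem conv_const_apply {ι : Type*} [Fintype ι] (hK : IsTest K)
    {f : Vec d → EuclideanSpace ℝ ι} (hf : Integrable f (volQ d)) (x : Vec d) (i : ι) :
    conv K f x i = ∫ y, K (x - y) * f y i ∂(volQ d) := by
  have := (EuclideanSpace.proj (𝕜 := ℝ) i).integral_comp_comm (hK.integrable_smul hf x)
  exact this.symm

end Conv

/-! ### Matrices acting on vectors, and gradients -/

/-- The action `(ξ v)_i = ∑_j ξ_{ij} v_j` of matrices on vectors. -/
def act (d : ℕ) : Mat d →L[ℝ] Vec d →L[ℝ] Vec d :=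
  LinearMap.mkContinuous₂
    (LinearMap.mk₂ ℝ (fun (ξ : Mat d) (v : Vec d) => WithLp.toLp 2 fun i => ∑ j, ξ (i, j) * v j)
      (fun a b v => by ext i; simp [add_mul, Finset.sum_add_distrib])
      (fun c a v => by ext i; simp [Finset.mul_sum, mul_assoc])
      (fun a v w => by ext i; simp [mul_add, Finset.sum_add_distrib])
      (fun c a v => by ext i; simp [Finset.mul_sum, mul_left_comm]))
    1 (fun ξ v => by
      rw [one_mul, LinearMap.mk₂_apply, EuclideanSpace.norm_eq, EuclideanSpace.norm_eq,
        EuclideanSpace.norm_eq, ← Real.sqrt_mul (by positivity)]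
      refine Real.sqrt_le_sqrt ?_
      simp only [Real.norm_eq_abs, sq_abs]
      rw [Fintype.sum_prod_type, Finset.sum_mul]
      exact Finset.sum_le_sum fun i _ => Finset.sum_mul_sq_le_sq_mul_sq _ _ _)

theorem act_apply {d : ℕ} (ξ : Mat d) (v : Vec d) (i : Fin d) :
    act d ξ v i = ∑ j, ξ (i, j) * v j := rfl

theorem act_single {d : ℕ} (ξ : Mat d) (i j : Fin d) :
    act d ξ (EuclideanSpace.single j 1) i = ξ (i, j) := by
  rw [act_apply, Finset.sum_eq_single j] <;> simp +contextual

theorem norm_act_le {d : ℕ} (ξ : Mat d) (v : Vec d) : ‖act d ξ v‖ ≤ ‖ξ‖ * ‖v‖ := by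
  rw [EuclideanSpace.norm_eq, EuclideanSpace.norm_eq,
    EuclideanSpace.norm_eq, ← Real.sqrt_mul (by positivity)]
  refine Real.sqrt_le_sqrt ?_
  simp only [Real.norm_eq_abs, sq_abs, act_apply]
  rw [Fintype.sum_prod_type, Finset.sum_mul]
  exact Finset.sum_le_sum fun i _ => Finset.sum_mul_sq_le_sq_mul_sq _ _ _

/-- The matrix of a linear map. -/
def jac {d : ℕ} (A : Vec d →L[ℝ] Vec d) : Mat d :=
  WithLp.toLp 2 fun ij => A (EuclideanSpace.single ij.2 1) ij.1

theorem jac_apply {d : ℕ} (A : Vec d →L[ℝ] Vec d) (i j : Fin d) :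
    jac A (i, j) = A (EuclideanSpace.single j 1) i := rfl

theorem jac_act {d : ℕ} (ξ : Mat d) : jac (act d ξ) = ξ := by
  ext ⟨i, j⟩
  rw [jac_apply, act_single]

theorem clm_ext_single {d : ℕ} {F : Type*} [NormedAddCommGroup F] [NormedSpace ℝ F]
    {A B : Vec d →L[ℝ] F}
    (h : ∀ j, A (EuclideanSpace.single j 1) = B (EuclideanSpace.single j 1)) : A = B := by
  ext v
  have hv : v = ∑ j, v j • EuclideanSpace.single j (1 : ℝ) := by
    ext i; simp [Finset.sum_apply, Pi.single_apply]
  rw [hv, map_sum, map_sum]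
  simp only [map_smul, h]

theorem jac_add {d : ℕ} (A B : Vec d →L[ℝ] Vec d) : jac (A + B) = jac A + jac B := by
  ext ⟨i, j⟩; simp [jac_apply]

theorem jac_sub {d : ℕ} (A B : Vec d →L[ℝ] Vec d) : jac (A - B) = jac A - jac B := by
  ext ⟨i, j⟩; simp [jac_apply]

theorem jac_smul {d : ℕ} (c : ℝ) (A : Vec d →L[ℝ] Vec d) : jac (c • A) = c • jac A := by
  ext ⟨i, j⟩; simp [jac_apply]

theorem norm_jac_le {d : ℕ} (A : Vec d →L[ℝ] Vec d) : ‖jac A‖ ≤ d * ‖A‖ := by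
  have h : ∀ ij : Fin d × Fin d, ‖jac A ij‖ ≤ ‖A‖ := by
    rintro ⟨i, j⟩
    rw [jac_apply]
    refine (PiLp.norm_apply_le (A (EuclideanSpace.single j 1)) i).trans ?_
    refine (A.le_opNorm _).trans ?_
    rw [PiLp.norm_single, norm_one, mul_one]
  rw [EuclideanSpace.norm_eq]
  refine Real.sqrt_le_iff.2 ⟨by positivity, ?_⟩
  calc ∑ ij, ‖jac A ij‖ ^ 2 ≤ ∑ _ij : Fin d × Fin d, ‖A‖ ^ 2 :=
        Finset.sum_le_sum fun ij _ => by gcongr; exact h ij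
    _ = (d * ‖A‖) ^ 2 := by simp; ring

theorem continuous_jac {d : ℕ} : Continuous (jac : (Vec d →L[ℝ] Vec d) → Mat d) := by
  let L : (Vec d →L[ℝ] Vec d) →ₗ[ℝ] Mat d := ⟨⟨jac, jac_add⟩, jac_smul⟩
  exact L.continuous_of_finiteDimensional

theorem norm_jac_smulRight_le {d : ℕ} (l : Vec d →L[ℝ] ℝ) (a : Vec d) :
    ‖jac (l.smulRight a)‖ ≤ d * (‖l‖ * ‖a‖) := by
  refine (norm_jac_le _).trans ?_
  rw [ContinuousLinearMap.norm_smulRight_apply]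

/-- The weak gradient commutes with smoothing: `∇(K * u) = K * ∇u`. -/
theorem hasFDerivAt_conv {d : ℕ} {K : Vec d → ℝ} (hK : IsTest K) {u : Vec d → Vec d}
    {g : Vec d → Mat d} (hu : Integrable u (volQ d)) (hg : Integrable g (volQ d))
    (hw : ∀ i j, IsWeakDeriv j (fun x => u x i) (fun x => g x (i, j))) (x : Vec d) :
    HasFDerivAt (conv K u) (act d (conv K g x)) x := by
  have hdK : Continuous (fderiv ℝ K) := hK.1.continuous_fderiv (by simp)
  have hdKp : IsPeriodic (fderiv ℝ K) := fun i y => by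
    rw [← fderiv_comp_add_right]
    congr 1
    funext z
    exact hK.2 i z
  obtain ⟨C, hC0, hC⟩ := hdKp.exists_bound hdK
  have hKd : Differentiable ℝ K := hK.1.differentiable (by simp)
  set F' : Vec d → Vec d → (Vec d →L[ℝ] Vec d) :=
    fun x y => (fderiv ℝ K (x - y)).smulRight (u y) with hF'
  have hF'i : ∀ x, Integrable (F' x) (volQ d) := fun x => by
    refine Integrable.mono' (hu.norm.const_mul C) ?_ (ae_of_all _ fun y => ?_)
    · have h1 : AEStronglyMeasurable (fun y => fderiv ℝ K (x - y)) (volQ d) :=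
        (hdK.comp (continuous_const.sub continuous_id)).aestronglyMeasurable
      exact ((ContinuousLinearMap.smulRightL ℝ (Vec d) (Vec d)).continuous₂.comp_aestronglyMeasurable
        (h1.prodMk hu.1))
    · rw [hF', ContinuousLinearMap.norm_smulRight_apply]
      exact mul_le_mul_of_nonneg_right (hC _) (norm_nonneg _)
  have h1 : HasFDerivAt (conv K u) (∫ y, F' x y ∂(volQ d)) x := by
    refine hasFDerivAt_integral_of_dominated_of_fderiv_le (bound := fun y => C * ‖u y‖)
      (s := univ) univ_mem (Eventually.of_forall fun z => (hK.integrable_smul hu z).1)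
      (hK.integrable_smul hu x) (hF'i x).1 (ae_of_all _ fun y z _ => ?_) (hu.norm.const_mul C)
      (ae_of_all _ fun y z _ => ?_)
    · rw [hF', ContinuousLinearMap.norm_smulRight_apply]
      exact mul_le_mul_of_nonneg_right (hC _) (norm_nonneg _)
    · have h2 : HasFDerivAt (fun z => K (z - y)) (fderiv ℝ K (z - y)) z :=
        (hasFDerivAt_comp_sub y).2 (hKd (z - y)).hasFDerivAt
      exact h2.smul_const (u y)
  convert h1 using 1
  refine clm_ext_single fun j => ?_
  ext i
  rw [act_single, conv_const_apply hK hg, ContinuousLinearMap.integral_apply (hF'i x)]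
  have hF'j : Integrable (fun y => F' x y (EuclideanSpace.single j 1)) (volQ d) :=
    (ContinuousLinearMap.apply ℝ (Vec d) (EuclideanSpace.single j (1 : ℝ))).integrable_comp (hF'i x)
  have h3 := (EuclideanSpace.proj (𝕜 := ℝ) i).integral_comp_comm hF'j
  have h3' : (∫ y, F' x y (EuclideanSpace.single j 1) ∂(volQ d)) i
      = ∫ y, fderiv ℝ K (x - y) (EuclideanSpace.single j 1) * u y i ∂(volQ d) := by
    simpa [hF'] using h3.symm
  rw [h3']
  have h4 := hw i j (fun y => K (x - y)) (hK.comp_const_sub x)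
  have h5 : ∀ y, partialD j (fun y => K (x - y)) y
      = -fderiv ℝ K (x - y) (EuclideanSpace.single j 1) := fun y => by
    have := (hKd (x - y)).hasFDerivAt.comp y ((hasFDerivAt_id y).const_sub x)
    have h6 : fderiv ℝ (fun y => K (x - y)) y = (fderiv ℝ K (x - y)).comp
      (-ContinuousLinearMap.id ℝ (Vec d)) := this.fderiv
    rw [partialD, h6]
    simp
  simp only [h5, mul_neg, integral_neg, neg_inj] at h4
  simp only [mul_comm (K _)]
  rw [← h4]
  simp only [mul_comm]

/-! ### Smooth periodic maps: oscillation controlled by the gradient -/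

/-- `w` is a `C¹` periodic map with gradient `D`. -/
structure IsC1Periodic {d : ℕ} (w : Vec d → Vec d) (D : Vec d → Mat d) : Prop where
  periodic : IsPeriodic w
  periodic_grad : IsPeriodic D
  continuous_grad : Continuous D
  hasFDerivAt : ∀ x, HasFDerivAt w (act d (D x)) x

section C1

variable {d : ℕ} {p : ℝ} {w : Vec d → Vec d} {D : Vec d → Mat d}

theorem isC1Periodic_conv {K : Vec d → ℝ} (hK : IsTest K) {u : Vec d → Vec d}
    {g : Vec d → Mat d} (hu : Integrable u (volQ d)) (hg : Integrable g (volQ d))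
    (hw : ∀ i j, IsWeakDeriv j (fun x => u x i) (fun x => g x (i, j))) :
    IsC1Periodic (conv K u) (conv K g) where
  periodic := conv_periodic hK.2 u
  periodic_grad := conv_periodic hK.2 g
  continuous_grad := conv_continuous hK hg
  hasFDerivAt := hasFDerivAt_conv hK hu hg hw

theorem IsC1Periodic.continuous (h : IsC1Periodic w D) : Continuous w :=
  continuous_iff_continuousAt.2 fun x => (h.hasFDerivAt x).continuousAt

theorem IsC1Periodic.sub {w' : Vec d → Vec d} {D' : Vec d → Mat d} (h : IsC1Periodic w D)
    (h' : IsC1Periodic w' D') :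
    IsC1Periodic (fun x => w x - w' x) (fun x => D x - D' x) where
  periodic i x := by simp only [h.periodic i, h'.periodic i]
  periodic_grad i x := by simp only [h.periodic_grad i, h'.periodic_grad i]
  continuous_grad := h.continuous_grad.sub h'.continuous_grad
  hasFDerivAt x := by
    rw [map_sub]
    exact (h.hasFDerivAt x).sub (h'.hasFDerivAt x)

theorem IsC1Periodic.integrable_V_sq (h : IsC1Periodic w D) (hp : 2 ≤ p) :
    Integrable (fun x => V p (w x) ^ 2) (volQ d) :=
  (h.periodic.comp fun y => V p y ^ 2).integrable ((continuous_V_sq hp).comp h.continuous)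

theorem IsC1Periodic.sub_eq_integral (h : IsC1Periodic w D) (x z : Vec d) :
    w (x + z) - w x = ∫ s in Ioc (0 : ℝ) 1, act d (D (x + s • z)) z := by
  have hc : Continuous fun s : ℝ => act d (D (x + s • z)) z :=
    ((act d).continuous.comp (h.continuous_grad.comp (by fun_prop))).clm_apply continuous_const
  have h1 : ∀ s ∈ uIcc (0 : ℝ) 1, HasDerivAt (fun s : ℝ => w (x + s • z))
      (act d (D (x + s • z)) z) s := fun s _ => by
    have h2 : HasDerivAt (fun s : ℝ => x + s • z) z s := by
      simpa using ((hasDerivAt_id s).smul_const z).const_add x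
    exact (h.hasFDerivAt (x + s • z)).comp_hasDerivAt s h2
  have h3 := intervalIntegral.integral_eq_sub_of_hasDerivAt h1 (hc.intervalIntegrable 0 1)
  rw [intervalIntegral.integral_of_le zero_le_one] at h3
  simpa using h3.symm

theorem IsC1Periodic.norm_sub_le (h : IsC1Periodic w D) {C : ℝ} (hC : ∀ x, ‖D x‖ ≤ C)
    (x y : Vec d) : ‖w x - w y‖ ≤ C * ‖x - y‖ := by
  refine Convex.norm_image_sub_le_of_norm_hasFDerivWithin_le (s := univ)
    (fun z _ => (h.hasFDerivAt z).hasFDerivWithinAt) (fun z _ => ?_) convex_univ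
    (mem_univ y) (mem_univ x)
  have hC0 : 0 ≤ C := (norm_nonneg _).trans (hC z)
  refine ContinuousLinearMap.opNorm_le_bound _ hC0 fun v => ?_
  exact (norm_act_le _ _).trans (mul_le_mul_of_nonneg_right (hC z) (norm_nonneg v))

/-- Translation estimate: `∫ V(w(x+z) - w(x))² ≤ V(|z|)² ∫ V(∇w)²`. -/
theorem IsC1Periodic.integral_V_sq_translate_le (h : IsC1Periodic w D) (hp : 2 ≤ p) (z : Vec d) :
    ∫ x, V p (w (x + z) - w x) ^ 2 ∂(volQ d) ≤ V p ‖z‖ ^ 2 * ∫ x, V p (D x) ^ 2 ∂(volQ d) := by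
  have hVc : Continuous fun ξ : Mat d => V p ξ ^ 2 := continuous_V_sq hp
  obtain ⟨C, hC0, hC⟩ := (h.periodic_grad.comp fun y => V p y ^ 2).exists_bound
    (hVc.comp h.continuous_grad)
  have hcont : Continuous fun q : Vec d × ℝ => V p (D (q.1 + q.2 • z)) ^ 2 :=
    hVc.comp (h.continuous_grad.comp (by fun_prop))
  have hprod : Integrable (fun q : Vec d × ℝ => V p (D (q.1 + q.2 • z)) ^ 2)
      ((volQ d).prod (volume.restrict (Ioc (0 : ℝ) 1))) :=
    Integrable.of_bound hcont.aestronglyMeasurable C (ae_of_all _ fun q => hC _)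
  have hpt : ∀ x, V p (w (x + z) - w x) ^ 2
      ≤ V p ‖z‖ ^ 2 * ∫ s in Ioc (0 : ℝ) 1, V p (D (x + s • z)) ^ 2 := fun x => by
    have hc : Continuous fun s : ℝ => act d (D (x + s • z)) z :=
      ((act d).continuous.comp (h.continuous_grad.comp (by fun_prop))).clm_apply continuous_const
    have hi : Integrable (fun s : ℝ => act d (D (x + s • z)) z) (volume.restrict (Ioc 0 1)) :=
      hc.integrableOn_Ioc
    have hi2 : Integrable (fun s : ℝ => V p (act d (D (x + s • z)) z) ^ 2)
        (volume.restrict (Ioc 0 1)) := ((continuous_V_sq hp).comp hc).integrableOn_Ioc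
    rw [h.sub_eq_integral x z]
    have hj := jensen_density (μ := volume.restrict (Ioc (0 : ℝ) 1)) (k := fun _ => 1)
      (fun _ => zero_le_one) measurable_const (by simp) (convexOn_V_sq (E := Vec d) hp)
      (continuous_V_sq hp) (f := fun s : ℝ => act d (D (x + s • z)) z) (by simpa using hi)
      (by simpa using hi2)
    simp only [one_smul, one_mul] at hj
    refine hj.trans ?_
    rw [← integral_const_mul]
    refine integral_mono hi2 ?_ fun s => ?_
    · exact (continuous_const.mul (hVc.comp (h.continuous_grad.comp (by fun_prop)))).integrableOn_Ioc
    · refine V_sq_le_mul hp (norm_nonneg z) ?_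
      rw [mul_comm]
      exact norm_act_le _ _
  have hl : Integrable (fun x => V p (w (x + z) - w x) ^ 2) (volQ d) := by
    refine IsPeriodic.integrable (fun i x => ?_) ((continuous_V_sq hp).comp
      ((h.continuous.comp (by fun_prop)).sub h.continuous))
    simp only [add_right_comm x, h.periodic i]
  refine (integral_mono hl (hprod.integral_prod_left.const_mul _) hpt).trans ?_
  rw [integral_const_mul, integral_integral_swap hprod]
  simp only [(h.periodic_grad.comp fun y => V p y ^ 2).integral_add]
  simp

/-- The centre of the unit cell. -/
def cellCentre (d : ℕ) : Vec d := WithLp.toLp 2 fun _ => 1 / 2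

/-- The modulus by which convolution with `K` moves a map with controlled gradient. -/
def kernelModulus {d : ℕ} (p : ℝ) (K : Vec d → ℝ) : ℝ :=
  conv K (fun z => V p ‖z - cellCentre d‖ ^ 2) (cellCentre d)

theorem integrable_dist_centre (hp : 2 ≤ p) :
    Integrable (fun z => V p ‖z - cellCentre d‖ ^ 2) (volQ d) := by
  have hc : Continuous fun z : Vec d => V p ‖z - cellCentre d‖ ^ 2 :=
    (continuous_V_sq hp).comp (by fun_prop)
  exact (memLp_top_of_continuous hc).integrable le_top

theorem kernelModulus_nonneg {K : Vec d → ℝ} (hK : IsKernel K) : 0 ≤ kernelModulus p K :=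
  integral_nonneg fun _ => mul_nonneg (hK.nonneg _) (V_sq_nonneg _ _)

/-- The distance of a map to its mollification, in the energy norm: a kernel is a probability
density on translations, so this follows from the translation estimate by Jensen's inequality. -/
theorem IsC1Periodic.integral_V_sq_sub_conv_le (h : IsC1Periodic w D) (hp : 2 ≤ p)
    {K : Vec d → ℝ} (hK : IsKernel K) :
    ∫ x, V p (w x - conv K w x) ^ 2 ∂(volQ d)
      ≤ kernelModulus p K * ∫ x, V p (D x) ^ 2 ∂(volQ d) := by
  set e := cellCentre d
  have hwi : Integrable w (volQ d) := h.periodic.integrable h.continuous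
  have hVc : Continuous fun ξ : Vec d => V p ξ ^ 2 := continuous_V_sq hp
  obtain ⟨C, hC0, hC⟩ := h.periodic.exists_bound h.continuous
  obtain ⟨C', hC'0, hC'⟩ := hK.test.exists_bound
  have hconv : ∀ x, conv K w x = ∫ z, K (e - z) • w (x + (z - e)) ∂(volQ d) := fun x => by
    have hper : IsPeriodic fun y => K (x - y) • w y := fun i y => by
      simp only [h.periodic i, (hK.test.2.comp_const_sub x) i y]
    rw [conv, ← hper.integral_add (x - e)]
    refine integral_congr_ae (ae_of_all _ fun z => ?_)
    change K (x - (z + (x - e))) • w (z + (x - e)) = K (e - z) • w (x + (z - e))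
    congr 2 <;> abel
  have hc2 : Continuous fun q : Vec d × Vec d =>
      K (e - q.2) * V p (w (q.1 + (q.2 - e)) - w q.1) ^ 2 :=
    (hK.test.continuous.comp (by fun_prop)).mul (hVc.comp
      ((h.continuous.comp (by fun_prop)).sub (h.continuous.comp continuous_fst)))
  have hprod : Integrable (fun q : Vec d × Vec d =>
      K (e - q.2) * V p (w (q.1 + (q.2 - e)) - w q.1) ^ 2) ((volQ d).prod (volQ d)) := by
    refine Integrable.of_bound hc2.aestronglyMeasurable (C' * V p (C + C) ^ 2)
      (ae_of_all _ fun q => ?_)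
    rw [norm_mul]
    refine mul_le_mul (hC' _) ?_ (norm_nonneg _) hC'0
    rw [Real.norm_of_nonneg (V_sq_nonneg _ _)]
    refine V_sq_mono hp ?_
    rw [Real.norm_of_nonneg (by positivity)]
    exact (_root_.norm_sub_le _ _).trans (add_le_add (hC _) (hC _))
  have hpt : ∀ x, V p (w x - conv K w x) ^ 2
      ≤ ∫ z, K (e - z) * V p (w (x + (z - e)) - w x) ^ 2 ∂(volQ d) := fun x => by
    have hcs : Continuous fun z : Vec d => w (x + (z - e)) - w x :=
      (h.continuous.comp (by fun_prop)).sub continuous_const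
    have hcK : Continuous fun z : Vec d => K (e - z) := (hK.test.comp_const_sub e).continuous
    have hint : ∀ {F : Type} [NormedAddCommGroup F] {f : Vec d → F}, Continuous f →
        Integrable f (volQ d) := fun {F} _ {f} hf => by
      have := (isBounded_Q d).isCompact_closure
      exact (hf.continuousOn.integrableOn_compact this).mono_set subset_closure
    have hj := jensen_density (fun z => hK.nonneg (e - z)) hcK.measurable
      (hK.integral_sub_left e) (convexOn_V_sq (E := Vec d) hp) hVc
      (f := fun z => w (x + (z - e)) - w x) (hint (hcK.smul hcs)) (hint (hcK.mul (hVc.comp hcs)))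
    have heq : ∫ z, K (e - z) • (w (x + (z - e)) - w x) ∂(volQ d) = conv K w x - w x := by
      simp only [smul_sub]
      have hca : Continuous fun z : Vec d => w (x + (z - e)) := h.continuous.comp (by fun_prop)
      have hcb : Continuous fun z : Vec d => K (e - z) • w (x + (z - e)) := hcK.smul hca
      have hcc : Continuous fun z : Vec d => K (e - z) • w x := hcK.smul continuous_const
      rw [integral_sub (hint hcb) (hint hcc), ← hconv, integral_smul_const, hK.integral_sub_left,
        one_smul]
    rw [heq] at hj
    rwa [← V_sq_neg, neg_sub]
  have hl : Integrable (fun x => V p (w x - conv K w x) ^ 2) (volQ d) := by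
    refine IsPeriodic.integrable (fun i x => ?_) (hVc.comp
      (h.continuous.sub (conv_continuous hK.test hwi)))
    simp only [h.periodic i, conv_periodic hK.test.2 w i]
  refine (integral_mono hl hprod.integral_prod_left hpt).trans ?_
  rw [integral_integral_swap hprod, kernelModulus, conv, ← integral_mul_const]
  refine integral_mono hprod.integral_prod_right
    ((hK.test.integrable_smul (integrable_dist_centre hp) e).mul_const _) fun z => ?_
  simp only [smul_eq_mul, integral_const_mul]
  rw [mul_assoc]
  exact mul_le_mul_of_nonneg_left (h.integral_V_sq_translate_le hp (z - e)) (hK.nonneg _)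

end C1

/-! ### An approximate identity on the torus -/

/-- The trigonometric bump `∏_j (1 + cos 2πx_j) / 2`, which attains its maximum `1` exactly on the
period lattice. -/
def cosBump {d : ℕ} (x : Vec d) : ℝ := ∏ j, (1 + Real.cos (2 * Real.pi * x j)) / 2

/-- The normalized powers of `cosBump`, an approximate identity on the torus. -/
def approxId (d n : ℕ) (x : Vec d) : ℝ := (∫ y, cosBump y ^ n ∂(volQ d))⁻¹ * cosBump x ^ n

section ApproxId

variable {d : ℕ}

theorem cosBump_nonneg (x : Vec d) : 0 ≤ cosBump x :=
  Finset.prod_nonneg fun j _ => by linarith [Real.neg_one_le_cos (2 * Real.pi * x j)]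

theorem contDiff_cosBump : ContDiff ℝ ∞ (cosBump : Vec d → ℝ) := by
  unfold cosBump
  refine contDiff_prod fun j _ => ContDiff.div_const (contDiff_const.add (Real.contDiff_cos.comp ?_)) _
  exact contDiff_const.mul (EuclideanSpace.proj (𝕜 := ℝ) j).contDiff

theorem periodic_cosBump : IsPeriodic (cosBump : Vec d → ℝ) := fun i x => by
  refine Finset.prod_congr rfl fun j _ => ?_
  rw [PiLp.add_apply, PiLp.single_apply]
  split_ifs
  · rw [mul_add, mul_one, Real.cos_add_two_pi]
  · rw [add_zero]

theorem isTest_cosBump_pow (n : ℕ) : IsTest fun x : Vec d => cosBump x ^ n :=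
  ⟨contDiff_cosBump.pow n, periodic_cosBump.comp (· ^ n)⟩

theorem cosBump_lt {x : Vec d} (hx : x ≠ 0) (h : ∀ j, |x j| < 1) :
    cosBump x < cosBump (0 : Vec d) := by
  have h0 : cosBump (0 : Vec d) = 1 := by simp [cosBump]
  obtain ⟨j, hj⟩ : ∃ j, x j ≠ 0 := by
    by_contra! hc
    exact hx (by ext j; simp [hc j])
  have hle : ∀ i, (1 + Real.cos (2 * Real.pi * x i)) / 2 ≤ 1 := fun i => by
    linarith [Real.cos_le_one (2 * Real.pi * x i)]
  have hpos : ∀ i, 0 ≤ (1 + Real.cos (2 * Real.pi * x i)) / 2 := fun i => by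
    linarith [Real.neg_one_le_cos (2 * Real.pi * x i)]
  have hlt : Real.cos (2 * Real.pi * x j) < 1 := by
    refine lt_of_le_of_ne (Real.cos_le_one _) fun hc => hj ?_
    obtain ⟨k, hk⟩ := (Real.cos_eq_one_iff _).1 hc
    have hk' : x j = k := by
      have := Real.pi_pos
      field_simp at hk
      linarith
    have h1 := h j
    rw [hk'] at h1 ⊢
    have h2 : |k| < 1 := (Int.cast_lt (R := ℝ)).1 (by rw [Int.cast_abs, Int.cast_one]; exact h1)
    simp [Int.abs_lt_one_iff.1 h2]
  rw [h0, cosBump, ← Finset.mul_prod_erase _ _ (Finset.mem_univ j)]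
  calc (1 + Real.cos (2 * Real.pi * x j)) / 2
        * ∏ i ∈ Finset.univ.erase j, (1 + Real.cos (2 * Real.pi * x i)) / 2
      ≤ (1 + Real.cos (2 * Real.pi * x j)) / 2 * 1 :=
        mul_le_mul_of_nonneg_left (Finset.prod_le_one (fun i _ => hpos i) fun i _ => hle i) (hpos j)
    _ < 1 := by linarith

theorem integral_cosBump_pow_pos (n : ℕ) : 0 < ∫ y : Vec d, cosBump y ^ n ∂(volQ d) := by
  have hc : Continuous fun y : Vec d => cosBump y ^ n := (isTest_cosBump_pow n).continuous
  have hne : (volQ d) ≠ 0 := IsProbabilityMeasure.ne_zero _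
  rw [integral_pos_iff_support_of_nonneg_ae (ae_of_all _ fun y => pow_nonneg (cosBump_nonneg y) n)
    ((isTest_cosBump_pow n).2.integrable hc)]
  -- the bump is positive on the open subcell `(0,1/2)^d`
  set U : Set (Vec d) := {x | ∀ i, x i ∈ Ioo (0 : ℝ) (1 / 2)} with hU
  have hUo : IsOpen U := by
    have : U = ⋂ i, (fun x : Vec d => x i) ⁻¹' Ioo 0 (1 / 2) := by ext; simp [hU]
    rw [this]
    exact isOpen_iInter_of_finite fun i =>
      isOpen_Ioo.preimage (by fun_prop : Continuous fun x : Vec d => x i)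
  have hUQ : U ⊆ Q d := fun x hx i => ⟨(hx i).1, (hx i).2.trans (by norm_num)⟩
  have hUne : U.Nonempty := ⟨WithLp.toLp 2 fun _ => 1 / 4, fun i => by
    change (1 / 4 : ℝ) ∈ Ioo (0 : ℝ) (1 / 2); norm_num⟩
  refine lt_of_lt_of_le (hUo.measure_pos volume hUne) ?_
  rw [volQ, Measure.restrict_apply (by
    rw [Function.support]
    exact (isOpen_ne_fun hc continuous_const).measurableSet)]
  refine measure_mono fun x hx => ⟨?_, hUQ hx⟩
  refine pow_ne_zero _ (Finset.prod_ne_zero_iff.2 fun j _ => ?_)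
  have h1 := hx j
  have hpi := Real.pi_pos
  have : -1 < Real.cos (2 * Real.pi * x j) := by
    rw [← Real.cos_pi]
    exact Real.cos_lt_cos_of_nonneg_of_le_pi (by nlinarith [h1.1]) le_rfl (by nlinarith [h1.2])
  intro h0
  linarith

theorem isKernel_approxId (n : ℕ) : IsKernel (approxId d n) where
  test := ⟨contDiff_const.mul (isTest_cosBump_pow n).1, fun i x => by
    simp only [approxId, periodic_cosBump i x]⟩
  nonneg x := mul_nonneg (inv_nonneg.2 (integral_cosBump_pow_pos n).le)
    (pow_nonneg (cosBump_nonneg x) n)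
  integral_eq := by
    simp only [approxId, integral_const_mul]
    exact inv_mul_cancel₀ (integral_cosBump_pow_pos n).ne'

theorem closure_Q_ae_eq (d : ℕ) : closure (Q d) =ᵐ[volume] Q d :=
  ((convex_Q d).addHaar_frontier volume |> fun h => by
    have : closure (Q d) = Q d ∪ frontier (Q d) := closure_eq_self_union_frontier _
    rw [this]
    exact union_ae_eq_left_of_ae_eq_empty (ae_eq_empty.2 h))

theorem mem_closure_Q {x : Vec d} (hx : x ∈ closure (Q d)) (i : Fin d) : x i ∈ Icc (0 : ℝ) 1 := by
  have hcl : IsClosed {x : Vec d | x i ∈ Icc (0 : ℝ) 1} :=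
    isClosed_Icc.preimage (by fun_prop : Continuous fun x : Vec d => x i)
  have hsub : Q d ⊆ {x : Vec d | x i ∈ Icc (0 : ℝ) 1} := fun y hy => ⟨(hy i).1.le, (hy i).2.le⟩
  exact closure_minimal hsub hcl hx

theorem tendsto_conv_approxId {E : Type*} [NormedAddCommGroup E] [NormedSpace ℝ E]
    [CompleteSpace E] {f : Vec d → E} (hf : Integrable f (volQ d)) {x : Vec d} (hx : x ∈ Q d)
    (hc : ContinuousAt f x) :
    Tendsto (fun n => conv (approxId d n) f x) atTop (𝓝 (f x)) := by
  have hcl : closure (Q d) =ᵐ[volume] Q d := closure_Q_ae_eq d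
  have hcompact : IsCompact (closure (Q d)) := (isBounded_Q d).isCompact_closure
  have hint : x ∈ interior (closure (Q d)) :=
    interior_mono subset_closure ((isOpen_Q d).interior_eq.symm ▸ hx)
  have hcont : Continuous fun y : Vec d => cosBump (x - y) :=
    contDiff_cosBump.continuous.comp (continuous_const.sub continuous_id)
  have key := tendsto_setIntegral_pow_smul_of_unique_maximum_of_isCompact_of_integrableOn
    (μ := volume) (c := fun y : Vec d => cosBump (x - y)) (g := f) (x₀ := x) hcompact
    hcont.continuousOn (fun y hy hne => ?_) (fun y _ => cosBump_nonneg _)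
    (by simp [cosBump]) (subset_closure hint)
    (by rw [IntegrableOn, Measure.restrict_congr_set hcl]; exact hf) hc.continuousWithinAt
  · refine key.congr fun n => ?_
    rw [Measure.restrict_congr_set hcl]
    change (∫ y, cosBump (x - y) ^ n ∂(volQ d))⁻¹ • ∫ y, cosBump (x - y) ^ n • f y ∂(volQ d) = _
    rw [conv, (isTest_cosBump_pow n).2.integral_sub_left, ← integral_smul]
    simp only [approxId, smul_smul]
  · rw [sub_self]
    refine cosBump_lt (sub_ne_zero.2 (Ne.symm hne)) fun j => ?_
    have h1 := hx j
    have h2 := mem_closure_Q hy j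
    rw [PiLp.sub_apply, abs_lt]
    constructor <;> linarith [h1.1, h1.2, h2.1, h2.2]

theorem tendsto_kernelModulus {p : ℝ} (hp : 2 ≤ p) :
    Tendsto (fun n => kernelModulus p (approxId d n)) atTop (𝓝 0) := by
  have hc : Continuous fun z : Vec d => V p ‖z - cellCentre d‖ ^ 2 :=
    (continuous_V_sq hp).comp (by fun_prop)
  have h := tendsto_conv_approxId (integrable_dist_centre (d := d) hp) (x := cellCentre d)
    (fun i => by change (1 / 2 : ℝ) ∈ Ioo (0 : ℝ) 1; norm_num) hc.continuousAt
  rw [sub_self, norm_zero, V_sq_zero hp] at h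
  exact h

/-- `K_n * f → f` in `L¹`. -/
theorem tendsto_integral_norm_conv_sub {E : Type*} [NormedAddCommGroup E] [NormedSpace ℝ E]
    [CompleteSpace E] {f : Vec d → E} (hf : Integrable f (volQ d)) :
    Tendsto (fun n => ∫ x, ‖conv (approxId d n) f x - f x‖ ∂(volQ d)) atTop (𝓝 0) := by
  refine Metric.tendsto_atTop.2 fun ε hε => ?_
  obtain ⟨φ, hφc, hφ, hφcont, hφi⟩ := hf.exists_hasCompactSupport_integral_sub_le
    (show (0 : ℝ) < ε / 4 by positivity)
  obtain ⟨C, hC⟩ := hφc.exists_bound_of_continuous hφcont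
  have hlim : Tendsto (fun n => ∫ x, ‖conv (approxId d n) φ x - φ x‖ ∂(volQ d)) atTop (𝓝 0) := by
    have : (0 : ℝ) = ∫ _x : Vec d, (0 : ℝ) ∂(volQ d) := by simp
    rw [this]
    refine tendsto_integral_of_dominated_convergence (fun _ => C + C)
      (fun n => ((conv_continuous (isKernel_approxId n).test hφi).sub
        hφcont).norm.aestronglyMeasurable) (integrable_const _) (fun n => ae_of_all _ fun x => ?_) ?_
    · rw [norm_norm]
      exact (norm_sub_le _ _).trans
        (add_le_add ((isKernel_approxId n).norm_conv_le hφi hC x) (hC x))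
    · refine (ae_restrict_iff' (measurableSet_Q d)).2 (ae_of_all _ fun x hx => ?_)
      have := tendsto_conv_approxId hφi hx hφcont.continuousAt
      simpa using (this.sub_const (φ x)).norm
  obtain ⟨N, hN⟩ := Metric.tendsto_atTop.1 hlim (ε / 4) (by positivity)
  refine ⟨N, fun n hn => ?_⟩
  have h1 := hN n hn
  rw [Real.dist_eq, sub_zero] at h1 ⊢
  have hK := isKernel_approxId (d := d) n
  have hd : Integrable (fun x => f x - φ x) (volQ d) := hf.sub hφi
  have h2 := hK.integral_map_conv_le (convexOn_norm convex_univ) continuous_norm hd hd.norm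
  have h3 : Integrable (fun x => ‖conv (approxId d n) φ x - φ x‖) (volQ d) :=
    ((conv_integrable hK.test hφi).sub hφi).norm
  have h4 : Integrable (fun x => ‖conv (approxId d n) (fun y => f y - φ y) x‖) (volQ d) :=
    (conv_integrable hK.test hd).norm
  rw [abs_of_nonneg (integral_nonneg fun _ => norm_nonneg _)] at h1 ⊢
  calc ∫ x, ‖conv (approxId d n) f x - f x‖ ∂(volQ d)
      ≤ ∫ x, (‖conv (approxId d n) (fun y => f y - φ y) x‖
          + ‖conv (approxId d n) φ x - φ x‖ + ‖f x - φ x‖) ∂(volQ d) := by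
        refine integral_mono ((conv_integrable hK.test hf).sub hf).norm
          ((h4.add h3).add hd.norm) fun x => ?_
        simp only [conv_sub hK.test hf hφi]
        have : conv (approxId d n) f x - f x = (conv (approxId d n) f x - conv (approxId d n) φ x)
          + (conv (approxId d n) φ x - φ x) - (f x - φ x) := by abel
        rw [this]
        exact (norm_sub_le _ _).trans (add_le_add_left (norm_add_le _ _) _)
    _ = ∫ x, ‖conv (approxId d n) (fun y => f y - φ y) x‖ ∂(volQ d)
        + ∫ x, ‖conv (approxId d n) φ x - φ x‖ ∂(volQ d) + ∫ x, ‖f x - φ x‖ ∂(volQ d) := by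
        have h43 : Integrable (fun x => ‖conv (approxId d n) (fun y => f y - φ y) x‖
          + ‖conv (approxId d n) φ x - φ x‖) (volQ d) := h4.add h3
        rw [integral_add h43 hd.norm, integral_add h4 h3]
    _ < ε := by linarith

theorem exists_subseq_conv_tendsto_ae {E : Type*} [NormedAddCommGroup E] [NormedSpace ℝ E]
    [CompleteSpace E] {f : Vec d → E} (hf : Integrable f (volQ d)) :
    ∃ ns : ℕ → ℕ, StrictMono ns ∧
      ∀ᵐ x ∂(volQ d), Tendsto (fun n => conv (approxId d (ns n)) f x) atTop (𝓝 (f x)) :=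
  exists_subseq_tendsto_ae (fun n => conv_integrable (isKernel_approxId n).test hf) hf
    (tendsto_integral_norm_conv_sub hf)

end ApproxId

/-! ### Periodic Sobolev maps -/

section Sobolev

variable {d : ℕ} {p : ℝ} {E : Type*} [NormedAddCommGroup E] {u : Vec d → Vec d} {g : Vec d → Mat d}

theorem one_le_ofReal (hp : 2 ≤ p) : (1 : ℝ≥0∞) ≤ ENNReal.ofReal p := by
  rw [← ENNReal.ofReal_one]; exact ENNReal.ofReal_le_ofReal (by linarith)

theorem integrable_V_sq_of_memLp {α : Type*} [MeasurableSpace α] {μ : Measure α}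
    [IsFiniteMeasure μ] (hp : 2 ≤ p) {f : α → E}
    (hf : MemLp f (ENNReal.ofReal p) μ) : Integrable (fun x => V p (f x) ^ 2) μ := by
  have hp0 : ENNReal.ofReal p ≠ 0 := by simp; linarith
  have h1 := hf.integrable_norm_rpow hp0 ENNReal.ofReal_ne_top
  rw [ENNReal.toReal_ofReal (by linarith)] at h1
  have h2 : MemLp f 2 μ := hf.mono_exponent (by
    rw [← ENNReal.ofReal_ofNat 2]; exact ENNReal.ofReal_le_ofReal hp)
  have h3 := h2.integrable_norm_pow (by norm_num)
  simp only [V_sq]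
  exact h3.add h1

theorem memLp_of_integrable_V_sq {α : Type*} [MeasurableSpace α] {μ : Measure α}
    (hp : 2 ≤ p) {f : α → E} (hfm : AEStronglyMeasurable f μ)
    (hf : Integrable (fun x => V p (f x) ^ 2) μ) : MemLp f (ENNReal.ofReal p) μ := by
  have hp0 : ENNReal.ofReal p ≠ 0 := by simp; linarith
  rw [← integrable_norm_rpow_iff hfm hp0 ENNReal.ofReal_ne_top,
    ENNReal.toReal_ofReal (by linarith)]
  refine hf.mono' (hfm.norm.aemeasurable.pow_const p).aestronglyMeasurable (ae_of_all _ fun x => ?_)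
  rw [Real.norm_of_nonneg (by positivity)]
  exact norm_rpow_le_V_sq p _

theorem IsSobolev.integrable (hp : 2 ≤ p) (h : IsSobolev (ENNReal.ofReal p) u g) :
    Integrable u (volQ d) := h.memLp.integrable (one_le_ofReal hp)

theorem IsSobolev.integrable_grad (hp : 2 ≤ p) (h : IsSobolev (ENNReal.ofReal p) u g) :
    Integrable g (volQ d) := h.memLp_grad.integrable (one_le_ofReal hp)

theorem IsSobolev.conv (hp : 2 ≤ p) (h : IsSobolev (ENNReal.ofReal p) u g) {K : Vec d → ℝ}
    (hK : IsTest K) : IsC1Periodic (conv K u) (conv K g) :=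
  isC1Periodic_conv hK (h.integrable hp) (h.integrable_grad hp) h.weak_deriv

/-- `∫ V(u - K * u)²` is controlled by the gradient, for Sobolev maps. -/
theorem IsSobolev.integral_V_sq_sub_conv_le (hp : 2 ≤ p) (h : IsSobolev (ENNReal.ofReal p) u g)
    {K : Vec d → ℝ} (hK : IsKernel K) :
    ∫ x, V p (u x - QCGarding.conv K u x) ^ 2 ∂(volQ d)
      ≤ kernelModulus p K * ∫ x, V p (g x) ^ 2 ∂(volQ d) := by
  have hu := h.integrable hp
  have hg := h.integrable_grad hp
  obtain ⟨ns, hmono, hns⟩ := exists_subseq_conv_tendsto_ae hu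
  set A := fun n => approxId d (ns n)
  have hA : ∀ n, IsKernel (A n) := fun n => isKernel_approxId _
  have hC1 : ∀ n, IsC1Periodic (QCGarding.conv (A n) u) (QCGarding.conv (A n) g) :=
    fun n => h.conv hp (hA n).test
  obtain ⟨C, hC0, hC⟩ := hK.test.exists_bound
  have hlim : ∀ x, Tendsto (fun n => QCGarding.conv K (QCGarding.conv (A n) u) x) atTop
      (𝓝 (QCGarding.conv K u x)) := fun x => by
    have h1 : Tendsto (fun n => C * ∫ y, ‖QCGarding.conv (approxId d n) u y - u y‖ ∂(volQ d)) atTop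
        (𝓝 0) := by
      simpa using (tendsto_integral_norm_conv_sub hu).const_mul C
    refine tendsto_iff_norm_sub_tendsto_zero.2 (squeeze_zero (fun _ => norm_nonneg _) (fun n => ?_)
      (h1.comp hmono.tendsto_atTop))
    have h2 := conv_integrable (hA n).test hu
    rw [← conv_sub hK.test h2 hu, Function.comp_apply, ← integral_const_mul]
    refine norm_integral_le_of_norm_le (((h2.sub hu).norm).const_mul C) (ae_of_all _ fun y => ?_)
    rw [norm_smul]
    exact mul_le_mul_of_nonneg_right (hC _) (norm_nonneg _)
  have hVc : Continuous fun ξ : Vec d => V p ξ ^ 2 := continuous_V_sq hp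
  refine (integrable_and_integral_le_of_tendsto
    (f := fun n x => V p (QCGarding.conv (A n) u x
      - QCGarding.conv K (QCGarding.conv (A n) u) x) ^ 2)
    (fun n => ?_) (fun n => ae_of_all _ fun x => V_sq_nonneg _ _) ?_ fun n => ?_).2
  · refine IsPeriodic.integrable (fun i x => ?_) (hVc.comp
      ((hC1 n).continuous.sub (conv_continuous hK.test (conv_integrable (hA n).test hu))))
    simp only [(hC1 n).periodic i, conv_periodic hK.test.2 _ i]
  · filter_upwards [hns] with x hx
    exact (hVc.tendsto _).comp (hx.sub (hlim x))
  · refine ((hC1 n).integral_V_sq_sub_conv_le hp hK).trans ?_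
    refine mul_le_mul_of_nonneg_left ?_ (kernelModulus_nonneg hK)
    exact (hA n).integral_map_conv_le (convexOn_V_sq hp) (continuous_V_sq hp) hg
      (integrable_V_sq_of_memLp hp h.memLp_grad)

theorem isKernel_one : IsKernel fun _ : Vec d => (1 : ℝ) where
  test := ⟨contDiff_const, fun _ _ => rfl⟩
  nonneg _ := zero_le_one
  integral_eq := by simp

/-- Poincaré's inequality. -/
theorem IsC1Periodic.poincare {w : Vec d → Vec d} {D : Vec d → Mat d} (h : IsC1Periodic w D)
    (hp : 2 ≤ p) (h0 : ∫ x, w x ∂(volQ d) = 0) :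
    ∫ x, V p (w x) ^ 2 ∂(volQ d)
      ≤ kernelModulus p (fun _ : Vec d => (1 : ℝ)) * ∫ x, V p (D x) ^ 2 ∂(volQ d) := by
  have := h.integral_V_sq_sub_conv_le hp isKernel_one
  have e : ∀ x, QCGarding.conv (fun _ : Vec d => (1 : ℝ)) w x = 0 := fun x => by
    simp only [QCGarding.conv, one_smul, h0]
  simpa only [e, sub_zero] using this

theorem IsC1Periodic.norm_le_of_integral_eq_zero {w : Vec d → Vec d} {D : Vec d → Mat d}
    (h : IsC1Periodic w D) (h0 : ∫ x, w x ∂(volQ d) = 0) {C : ℝ} (hC : ∀ x, ‖D x‖ ≤ C)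
    {x : Vec d} (hx : x ∈ Q d) : ‖w x‖ ≤ C * Real.sqrt d := by
  have hC0 : 0 ≤ C := (norm_nonneg _).trans (hC 0)
  have hw : Integrable w (volQ d) := h.periodic.integrable h.continuous
  have e : w x = ∫ y, (w x - w y) ∂(volQ d) := by
    rw [integral_sub (integrable_const _) hw, h0, sub_zero]
    simp
  rw [e]
  have := norm_integral_le_of_norm_le (μ := volQ d) (f := fun y => w x - w y)
    (g := fun _ => C * Real.sqrt d) (integrable_const _)
    ((ae_restrict_iff' (measurableSet_Q d)).2 (ae_of_all _ fun y hy =>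
      (h.norm_sub_le hC x y).trans (mul_le_mul_of_nonneg_left (norm_sub_le_of_mem_Q hx hy) hC0)))
  simpa using this

theorem integrable_mul_continuous {u f : Vec d → ℝ} (hu : Integrable u (volQ d))
    (hf : Continuous f) : Integrable (fun x => u x * f x) (volQ d) :=
  hu.mul_of_top_left (memLp_top_of_continuous hf)

theorem integrable_apply {α ι : Type*} [Fintype ι] [MeasurableSpace α] {μ : Measure α}
    {f : α → EuclideanSpace ℝ ι} (hf : Integrable f μ) (i : ι) :
    Integrable (fun x => f x i) μ :=
  (EuclideanSpace.proj (𝕜 := ℝ) i).integrable_comp hf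

theorem integral_apply {α ι : Type*} [Fintype ι] [MeasurableSpace α] {μ : Measure α}
    {f : α → EuclideanSpace ℝ ι} (hf : Integrable f μ) (i : ι) :
    (∫ x, f x ∂μ) i = ∫ x, f x i ∂μ :=
  ((EuclideanSpace.proj (𝕜 := ℝ) i).integral_comp_comm hf).symm

/-- The gradient of a periodic map has zero average. -/
theorem IsWeakDeriv.integral_eq_zero {j : Fin d} {u g : Vec d → ℝ} (h : IsWeakDeriv j u g) :
    ∫ x, g x ∂(volQ d) = 0 := by
  have := h (fun _ => 1) ⟨contDiff_const, fun _ _ => rfl⟩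
  simpa [partialD] using this

end Sobolev

/-! ### Integration by parts for smooth periodic and for Lipschitz functions -/

section ByParts

variable {d : ℕ}

theorem partialD_mul {φ ψ : Vec d → ℝ} (j : Fin d) {x : Vec d} (hφ : DifferentiableAt ℝ φ x)
    (hψ : DifferentiableAt ℝ ψ x) :
    partialD j (fun x => φ x * ψ x) x = φ x * partialD j ψ x + ψ x * partialD j φ x := by
  have := fderiv_mul hφ hψ
  rw [partialD]
  change (fderiv ℝ (φ * ψ) x) _ = _
  rw [this]
  simp [partialD]

theorem IsPeriodic.partialD {φ : Vec d → ℝ} (hφ : IsPeriodic φ) (j : Fin d) :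
    IsPeriodic (partialD j φ) := fun i x => by
  rw [QCGarding.partialD, ← fderiv_comp_add_right]
  congr 2
  funext z
  exact hφ i z

theorem continuous_partialD {φ : Vec d → ℝ} (hφ : ContDiff ℝ 1 φ) (j : Fin d) :
    Continuous (partialD j φ) :=
  (hφ.continuous_fderiv (by simp)).clm_apply continuous_const

theorem integral_partialD_eq_zero {φ : Vec d → ℝ} (hφ : ContDiff ℝ 1 φ) (hφp : IsPeriodic φ)
    (j : Fin d) :
    ∫ x, partialD j φ x ∂(volQ d) = 0 := by
  set e : Vec d := EuclideanSpace.single j 1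
  -- integrate the fundamental theorem of calculus along the period `e`
  have hd := continuous_partialD hφ j
  have hp := hφp.partialD j
  obtain ⟨C, -, hC⟩ := hp.exists_bound hd
  have hpt : ∀ x, ∫ s in Ioc (0 : ℝ) 1, partialD j φ (x + s • e) = 0 := fun x => by
    have hder : ∀ s ∈ uIcc (0 : ℝ) 1, HasDerivAt (fun s : ℝ => φ (x + s • e))
        (partialD j φ (x + s • e)) s := fun s _ => by
      have h2 : HasDerivAt (fun s : ℝ => x + s • e) e s := by
        simpa using ((hasDerivAt_id s).smul_const e).const_add x
      exact ((hφ.differentiable (by simp)) (x + s • e)).hasFDerivAt.comp_hasDerivAt s h2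
    have hcs : Continuous fun s : ℝ => partialD j φ (x + s • e) := hd.comp (by fun_prop)
    have h3 := intervalIntegral.integral_eq_sub_of_hasDerivAt hder (hcs.intervalIntegrable 0 1)
    rw [intervalIntegral.integral_of_le zero_le_one] at h3
    rw [h3, one_smul, zero_smul, add_zero, hφp j x, sub_self]
  have hcont : Continuous fun q : Vec d × ℝ => partialD j φ (q.1 + q.2 • e) :=
    hd.comp (by fun_prop)
  have hprod : Integrable (fun q : Vec d × ℝ => partialD j φ (q.1 + q.2 • e))
      ((volQ d).prod (volume.restrict (Ioc (0 : ℝ) 1))) :=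
    Integrable.of_bound hcont.aestronglyMeasurable C (ae_of_all _ fun q => hC _)
  have h4 := integral_integral_swap (f := fun (x : Vec d) (s : ℝ) => partialD j φ (x + s • e)) hprod
  simp only [hpt, hp.integral_add] at h4
  simpa using h4.symm

theorem isWeakDeriv_of_contDiff {ψ : Vec d → ℝ} (hψ : ContDiff ℝ 1 ψ) (hψp : IsPeriodic ψ)
    (j : Fin d) :
    IsWeakDeriv j ψ (partialD j ψ) := fun φ hφ => by
  have h := integral_partialD_eq_zero (φ := fun x => ψ x * φ x)
    (hψ.mul (hφ.1.of_le (by exact_mod_cast le_top))) (fun i x => by simp only [hψp i, hφ.2 i]) j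
  have e : ∀ x, partialD j (fun x => ψ x * φ x) x
      = ψ x * partialD j φ x + partialD j ψ x * φ x := fun x => by
    rw [partialD_mul j (hψ.differentiable (by simp) x) (hφ.1.differentiable (by simp) x)]
    ring
  simp only [e] at h
  have hi : ∀ {f : Vec d → ℝ}, Continuous f → Integrable f (volQ d) := fun hf =>
    (memLp_top_of_continuous hf).integrable le_top
  rw [integral_add (integrable_mul_continuous (hi hψ.continuous) (hφ.partialD_continuous j))
    (integrable_mul_continuous (hi (continuous_partialD hψ j)) hφ.continuous)] at h
  linarith

theorem isWeakDeriv_of_isTest {ψ : Vec d → ℝ} (hψ : IsTest ψ) (j : Fin d) :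
    IsWeakDeriv j ψ (partialD j ψ) :=
  isWeakDeriv_of_contDiff (hψ.1.of_le (by exact_mod_cast le_top)) hψ.2 j

end ByParts

/-! ### Consequences of strong quasiconvexity for the integrand -/

section Integrand

variable {d : ℕ} {p : ℝ} {W : Mat d → ℝ}

theorem memLp_top_of_continuous_periodic {E : Type*} [NormedAddCommGroup E] {f : Vec d → E}
    (hf : IsPeriodic f) (hc : Continuous f) : MemLp f ∞ (volQ d) := by
  obtain ⟨C, -, hC⟩ := hf.exists_bound hc
  exact memLp_top_of_bound hc.aestronglyMeasurable C (ae_of_all _ hC)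

theorem periodic_cos (j : Fin d) (c : ℝ) :
    IsPeriodic fun x : Vec d => Real.cos (2 * Real.pi * x j + c) := fun i x => by
  simp only [PiLp.add_apply, PiLp.single_apply]
  split_ifs
  · rw [mul_add, mul_one, add_right_comm, Real.cos_add_two_pi]
  · rw [add_zero]

theorem integral_cos_coord (j : Fin d) :
    ∫ x : Vec d, Real.cos (2 * Real.pi * x j) ∂(volQ d) = 0 := by
  have h0 := periodic_cos (d := d) j 0
  simp only [add_zero] at h0
  have h := h0.integral_add (EuclideanSpace.single j (1 / 2 : ℝ))
  have e : ∀ x : Vec d, Real.cos (2 * Real.pi * (x + EuclideanSpace.single j (1 / 2 : ℝ)) j)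
      = -Real.cos (2 * Real.pi * x j) := fun x => by
    rw [PiLp.add_apply, PiLp.single_apply, if_pos rfl, ← Real.cos_add_pi]
    congr 1; ring
  simp only [e, integral_neg] at h
  linarith

theorem integral_cos_sq_coord (j : Fin d) :
    ∫ x : Vec d, Real.cos (2 * Real.pi * x j) ^ 2 ∂(volQ d) = 1 / 2 := by
  have h0 := periodic_cos (d := d) j 0
  simp only [add_zero] at h0
  have h1 := h0.comp (fun y : ℝ => y ^ 2)
  have hc : Continuous fun x : Vec d => Real.cos (2 * Real.pi * x j) ^ 2 := by fun_prop
  have hi := h1.integrable hc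
  have h := h1.integral_add (EuclideanSpace.single j (1 / 4 : ℝ))
  have e : ∀ x : Vec d, Real.cos (2 * Real.pi * (x + EuclideanSpace.single j (1 / 4 : ℝ)) j) ^ 2
      = 1 - Real.cos (2 * Real.pi * x j) ^ 2 := fun x => by
    rw [PiLp.add_apply, PiLp.single_apply, if_pos rfl, ← Real.sin_sq,
      show 2 * Real.pi * (x j + 1 / 4) = 2 * Real.pi * x j + Real.pi / 2 by ring,
      Real.cos_add_pi_div_two, neg_sq]
  simp only [e] at h
  rw [integral_sub (integrable_const _) hi] at h
  simp only [integral_const, probReal_univ, smul_eq_mul, mul_one] at h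
  linarith

theorem continuous_single {ι : Type*} [Fintype ι] [DecidableEq ι] (k : ι) :
    Continuous fun t : ℝ => (EuclideanSpace.single k t : EuclideanSpace ℝ ι) := by
  refine (PiLp.continuous_toLp 2 _).comp (continuous_pi fun l => ?_)
  by_cases h : l = k
  · subst h; simpa using continuous_id'
  · simpa [h] using continuous_const

/-- The plane wave `ε sin(2πx_j)/(2π) e_i`, whose gradient is `ε cos(2πx_j) e_i ⊗ e_j`. -/
theorem isSobolev_planeWave (i j : Fin d) (ε : ℝ) :
    IsSobolev ∞ (fun x : Vec d => EuclideanSpace.single i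
        (ε * (Real.sin (2 * Real.pi * x j) / (2 * Real.pi))))
      (fun x : Vec d => EuclideanSpace.single (i, j) (ε * Real.cos (2 * Real.pi * x j))) := by
  set s : Vec d → ℝ := fun x => ε * (Real.sin (2 * Real.pi * x j) / (2 * Real.pi)) with hs
  have hsp : IsPeriodic s := fun k x => by
    simp only [hs, PiLp.add_apply, PiLp.single_apply]
    split_ifs
    · rw [mul_add, mul_one, Real.sin_add_two_pi]
    · rw [add_zero]
  have hcp : IsPeriodic fun x : Vec d => ε * Real.cos (2 * Real.pi * x j) := by
    have := (periodic_cos (d := d) j 0).comp (fun y => ε * y)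
    simpa only [add_zero] using this
  have hproj : ContDiff ℝ ∞ fun x : Vec d => x j := (EuclideanSpace.proj (𝕜 := ℝ) j).contDiff
  have hst : IsTest s :=
    ⟨contDiff_const.mul ((Real.contDiff_sin.comp (contDiff_const.mul hproj)).div_const _), hsp⟩
  have hzero : IsTest (fun _ : Vec d => (0 : ℝ)) := ⟨contDiff_const, fun _ _ => rfl⟩
  have hder : ∀ (k : Fin d) (x : Vec d), partialD k s x
      = if k = j then ε * Real.cos (2 * Real.pi * x j) else 0 := fun k x => by
    have h1 : HasFDerivAt (fun x : Vec d => x j) (EuclideanSpace.proj (𝕜 := ℝ) j) x :=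
      (EuclideanSpace.proj (𝕜 := ℝ) j).hasFDerivAt
    have h2 := ((h1.const_mul (2 * Real.pi)).sin.mul_const (2 * Real.pi)⁻¹).const_mul ε
    have h3 : HasFDerivAt s _ x := h2
    rw [partialD, h3.fderiv]
    have hpi := Real.pi_pos
    have h4 : (EuclideanSpace.proj (𝕜 := ℝ) j : Vec d →L[ℝ] ℝ) (EuclideanSpace.single k 1)
        = if k = j then 1 else 0 := by
      simp [PiLp.single_apply, eq_comm (a := j)]
    simp only [smul_apply, h4, smul_eq_mul]
    split_ifs
    · field_simp
    · simp
  refine ⟨memLp_top_of_continuous_periodic (hsp.comp _) ((continuous_single i).comp hst.continuous),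
    memLp_top_of_continuous_periodic (hcp.comp _) ((continuous_single (i, j)).comp (by fun_prop)),
    fun k l => ?_⟩
  by_cases hk : k = i
  · subst hk
    have := isWeakDeriv_of_isTest hst l
    have e : partialD l s = fun x : Vec d =>
        (EuclideanSpace.single (k, j) (ε * Real.cos (2 * Real.pi * x j)) : Mat d) (k, l) := by
      funext x
      rw [hder, PiLp.single_apply]
      simp
    rw [e] at this
    simpa [hs] using this
  · have := isWeakDeriv_of_isTest hzero l
    have e : partialD l (fun _ : Vec d => (0 : ℝ)) = fun _ => 0 := by
      funext x; simp [partialD]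
    rw [e] at this
    simpa [PiLp.single_apply, hk] using this

/-- The strong quasiconvexity inequality with the constant `c₀` made explicit. -/
def QuasiconvexWith (p c₀ : ℝ) (W : Mat d → ℝ) : Prop :=
  ∀ (ξ : Mat d) (φ : Vec d → Vec d) (g : Vec d → Mat d), IsSobolev ∞ φ g →
    c₀ * ∫ x, V p (g x) ^ 2 ∂(volQ d) ≤ ∫ x, (W (ξ + g x) - W ξ) ∂(volQ d)

/-- A quasiconvex function is convex in each matrix entry. If its restriction to a coordinate line
rose above a chord, testing with a small plane wave at a point of maximal excess would contradict
strong quasiconvexity. -/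
theorem QuasiconvexWith.convexOn_line {c₀ : ℝ} (hc₀ : 0 < c₀) (hp : 2 ≤ p)
    (hW : Continuous W) (hqc : QuasiconvexWith p c₀ W) (ξ : Mat d) (ij : Fin d × Fin d) :
    ConvexOn ℝ univ fun s : ℝ => W (ξ + EuclideanSpace.single ij s) := by
  obtain ⟨i, j⟩ := ij
  set f : ℝ → ℝ := fun s => W (ξ + EuclideanSpace.single (i, j) s) with hf
  have hfc : Continuous f := hW.comp (continuous_const.add (continuous_single _))
  -- testing with a plane wave: `f` has a strict mean value inequality at every point
  have key : ∀ s₀ ε : ℝ, ε ≠ 0 →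
      0 < ∫ x : Vec d, (f (s₀ + ε * Real.cos (2 * Real.pi * x j)) - f s₀) ∂(volQ d) := by
    intro s₀ ε hε
    have h := hqc (ξ + EuclideanSpace.single (i, j) s₀) _ _ (isSobolev_planeWave i j ε)
    have e : ∀ x : Vec d, W (ξ + EuclideanSpace.single (i, j) s₀
        + EuclideanSpace.single (i, j) (ε * Real.cos (2 * Real.pi * x j)))
        = f (s₀ + ε * Real.cos (2 * Real.pi * x j)) := fun x => by
      rw [hf]
      simp only [add_assoc]
      congr 2
      ext l
      simp only [PiLp.add_apply, PiLp.single_apply]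
      split_ifs <;> simp
    simp only [e] at h
    refine lt_of_lt_of_le (mul_pos hc₀ ?_) h
    have hcos : Continuous fun x : Vec d => (ε * Real.cos (2 * Real.pi * x j)) ^ 2 := by fun_prop
    have hcp : IsPeriodic fun x : Vec d => ε * Real.cos (2 * Real.pi * x j) := by
      have := (periodic_cos (d := d) j 0).comp (fun y => ε * y)
      simpa only [add_zero] using this
    calc (0 : ℝ) < ε ^ 2 * (1 / 2) := by positivity
      _ = ∫ x : Vec d, (ε * Real.cos (2 * Real.pi * x j)) ^ 2 ∂(volQ d) := by
          simp only [mul_pow, integral_const_mul, integral_cos_sq_coord]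
      _ ≤ _ := ?_
    have hpp : ∀ s : ℝ, V p (EuclideanSpace.single (i, j) s : Mat d) ^ 2 = |s| ^ 2 + |s| ^ p :=
      fun s => by rw [V_sq, PiLp.norm_single, Real.norm_eq_abs]
    simp only [hpp]
    refine integral_mono_of_nonneg (ae_of_all _ fun x => sq_nonneg _) ?_ (ae_of_all _ fun x => ?_)
    · obtain ⟨C, hC0, hC⟩ := hcp.exists_bound (by fun_prop)
      exact (hcp.comp fun s : ℝ => |s| ^ 2 + |s| ^ p).integrable
        (((continuous_abs.pow 2).add (continuous_abs.rpow_const fun _ => Or.inr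
          (by linarith))).comp (by fun_prop))
    · simp only [sq_abs]
      have := Real.rpow_nonneg (abs_nonneg (ε * Real.cos (2 * Real.pi * x j))) p
      linarith
  refine ⟨convex_univ, fun a _ b _ α β hα hβ hαβ => ?_⟩
  by_contra! hcon
  simp only [smul_eq_mul] at hcon
  -- the excess of `f` over its chord, and a point `t₀` where it is maximal
  set h : ℝ → ℝ := fun t => f (a + t * (b - a)) - (1 - t) * f a - t * f b with hh
  have hhc : Continuous h := by
    have : Continuous fun t : ℝ => f (a + t * (b - a)) := hfc.comp (by fun_prop)
    simp only [hh]
    fun_prop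
  have hβpos : 0 < h β := by
    have h1 : a + β * (b - a) = α * a + β * b := by rw [← eq_sub_iff_add_eq] at hαβ; rw [hαβ]; ring
    simp only [hh, h1]
    rw [← eq_sub_iff_add_eq] at hαβ
    rw [← hαβ]
    linarith
  have hab : a ≠ b := by
    rintro rfl
    simp only [hh, sub_self, mul_zero, add_zero] at hβpos
    nlinarith
  obtain ⟨t₀, ht₀, hmax⟩ := isCompact_Icc.exists_isMaxOn (nonempty_Icc.2 zero_le_one)
    (hhc.continuousOn (s := Icc (0 : ℝ) 1))
  have hmax' : ∀ t ∈ Icc (0 : ℝ) 1, h t ≤ h t₀ := fun t ht => hmax ht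
  have ht₀pos : 0 < h t₀ := hβpos.trans_le (hmax' β ⟨hβ, by linarith⟩)
  have h0 : t₀ ≠ 0 := by rintro rfl; simp [hh] at ht₀pos
  have h1 : t₀ ≠ 1 := by rintro rfl; simp [hh] at ht₀pos
  have h0' : 0 < t₀ := lt_of_le_of_ne ht₀.1 (Ne.symm h0)
  have h1' : t₀ < 1 := lt_of_le_of_ne ht₀.2 h1
  -- With this amplitude the wave stays in `[0,1]`, where the excess is at most `h t₀`; hence `f`
  -- lies below an affine function touching it at `a + t₀ (b - a)`, and its mean along the wave is
  -- at most the value there.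
  set δ := min t₀ (1 - t₀) with hδ
  have hδ0 : 0 < δ := lt_min h0' (by linarith)
  have hk := key (a + t₀ * (b - a)) (δ * (b - a)) (mul_ne_zero hδ0.ne' (sub_ne_zero.2 hab.symm))
  refine absurd hk (not_lt.2 ?_)
  have hcp : IsPeriodic fun x : Vec d => Real.cos (2 * Real.pi * x j) := by
    simpa only [add_zero] using periodic_cos (d := d) j 0
  have hrhs : ∫ x : Vec d, (f b - f a) * δ * Real.cos (2 * Real.pi * x j) ∂(volQ d) = 0 := by
    rw [integral_const_mul, integral_cos_coord, mul_zero]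
  rw [← hrhs]
  refine integral_mono ?_ ((hcp.comp fun y => (f b - f a) * δ * y).integrable (by fun_prop))
    fun x => ?_
  · exact (hcp.comp fun y => f (a + t₀ * (b - a) + δ * (b - a) * y) - f (a + t₀ * (b - a))).integrable
      ((hfc.comp (by fun_prop)).sub continuous_const)
  · set c := Real.cos (2 * Real.pi * x j)
    have hc1 : -1 ≤ c := Real.neg_one_le_cos _
    have hc2 : c ≤ 1 := Real.cos_le_one _
    have hδ1 : δ ≤ t₀ := min_le_left _ _
    have hδ2 : δ ≤ 1 - t₀ := min_le_right _ _
    have := hmax' (t₀ + δ * c) ⟨by nlinarith, by nlinarith⟩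
    simp only [hh] at this
    have e : a + (t₀ + δ * c) * (b - a) = a + t₀ * (b - a) + δ * (b - a) * c := by ring
    rw [e] at this
    change f (a + t₀ * (b - a) + δ * (b - a) * c) - f (a + t₀ * (b - a)) ≤ (f b - f a) * δ * c
    linarith

end Integrand

/-! ### Estimates for the Taylor remainder `G` -/

section Remainder

variable {d : ℕ} {p c₀ : ℝ} {W : Mat d → ℝ}

/-- A convex function on the line is Lipschitz near `0`, with a constant given by its values. -/
theorem abs_sub_le_of_convexOn {f : ℝ → ℝ} (hf : ConvexOn ℝ univ f) {B s : ℝ} (hs : |s| ≤ 1)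
    (h0 : |f 0| ≤ B) (h1 : |f 1| ≤ B) (h2 : |f (-1)| ≤ B) : |f s - f 0| ≤ 2 * B * |s| := by
  rw [abs_le] at h0 h1 h2 ⊢
  -- for `0 ≤ t ≤ 1` and `g` convex the slopes at `0` are between those of the unit chords
  have key : ∀ g : ℝ → ℝ, ConvexOn ℝ univ g → ∀ t : ℝ, 0 ≤ t → t ≤ 1 →
      g t - g 0 ≤ t * (g 1 - g 0) ∧ t * (g 0 - g (-1)) ≤ g t - g 0 := by
    intro g hg t ht0 ht1
    constructor
    · have := hg.2 (mem_univ 0) (mem_univ 1) (sub_nonneg.2 ht1) ht0 (by ring)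
      simp only [smul_eq_mul, mul_zero, mul_one, zero_add] at this
      linarith
    · have ht : 0 < 1 + t := by linarith
      have hp1 : 0 ≤ 1 / (1 + t) := by positivity
      have hp2 : 0 ≤ t / (1 + t) := by positivity
      have := hg.2 (mem_univ t) (mem_univ (-1)) hp1 hp2 (by field_simp)
      have e : (1 / (1 + t)) • t + (t / (1 + t)) • (-1 : ℝ) = 0 := by
        simp only [smul_eq_mul]; field_simp; ring
      rw [e] at this
      simp only [smul_eq_mul] at this
      have h3 : g 0 * (1 + t) ≤ g t + t * g (-1) := by
        calc g 0 * (1 + t) ≤ (1 / (1 + t) * g t + t / (1 + t) * g (-1)) * (1 + t) :=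
              mul_le_mul_of_nonneg_right this ht.le
          _ = g t + t * g (-1) := by field_simp
      linarith
  rcases le_total 0 s with h | h
  · rw [abs_of_nonneg h] at hs ⊢
    obtain ⟨k1, k2⟩ := key f hf s h hs
    constructor <;> nlinarith
  · rw [abs_of_nonpos h] at hs ⊢
    have hf' : ConvexOn ℝ univ fun t => f (-t) := by
      have := hf.comp_linearMap (-LinearMap.id : ℝ →ₗ[ℝ] ℝ)
      simpa [Function.comp_def] using this
    obtain ⟨k1, k2⟩ := key _ hf' (-s) (by linarith) hs
    simp only [neg_neg, neg_zero] at k1 k2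
    constructor <;> nlinarith

/-- Lipschitz bound on balls, from convexity in the entries. -/
theorem abs_sub_le_of_separatelyConvex
    (hsep : ∀ ξ ij, ConvexOn ℝ univ fun s : ℝ => W (ξ + EuclideanSpace.single ij s))
    {ρ B : ℝ} (hB : ∀ ξ, ‖ξ‖ ≤ ρ + 2 → |W ξ| ≤ B) {η D : Mat d} (hη : ‖η‖ ≤ ρ)
    (hD : ∑ ij, |D ij| ≤ 1) : |W (η + D) - W η| ≤ 2 * B * ∑ ij, |D ij| := by
  have hB0 : 0 ≤ B := (abs_nonneg _).trans (hB η (by linarith))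
  have key : ∀ S : Finset (Fin d × Fin d),
      |W (η + ∑ ij ∈ S, EuclideanSpace.single ij (D ij)) - W η| ≤ 2 * B * ∑ ij ∈ S, |D ij| := by
    intro S
    induction S using Finset.induction_on with
    | empty => simp
    | insert a S ha ih =>
      rw [Finset.sum_insert ha, Finset.sum_insert ha]
      set ζ : Mat d := η + ∑ ij ∈ S, EuclideanSpace.single ij (D ij) with hζ
      have hsumS : ∑ ij ∈ S, |D ij| ≤ 1 :=
        (Finset.sum_le_univ_sum_of_nonneg fun _ => abs_nonneg _).trans hD
      have hζn : ‖ζ‖ ≤ ρ + 1 := by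
        refine (norm_add_le _ _).trans (add_le_add hη ?_)
        refine (norm_sum_le _ _).trans ?_
        simpa using hsumS
      have hDa : |D a| ≤ 1 :=
        (Finset.single_le_sum (fun i _ => abs_nonneg (D i)) (Finset.mem_univ a)).trans hD
      have hn : ∀ s : ℝ, |s| ≤ 1 → |W (ζ + EuclideanSpace.single a s)| ≤ B := fun s hs => by
        refine hB _ ((norm_add_le _ _).trans ?_)
        rw [PiLp.norm_single, Real.norm_eq_abs]
        linarith
      have hl := abs_sub_le_of_convexOn (hsep ζ a) hDa (hn 0 (by simp)) (hn 1 (by simp))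
        (hn (-1) (by simp))
      have hz : (EuclideanSpace.single a (0 : ℝ) : Mat d) = 0 := by simp
      simp only [hz, add_zero] at hl
      have e : η + (EuclideanSpace.single a (D a) + ∑ ij ∈ S, EuclideanSpace.single ij (D ij))
          = ζ + EuclideanSpace.single a (D a) := by rw [hζ]; abel
      rw [e]
      calc |W (ζ + EuclideanSpace.single a (D a)) - W η|
          ≤ |W (ζ + EuclideanSpace.single a (D a)) - W ζ| + |W ζ - W η| := abs_sub_le _ _ _
        _ ≤ 2 * B * (|D a| + ∑ ij ∈ S, |D ij|) := by linarith
  have hDs : ∑ ij, EuclideanSpace.single ij (D ij) = D := by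
    ext ij
    simp [Finset.sum_apply, Pi.single_apply]
  simpa only [hDs] using key Finset.univ

theorem sum_abs_le (D : Mat d) : ∑ ij, |D ij| ≤ (d : ℝ) ^ 2 * ‖D‖ := by
  calc ∑ ij, |D ij| ≤ ∑ _ij : Fin d × Fin d, ‖D‖ :=
        Finset.sum_le_sum fun ij _ => PiLp.norm_apply_le D ij
    _ = (d : ℝ) ^ 2 * ‖D‖ := by
        rw [Finset.sum_const, Finset.card_univ, Fintype.card_prod, Fintype.card_fin, nsmul_eq_mul]
        push_cast
        ring

theorem taylor_remainder_le {k : Mat d → ℝ} (hk : ContDiff ℝ 2 k) {M : ℝ}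
    (hM : ∀ η, ‖η‖ ≤ 1 → ‖fderiv ℝ (fderiv ℝ k) η‖ ≤ M) {ξ : Mat d} (hξ : ‖ξ‖ ≤ 1) :
    |k ξ - k 0 - fderiv ℝ k 0 ξ| ≤ M * ‖ξ‖ ^ 2 := by
  have hM0 : 0 ≤ M := (norm_nonneg (fderiv ℝ (fderiv ℝ k) 0)).trans (hM 0 (by simp))
  have hd1 : Differentiable ℝ k := hk.differentiable (by simp)
  have hd2 : Differentiable ℝ (fderiv ℝ k) := (hk.fderiv_right (m := 1) (by norm_num)).differentiable
    (by simp)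
  have h1 : ∀ η ∈ Metric.closedBall (0 : Mat d) ‖ξ‖, ‖fderiv ℝ k η - fderiv ℝ k 0‖ ≤ M * ‖ξ‖ := by
    intro η hη
    rw [mem_closedBall_zero_iff] at hη
    have := (convex_closedBall (0 : Mat d) 1).norm_image_sub_le_of_norm_fderiv_le
      (f := fderiv ℝ k) (fun z _ => hd2 z) (C := M)
      (fun z hz => hM z (mem_closedBall_zero_iff.1 hz))
      (Metric.mem_closedBall_self zero_le_one) (mem_closedBall_zero_iff.2 (hη.trans hξ))
    rw [sub_zero] at this
    exact this.trans (mul_le_mul_of_nonneg_left hη hM0)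
  have h2 := (convex_closedBall (0 : Mat d) ‖ξ‖).norm_image_sub_le_of_norm_fderiv_le'
    (fun z _ => hd1 z) h1 (Metric.mem_closedBall_self (norm_nonneg _))
    (mem_closedBall_zero_iff.2 le_rfl)
  rw [sub_zero, Real.norm_eq_abs] at h2
  calc _ ≤ M * ‖ξ‖ * ‖ξ‖ := h2
    _ = _ := by ring

/-- The assumptions on the integrand: `C²`, `p`-growth, convexity in the entries. -/
structure IsIntegrand (p : ℝ) (W : Mat d → ℝ) : Prop where
  contDiff : ContDiff ℝ 2 W
  growth : ∃ c : ℝ, 0 ≤ c ∧ ∀ ξ, |W ξ| ≤ c * (1 + ‖ξ‖ ^ p)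
  convexOn_line : ∀ ξ ij, ConvexOn ℝ univ fun s : ℝ => W (ξ + EuclideanSpace.single ij s)

theorem IsIntegrand.continuous (hW : IsIntegrand p W) : Continuous W := hW.contDiff.continuous

theorem IsIntegrand.continuous_fderiv (hW : IsIntegrand p W) : Continuous (fderiv ℝ W) :=
  hW.contDiff.continuous_fderiv (by simp)

theorem IsIntegrand.continuous_G (hW : IsIntegrand p W) :
    Continuous fun q : Mat d × Mat d => G W q.1 q.2 :=
  ((hW.continuous.comp (continuous_fst.add continuous_snd)).sub
    (hW.continuous.comp continuous_fst)).sub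
    ((hW.continuous_fderiv.comp continuous_fst).clm_apply continuous_snd)

theorem G_zero (W : Mat d → ℝ) (F : Mat d) : G W F 0 = 0 := by simp [G]

theorem norm_rpow_add_le (hp : 2 ≤ p) {R : ℝ} (hR : 0 ≤ R) {F ξ : Mat d} (hF : ‖F‖ ≤ R)
    (hξ : 1 ≤ ‖ξ‖) : 1 + ‖F + ξ‖ ^ p ≤ (1 + (R + 1) ^ p) * ‖ξ‖ ^ p := by
  have h1 : (1 : ℝ) ≤ ‖ξ‖ ^ p := Real.one_le_rpow hξ (by linarith)
  have h2 : ‖F + ξ‖ ^ p ≤ (R + 1) ^ p * ‖ξ‖ ^ p := by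
    rw [← Real.mul_rpow (by positivity) (norm_nonneg _)]
    refine Real.rpow_le_rpow (norm_nonneg _) ((norm_add_le _ _).trans ?_) (by linarith)
    nlinarith
  linarith

/-- `G(F, ·)` grows at most like `V²`, uniformly for `F` in a ball. -/
theorem IsIntegrand.abs_G_le (hW : IsIntegrand p W) (hp : 2 ≤ p) {R : ℝ} (hR : 0 ≤ R) :
    ∃ C : ℝ, 0 ≤ C ∧ ∀ F ξ : Mat d, ‖F‖ ≤ R → |G W F ξ| ≤ C * V p ξ ^ 2 := by
  obtain ⟨c, hc0, hc⟩ := hW.growth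
  have hc2 : Continuous (fderiv ℝ (fderiv ℝ W)) :=
    (hW.contDiff.fderiv_right (m := 1) (by norm_num)).continuous_fderiv (by simp)
  obtain ⟨M, hM⟩ := (isCompact_closedBall (0 : Mat d) (R + 1)).exists_bound_of_continuousOn
    (E := Mat d →L[ℝ] Mat d →L[ℝ] ℝ) hc2.continuousOn
  obtain ⟨L, hL⟩ := (isCompact_closedBall (0 : Mat d) (R + 1)).exists_bound_of_continuousOn
    hW.continuous_fderiv.continuousOn
  have hM0 : 0 ≤ M := (norm_nonneg (fderiv ℝ (fderiv ℝ W) 0)).trans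
    (hM 0 (Metric.mem_closedBall_self (by linarith)))
  have hL0 : 0 ≤ L := (norm_nonneg _).trans (hL 0 (Metric.mem_closedBall_self (by linarith)))
  set A := c * (1 + (R + 1) ^ p)
  have hA0 : 0 ≤ A := by positivity
  refine ⟨M + (A + A + L), by positivity, fun F ξ hF => ?_⟩
  rcases le_total ‖ξ‖ 1 with h | h
  · have hk : ContDiff ℝ 2 fun η : Mat d => W (F + η) := hW.contDiff.comp (contDiff_const.add contDiff_id)
    have e1 : fderiv ℝ (fun η : Mat d => W (F + η)) = fun η => fderiv ℝ W (F + η) := by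
      funext η; exact fderiv_comp_add_left F
    have e2 : ∀ η, fderiv ℝ (fderiv ℝ fun η : Mat d => W (F + η)) η
        = fderiv ℝ (fderiv ℝ W) (F + η) := fun η => by
      rw [e1]; exact fderiv_comp_add_left F
    have := taylor_remainder_le hk (M := M) (fun η hη => by
      rw [e2]
      exact hM _ (mem_closedBall_zero_iff.2 ((norm_add_le _ _).trans (add_le_add hF hη)))) h
    simp only [e1, add_zero] at this
    refine (show |G W F ξ| ≤ M * ‖ξ‖ ^ 2 from this).trans ?_
    have hv := norm_sq_le_V_sq p ξ
    have hA' : 0 ≤ (A + A + L) * V p ξ ^ 2 := by positivity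
    nlinarith
  · have h1 : (1 : ℝ) ≤ ‖ξ‖ ^ p := Real.one_le_rpow h (by linarith)
    have hξp : ‖ξ‖ ≤ ‖ξ‖ ^ p := by
      conv_lhs => rw [← Real.rpow_one ‖ξ‖]
      exact Real.rpow_le_rpow_of_exponent_le h (by linarith)
    have hg := norm_rpow_add_le hp hR hF h
    have hw1 : |W (F + ξ)| ≤ A * ‖ξ‖ ^ p := by
      refine (hc _).trans ?_
      rw [mul_assoc]
      exact mul_le_mul_of_nonneg_left hg hc0
    have hw2 : |W F| ≤ A * ‖ξ‖ ^ p := by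
      refine (hc _).trans ?_
      have : ‖F‖ ^ p ≤ (R + 1) ^ p := by gcongr; linarith
      calc c * (1 + ‖F‖ ^ p) ≤ A * 1 := by
            rw [mul_one]
            exact mul_le_mul_of_nonneg_left (by linarith) hc0
        _ ≤ _ := by gcongr
    have hw3 : |fderiv ℝ W F ξ| ≤ L * ‖ξ‖ ^ p := by
      calc |fderiv ℝ W F ξ| ≤ ‖fderiv ℝ W F‖ * ‖ξ‖ := (fderiv ℝ W F).le_opNorm ξ
        _ ≤ L * ‖ξ‖ ^ p := mul_le_mul (hL _ (mem_closedBall_zero_iff.2 (by linarith))) hξp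
            (norm_nonneg _) hL0
    have hv := norm_rpow_le_V_sq p ξ
    have hG : |G W F ξ| ≤ |W (F + ξ)| + |W F| + |fderiv ℝ W F ξ| := by
      rw [G]
      exact (abs_sub _ _).trans (add_le_add_left (abs_sub _ _) _)
    have hM' : 0 ≤ M * V p ξ ^ 2 := by positivity
    have : (A + A + L) * ‖ξ‖ ^ p ≤ (A + A + L) * V p ξ ^ 2 :=
      mul_le_mul_of_nonneg_left hv (by positivity)
    nlinarith

/-- `G(F, ·)` depends continuously on `F`, in the sense that differences are small multiples
of `V²`. Separate convexity enters for large `ξ`, where it makes `W` locally Lipschitz with a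
constant of order `|ξ|^p`. -/
theorem IsIntegrand.abs_G_sub_le (hW : IsIntegrand p W) (hp : 2 ≤ p) {R ε : ℝ} (hR : 0 ≤ R)
    (hε : 0 < ε) :
    ∃ δ : ℝ, 0 < δ ∧ ∀ F F' ξ : Mat d, ‖F‖ ≤ R → ‖F'‖ ≤ R → ‖F - F'‖ ≤ δ →
      |G W F ξ - G W F' ξ| ≤ ε * V p ξ ^ 2 := by
  obtain ⟨c, hc0, hc⟩ := hW.growth
  have hc2 : Continuous (fderiv ℝ (fderiv ℝ W)) :=
    (hW.contDiff.fderiv_right (m := 1) (by norm_num)).continuous_fderiv (by simp)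
  have hK := isCompact_closedBall (0 : Mat d) (R + 1)
  obtain ⟨δ₁, hδ₁, h₁⟩ := (Metric.uniformContinuousOn_iff (β := Mat d →L[ℝ] Mat d →L[ℝ] ℝ)).1
    (hK.uniformContinuousOn_of_continuous (β := Mat d →L[ℝ] Mat d →L[ℝ] ℝ) hc2.continuousOn) ε hε
  obtain ⟨δ₂, hδ₂, h₂⟩ := Metric.uniformContinuousOn_iff.1
    (hK.uniformContinuousOn_of_continuous hW.continuous.continuousOn) (ε / 3) (by positivity)
  obtain ⟨δ₃, hδ₃, h₃⟩ := Metric.uniformContinuousOn_iff.1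
    (hK.uniformContinuousOn_of_continuous hW.continuous_fderiv.continuousOn) (ε / 3) (by positivity)
  set A := c * (1 + (R + 2 + 1) ^ p) with hA
  have hA0 : 0 ≤ A := by positivity
  set N := (d : ℝ) ^ 2 with hN
  set δ₄ := min 1 (ε / (6 * A + 1)) / (N + 1) with hδ₄
  have hN0 : 0 ≤ N := by positivity
  have hδ₄0 : 0 < δ₄ := by positivity
  refine ⟨min (min (δ₁ / 2) (δ₂ / 2)) (min (δ₃ / 2) δ₄), by positivity,
    fun F F' ξ hF hF' hFF => ?_⟩
  have hm1 : ‖F - F'‖ < δ₁ := by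
    have := hFF.trans ((min_le_left _ _).trans (min_le_left _ _)); linarith
  have hm2 : ‖F - F'‖ < δ₂ := by
    have := hFF.trans ((min_le_left _ _).trans (min_le_right _ _)); linarith
  have hm3 : ‖F - F'‖ < δ₃ := by
    have := hFF.trans ((min_le_right _ _).trans (min_le_left _ _)); linarith
  have hm4 : ‖F - F'‖ ≤ δ₄ := hFF.trans ((min_le_right _ _).trans (min_le_right _ _))
  have hmem : ∀ {H η : Mat d}, ‖H‖ ≤ R → ‖η‖ ≤ 1 → H + η ∈ Metric.closedBall (0 : Mat d) (R + 1) :=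
    fun hH hη => mem_closedBall_zero_iff.2 ((norm_add_le _ _).trans (add_le_add hH hη))
  -- for `‖ξ‖ ≤ 1`, second derivatives of `W` at `F + η` and `F' + η` are uniformly close
  rcases le_total ‖ξ‖ 1 with h | h
  · have hd1 : Differentiable ℝ W := hW.contDiff.differentiable (by simp)
    have hd2 : Differentiable ℝ (fderiv ℝ W) :=
      (hW.contDiff.fderiv_right (m := 1) (by norm_num)).differentiable (by simp)
    have hk : ContDiff ℝ 2 fun η : Mat d => W (F + η) - W (F' + η) :=
      (hW.contDiff.comp (contDiff_const.add contDiff_id)).sub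
        (hW.contDiff.comp (contDiff_const.add contDiff_id))
    have e1 : fderiv ℝ (fun η : Mat d => W (F + η) - W (F' + η))
        = fun η => fderiv ℝ W (F + η) - fderiv ℝ W (F' + η) := by
      funext η
      rw [fderiv_fun_sub ((differentiableAt_comp_add_left F).2 (hd1 _))
        ((differentiableAt_comp_add_left F').2 (hd1 _)), fderiv_comp_add_left,
        fderiv_comp_add_left]
    have e2 : ∀ η, fderiv ℝ (fderiv ℝ fun η : Mat d => W (F + η) - W (F' + η)) η
        = fderiv ℝ (fderiv ℝ W) (F + η) - fderiv ℝ (fderiv ℝ W) (F' + η) := fun η => by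
      rw [e1, fderiv_fun_sub ((differentiableAt_comp_add_left F).2 (hd2 _))
        ((differentiableAt_comp_add_left F').2 (hd2 _)), fderiv_comp_add_left,
        fderiv_comp_add_left]
    have := taylor_remainder_le hk (M := ε) (fun η hη => by
      rw [e2]
      have := h₁ (F + η) (hmem hF hη) (F' + η) (hmem hF' hη) (by
        rw [dist_eq_norm, add_sub_add_right_eq_sub]; exact hm1)
      exact (dist_eq_norm (fderiv ℝ (fderiv ℝ W) (F + η)) (fderiv ℝ (fderiv ℝ W) (F' + η))).symm.le.trans
        this.le) h
    simp only [e1, add_zero] at this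
    have e3 : G W F ξ - G W F' ξ = W (F + ξ) - W (F' + ξ) - (W F - W F')
        - (fderiv ℝ W F - fderiv ℝ W F') ξ := by
      simp only [G, sub_apply]; ring
    rw [e3]
    exact this.trans (mul_le_mul_of_nonneg_left (norm_sq_le_V_sq p ξ) hε.le)
  -- for `‖ξ‖ ≥ 1` the three differences in `G` are each a small multiple of `‖ξ‖ ^ p`
  · have h1 : (1 : ℝ) ≤ ‖ξ‖ ^ p := Real.one_le_rpow h (by linarith)
    have hξp : ‖ξ‖ ≤ ‖ξ‖ ^ p := by
      conv_lhs => rw [← Real.rpow_one ‖ξ‖]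
      exact Real.rpow_le_rpow_of_exponent_le h (by linarith)
    have hR1 : ‖F‖ ≤ R + 1 := by linarith
    have hR1' : ‖F'‖ ≤ R + 1 := by linarith
    have hw2 : |W F - W F'| ≤ ε / 3 * ‖ξ‖ ^ p := by
      have := h₂ F (mem_closedBall_zero_iff.2 hR1) F' (mem_closedBall_zero_iff.2 hR1')
        (by rw [dist_eq_norm]; exact hm2)
      rw [Real.dist_eq] at this
      nlinarith
    have hw3 : |(fderiv ℝ W F - fderiv ℝ W F') ξ| ≤ ε / 3 * ‖ξ‖ ^ p := by
      have := h₃ F (mem_closedBall_zero_iff.2 hR1) F' (mem_closedBall_zero_iff.2 hR1')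
        (by rw [dist_eq_norm]; exact hm3)
      rw [dist_eq_norm] at this
      calc _ ≤ ‖fderiv ℝ W F - fderiv ℝ W F'‖ * ‖ξ‖ := ContinuousLinearMap.le_opNorm _ ξ
        _ ≤ _ := mul_le_mul this.le hξp (norm_nonneg _) (by positivity)
    have hw1 : |W (F + ξ) - W (F' + ξ)| ≤ ε / 3 * ‖ξ‖ ^ p := by
      have hsum : ∑ ij, |(F - F') ij| ≤ min 1 (ε / (6 * A + 1)) := by
        refine (sum_abs_le _).trans ?_
        calc N * ‖F - F'‖ ≤ N * δ₄ := by gcongr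
          _ ≤ (N + 1) * δ₄ := by gcongr; linarith
          _ = min 1 (ε / (6 * A + 1)) := by rw [hδ₄]; field_simp
      have hB : ∀ ζ : Mat d, ‖ζ‖ ≤ (R + ‖ξ‖) + 2 → |W ζ| ≤ A * ‖ξ‖ ^ p := fun ζ hζ => by
        refine (hc ζ).trans ?_
        rw [hA, mul_assoc]
        refine mul_le_mul_of_nonneg_left ?_ hc0
        have h2 : ‖ζ‖ ^ p ≤ (R + 2 + 1) ^ p * ‖ξ‖ ^ p := by
          rw [← Real.mul_rpow (by positivity) (norm_nonneg _)]
          refine Real.rpow_le_rpow (norm_nonneg _) (hζ.trans ?_) (by linarith)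
          nlinarith
        linarith
      have := abs_sub_le_of_separatelyConvex hW.convexOn_line hB (η := F' + ξ) (D := F - F')
        ((norm_add_le _ _).trans (by linarith)) (hsum.trans (min_le_left _ _))
      rw [show F' + ξ + (F - F') = F + ξ by abel] at this
      refine this.trans ?_
      calc 2 * (A * ‖ξ‖ ^ p) * ∑ ij, |(F - F') ij|
          ≤ 2 * (A * ‖ξ‖ ^ p) * (ε / (6 * A + 1)) := by
            gcongr; exact hsum.trans (min_le_right _ _)
        _ = ε / 3 * ‖ξ‖ ^ p * (6 * A / (6 * A + 1)) := by field_simp; ring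
        _ ≤ ε / 3 * ‖ξ‖ ^ p * 1 := by
            refine mul_le_mul_of_nonneg_left ?_ (by positivity)
            rw [div_le_one (by positivity)]; linarith
        _ = _ := mul_one _
    have e3 : G W F ξ - G W F' ξ = W (F + ξ) - W (F' + ξ) - (W F - W F')
        - (fderiv ℝ W F - fderiv ℝ W F') ξ := by
      simp only [G, sub_apply]; ring
    rw [e3]
    have hv := norm_rpow_le_V_sq p ξ
    calc _ ≤ |W (F + ξ) - W (F' + ξ)| + |W F - W F'| + |(fderiv ℝ W F - fderiv ℝ W F') ξ| :=
          (abs_sub _ _).trans (add_le_add_left (abs_sub _ _) _)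
      _ ≤ ε * ‖ξ‖ ^ p := by linarith
      _ ≤ _ := mul_le_mul_of_nonneg_left hv hε.le

end Remainder

/-! ### Gårding's inequality for Lipschitz maps -/

/-- The gradient of a map, as a matrix field. -/
def grad {d : ℕ} (φ : Vec d → Vec d) (x : Vec d) : Mat d := jac (fderiv ℝ φ x)

section Garding

variable {d : ℕ} {p c₀ : ℝ} {W : Mat d → ℝ}

theorem measurable_grad (φ : Vec d → Vec d) : Measurable (grad φ) :=
  continuous_jac.measurable.comp (measurable_fderiv ℝ φ)

theorem norm_grad_le {φ : Vec d → Vec d} {C : ℝ≥0} (hφ : LipschitzWith C φ) (x : Vec d) :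
    ‖grad φ x‖ ≤ d * C :=
  (norm_jac_le _).trans (mul_le_mul_of_nonneg_left (norm_fderiv_le_of_lipschitz ℝ hφ)
    (Nat.cast_nonneg _))

theorem IsPeriodic.grad {φ : Vec d → Vec d} (hφ : IsPeriodic φ) : IsPeriodic (grad φ) :=
  fun i x => by
    rw [QCGarding.grad, ← fderiv_comp_add_right]
    congr 2
    funext z
    exact hφ i z

theorem grad_eq_zero_of_notMem_tsupport {ψ : Vec d → Vec d} {x : Vec d} (hx : x ∉ tsupport ψ) :
    grad ψ x = 0 := by
  have : fderiv ℝ ψ x = 0 := by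
    by_contra h
    exact hx (support_fderiv_subset ℝ h)
  rw [grad, this]
  ext ⟨i, j⟩
  simp [jac_apply]

theorem grad_comp_add (ψ : Vec d → Vec d) (a x : Vec d) :
    grad (fun y => ψ (y + a)) x = grad ψ (x + a) := by
  rw [grad, grad, fderiv_comp_add_right]

theorem exists_bound_of_norm_le {H : Mat d → ℝ} (hH : Continuous H) (B : ℝ) :
    ∃ C : ℝ, 0 ≤ C ∧ ∀ ξ, ‖ξ‖ ≤ B → |H ξ| ≤ C := by
  obtain ⟨C, hC⟩ := (isCompact_closedBall (0 : Mat d) B).exists_bound_of_continuousOn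
    hH.continuousOn
  exact ⟨max C 0, le_max_right _ _, fun ξ hξ =>
    (hC ξ (mem_closedBall_zero_iff.2 hξ)).trans (le_max_left _ _)⟩

theorem integrable_comp_grad {H : Mat d → ℝ} (hH : Continuous H) (h0 : H 0 = 0)
    {ψ : Vec d → Vec d} {C : ℝ≥0} (hψ : LipschitzWith C ψ) (hs : HasCompactSupport ψ) :
    Integrable (fun x => H (grad ψ x)) := by
  obtain ⟨B, hB0, hB⟩ := exists_bound_of_norm_le hH (d * C)
  have h1 : IntegrableOn (fun x => H (grad ψ x)) (tsupport ψ) :=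
    Measure.integrableOn_of_bounded hs.measure_lt_top.ne
      (hH.measurable.comp (measurable_grad ψ)).aestronglyMeasurable
      (ae_of_all _ fun x => hB _ (norm_grad_le hψ x))
  refine (integrableOn_iff_integrable_of_support_subset fun x hx => ?_).1 h1
  by_contra hn
  exact hx (by simp only [grad_eq_zero_of_notMem_tsupport hn, h0])

theorem isSobolev_of_tsupport_subset {ψ : Vec d → Vec d} {C : ℝ≥0} (hψ : LipschitzWith C ψ)
    (hcs : HasCompactSupport ψ) (hs : tsupport ψ ⊆ Q d) : IsSobolev ∞ ψ (grad ψ) := by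
  obtain ⟨B, hB⟩ := hcs.exists_bound_of_continuous hψ.continuous
  refine ⟨memLp_top_of_bound hψ.continuous.aestronglyMeasurable B (ae_of_all _ hB),
    memLp_top_of_bound (measurable_grad ψ).aestronglyMeasurable _ (ae_of_all _ (norm_grad_le hψ)),
    fun i j φ hφ => ?_⟩
  have hdφ : Continuous (fderiv ℝ φ) := hφ.1.continuous_fderiv (by simp)
  have hdφp : IsPeriodic (fderiv ℝ φ) := fun k y => by
    rw [← fderiv_comp_add_right]
    congr 1
    funext z
    exact hφ.2 k z
  obtain ⟨D, hD0, hD⟩ := hdφp.exists_bound hdφ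
  have hφl : LipschitzWith D.toNNReal φ :=
    lipschitzWith_of_nnnorm_fderiv_le (hφ.1.differentiable (by simp)) fun x => by
      rw [← NNReal.coe_le_coe, coe_nnnorm, Real.coe_toNNReal _ hD0]; exact hD x
  have hψi : LipschitzWith (‖(EuclideanSpace.proj (𝕜 := ℝ) i : Vec d →L[ℝ] ℝ)‖₊ * C)
      fun x => ψ x i := (EuclideanSpace.proj (𝕜 := ℝ) i : Vec d →L[ℝ] ℝ).lipschitz.comp hψ
  have hcsi : HasCompactSupport fun x => ψ x i :=
    hcs.comp_left (g := fun v : Vec d => v i) (by simp)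
  have key := LipschitzWith.integral_lineDeriv_mul_eq (μ := volume) hφl hψi hcsi
    (EuclideanSpace.single j 1)
  have hzero : ∀ x, x ∉ Q d → ψ x = 0 := fun x hx => image_eq_zero_of_notMem_tsupport fun h =>
    hx (hs h)
  have e1 : ∫ x, ψ x i * partialD j φ x ∂(volQ d)
      = ∫ x, lineDeriv ℝ φ x (EuclideanSpace.single j 1) * ψ x i := by
    rw [volQ, setIntegral_eq_integral_of_forall_compl_eq_zero fun x hx => by simp [hzero x hx]]
    refine integral_congr_ae (ae_of_all _ fun x => ?_)
    change ψ x i * partialD j φ x = lineDeriv ℝ φ x (EuclideanSpace.single j 1) * ψ x i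
    rw [((hφ.1.differentiable (by simp)) x).lineDeriv_eq_fderiv, mul_comm]
    rfl
  have e2 : ∫ x, grad ψ x (i, j) * φ x ∂(volQ d) = ∫ x, grad ψ x (i, j) * φ x := by
    rw [volQ, setIntegral_eq_integral_of_forall_compl_eq_zero fun x hx => by
      simp [grad_eq_zero_of_notMem_tsupport fun h => hx (hs h)]]
  rw [e1, key, e2, ← integral_neg]
  refine integral_congr_ae ?_
  filter_upwards [hψ.ae_differentiableAt] with x hx
  have h1 : HasFDerivAt (fun x => ψ x i)
      ((EuclideanSpace.proj (𝕜 := ℝ) i : Vec d →L[ℝ] ℝ).comp (fderiv ℝ ψ x)) x :=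
    (EuclideanSpace.proj (𝕜 := ℝ) i : Vec d →L[ℝ] ℝ).hasFDerivAt.comp x hx.hasFDerivAt
  rw [h1.differentiableAt.lineDeriv_eq_fderiv, h1.fderiv, map_neg]
  change -(fderiv ℝ ψ x (EuclideanSpace.single j 1) i) * φ x = _
  rw [neg_mul]
  rfl

/-- Strong quasiconvexity for Lipschitz maps with small support, anywhere in space. -/
theorem QuasiconvexWith.le_integral_G (hqc : QuasiconvexWith p c₀ W) (hp : 2 ≤ p)
    (hW : IsIntegrand p W) {ψ : Vec d → Vec d} {C : ℝ≥0} (hψ : LipschitzWith C ψ) {z : Vec d}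
    {r : ℝ} (hr : r < 1 / 2) (hs : tsupport ψ ⊆ Metric.closedBall z r) (F : Mat d) :
    0 ≤ ∫ x, (G W F (grad ψ x) - c₀ * V p (grad ψ x) ^ 2) := by
  -- translate the support into the unit cell, where `ψ` is a periodic Sobolev map
  set a := z - cellCentre d
  set χ : Vec d → Vec d := fun y => ψ (y + a) with hχ
  have hχl : LipschitzWith C χ := by
    refine LipschitzWith.of_dist_le_mul fun x y => ?_
    have := hψ.dist_le_mul (x + a) (y + a)
    rwa [dist_add_right] at this
  have hsub : tsupport χ ⊆ Metric.closedBall (cellCentre d) r := by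
    refine closure_minimal (fun y hy => ?_) Metric.isClosed_closedBall
    have h1 := hs (subset_tsupport ψ (show y + a ∈ Function.support ψ from hy))
    rw [Metric.mem_closedBall, dist_eq_norm] at h1 ⊢
    rwa [show y - cellCentre d = y + a - z by simp only [a]; abel]
  have hcs : HasCompactSupport χ :=
    (isCompact_closedBall (cellCentre d) r).of_isClosed_subset (isClosed_tsupport _) hsub
  have hQ : tsupport χ ⊆ Q d := fun y hy i => by
    have h1 := hsub hy
    rw [Metric.mem_closedBall, dist_eq_norm] at h1
    have h2 := (PiLp.norm_apply_le (y - cellCentre d) i).trans h1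
    rw [PiLp.sub_apply, Real.norm_eq_abs, abs_le] at h2
    change -r ≤ y i - 1 / 2 ∧ y i - 1 / 2 ≤ r at h2
    constructor <;> linarith [h2.1, h2.2]
  have hsob := isSobolev_of_tsupport_subset hχl hcs hQ
  have h := hqc F χ (grad χ) hsob
  have hGc : Continuous (G W F) := hW.continuous_G.comp (continuous_const.prodMk continuous_id)
  have iG := integrable_comp_grad hGc (G_zero W F) hχl hcs
  have iV := integrable_comp_grad (H := fun ξ => V p ξ ^ 2) (continuous_V_sq hp) (V_sq_zero hp)
    hχl hcs
  have iGQ : Integrable (fun x => G W F (grad χ x)) (volQ d) := iG.restrict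
  have iVQ : Integrable (fun x => V p (grad χ x) ^ 2) (volQ d) := iV.restrict
  have ig : Integrable (grad χ) (volQ d) := integrable_of_norm_le
    (measurable_grad χ).aestronglyMeasurable (norm_grad_le hχl)
  -- gradients have zero average, so the linear term of `G` does not contribute
  have hmean : ∫ x, grad χ x ∂(volQ d) = 0 := by
    ext ⟨i, j⟩
    rw [integral_apply ig, (hsob.weak_deriv i j).integral_eq_zero]
    rfl
  have e1 : ∫ x, (W (F + grad χ x) - W F) ∂(volQ d) = ∫ x, G W F (grad χ x) ∂(volQ d) := by
    have e2 : ∀ x, W (F + grad χ x) - W F = G W F (grad χ x) + fderiv ℝ W F (grad χ x) :=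
      fun x => by simp [G]
    simp only [e2]
    rw [integral_add iGQ ((fderiv ℝ W F).integrable_comp ig),
      ContinuousLinearMap.integral_comp_comm _ ig, hmean, map_zero, add_zero]
  rw [e1] at h
  have hz : ∀ x, x ∉ Q d → grad χ x = 0 := fun x hx =>
    grad_eq_zero_of_notMem_tsupport fun h => hx (hQ h)
  have h2 : 0 ≤ ∫ x, (G W F (grad χ x) - c₀ * V p (grad χ x) ^ 2) ∂(volQ d) := by
    rw [integral_sub iGQ (iVQ.const_mul c₀), integral_const_mul]
    linarith
  have h3 := setIntegral_eq_integral_of_forall_compl_eq_zero (μ := volume) (s := Q d)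
    (f := fun x => G W F (grad χ x) - c₀ * V p (grad χ x) ^ 2) fun x hx => by
      rw [hz x hx, G_zero, V_sq_zero hp]; simp
  rw [volQ, h3] at h2
  simp only [hχ, grad_comp_add] at h2
  rwa [integral_add_right_eq_self (fun x => G W F (grad ψ x) - c₀ * V p (grad ψ x) ^ 2) a] at h2

/-- Averaging a periodic function over all translates of a set. -/
theorem integral_cell_setIntegral {h : Vec d → ℝ} (hper : IsPeriodic h) (hm : Measurable h) {B : ℝ}
    (hB : ∀ x, |h x| ≤ B) {S : Set (Vec d)} (hS : volume S ≠ ⊤) :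
    Integrable (fun z => ∫ w in S, h (z + w)) (volQ d) ∧
      ∫ z, (∫ w in S, h (z + w)) ∂(volQ d) = volume.real S * ∫ x, h x ∂(volQ d) := by
  have : IsFiniteMeasure (volume.restrict S) := ⟨by
    rw [Measure.restrict_apply_univ]; exact hS.lt_top⟩
  have hprod : Integrable (fun q : Vec d × Vec d => h (q.1 + q.2))
      ((volQ d).prod (volume.restrict S)) :=
    Integrable.of_bound (hm.comp (measurable_fst.add measurable_snd)).aestronglyMeasurable B
      (ae_of_all _ fun q => hB _)
  refine ⟨hprod.integral_prod_left, ?_⟩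
  rw [integral_integral_swap (f := fun z w => h (z + w)) hprod]
  simp only [hper.integral_add]
  rw [integral_const, smul_eq_mul, Measure.real, Measure.restrict_apply_univ]
  rfl

end Garding

section GardingLipschitz

variable {d : ℕ} {p c₀ : ℝ} {W : Mat d → ℝ}

theorem grad_bump_smul {ρ : Vec d → ℝ} {φ : Vec d → Vec d} {x z : Vec d}
    (hρ : Differentiable ℝ ρ) (hφ : DifferentiableAt ℝ φ x) :
    grad (fun y => ρ (y - z) • φ y) x
      = ρ (x - z) • grad φ x + jac ((fderiv ℝ ρ (x - z)).smulRight (φ x)) := by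
  have h1 : HasFDerivAt (fun y => ρ (y - z)) (fderiv ℝ ρ (x - z)) x :=
    (hasFDerivAt_comp_sub z).2 (hρ (x - z)).hasFDerivAt
  have h2 := h1.smul hφ.hasFDerivAt
  have h3 : HasFDerivAt (fun y => ρ (y - z) • φ y) _ x := h2
  rw [grad, h3.fderiv, jac_add, jac_smul, grad]

theorem lipschitzWith_bump_smul {ρ : Vec d → ℝ} {φ : Vec d → Vec d} {A B : ℝ} {C : ℝ≥0}
    (hA : ∀ x y, |ρ x - ρ y| ≤ A * ‖x - y‖) (hA0 : 0 ≤ A) (hρ1 : ∀ x, |ρ x| ≤ 1)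
    (hB : ∀ x, ‖φ x‖ ≤ B) (hB0 : 0 ≤ B) (hφ : LipschitzWith C φ) (z : Vec d) :
    LipschitzWith (A * B + C).toNNReal fun y => ρ (y - z) • φ y := by
  refine LipschitzWith.of_dist_le_mul fun x y => ?_
  have hC0 : (0 : ℝ) ≤ C := C.2
  rw [Real.coe_toNNReal _ (by positivity), dist_eq_norm, dist_eq_norm]
  have e : ρ (x - z) • φ x - ρ (y - z) • φ y
      = (ρ (x - z) - ρ (y - z)) • φ x + ρ (y - z) • (φ x - φ y) := by
    rw [sub_smul, smul_sub]; abel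
  rw [e]
  have h1 : ‖(ρ (x - z) - ρ (y - z)) • φ x‖ ≤ A * ‖x - y‖ * B := by
    rw [norm_smul]
    refine mul_le_mul ?_ (hB x) (norm_nonneg _) (by positivity)
    have := hA (x - z) (y - z)
    rwa [sub_sub_sub_cancel_right] at this
  have h2 : ‖ρ (y - z) • (φ x - φ y)‖ ≤ 1 * (C * ‖x - y‖) := by
    rw [norm_smul]
    refine mul_le_mul (hρ1 _) ?_ (norm_nonneg _) zero_le_one
    have := hφ.dist_le_mul x y
    rwa [dist_eq_norm, dist_eq_norm] at this
  calc _ ≤ _ := norm_add_le _ _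
    _ ≤ A * ‖x - y‖ * B + 1 * (C * ‖x - y‖) := add_le_add h1 h2
    _ = _ := by ring

/-- There are concentric balls of arbitrarily small radius for which the shell is a small fraction
of the inner ball. -/
theorem exists_radii (d : ℕ) {τ r : ℝ} (hτ : 0 < τ) (hr : 0 < r) :
    ∃ r₁ r₂ : ℝ, 0 < r₁ ∧ r₁ < r₂ ∧ r₂ ≤ r ∧
      volume.real (Metric.closedBall (0 : Vec d) r₂ \ Metric.ball 0 r₁)
        ≤ τ * volume.real (Metric.ball (0 : Vec d) r₁) := by
  have hc : Tendsto (fun θ : ℝ => 1 - θ ^ d - τ * θ ^ d) (𝓝[<] 1)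
      (𝓝 (1 - 1 ^ d - τ * 1 ^ d)) :=
    ((by fun_prop : Continuous fun θ : ℝ => 1 - θ ^ d - τ * θ ^ d).tendsto 1).mono_left
      nhdsWithin_le_nhds
  have h1 : ∀ᶠ θ in 𝓝[<] (1 : ℝ), 1 - θ ^ d - τ * θ ^ d < 0 :=
    hc.eventually_lt_const (by simp [hτ])
  have h2 : ∀ᶠ θ in 𝓝[<] (1 : ℝ), 0 < θ :=
    nhdsWithin_le_nhds (lt_mem_nhds zero_lt_one)
  obtain ⟨θ, hθ1, hθ0, hθlt⟩ := (h1.and (h2.and self_mem_nhdsWithin)).exists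
  have hθlt' : θ < 1 := hθlt
  refine ⟨r * θ, r, by positivity, by nlinarith, le_rfl, ?_⟩
  have hfin : Module.finrank ℝ (Vec d) = d := by simp
  have hsub : Metric.ball (0 : Vec d) (r * θ) ⊆ Metric.closedBall 0 r :=
    Metric.ball_subset_closedBall.trans (Metric.closedBall_subset_closedBall (by nlinarith))
  have e1 : volume.real (Metric.closedBall (0 : Vec d) r)
      = r ^ d * volume.real (Metric.ball (0 : Vec d) 1) := by
    rw [Measure.addHaar_real_closedBall _ _ hr.le, hfin]
  have e2 : volume.real (Metric.ball (0 : Vec d) (r * θ))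
      = (r * θ) ^ d * volume.real (Metric.ball (0 : Vec d) 1) := by
    rw [measureReal_def, Measure.addHaar_ball_of_pos _ _ (by positivity), ENNReal.toReal_mul, hfin,
      ENNReal.toReal_ofReal (by positivity), measureReal_def]
  rw [measureReal_sdiff (h₁ := measure_closedBall_lt_top.ne) hsub measurableSet_ball, e1, e2, mul_pow]
  have hv : 0 ≤ volume.real (Metric.ball (0 : Vec d) 1) := measureReal_nonneg
  have hrd : 0 ≤ r ^ d := by positivity
  have := mul_nonneg hrd hv
  nlinarith

/-- **Gårding's inequality** for periodic Lipschitz maps, with constants that do not depend on the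
Lipschitz constant. The strong quasiconvexity inequality is tested with `ρ(· - z) φ` for a bump `ρ`
at small scale, where `Fbar` is frozen at `z`, and is then averaged over all `z`; the transition
shell of `ρ` carries only a small part of the average. -/
theorem garding_lipschitz (hW : IsIntegrand p W) (hqc : QuasiconvexWith p c₀ W) (hc₀ : 0 < c₀)
    (hp : 2 ≤ p) {R : ℝ} (hR : 0 ≤ R) :
    ∃ δ : ℝ, 0 < δ ∧ ∀ r : ℝ, 0 < r → ∃ C₀ : ℝ, 0 ≤ C₀ ∧ ∀ Fb : Vec d → Mat d,
      Continuous Fb → IsPeriodic Fb → (∀ x, ‖Fb x‖ ≤ R) →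
      (∀ x y, ‖x - y‖ ≤ r → ‖Fb x - Fb y‖ ≤ δ) →
      ∀ (φ : Vec d → Vec d) (C : ℝ≥0), LipschitzWith C φ → IsPeriodic φ →
        c₀ / 2 * ∫ x, V p (grad φ x) ^ 2 ∂(volQ d)
          ≤ ∫ x, G W (Fb x) (grad φ x) ∂(volQ d) + C₀ * ∫ x, V p (φ x) ^ 2 ∂(volQ d) := by
  obtain ⟨CG, hCG0, hCG⟩ := hW.abs_G_le hp hR
  obtain ⟨δ, hδ, hδG⟩ := hW.abs_G_sub_le hp hR (ε := c₀ / 4) (by positivity)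
  refine ⟨δ, hδ, fun r hr => ?_⟩
  set P : ℝ := 2 ^ p with hP
  have hP0 : 0 < P := by positivity
  -- the shell is so thin that its contribution can be absorbed in `c₀ / 4` times the energy
  obtain ⟨r₁, r₂, hr₁, hr₁₂, hr₂, hvol⟩ := exists_radii d (τ := c₀ / (4 * (CG * P + 1)))
    (r := min r (1 / 4)) (by positivity) (by positivity)
  have hr₂r : r₂ ≤ r := hr₂.trans (min_le_left _ _)
  have hr₂h : r₂ < 1 / 2 := by linarith [hr₂.trans (min_le_right r (1 / 4))]
  let ρ : ContDiffBump (0 : Vec d) := ⟨r₁, r₂, hr₁, hr₁₂⟩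
  have hρs : ContDiff ℝ 1 (ρ : Vec d → ℝ) := ρ.contDiff
  have hρd : Differentiable ℝ (ρ : Vec d → ℝ) := hρs.differentiable (by simp)
  have hρc : HasCompactSupport (fderiv ℝ (ρ : Vec d → ℝ)) := ρ.hasCompactSupport.fderiv (𝕜 := ℝ)
  obtain ⟨A, hA⟩ := hρc.exists_bound_of_continuous (hρs.continuous_fderiv (by simp))
  have hA0 : 0 ≤ A := (norm_nonneg _).trans (hA 0)
  have hρA : ∀ x y, |ρ x - ρ y| ≤ A * ‖x - y‖ := fun x y =>
    convex_univ.norm_image_sub_le_of_norm_fderiv_le (f := (ρ : Vec d → ℝ)) (fun z _ => hρd z)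
      (fun z _ => hA z) (mem_univ y) (mem_univ x)
  have hρ0 : ∀ x, 0 ≤ ρ x := fun x => ρ.nonneg
  have hρle : ∀ x, ρ x ≤ 1 := fun x => ρ.le_one
  have hρ1 : ∀ x, |ρ x| ≤ 1 := fun x => by rw [abs_of_nonneg (hρ0 x)]; exact hρle x
  set κ : ℝ := V p ((d : ℝ) * A) ^ 2 with hκ
  have hκ0 : 0 ≤ κ := V_sq_nonneg _ _
  set S₁ : Set (Vec d) := Metric.ball 0 r₁
  set S₂ : Set (Vec d) := Metric.closedBall 0 r₂ \ Metric.ball 0 r₁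
  set v₁ := volume.real S₁ with hv₁
  set v₂ := volume.real S₂ with hv₂
  have hv₁0 : 0 < v₁ := by
    rw [hv₁, Measure.real]
    exact ENNReal.toReal_pos (Metric.measure_ball_pos volume 0 hr₁).ne' measure_ball_lt_top.ne
  have hS₁ : volume S₁ ≠ ⊤ := measure_ball_lt_top.ne
  have hS₂ : volume S₂ ≠ ⊤ :=
    (lt_of_le_of_lt (measure_mono sdiff_subset) measure_closedBall_lt_top).ne
  refine ⟨CG * P * κ * v₂ / v₁, by positivity, fun Fb hFc hFp hFR hFδ φ C hφ hφp => ?_⟩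
  obtain ⟨B, hB0, hB⟩ := hφp.exists_bound hφ.continuous
  have hVc : Continuous fun ξ : Mat d => V p ξ ^ 2 := continuous_V_sq hp
  -- the integrands on the inner ball and on the shell
  set a : Vec d → ℝ := fun x => G W (Fb x) (grad φ x) - (3 * c₀ / 4) * V p (grad φ x) ^ 2 with ha
  set b : Vec d → ℝ := fun x => CG * P * (V p (grad φ x) ^ 2 + κ * V p (φ x) ^ 2) with hb
  have hgm := measurable_grad φ
  have hGm : Measurable fun x => G W (Fb x) (grad φ x) :=
    hW.continuous_G.measurable.comp (hFc.measurable.prodMk hgm)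
  have hVgm : Measurable fun x => V p (grad φ x) ^ 2 := hVc.measurable.comp hgm
  have hVφm : Measurable fun x => V p (φ x) ^ 2 :=
    ((continuous_V_sq hp).comp hφ.continuous).measurable
  set BV : ℝ := V p ((d : ℝ) * C) ^ 2
  set BB : ℝ := V p B ^ 2
  have hBV : ∀ x, V p (grad φ x) ^ 2 ≤ BV := fun x => V_sq_mono hp (by
    rw [Real.norm_of_nonneg (by positivity)]; exact norm_grad_le hφ x)
  have hBB : ∀ x, V p (φ x) ^ 2 ≤ BB := fun x => V_sq_mono hp (by
    rw [Real.norm_of_nonneg hB0]; exact hB x)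
  have hGB : ∀ x, |G W (Fb x) (grad φ x)| ≤ CG * BV := fun x =>
    (hCG _ _ (hFR x)).trans (mul_le_mul_of_nonneg_left (hBV x) hCG0)
  have iG : Integrable (fun x => G W (Fb x) (grad φ x)) (volQ d) :=
    integrable_of_norm_le hGm.aestronglyMeasurable hGB
  have iVg : Integrable (fun x => V p (grad φ x) ^ 2) (volQ d) :=
    integrable_of_norm_le hVgm.aestronglyMeasurable (C := BV) fun x => by
      rw [Real.norm_of_nonneg (V_sq_nonneg _ _)]; exact hBV x
  have iVφ : Integrable (fun x => V p (φ x) ^ 2) (volQ d) :=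
    integrable_of_norm_le hVφm.aestronglyMeasurable (C := BB) fun x => by
      rw [Real.norm_of_nonneg (V_sq_nonneg _ _)]; exact hBB x
  have ham : Measurable a := hGm.sub (hVgm.const_mul _)
  have hbm : Measurable b := (hVgm.add (hVφm.const_mul _)).const_mul _
  have hap : IsPeriodic a := fun i x => by
    simp only [ha, hFp i, hφp.grad i]
  have hbp : IsPeriodic b := fun i x => by
    simp only [hb, hφp i, hφp.grad i]
  have haB : ∀ x, |a x| ≤ CG * BV + 3 * c₀ / 4 * BV := fun x => by
    refine (abs_sub _ _).trans (add_le_add (hGB x) ?_)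
    rw [abs_of_nonneg (mul_nonneg (by positivity) (V_sq_nonneg _ _))]
    exact mul_le_mul_of_nonneg_left (hBV x) (by positivity)
  have hbB : ∀ x, |b x| ≤ CG * P * (BV + κ * BB) := fun x => by
    have h1 := hBV x
    have h2 := mul_le_mul_of_nonneg_left (hBB x) hκ0
    rw [abs_of_nonneg (mul_nonneg (by positivity) (add_nonneg (V_sq_nonneg _ _)
      (mul_nonneg hκ0 (V_sq_nonneg _ _))))]
    exact mul_le_mul_of_nonneg_left (by linarith) (by positivity)
  -- the inequality at a fixed centre `z`
  have hz : ∀ z, 0 ≤ (∫ w in S₁, a (z + w)) + ∫ w in S₂, b (z + w) := fun z => by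
    set ψ : Vec d → Vec d := fun y => ρ (y - z) • φ y with hψ
    have hψl := lipschitzWith_bump_smul hρA hA0 hρ1 hB hB0 hφ z
    have hψs : tsupport ψ ⊆ Metric.closedBall z r₂ := by
      refine closure_minimal (fun y hy => ?_) Metric.isClosed_closedBall
      by_contra hn
      refine hy ?_
      have : ρ (y - z) = 0 := ρ.zero_of_le_dist (by
        rw [Metric.mem_closedBall, not_le] at hn
        rw [dist_zero_right, ← dist_eq_norm]
        exact hn.le)
      simp only [hψ, this, zero_smul]
    have hcs : HasCompactSupport ψ :=
      (isCompact_closedBall z r₂).of_isClosed_subset (isClosed_tsupport _) hψs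
    have h0 := hqc.le_integral_G hp hW hψl hr₂h hψs (Fb z)
    have hGz : Continuous (G W (Fb z)) :=
      hW.continuous_G.comp (continuous_const.prodMk continuous_id)
    have iT : Integrable fun x => G W (Fb z) (grad ψ x) - c₀ * V p (grad ψ x) ^ 2 :=
      integrable_comp_grad (H := fun ξ => G W (Fb z) ξ - c₀ * V p ξ ^ 2)
        (hGz.sub (continuous_const.mul hVc)) (by
          simp only [G_zero, V_sq_zero hp]; simp) hψl hcs
    rw [← integral_add_left_eq_self (fun x => G W (Fb z) (grad ψ x) - c₀ * V p (grad ψ x) ^ 2) z]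
      at h0
    have ia : IntegrableOn (fun w => a (z + w)) S₁ :=
      Measure.integrableOn_of_bounded hS₁
        (ham.comp (measurable_const_add z)).aestronglyMeasurable (ae_of_all _ fun w => haB _)
    have ib : IntegrableOn (fun w => b (z + w)) S₂ :=
      Measure.integrableOn_of_bounded hS₂
        (hbm.comp (measurable_const_add z)).aestronglyMeasurable (ae_of_all _ fun w => hbB _)
    have hmS₁ : MeasurableSet S₁ := measurableSet_ball
    have hmS₂ : MeasurableSet S₂ := measurableSet_closedBall.diff measurableSet_ball
    rw [← integral_indicator hmS₁, ← integral_indicator hmS₂,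
      ← integral_add (ia.integrable_indicator hmS₁) (ib.integrable_indicator hmS₂)]
    refine h0.trans (integral_mono_ae (iT.comp_add_left z)
      ((ia.integrable_indicator hmS₁).add (ib.integrable_indicator hmS₂)) ?_)
    have hdiff : ∀ᵐ w : Vec d, DifferentiableAt ℝ φ (z + w) :=
      (measurePreserving_add_left volume z).quasiMeasurePreserving.ae hφ.ae_differentiableAt
    filter_upwards [hdiff] with w hw
    have hgrad := grad_bump_smul (z := z) hρd hw
    rw [show z + w - z = w by abel] at hgrad
    change G W (Fb z) (grad ψ (z + w)) - c₀ * V p (grad ψ (z + w)) ^ 2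
      ≤ S₁.indicator (fun w => a (z + w)) w + S₂.indicator (fun w => b (z + w)) w
    -- In the inner ball `ψ = φ`, and replacing `Fb z` by `Fb (z + w)` costs at most `c₀ / 4` times
    -- `V²`. In the shell `G` is only estimated from above; outside, `ψ` vanishes.
    by_cases h1 : w ∈ S₁
    · have h2 : w ∉ S₂ := fun h => h.2 h1
      rw [indicator_of_mem h1, indicator_of_notMem h2, add_zero]
      have hev : (ρ : Vec d → ℝ) =ᶠ[𝓝 w] fun _ => 1 :=
        ρ.eventuallyEq_one_of_mem_ball h1
      have hval : ρ w = 1 := hev.eq_of_nhds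
      have hder : fderiv ℝ (ρ : Vec d → ℝ) w = 0 := by
        rw [hev.fderiv_eq]; simp
      have hgr : grad ψ (z + w) = grad φ (z + w) := by
        rw [hψ, hgrad, hval, hder, one_smul]
        have : jac ((0 : Vec d →L[ℝ] ℝ).smulRight (φ (z + w))) = 0 := by
          ext ⟨i, j⟩; simp [jac_apply]
        rw [this, add_zero]
      rw [hgr]
      have hw' : ‖w‖ < r₁ := by simpa [S₁] using h1
      have h3 := hδG (Fb z) (Fb (z + w)) (grad φ (z + w)) (hFR _) (hFR _) (hFδ _ _ (by
        rw [show z - (z + w) = -w by abel, norm_neg]; linarith))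
      have h4 := (abs_le.1 h3).2
      simp only [ha]
      linarith
    · rw [indicator_of_notMem h1, zero_add]
      by_cases h2 : w ∈ S₂
      · rw [indicator_of_mem h2]
        have h3 := (abs_le.1 (hCG (Fb z) (grad ψ (z + w)) (hFR z))).2
        have h4 : V p (grad ψ (z + w)) ^ 2
            ≤ P * (V p (grad φ (z + w)) ^ 2 + κ * V p (φ (z + w)) ^ 2) := by
          rw [hψ, hgrad]
          refine (V_sq_add_le hp _ _).trans (mul_le_mul_of_nonneg_left ?_ hP0.le)
          refine add_le_add (V_sq_mono hp ?_) (V_sq_le_mul hp (by positivity) ?_)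
          · rw [norm_smul]
            exact mul_le_of_le_one_left (norm_nonneg _) (hρ1 w)
          · refine (norm_jac_smulRight_le _ _).trans ?_
            rw [mul_assoc]
            gcongr
            exact hA w
        have h5 := mul_nonneg hc₀.le (V_sq_nonneg p (grad ψ (z + w)))
        have h6 := mul_le_mul_of_nonneg_left h4 hCG0
        simp only [hb]
        linarith
      · rw [indicator_of_notMem h2]
        have hψ0 : grad ψ (z + w) = 0 := by
          refine grad_eq_zero_of_notMem_tsupport fun h => h2 ⟨?_, h1⟩
          have := hψs h
          rw [Metric.mem_closedBall, dist_eq_norm, show z + w - z = w by abel] at this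
          exact mem_closedBall_zero_iff.2 this
        rw [hψ0, G_zero, V_sq_zero hp]
        simp
  -- averaging over the centres
  obtain ⟨ia, ea⟩ := integral_cell_setIntegral hap ham haB hS₁
  obtain ⟨ib, eb⟩ := integral_cell_setIntegral hbp hbm hbB hS₂
  have h0 : 0 ≤ ∫ z, ((∫ w in S₁, a (z + w)) + ∫ w in S₂, b (z + w)) ∂(volQ d) :=
    integral_nonneg hz
  rw [integral_add ia ib, ea, eb] at h0
  have ea' : ∫ x, a x ∂(volQ d) = ∫ x, G W (Fb x) (grad φ x) ∂(volQ d)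
      - 3 * c₀ / 4 * ∫ x, V p (grad φ x) ^ 2 ∂(volQ d) := by
    simp only [ha]
    rw [integral_sub iG (iVg.const_mul _), integral_const_mul]
  have eb' : ∫ x, b x ∂(volQ d) = CG * P * (∫ x, V p (grad φ x) ^ 2 ∂(volQ d)
      + κ * ∫ x, V p (φ x) ^ 2 ∂(volQ d)) := by
    simp only [hb]
    rw [integral_const_mul, integral_add iVg (iVφ.const_mul _), integral_const_mul]
  rw [ea', eb'] at h0
  set X := ∫ x, V p (grad φ x) ^ 2 ∂(volQ d)
  set Y := ∫ x, V p (φ x) ^ 2 ∂(volQ d)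
  set Z := ∫ x, G W (Fb x) (grad φ x) ∂(volQ d)
  have hX0 : 0 ≤ X := integral_nonneg fun _ => V_sq_nonneg _ _
  -- absorb the shell
  have hvol' : v₂ * (CG * P) ≤ c₀ / 4 * v₁ := by
    calc v₂ * (CG * P) ≤ (c₀ / (4 * (CG * P + 1)) * v₁) * (CG * P) := by gcongr
      _ = c₀ / 4 * v₁ * (CG * P / (CG * P + 1)) := by field_simp
      _ ≤ c₀ / 4 * v₁ * 1 := by
          refine mul_le_mul_of_nonneg_left ?_ (by positivity)
          rw [div_le_one (by positivity)]; linarith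
      _ = _ := mul_one _
  have h1 : v₂ * (CG * P) * X ≤ c₀ / 4 * v₁ * X := mul_le_mul_of_nonneg_right hvol' hX0
  refine le_of_mul_le_mul_left ?_ hv₁0
  have e : v₁ * (Z + CG * P * κ * v₂ / v₁ * Y) = v₁ * Z + CG * P * κ * v₂ * Y := by
    field_simp
  rw [e]
  linarith

end GardingLipschitz

/-! ### The set where the maximal function is small -/

section MaximalSet

variable {d : ℕ} {f : Vec d → ℝ} {l : ℝ}

/-- The Lebesgue measure of the unit ball of `ℝ^d`. -/
def ballVol (d : ℕ) : ℝ := volume.real (Metric.ball (0 : Vec d) 1)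

theorem ballVol_pos (d : ℕ) : 0 < ballVol d :=
  ENNReal.toReal_pos (Metric.measure_ball_pos volume 0 zero_lt_one).ne' measure_ball_lt_top.ne

/-- Lebesgue measure on the unit ball of `ℝ^d`. -/
def volB (d : ℕ) : Measure (Vec d) := volume.restrict (Metric.ball 0 1)

instance finiteVolB (d : ℕ) : IsFiniteMeasure (volB d) := ⟨by
  rw [volB, Measure.restrict_apply_univ]; exact measure_ball_lt_top⟩

theorem integral_volB_const (c : ℝ) : ∫ _z, c ∂(volB d) = c * ballVol d := by
  rw [integral_const, smul_eq_mul, measureReal_def, volB, Measure.restrict_apply_univ, mul_comm]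
  rfl

/-- The set of points at which the averages of `f` over balls of radius at most `1`, that is, its
local Hardy–Littlewood maximal function, are at most `l`. -/
def maximalSet (f : Vec d → ℝ) (l : ℝ) : Set (Vec d) :=
  {x | ∀ r ∈ Ioc (0 : ℝ) 1, ∫ z, f (x + r • z) ∂(volB d) ≤ l * ballVol d}

theorem continuous_average (hf : Continuous f) {B : ℝ} (hB : ∀ x, |f x| ≤ B) :
    Continuous fun q : Vec d × ℝ => ∫ z, f (q.1 + q.2 • z) ∂(volB d) :=
  continuous_of_dominated (bound := fun _ => B)
    (fun q => (hf.comp (by fun_prop)).aestronglyMeasurable)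
    (fun q => ae_of_all _ fun z => hB _) (integrable_const _)
    (ae_of_all _ fun z => hf.comp (by fun_prop))

theorem isClosed_maximalSet (hf : Continuous f) {B : ℝ} (hB : ∀ x, |f x| ≤ B) :
    IsClosed (maximalSet f l) := by
  have : maximalSet f l
      = ⋂ r ∈ Ioc (0 : ℝ) 1, {x | ∫ z, f (x + r • z) ∂(volB d) ≤ l * ballVol d} := by
    ext x; simp [maximalSet]
  rw [this]
  exact isClosed_biInter fun r _ => isClosed_le
    ((continuous_average hf hB).comp (by fun_prop : Continuous fun x : Vec d => (x, r)))
    continuous_const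

theorem isPeriodic_maximalSet (hp : IsPeriodic f) : IsPeriodic fun x => x ∈ maximalSet f l :=
  fun i x => by
    simp only [maximalSet, mem_ofPred_eq]
    have h : ∀ v : Vec d, f (x + EuclideanSpace.single i 1 + v) = f (x + v) := fun v => by
      rw [add_right_comm, hp i]
    simp only [h]

theorem le_of_mem_maximalSet (hf : Continuous f) {B : ℝ} (hB : ∀ x, |f x| ≤ B) {x : Vec d}
    (hx : x ∈ maximalSet f l) : f x ≤ l := by
  have h1 : Tendsto (fun r : ℝ => ∫ z, f (x + r • z) ∂(volB d)) (𝓝[>] 0)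
      (𝓝 (∫ z, f (x + (0 : ℝ) • z) ∂(volB d))) :=
    (((continuous_average hf hB).comp (by fun_prop : Continuous fun r : ℝ => (x, r))).tendsto
      0).mono_left nhdsWithin_le_nhds
  have h2 : ∫ z, f (x + (0 : ℝ) • z) ∂(volB d) ≤ l * ballVol d := by
    refine le_of_tendsto h1 ?_
    filter_upwards [Ioo_mem_nhdsGT zero_lt_one] with r hr
    exact hx r ⟨hr.1, hr.2.le⟩
  simp only [zero_smul, add_zero, integral_volB_const] at h2
  exact le_of_mul_le_mul_right h2 (ballVol_pos d)

/-- A bounded region is covered by finitely many periods. -/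
theorem exists_setIntegral_closedBall_le (d : ℕ) (R : ℝ) :
    ∃ N : ℝ, 0 ≤ N ∧ ∀ h : Vec d → ℝ, Continuous h → IsPeriodic h → (∀ x, 0 ≤ h x) →
      ∫ x in Metric.closedBall 0 R, h x ≤ N * ∫ x, h x ∂(volQ d) := by
  set S : Set (Vec d) := Metric.closedBall 0 (R + Real.sqrt d) with hS
  refine ⟨volume.real S, measureReal_nonneg, fun h hc hp h0 => ?_⟩
  obtain ⟨B, -, hB⟩ := hp.exists_bound hc
  obtain ⟨h1, h2⟩ := integral_cell_setIntegral hp hc.measurable hB (S := S)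
    measure_closedBall_lt_top.ne
  rw [← h2]
  have h3 : ∫ _z, (∫ x in Metric.closedBall 0 R, h x) ∂(volQ d)
      = ∫ x in Metric.closedBall 0 R, h x := by
    rw [integral_const]; simp [probReal_univ]
  rw [← h3]
  refine integral_mono_ae (integrable_const _) h1 ?_
  filter_upwards [ae_restrict_mem (measurableSet_Q d)] with z hz
  have hz' : ‖z‖ ≤ Real.sqrt d := norm_le_sqrt_of_abs_le fun i => by
    have := hz i
    rw [abs_of_pos this.1]; exact this.2.le
  rw [← (measurePreserving_add_left volume z).setIntegral_preimage_emb
    (measurableEmbedding_addLeft z) h (Metric.closedBall 0 R)]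
  refine setIntegral_mono_set ?_ (ae_of_all _ fun x => h0 _) (LE.le.eventuallyLE ?_)
  · exact (hc.comp (by fun_prop)).continuousOn.integrableOn_compact (isCompact_closedBall _ _)
  · intro w hw
    rw [mem_preimage, mem_closedBall_zero_iff] at hw
    rw [hS, mem_closedBall_zero_iff]
    calc ‖w‖ = ‖(z + w) - z‖ := by congr 1; abel
      _ ≤ ‖z + w‖ + ‖z‖ := norm_sub_le _ _
      _ ≤ _ := add_le_add hw hz'

/-- The maximal inequality, of weak type `(1,1)`, for the part of `f` above a quarter of the level:
the Vitali covering lemma. -/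
theorem exists_volume_compl_maximalSet_le (d : ℕ) :
    ∃ C : ℝ, 0 ≤ C ∧ ∀ f : Vec d → ℝ, Continuous f → IsPeriodic f → ∀ l : ℝ, 0 < l →
      l * (volQ d).real (maximalSet f l)ᶜ ≤ C * ∫ x, max (f x - l / 4) 0 ∂(volQ d) := by
  obtain ⟨N, hN0, hN⟩ := exists_setIntegral_closedBall_le d (Real.sqrt d + 1)
  refine ⟨4 ^ d * 4 * N, by positivity, fun f hf hp l hl => ?_⟩
  set h : Vec d → ℝ := fun x => max (f x - l / 4) 0 with hh
  have hhc : Continuous h := by fun_prop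
  have hhp : IsPeriodic h := fun i x => by simp only [hh, hp i]
  have hh0 : ∀ x, 0 ≤ h x := fun x => le_max_right _ _
  have hfh : ∀ x, f x ≤ l / 2 + 2 * h x := fun x => by
    rcases le_total (f x) (l / 2) with h1 | h1
    · linarith [hh0 x]
    · have := le_max_left (f x - l / 4) 0
      simp only [hh]; linarith
  obtain ⟨B, -, hB⟩ := hp.exists_bound hf
  obtain ⟨B', -, hB'⟩ := hhp.exists_bound hhc
  set t : Set (Vec d) := Q d ∩ (maximalSet f l)ᶜ with ht
  -- every point of `t` is the centre of a ball of radius at most `1` on which the mean of `f`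
  -- exceeds `l`
  have hex : ∀ x : Vec d, ∃ r : ℝ, x ∈ t → r ∈ Ioc (0 : ℝ) 1 ∧
      l * ballVol d < ∫ z, f (x + r • z) ∂(volB d) := fun x => by
    by_cases hx : x ∈ t
    · have := hx.2
      simp only [maximalSet, mem_compl_iff, mem_ofPred_eq, not_forall, not_le] at this
      obtain ⟨r, hr, h1⟩ := this
      exact ⟨r, fun _ => ⟨hr, h1⟩⟩
    · exact ⟨0, fun h => absurd h hx⟩
  choose r hr using hex
  -- the averages of `h` over the selected balls are at least `l / 4`
  have hball : ∀ x ∈ t, l / 4 * (r x ^ d * ballVol d)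
      ≤ ∫ y in Metric.closedBall x (r x), h y := fun x hx => by
    obtain ⟨⟨hr0, hr1⟩, h1⟩ := hr x hx
    have i1 : Integrable (fun z => f (x + r x • z)) (volB d) :=
      Integrable.of_bound (hf.comp (by fun_prop)).aestronglyMeasurable B (ae_of_all _ fun z => hB _)
    have i2 : Integrable (fun z => h (x + r x • z)) (volB d) :=
      Integrable.of_bound (hhc.comp (by fun_prop)).aestronglyMeasurable B'
        (ae_of_all _ fun z => hB' _)
    have h2 : ∫ z, f (x + r x • z) ∂(volB d) ≤ ∫ z, (l / 2 + 2 * h (x + r x • z)) ∂(volB d) :=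
      integral_mono i1 ((integrable_const _).add (i2.const_mul 2)) fun z => hfh _
    rw [integral_add (integrable_const _) (i2.const_mul 2), integral_volB_const,
      integral_const_mul] at h2
    have h3 : ∫ z, h (x + r x • z) ∂(volB d)
        = (r x ^ d)⁻¹ * ∫ y in Metric.ball (0 : Vec d) (r x), h (x + y) := by
      rw [volB, Measure.setIntegral_comp_smul_of_pos volume (fun y => h (x + y)) _ hr0,
        smul_unitBall_of_pos hr0]
      simp
    have h4 : ∫ y in Metric.ball (0 : Vec d) (r x), h (x + y)
        = ∫ y in Metric.ball x (r x), h y := by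
      rw [← (measurePreserving_add_left volume x).setIntegral_preimage_emb
        (measurableEmbedding_addLeft x) h (Metric.ball x (r x))]
      congr 2
      ext y
      simp [dist_eq_norm]
    have h5 : ∫ y in Metric.ball x (r x), h y ≤ ∫ y in Metric.closedBall x (r x), h y :=
      setIntegral_mono_set (hhc.continuousOn.integrableOn_compact (isCompact_closedBall _ _))
        (ae_of_all _ hh0) (LE.le.eventuallyLE Metric.ball_subset_closedBall)
    have hrd : 0 < r x ^ d := by positivity
    have h6 : l / 4 * ballVol d ≤ (r x ^ d)⁻¹ * ∫ y in Metric.ball x (r x), h y := by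
      rw [← h4, ← h3]; linarith
    calc l / 4 * (r x ^ d * ballVol d) = r x ^ d * (l / 4 * ballVol d) := by ring
      _ ≤ r x ^ d * ((r x ^ d)⁻¹ * ∫ y in Metric.ball x (r x), h y) :=
          mul_le_mul_of_nonneg_left h6 hrd.le
      _ = ∫ y in Metric.ball x (r x), h y := by field_simp
      _ ≤ _ := h5
  -- Vitali: disjoint balls among these whose fourfold enlargements cover `t`
  obtain ⟨u, hut, hdisj, hcov⟩ := Vitali.exists_disjoint_subfamily_covering_enlargement_closedBall
    t id r 1 (fun x hx => (hr x hx).1.2) 4 (by norm_num)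
  have hcount : u.Countable := hdisj.countable_of_nonempty_interior fun x hx =>
    ⟨x, Metric.ball_subset_interior_closedBall (Metric.mem_ball_self (hr x (hut hx)).1.1)⟩
  have hsub : t ⊆ ⋃ x ∈ u, Metric.closedBall x (4 * r x) := fun x hx => by
    obtain ⟨b, hb, hxb⟩ := hcov x hx
    exact mem_biUnion hb (hxb (Metric.mem_closedBall_self (hr x hx).1.1.le))
  have hone : ∀ x ∈ u, volume (Metric.closedBall x (4 * r x))
      ≤ ENNReal.ofReal (4 ^ d * (4 / l)) *
        ∫⁻ y in Metric.closedBall x (r x), ENNReal.ofReal (h y) := fun x hx => by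
    have hr0 := (hr x (hut hx)).1.1
    have h1 := hball x (hut hx)
    rw [← ofReal_integral_eq_lintegral_ofReal
      (hhc.continuousOn.integrableOn_compact (isCompact_closedBall _ _)) (ae_of_all _ hh0),
      ← ENNReal.ofReal_mul (by positivity), ← ENNReal.ofReal_toReal
        (measure_closedBall_lt_top (μ := volume) (x := x) (r := 4 * r x)).ne]
    refine ENNReal.ofReal_le_ofReal ?_
    rw [← measureReal_def, Measure.addHaar_real_closedBall _ _ (by positivity),
      finrank_euclideanSpace_fin]
    calc (4 * r x) ^ d * volume.real (Metric.ball (0 : Vec d) 1)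
        = 4 ^ d * (4 / l) * (l / 4 * (r x ^ d * ballVol d)) := by
          rw [ballVol, mul_pow]; field_simp
      _ ≤ _ := mul_le_mul_of_nonneg_left h1 (by positivity)
  have hbig : ⋃ x ∈ u, Metric.closedBall x (r x)
      ⊆ Metric.closedBall (0 : Vec d) (Real.sqrt d + 1) := by
    refine iUnion₂_subset fun x hx y hy => ?_
    have hxQ : x ∈ Q d := (hut hx).1
    have h1 : ‖x‖ ≤ Real.sqrt d := norm_le_sqrt_of_abs_le fun i => by
      have := hxQ i
      rw [abs_of_pos this.1]; exact this.2.le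
    rw [mem_closedBall_iff_norm] at hy
    rw [mem_closedBall_zero_iff]
    calc ‖y‖ = ‖x + (y - x)‖ := by congr 1; abel
      _ ≤ ‖x‖ + ‖y - x‖ := norm_add_le _ _
      _ ≤ _ := add_le_add h1 (hy.trans (hr x (hut hx)).1.2)
  have hmain : volume t ≤ ENNReal.ofReal (4 ^ d * (4 / l) * (N * ∫ x, h x ∂(volQ d))) := by
    calc volume t ≤ volume (⋃ x ∈ u, Metric.closedBall x (4 * r x)) := measure_mono hsub
      _ ≤ ∑' x : u, volume (Metric.closedBall (x : Vec d) (4 * r x)) :=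
          measure_biUnion_le volume hcount _
      _ ≤ ∑' x : u, ENNReal.ofReal (4 ^ d * (4 / l)) *
            ∫⁻ y in Metric.closedBall (x : Vec d) (r x), ENNReal.ofReal (h y) :=
          ENNReal.tsum_le_tsum fun x => hone x x.2
      _ = ENNReal.ofReal (4 ^ d * (4 / l)) *
            ∫⁻ y in ⋃ x ∈ u, Metric.closedBall x (r x), ENNReal.ofReal (h y) := by
          rw [ENNReal.tsum_mul_left, lintegral_biUnion (s := fun x => Metric.closedBall x (r x))
            hcount (fun x _ => measurableSet_closedBall) hdisj]
      _ ≤ ENNReal.ofReal (4 ^ d * (4 / l)) *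
            ∫⁻ y in Metric.closedBall (0 : Vec d) (Real.sqrt d + 1), ENNReal.ofReal (h y) := by
          gcongr
      _ ≤ _ := by
          rw [← ofReal_integral_eq_lintegral_ofReal
            (hhc.continuousOn.integrableOn_compact (isCompact_closedBall _ _)) (ae_of_all _ hh0),
            ← ENNReal.ofReal_mul (by positivity)]
          exact ENNReal.ofReal_le_ofReal
            (mul_le_mul_of_nonneg_left (hN h hhc hhp hh0) (by positivity))
  have hI : 0 ≤ ∫ x, h x ∂(volQ d) := integral_nonneg hh0
  have hvol : (volQ d).real (maximalSet f l)ᶜ ≤ 4 ^ d * (4 / l) * (N * ∫ x, h x ∂(volQ d)) := by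
    rw [measureReal_def, volQ, Measure.restrict_apply' (measurableSet_Q d), inter_comm]
    exact ENNReal.toReal_le_of_le_ofReal (by positivity) hmain
  calc l * (volQ d).real (maximalSet f l)ᶜ
      ≤ l * (4 ^ d * (4 / l) * (N * ∫ x, h x ∂(volQ d))) := by gcongr
    _ = _ := by field_simp

variable {w : Vec d → Vec d} {D : Vec d → Mat d}

/-- Mean oscillation about a point where the maximal function of the gradient is below `l`:
integrating along rays reduces it to averages of `f` over balls centred at `x`. -/
theorem IsC1Periodic.integral_norm_sub_le (hw : IsC1Periodic w D) (hf : Continuous f) {B : ℝ}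
    (hB : ∀ x, |f x| ≤ B) (hDf : ∀ x, ‖D x‖ ≤ f x) {x : Vec d} (hx : x ∈ maximalSet f l) {r : ℝ}
    (hr0 : 0 < r) (hr1 : r ≤ 1) :
    ∫ z, ‖w (x + r • z) - w x‖ ∂(volB d) ≤ r * (l * ballVol d) := by
  have hf0 : ∀ x, 0 ≤ f x := fun x => (norm_nonneg _).trans (hDf x)
  have hzB : ∀ᵐ z ∂(volB d), ‖z‖ < 1 := by
    filter_upwards [ae_restrict_mem (measurableSet_ball (x := (0 : Vec d)) (ε := 1))] with z hz
    simpa using hz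
  have hprod : Integrable (fun q : Vec d × ℝ => f (x + q.2 • r • q.1))
      ((volB d).prod (volume.restrict (Ioc (0 : ℝ) 1))) :=
    Integrable.of_bound (hf.comp (by fun_prop)).aestronglyMeasurable B (ae_of_all _ fun q => hB _)
  have h1 : ∀ᵐ z ∂(volB d), ‖w (x + r • z) - w x‖
      ≤ r * ∫ s in Ioc (0 : ℝ) 1, f (x + s • r • z) := by
    filter_upwards [hzB] with z hz
    rw [hw.sub_eq_integral x (r • z), ← integral_const_mul]
    refine norm_integral_le_of_norm_le ?_ (ae_of_all _ fun s => ?_)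
    · exact (Integrable.of_bound (hf.comp (by fun_prop)).aestronglyMeasurable B
        (ae_of_all _ fun q => hB _)).const_mul r
    · refine (norm_act_le _ _).trans ?_
      rw [mul_comm, norm_smul, Real.norm_of_nonneg hr0.le]
      exact mul_le_mul (mul_le_of_le_one_right hr0.le hz.le) (hDf _) (norm_nonneg _) hr0.le
  have hw' : Continuous fun z => ‖w (x + r • z) - w x‖ :=
    ((hw.continuous.comp (by fun_prop)).sub continuous_const).norm
  obtain ⟨Bw, -, hBw⟩ := hw.periodic.exists_bound hw.continuous
  have iw : Integrable (fun z => ‖w (x + r • z) - w x‖) (volB d) :=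
    Integrable.of_bound hw'.aestronglyMeasurable (Bw + Bw) (ae_of_all _ fun z => by
      rw [norm_norm]
      exact (_root_.norm_sub_le _ _).trans (add_le_add (hBw _) (hBw _)))
  calc ∫ z, ‖w (x + r • z) - w x‖ ∂(volB d)
      ≤ ∫ z, r * (∫ s in Ioc (0 : ℝ) 1, f (x + s • r • z)) ∂(volB d) :=
        integral_mono_ae iw (hprod.integral_prod_left.const_mul r) h1
    _ = r * ∫ s in Ioc (0 : ℝ) 1, (∫ z, f (x + s • r • z) ∂(volB d)) := by
        rw [integral_const_mul, integral_integral_swap (f := fun z s => f (x + s • r • z)) hprod]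
    _ ≤ r * ∫ _s in Ioc (0 : ℝ) 1, l * ballVol d := by
        refine mul_le_mul_of_nonneg_left ?_ hr0.le
        refine setIntegral_mono_on hprod.integral_prod_right (integrable_const _)
          measurableSet_Ioc fun s hs => ?_
        simp only [smul_smul]
        exact hx (s * r) ⟨mul_pos hs.1 hr0, mul_le_one₀ hs.2 hr0.le hr1⟩
    _ = _ := by simp

/-- A `C¹` map is Lipschitz, with constant proportional to the level, on the set where the maximal
function of its gradient is below that level: two points are compared with the averages over a ball
between them. -/
theorem IsC1Periodic.norm_sub_le_of_mem_maximalSet (hw : IsC1Periodic w D) (hf : Continuous f)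
    {B : ℝ} (hB : ∀ x, |f x| ≤ B) (hDf : ∀ x, ‖w x‖ + ‖D x‖ ≤ f x) {x y : Vec d}
    (hx : x ∈ maximalSet f l) (hy : y ∈ maximalSet f l) :
    ‖w x - w y‖ ≤ 2 ^ (d + 1) * l * ‖x - y‖ := by
  have hwl : ∀ z ∈ maximalSet f l, ‖w z‖ ≤ l := fun z hz => by
    have h1 := le_of_mem_maximalSet hf hB hz
    have h2 := hDf z
    linarith [norm_nonneg (D z)]
  have hl0 : 0 ≤ l := (norm_nonneg _).trans (hwl x hx)
  have h2d : (2 : ℝ) ≤ 2 ^ (d + 1) := by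
    rw [pow_succ]; linarith [one_le_pow₀ (M₀ := ℝ) (n := d) one_le_two]
  rcases eq_or_ne x y with rfl | hxy
  · simp
  set r := ‖x - y‖ with hr
  have hr0 : 0 < r := norm_pos_iff.2 (sub_ne_zero.2 hxy)
  -- points at distance greater than `1`: the bound `‖w‖ ≤ l` suffices
  rcases lt_or_ge 1 r with hr1 | hr1
  · calc ‖w x - w y‖ ≤ ‖w x‖ + ‖w y‖ := _root_.norm_sub_le _ _
      _ ≤ 2 * l := by linarith [hwl x hx, hwl y hy]
      _ ≤ 2 ^ (d + 1) * l := by gcongr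
      _ ≤ 2 ^ (d + 1) * l * r := le_mul_of_one_le_right (by positivity) hr1.le
  have hD : ∀ x, ‖D x‖ ≤ f x := fun x => by linarith [hDf x, norm_nonneg (w x)]
  -- After rescaling by `r`, the unit balls about `x` and `y` both contain the ball `S` of radius
  -- `1/2` about the midpoint; over it `w x` and `w y` are compared with `w`.
  set e : Vec d := r⁻¹ • (y - x) with he
  have hen : ‖e‖ = 1 := by
    rw [he, norm_smul, norm_inv, Real.norm_of_nonneg hr0.le, norm_sub_rev, ← hr,
      inv_mul_cancel₀ hr0.ne']
  have hre : r • e = y - x := by rw [he, smul_smul, mul_inv_cancel₀ hr0.ne', one_smul]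
  set S : Set (Vec d) := Metric.ball ((1 / 2 : ℝ) • e) (1 / 2) with hS
  set b : Set (Vec d) := Metric.ball 0 1 with hb
  have hhalf : ‖(1 / 2 : ℝ) • e‖ = 1 / 2 := by
    rw [norm_smul, hen]; norm_num
  have hS1 : ∀ z ∈ S, z ∈ b := fun z hz => by
    rw [hS, mem_ball_iff_norm] at hz
    rw [hb, mem_ball_zero_iff]
    calc ‖z‖ = ‖(z - (1 / 2 : ℝ) • e) + (1 / 2 : ℝ) • e‖ := by congr 1; abel
      _ ≤ _ := norm_add_le _ _
      _ < 1 := by rw [hhalf]; linarith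
  have hS2 : ∀ z ∈ S, z - e ∈ b := fun z hz => by
    rw [hS, mem_ball_iff_norm] at hz
    rw [hb, mem_ball_zero_iff]
    calc ‖z - e‖ = ‖(z - (1 / 2 : ℝ) • e) - (1 / 2 : ℝ) • e‖ := by
          congr 1; rw [sub_sub, ← add_smul]; norm_num
      _ ≤ _ := _root_.norm_sub_le _ _
      _ < 1 := by rw [hhalf]; linarith
  set g : Vec d → Vec d → ℝ := fun a => b.indicator fun z => ‖w (a + r • z) - w a‖ with hg
  have hmb : MeasurableSet b := measurableSet_ball
  have hmS : MeasurableSet S := measurableSet_ball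
  obtain ⟨Bw, -, hBw⟩ := hw.periodic.exists_bound hw.continuous
  have ig : ∀ a, Integrable (g a) := fun a => by
    have hc : Continuous fun z => ‖w (a + r • z) - w a‖ :=
      ((hw.continuous.comp (by fun_prop)).sub continuous_const).norm
    refine IntegrableOn.integrable_indicator ?_ hmb
    exact (hc.continuousOn.integrableOn_compact (isCompact_closedBall 0 1)).mono_set
      Metric.ball_subset_closedBall
  have eg : ∀ a ∈ maximalSet f l, ∫ z, g a z ≤ r * (l * ballVol d) := fun a ha => by
    have := hw.integral_norm_sub_le hf hB hD ha hr0 hr1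
    rwa [volB, ← integral_indicator hmb] at this
  have hpt : ∀ z, S.indicator (fun _ => ‖w x - w y‖) z ≤ g x z + g y (z - e) := fun z => by
    have hg0 : ∀ a z, 0 ≤ g a z := fun a z => indicator_nonneg (fun _ _ => norm_nonneg _) _
    by_cases hz : z ∈ S
    · rw [indicator_of_mem hz]
      simp only [hg]
      rw [indicator_of_mem (hS1 z hz), indicator_of_mem (hS2 z hz),
        show y + r • (z - e) = x + r • z by rw [smul_sub, hre]; abel]
      calc ‖w x - w y‖ = ‖(w (x + r • z) - w y) - (w (x + r • z) - w x)‖ := by congr 1; abel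
        _ ≤ _ := _root_.norm_sub_le _ _
        _ = _ := add_comm _ _
    · rw [indicator_of_notMem hz]
      exact add_nonneg (hg0 _ _) (hg0 _ _)
  have hint : ∫ z, S.indicator (fun _ => ‖w x - w y‖) z ≤ ∫ z, (g x z + g y (z - e)) :=
    integral_mono ((integrable_indicator_iff hmS).2 (integrableOn_const measure_ball_lt_top.ne))
      ((ig x).add ((ig y).comp_sub_right e)) hpt
  rw [integral_add (ig x) ((ig y).comp_sub_right e), integral_sub_right_eq_self (g y) e,
    integral_indicator hmS, setIntegral_const, smul_eq_mul] at hint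
  have hvS : volume.real S = (1 / 2) ^ d * ballVol d := by
    rw [measureReal_def, hS, Measure.addHaar_ball_of_pos _ _ (by norm_num), ENNReal.toReal_mul,
      finrank_euclideanSpace_fin, ENNReal.toReal_ofReal (by positivity)]
    rfl
  rw [hvS] at hint
  have h3 := hint.trans (add_le_add (eg x hx) (eg y hy))
  have hv := ballVol_pos d
  have h4 : ballVol d * ((1 / 2) ^ d * ‖w x - w y‖) ≤ ballVol d * (2 * (r * l)) := by linarith
  have h5 := le_of_mul_le_mul_left h4 hv
  calc ‖w x - w y‖ = 2 ^ d * ((1 / 2) ^ d * ‖w x - w y‖) := by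
        rw [← mul_assoc, ← mul_pow]; norm_num
    _ ≤ 2 ^ d * (2 * (r * l)) := by gcongr
    _ = _ := by ring

end MaximalSet

/-! ### Lipschitz truncation -/

section Truncation

variable {d : ℕ}

/-- The McShane extension of a scalar function that is `K`-Lipschitz on `A`. -/
def mcShane (A : Set (Vec d)) (K : ℝ) (f : Vec d → ℝ) (x : Vec d) : ℝ :=
  ⨅ a : A, (f a + K * ‖x - a‖)

variable {A : Set (Vec d)} {K : ℝ} {f : Vec d → ℝ}

theorem mcShane_bddBelow (hf : ∀ x ∈ A, ∀ y ∈ A, f x - f y ≤ K * ‖x - y‖)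
    (hK : 0 ≤ K) (x : Vec d) : BddBelow (range fun a : A => f a + K * ‖x - a‖) := by
  rcases A.eq_empty_or_nonempty with rfl | ⟨b, hb⟩
  · simp [range_eq_empty]
  · refine ⟨f b - K * ‖x - b‖, ?_⟩
    rintro _ ⟨a, rfl⟩
    have h1 := hf b hb a a.2
    have h2 : ‖b - a‖ ≤ ‖x - a‖ + ‖x - b‖ := by
      calc ‖b - (a : Vec d)‖ = ‖(x - a) - (x - b)‖ := by congr 1; abel
        _ ≤ _ := norm_sub_le _ _
    have h3 := mul_le_mul_of_nonneg_left h2 hK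
    change f b - K * ‖x - b‖ ≤ f a + K * ‖x - a‖
    linarith

theorem mcShane_eq (hf : ∀ x ∈ A, ∀ y ∈ A, f x - f y ≤ K * ‖x - y‖) (hK : 0 ≤ K)
    {x : Vec d} (hx : x ∈ A) : mcShane A K f x = f x := by
  have : Nonempty A := ⟨⟨x, hx⟩⟩
  refine le_antisymm ?_ (le_ciInf fun a => ?_)
  · refine (ciInf_le (mcShane_bddBelow hf hK x) ⟨x, hx⟩).trans ?_
    simp
  · linarith [hf x hx a a.2]

theorem mcShane_sub_le (hA : A.Nonempty) (hf : ∀ x ∈ A, ∀ y ∈ A, f x - f y ≤ K * ‖x - y‖)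
    (hK : 0 ≤ K) (x y : Vec d) : mcShane A K f x - mcShane A K f y ≤ K * ‖x - y‖ := by
  have : Nonempty A := hA.to_subtype
  rw [sub_le_iff_le_add, ← sub_le_iff_le_add']
  refine le_ciInf fun a => ?_
  have h1 := ciInf_le (mcShane_bddBelow hf hK x) a
  have h2 : ‖x - a‖ ≤ ‖x - y‖ + ‖y - a‖ := by
    calc ‖x - (a : Vec d)‖ = ‖(x - y) + (y - a)‖ := by congr 1; abel
      _ ≤ _ := norm_add_le _ _
  have h3 := mul_le_mul_of_nonneg_left h2 hK
  rw [sub_le_iff_le_add']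
  refine h1.trans ?_
  linarith

theorem isPeriodic_mcShane (hA : IsPeriodic fun x => x ∈ A) (hf : IsPeriodic f) :
    IsPeriodic (mcShane A K f) := fun i x => by
  have hA' : ∀ a, a + EuclideanSpace.single i 1 ∈ A ↔ a ∈ A := fun a => Iff.of_eq (hA i a)
  let e : A ≃ A := (Equiv.addRight (EuclideanSpace.single i (1 : ℝ))).subtypeEquiv
    fun a => (hA' a).symm
  rw [mcShane, ← e.iInf_comp]
  refine iInf_congr fun a => ?_
  change f ((a : Vec d) + EuclideanSpace.single i 1) + K * ‖x + EuclideanSpace.single i 1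
    - ((a : Vec d) + EuclideanSpace.single i 1)‖ = _
  rw [hf i, add_sub_add_right_eq_sub]

/-- A periodic map that is Lipschitz on a periodic set extends to a periodic Lipschitz map. -/
theorem exists_periodic_lipschitz_extension {w : Vec d → Vec d} (hA : IsPeriodic fun x => x ∈ A)
    (hw : IsPeriodic w) (hK : 0 ≤ K) (hKw : ∀ x ∈ A, ∀ y ∈ A, ‖w x - w y‖ ≤ K * ‖x - y‖) {l : ℝ}
    (hl : 0 ≤ l) (hwl : ∀ x ∈ A, ‖w x‖ ≤ l) :
    ∃ v : Vec d → Vec d, (∀ x y, ‖v x - v y‖ ≤ Real.sqrt d * K * ‖x - y‖) ∧ IsPeriodic v ∧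
      (∀ x ∈ A, v x = w x) ∧ ∀ x, ‖v x‖ ≤ l + Real.sqrt d * K * Real.sqrt d := by
  rcases A.eq_empty_or_nonempty with rfl | hne
  · refine ⟨fun _ => 0, fun x y => ?_, fun _ _ => rfl, by simp, fun x => ?_⟩
    · simp only [sub_self, norm_zero]; positivity
    · simp only [norm_zero]; positivity
  have hf : ∀ i, ∀ x ∈ A, ∀ y ∈ A, w x i - w y i ≤ K * ‖x - y‖ := fun i x hx y hy => by
    have h1 := PiLp.norm_apply_le (w x - w y) i
    rw [PiLp.sub_apply, Real.norm_eq_abs] at h1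
    exact (le_abs_self _).trans (h1.trans (hKw x hx y hy))
  set v : Vec d → Vec d := fun x => WithLp.toLp 2 fun i => mcShane A K (fun y => w y i) x with hv
  have hvl : ∀ x y, ‖v x - v y‖ ≤ Real.sqrt d * K * ‖x - y‖ := fun x y => by
    have hc : ∀ i, |(v x - v y) i| ≤ K * ‖x - y‖ := fun i => by
      have h1 := mcShane_sub_le hne (hf i) hK x y
      have h2 := mcShane_sub_le hne (hf i) hK y x
      rw [norm_sub_rev] at h2
      rw [PiLp.sub_apply, abs_le]
      constructor <;> simp only [hv] <;> linarith
    rw [EuclideanSpace.norm_eq]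
    refine Real.sqrt_le_iff.2 ⟨by positivity, ?_⟩
    calc ∑ i, ‖(v x - v y) i‖ ^ 2 ≤ ∑ _i : Fin d, (K * ‖x - y‖) ^ 2 :=
          Finset.sum_le_sum fun i _ => by
            rw [Real.norm_eq_abs]
            exact pow_le_pow_left₀ (abs_nonneg _) (hc i) 2
      _ = d * (K * ‖x - y‖) ^ 2 := by simp
      _ = _ := by rw [mul_assoc, mul_pow (Real.sqrt d), Real.sq_sqrt (Nat.cast_nonneg d)]
  have hvp : IsPeriodic v := fun i x => by
    ext j
    exact isPeriodic_mcShane (K := K) hA (hw.comp fun y => y j) i x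
  have hvA : ∀ x ∈ A, v x = w x := fun x hx => by
    ext j
    exact mcShane_eq (hf j) hK hx
  refine ⟨v, hvl, hvp, hvA, fun x => ?_⟩
  -- every point has a translate by a period near `a`, which gives the bound
  obtain ⟨a, ha⟩ := hne
  obtain ⟨y, hy, hyx⟩ := exists_mem_fundamentalDomain (x - a)
  have h1 : ‖x - a + y‖ ≤ Real.sqrt d := norm_le_sqrt_of_abs_le fun i => by
    rw [abs_of_nonneg (hyx i).1]; exact (hyx i).2.le
  have h2 := hvl (x + y) a
  rw [hvp.lattice hy, show x + y - a = x - a + y by abel] at h2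
  have h3 := hwl a ha
  rw [← hvA a ha] at h3
  calc ‖v x‖ = ‖v a + (v x - v a)‖ := by congr 1; abel
    _ ≤ ‖v a‖ + ‖v x - v a‖ := norm_add_le _ _
    _ ≤ l + Real.sqrt d * K * Real.sqrt d := by
        refine add_le_add h3 (h2.trans ?_)
        exact mul_le_mul_of_nonneg_left h1 (by positivity)

/-- A Lipschitz map and a `C¹` map that agree on a set have the same gradient almost everywhere on
it, because almost every point of the set is a density point. -/
theorem grad_ae_eq_of_eqOn {v w : Vec d → Vec d} {D : Vec d → Mat d} {C : ℝ≥0}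
    (hv : LipschitzWith C v) (hw : IsC1Periodic w D) (hA : MeasurableSet A)
    (h : ∀ x ∈ A, v x = w x) : ∀ᵐ x ∂(volume : Measure (Vec d)), x ∈ A → grad v x = D x := by
  set u : Vec d → Vec d := fun x => v x - w x with hu
  have hdiff : ∀ᵐ x ∂(volume : Measure (Vec d)), DifferentiableAt ℝ v x := hv.ae_differentiableAt
  set A' : Set (Vec d) := A ∩ {x | DifferentiableAt ℝ v x} with hA'
  have hmA' : MeasurableSet A' := hA.inter (measurableSet_of_differentiableAt ℝ v)
  -- the difference is constant on the set, so it is approximated there by the zero map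
  have happ : ApproximatesLinearOn u (0 : Vec d →L[ℝ] Vec d) A' 0 := fun x hx y hy => by
    simp [hu, h x hx.1, h y hy.1]
  have key := happ.norm_fderiv_sub_le volume hmA' (fun x => fderiv ℝ v x - act d (D x))
    fun x hx => (hx.2.hasFDerivAt.sub (hw.hasFDerivAt x)).hasFDerivWithinAt
  rw [ae_restrict_iff' hmA'] at key
  filter_upwards [key, hdiff] with x hx hd hxA
  have h1 := hx ⟨hxA, hd⟩
  rw [sub_zero, nonpos_iff_eq_zero, nnnorm_eq_zero, sub_eq_zero] at h1
  rw [grad, h1, jac_act]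

/-- **Lipschitz truncation.** A periodic `C¹` map agrees with a periodic map that is bounded and
Lipschitz with constants of order `l`, together with the gradients, outside a set controlled by the
part of `|w| + |∇w|` above `l / 4`. -/
theorem exists_lipschitz_truncation (d : ℕ) :
    ∃ C : ℝ, 1 ≤ C ∧ ∀ (w : Vec d → Vec d) (D : Vec d → Mat d), IsC1Periodic w D →
      ∀ l : ℝ, 0 < l → ∃ (v : Vec d → Vec d) (A : Set (Vec d)),
        LipschitzWith (C * l).toNNReal v ∧ IsPeriodic v ∧ (∀ x, ‖v x‖ ≤ C * l) ∧
        (∀ x, ‖grad v x‖ ≤ C * l) ∧ MeasurableSet A ∧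
        (∀ x ∈ A, v x = w x ∧ ‖D x‖ ≤ l) ∧ (∀ᵐ x ∂(volQ d), x ∈ A → grad v x = D x) ∧
        l * (volQ d).real Aᶜ ≤ C * ∫ x, max (‖w x‖ + ‖D x‖ - l / 4) 0 ∂(volQ d) := by
  obtain ⟨CM, hCM0, hCM⟩ := exists_volume_compl_maximalSet_le d
  set K₀ : ℝ := Real.sqrt d * 2 ^ (d + 1) with hK₀
  have hK₀0 : 0 ≤ K₀ := by positivity
  set C : ℝ := 1 + CM + K₀ + d * K₀ + K₀ * Real.sqrt d with hC
  have hs : 0 ≤ K₀ * Real.sqrt d := by positivity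
  have hdK : 0 ≤ d * K₀ := by positivity
  refine ⟨C, by linarith, fun w D hw l hl => ?_⟩
  set f : Vec d → ℝ := fun x => ‖w x‖ + ‖D x‖ with hf
  have hfc : Continuous f := hw.continuous.norm.add hw.continuous_grad.norm
  have hfp : IsPeriodic f := fun i x => by simp only [hf, hw.periodic i, hw.periodic_grad i]
  obtain ⟨B, -, hB⟩ := hfp.exists_bound hfc
  set A := maximalSet f l with hA
  have hfl : ∀ x ∈ A, f x ≤ l := fun x hx => le_of_mem_maximalSet hfc hB hx
  obtain ⟨v, hvl, hvp, hvA, hvb⟩ := exists_periodic_lipschitz_extension (A := A) (w := w)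
    (K := 2 ^ (d + 1) * l) (isPeriodic_maximalSet hfp) hw.periodic (by positivity)
    (fun x hx y hy => hw.norm_sub_le_of_mem_maximalSet hfc hB (fun _ => le_rfl) hx hy) hl.le
    (fun x hx => by have := hfl x hx; simp only [hf] at this; linarith [norm_nonneg (D x)])
  have hlip : LipschitzWith (K₀ * l).toNNReal v := LipschitzWith.of_dist_le_mul fun x y => by
    rw [Real.coe_toNNReal _ (by positivity), dist_eq_norm, dist_eq_norm]
    calc _ ≤ _ := hvl x y
      _ = _ := by rw [hK₀]; ring
  have hmA : MeasurableSet A := (isClosed_maximalSet hfc hB).measurableSet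
  refine ⟨v, A, hlip.weaken (Real.toNNReal_le_toNNReal ?_), hvp, fun x => ?_, fun x => ?_, hmA,
    fun x hx => ⟨hvA x hx, ?_⟩, ae_restrict_of_ae (grad_ae_eq_of_eqOn hlip hw hmA hvA), ?_⟩
  · exact mul_le_mul_of_nonneg_right (by linarith) hl.le
  · calc ‖v x‖ ≤ l + Real.sqrt d * (2 ^ (d + 1) * l) * Real.sqrt d := hvb x
      _ = (1 + K₀ * Real.sqrt d) * l := by rw [hK₀]; ring
      _ ≤ C * l := mul_le_mul_of_nonneg_right (by linarith) hl.le
  · calc ‖grad v x‖ ≤ d * ((K₀ * l).toNNReal : ℝ) := norm_grad_le hlip x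
      _ = d * K₀ * l := by rw [Real.coe_toNNReal _ (by positivity)]; ring
      _ ≤ C * l := mul_le_mul_of_nonneg_right (by linarith) hl.le
  · have := hfl x hx; simp only [hf] at this; linarith [norm_nonneg (w x)]
  · refine (hCM f hfc hfp l hl).trans (mul_le_mul_of_nonneg_right (by linarith) ?_)
    exact integral_nonneg fun _ => le_max_right _ _

end Truncation

/-! ### The truncated Gårding inequality -/

section TruncatedGarding

variable {d : ℕ} {p c₀ : ℝ} {W : Mat d → ℝ}

/-- A continuous cut-off in the space of matrices, equal to `1` for `‖ξ‖ ≤ l` and to `0` for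
`‖ξ‖ ≥ 2 l`. -/
def cutoff (l : ℝ) (ξ : Mat d) : ℝ := max 0 (min 1 (2 - ‖ξ‖ / l))

theorem continuous_cutoff (l : ℝ) : Continuous (cutoff l : Mat d → ℝ) := by
  unfold cutoff; fun_prop

theorem cutoff_nonneg (l : ℝ) (ξ : Mat d) : 0 ≤ cutoff l ξ := le_max_left _ _

theorem cutoff_le_one (l : ℝ) (ξ : Mat d) : cutoff l ξ ≤ 1 :=
  max_le zero_le_one (min_le_left _ _)

theorem abs_cutoff_le_one (l : ℝ) (ξ : Mat d) : |cutoff l ξ| ≤ 1 := by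
  rw [abs_of_nonneg (cutoff_nonneg l ξ)]; exact cutoff_le_one l ξ

theorem cutoff_eq_one {l : ℝ} (hl : 0 < l) {ξ : Mat d} (h : ‖ξ‖ ≤ l) : cutoff l ξ = 1 := by
  have : ‖ξ‖ / l ≤ 1 := (div_le_one hl).2 h
  rw [cutoff, min_eq_left (by linarith), max_eq_right zero_le_one]

theorem cutoff_eq_zero {l : ℝ} (hl : 0 < l) {ξ : Mat d} (h : 2 * l ≤ ‖ξ‖) : cutoff l ξ = 0 := by
  have : 2 ≤ ‖ξ‖ / l := (le_div_iff₀ hl).2 h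
  exact max_eq_left ((min_le_right _ _).trans (by linarith))

/-- The integrand `(2 / c₀) G(F, η) - V(η)²`, whose integral is bounded from below. -/
def excess (p c₀ : ℝ) (W : Mat d → ℝ) (F η : Mat d) : ℝ := 2 / c₀ * G W F η - V p η ^ 2

theorem IsIntegrand.continuous_excess (hW : IsIntegrand p W) (hp : 2 ≤ p) :
    Continuous fun q : Mat d × Mat d => excess p c₀ W q.1 q.2 :=
  (continuous_const.mul hW.continuous_G).sub ((continuous_V_sq hp).comp continuous_snd)

theorem IsIntegrand.abs_excess_le (hW : IsIntegrand p W) (hp : 2 ≤ p) (hc₀ : 0 < c₀) {R : ℝ}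
    (hR : 0 ≤ R) :
    ∃ C : ℝ, 0 ≤ C ∧ ∀ F η : Mat d, ‖F‖ ≤ R → |excess p c₀ W F η| ≤ C * V p η ^ 2 := by
  obtain ⟨C, hC0, hC⟩ := hW.abs_G_le hp hR
  refine ⟨2 / c₀ * C + 1, by positivity, fun F η hF => ?_⟩
  calc |excess p c₀ W F η| ≤ |2 / c₀ * G W F η| + |V p η ^ 2| := abs_sub _ _
    _ = 2 / c₀ * |G W F η| + V p η ^ 2 := by
        rw [abs_mul, abs_of_pos (by positivity : 0 < 2 / c₀), abs_of_nonneg (V_sq_nonneg _ _)]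
    _ ≤ 2 / c₀ * (C * V p η ^ 2) + V p η ^ 2 := by
        have := mul_le_mul_of_nonneg_left (hC F η hF) (by positivity : 0 ≤ 2 / c₀)
        linarith
    _ = _ := by ring

theorem V_sq_le_of_norm_le {E : Type*} [NormedAddCommGroup E] (hp : 2 ≤ p) {a l : ℝ} (ha : 1 ≤ a)
    (hl : 1 ≤ l) {ξ : E} (h : ‖ξ‖ ≤ a * l) : V p ξ ^ 2 ≤ 2 * a ^ p * l ^ p := by
  have hal : 1 ≤ a * l := one_le_mul_of_one_le_of_one_le ha hl
  have h1 : ‖ξ‖ ^ 2 ≤ (a * l) ^ p := by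
    calc ‖ξ‖ ^ 2 ≤ (a * l) ^ 2 := pow_le_pow_left₀ (norm_nonneg _) h 2
      _ = (a * l) ^ (2 : ℝ) := by norm_cast
      _ ≤ _ := Real.rpow_le_rpow_of_exponent_le hal hp
  have h2 : ‖ξ‖ ^ p ≤ (a * l) ^ p :=
    Real.rpow_le_rpow (norm_nonneg _) h (by linarith)
  rw [V_sq, mul_assoc, ← Real.mul_rpow (by linarith) (by linarith)]
  linarith

/-- `IsBackground R r δ Fb`: a continuous periodic matrix field with bound `R` that oscillates by at
most `δ` at distances up to `r`. -/
structure IsBackground (R r δ : ℝ) (Fb : Vec d → Mat d) : Prop where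
  continuous : Continuous Fb
  periodic : IsPeriodic Fb
  bound : ∀ x, ‖Fb x‖ ≤ R
  oscillation : ∀ x y, ‖x - y‖ ≤ r → ‖Fb x - Fb y‖ ≤ δ

/-- The truncated Gårding inequality for `C¹` maps: Gårding's inequality for the Lipschitz
truncation of `w` minus the background potential `b`. The background `Fb` of the integrand and the
gradient `B` that is subtracted are kept apart, since later only `B` is mollified. -/
theorem truncated_garding_smooth (hW : IsIntegrand p W) (hqc : QuasiconvexWith p c₀ W)
    (hc₀ : 0 < c₀) (hp : 2 ≤ p) {R : ℝ} (hR : 0 ≤ R) :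
    ∃ δ : ℝ, 0 < δ ∧ ∀ r : ℝ, 0 < r → ∃ C₀ C : ℝ, 0 ≤ C₀ ∧ 0 ≤ C ∧
      ∀ Fb : Vec d → Mat d, IsBackground R r δ Fb →
      ∀ (w b : Vec d → Vec d) (D B : Vec d → Mat d), IsC1Periodic w D → IsC1Periodic b B →
        ∫ x, b x ∂(volQ d) = 0 → (∀ x, ‖B x‖ ≤ R) → ∀ l : ℝ, 1 ≤ l →
        0 ≤ ∫ x, excess p c₀ W (Fb x) (D x - B x) * cutoff l (D x) ∂(volQ d)
          + C₀ * ∫ x, V p (w x - b x) ^ 2 ∂(volQ d)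
          + C * l ^ (p - 1) * ∫ x, max (‖w x‖ + ‖D x‖ - l / 4) 0 ∂(volQ d) := by
  obtain ⟨δ, hδ, hδ'⟩ := garding_lipschitz hW hqc hc₀ hp hR
  obtain ⟨M, hM0, hM⟩ := hW.abs_excess_le hp hc₀ hR
  obtain ⟨CT, hCT1, hCT⟩ := exists_lipschitz_truncation d
  refine ⟨δ, hδ, fun r hr => ?_⟩
  obtain ⟨K, hK0, hK⟩ := hδ' r hr
  set C₀ : ℝ := 2 / c₀ * K with hC₀
  have hC₀0 : 0 ≤ C₀ := by positivity
  set N : ℝ := M * (2 * (CT + R) ^ p) + M * (2 * (2 + R) ^ p)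
    + C₀ * (2 * (CT + R * Real.sqrt d) ^ p) with hN
  have hCT0 : 0 < CT := by linarith
  have hN0 : 0 ≤ N := by positivity
  refine ⟨C₀, N * CT, hC₀0, by positivity, fun Fb hFb w b D B hw hb hb0 hB l hl => ?_⟩
  have hl0 : 0 < l := by linarith
  obtain ⟨v, A, hvL, hvp, hvb, hvg, hmA, hvA, hgA, hvol⟩ := hCT w D hw l hl0
  set φ : Vec d → Vec d := fun x => v x - b x with hφ
  have hbL : LipschitzWith R.toNNReal b := LipschitzWith.of_dist_le_mul fun x y => by
    rw [Real.coe_toNNReal _ hR, dist_eq_norm, dist_eq_norm]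
    exact hb.norm_sub_le hB x y
  have hφL : LipschitzWith ((CT * l).toNNReal + R.toNNReal) φ := hvL.sub hbL
  have hφp : IsPeriodic φ := fun i x => by simp only [hφ, hvp i, hb.periodic i]
  have hG := hK Fb hFb.continuous hFb.periodic hFb.bound hFb.oscillation φ _ hφL hφp
  have hVc : Continuous fun ξ : Mat d => V p ξ ^ 2 := continuous_V_sq hp
  have hVc' : Continuous fun ξ : Vec d => V p ξ ^ 2 := continuous_V_sq hp
  -- bounds for the gradient and the values of the competitor
  have hgφ : ∀ᵐ x ∂(volQ d), grad φ x = grad v x - B x := by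
    refine ae_restrict_of_ae ?_
    have : ∀ᵐ x ∂(volume : Measure (Vec d)), DifferentiableAt ℝ v x := hvL.ae_differentiableAt
    filter_upwards [this] with x hx
    have h1 : HasFDerivAt φ (fderiv ℝ v x - act d (B x)) x := hx.hasFDerivAt.sub (hb.hasFDerivAt x)
    rw [grad, h1.fderiv, jac_sub, jac_act, grad]
  obtain ⟨BE, -, hBE⟩ := (hφp.comp fun y => V p y ^ 2).exists_bound (hVc'.comp hφL.continuous)
  have iVφ : Integrable (fun x => V p (φ x) ^ 2) (volQ d) :=
    integrable_of_norm_le (hVc'.comp hφL.continuous).aestronglyMeasurable hBE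
  set L : ℝ := d * (((CT * l).toNNReal + R.toNNReal : ℝ≥0) : ℝ) with hL
  have hL0 : 0 ≤ L := by positivity
  have hgL : ∀ x, V p (grad φ x) ^ 2 ≤ V p L ^ 2 := fun x => V_sq_mono hp (by
    rw [Real.norm_of_nonneg hL0]; exact norm_grad_le hφL x)
  have iVg : Integrable (fun x => V p (grad φ x) ^ 2) (volQ d) :=
    integrable_of_norm_le (hVc.measurable.comp (measurable_grad φ)).aestronglyMeasurable
      (C := V p L ^ 2) fun x => by
        rw [Real.norm_of_nonneg (V_sq_nonneg _ _)]; exact hgL x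
  have hEc := hW.continuous_excess (c₀ := c₀) hp
  have hEb : ∀ x, |excess p c₀ W (Fb x) (grad φ x)| ≤ M * V p L ^ 2 := fun x =>
    (hM _ _ (hFb.bound x)).trans (mul_le_mul_of_nonneg_left (hgL x) hM0)
  have iE : Integrable (fun x => excess p c₀ W (Fb x) (grad φ x)) (volQ d) :=
    integrable_of_norm_le (hEc.measurable.comp (hFb.continuous.measurable.prodMk
      (measurable_grad φ))).aestronglyMeasurable hEb
  have h0 : 0 ≤ ∫ x, (excess p c₀ W (Fb x) (grad φ x) + C₀ * V p (φ x) ^ 2) ∂(volQ d) := by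
    rw [integral_add iE (iVφ.const_mul _), integral_const_mul]
    have iGG : Integrable (fun x => G W (Fb x) (grad φ x)) (volQ d) := by
      have := (iE.add iVg).const_mul (c₀ / 2)
      refine this.congr (ae_of_all _ fun x => ?_)
      simp only [Pi.add_apply, excess]
      field_simp
      ring
    have e : ∫ x, excess p c₀ W (Fb x) (grad φ x) ∂(volQ d)
        = 2 / c₀ * ∫ x, G W (Fb x) (grad φ x) ∂(volQ d) - ∫ x, V p (grad φ x) ^ 2 ∂(volQ d) := by
      simp only [excess]
      rw [integral_sub (iGG.const_mul _) iVg, integral_const_mul]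
    rw [e, hC₀]
    have h1 := mul_le_mul_of_nonneg_left hG (by positivity : 0 ≤ 2 / c₀)
    have h2 : 2 / c₀ * (c₀ / 2 * ∫ x, V p (grad φ x) ^ 2 ∂(volQ d))
        = ∫ x, V p (grad φ x) ^ 2 ∂(volQ d) := by field_simp
    rw [h2] at h1
    linarith
  -- the integrands on the right-hand side
  set E₁ : Vec d → ℝ := fun x => excess p c₀ W (Fb x) (D x - B x) * cutoff l (D x) with hE₁
  have hE₁c : Continuous E₁ :=
    (hEc.comp (hFb.continuous.prodMk (hw.continuous_grad.sub hb.continuous_grad))).mul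
      ((continuous_cutoff l).comp hw.continuous_grad)
  have hE₁p : IsPeriodic E₁ := fun i x => by
    simp only [hE₁, hFb.periodic i, hw.periodic_grad i, hb.periodic_grad i]
  have iE₁ : Integrable E₁ (volQ d) := hE₁p.integrable hE₁c
  have iVw : Integrable (fun x => V p (w x - b x) ^ 2) (volQ d) := (hw.sub hb).integrable_V_sq hp
  have iA : Integrable (Aᶜ.indicator fun _ => N * l ^ p) (volQ d) :=
    (integrable_const _).indicator hmA.compl
  have iR : Integrable (fun x => E₁ x + C₀ * V p (w x - b x) ^ 2
      + Aᶜ.indicator (fun _ => N * l ^ p) x) (volQ d) :=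
    (iE₁.add (iVw.const_mul _)).add iA
  have hlp : 0 ≤ l ^ p := by positivity
  have hpt : ∀ᵐ x ∂(volQ d), excess p c₀ W (Fb x) (grad φ x) + C₀ * V p (φ x) ^ 2
      ≤ E₁ x + C₀ * V p (w x - b x) ^ 2 + Aᶜ.indicator (fun _ => N * l ^ p) x := by
    filter_upwards [hgφ, hgA, ae_restrict_mem (measurableSet_Q d)] with x h1 h2 hxQ
    -- on `A` both sides have the same integrand; off `A` every term is of order `l ^ p`
    by_cases hx : x ∈ A
    · rw [indicator_of_notMem (notMem_compl_iff.2 hx), add_zero, h1, h2 hx]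
      simp only [hE₁, hφ, (hvA x hx).1, cutoff_eq_one hl0 (hvA x hx).2, mul_one]
      exact le_rfl
    · rw [indicator_of_mem hx]
      have hRl : R ≤ R * l := le_mul_of_one_le_right hR hl
      have a1 : V p (grad φ x) ^ 2 ≤ 2 * (CT + R) ^ p * l ^ p := by
        refine V_sq_le_of_norm_le hp (by linarith) hl ?_
        rw [h1]
        refine (norm_sub_le _ _).trans ?_
        linarith [hvg x, hB x]
      have a2 : |E₁ x| ≤ M * (2 * (2 + R) ^ p * l ^ p) := by
        rcases le_total ‖D x‖ (2 * l) with h3 | h3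
        · simp only [hE₁]
          rw [abs_mul]
          have a3 : V p (D x - B x) ^ 2 ≤ 2 * (2 + R) ^ p * l ^ p := by
            refine V_sq_le_of_norm_le hp (by linarith) hl ?_
            refine (norm_sub_le _ _).trans ?_
            linarith [hB x]
          calc _ ≤ |excess p c₀ W (Fb x) (D x - B x)| * 1 :=
                mul_le_mul_of_nonneg_left (abs_cutoff_le_one _ _) (abs_nonneg _)
            _ ≤ M * V p (D x - B x) ^ 2 := by rw [mul_one]; exact hM _ _ (hFb.bound x)
            _ ≤ _ := mul_le_mul_of_nonneg_left a3 hM0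
        · simp only [hE₁, cutoff_eq_zero hl0 h3, mul_zero, abs_zero]
          positivity
      have a4 : V p (φ x) ^ 2 ≤ 2 * (CT + R * Real.sqrt d) ^ p * l ^ p := by
        have hs : 0 ≤ R * Real.sqrt d := by positivity
        refine V_sq_le_of_norm_le hp (by linarith) hl ?_
        have := hb.norm_le_of_integral_eq_zero hb0 hB hxQ
        refine (norm_sub_le _ _).trans ?_
        have := le_mul_of_one_le_right hs hl
        linarith [hvb x]
      have b1 := (le_abs_self _).trans ((hM (Fb x) (grad φ x) (hFb.bound x)).trans
        (mul_le_mul_of_nonneg_left a1 hM0))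
      have b2 := (abs_le.1 a2).1
      have b4 := mul_le_mul_of_nonneg_left a4 hC₀0
      have b5 := mul_nonneg hC₀0 (V_sq_nonneg p (w x - b x))
      simp only [hN]
      linarith
  have h1 := h0.trans (integral_mono_ae (iE.add (iVφ.const_mul C₀)) iR hpt)
  have i12 : Integrable (fun x => E₁ x + C₀ * V p (w x - b x) ^ 2) (volQ d) :=
    iE₁.add (iVw.const_mul _)
  rw [integral_add i12 iA, integral_add iE₁ (iVw.const_mul _), integral_const_mul,
    integral_indicator hmA.compl, setIntegral_const, smul_eq_mul] at h1
  have h2 : (volQ d).real Aᶜ * (N * l ^ p)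
      ≤ N * CT * l ^ (p - 1) * ∫ x, max (‖w x‖ + ‖D x‖ - l / 4) 0 ∂(volQ d) := by
    have e : l ^ p = l ^ (p - 1) * l := by
      rw [← Real.rpow_add_one hl0.ne']; congr 1; ring
    calc (volQ d).real Aᶜ * (N * l ^ p) = N * l ^ (p - 1) * (l * (volQ d).real Aᶜ) := by
          rw [e]; ring
      _ ≤ N * l ^ (p - 1) * (CT * ∫ x, max (‖w x‖ + ‖D x‖ - l / 4) 0 ∂(volQ d)) :=
          mul_le_mul_of_nonneg_left hvol (by positivity)
      _ = _ := by ring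
  linarith

theorem convexOn_max_norm_sub {E : Type*} [NormedAddCommGroup E] [NormedSpace ℝ E] (c : ℝ) :
    ConvexOn ℝ univ fun ξ : E => max (‖ξ‖ - c) 0 := by
  have h : ConvexOn ℝ univ fun ξ : E => ‖ξ‖ + -c :=
    (convexOn_norm (convex_univ (𝕜 := ℝ) (E := E))).add_const (-c)
  exact h.sup (convexOn_const 0 convex_univ)

/-- **The truncated Gårding inequality** for Sobolev maps: the gradients enter the first term only
where they are of size at most `2 l`, at the cost of a term that measures their concentration
above the level `l / 8`. -/
theorem truncated_garding (hW : IsIntegrand p W) (hqc : QuasiconvexWith p c₀ W)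
    (hc₀ : 0 < c₀) (hp : 2 ≤ p) {R : ℝ} (hR : 0 ≤ R) :
    ∃ δ : ℝ, 0 < δ ∧ ∀ r : ℝ, 0 < r → ∃ C₀ C : ℝ, 0 ≤ C₀ ∧ 0 ≤ C ∧
      ∀ (Fb : Vec d → Mat d) (ub : Vec d → Vec d), IsBackground R r δ Fb →
        IsSobolev (ENNReal.ofReal p) ub Fb → ∫ x, ub x ∂(volQ d) = 0 →
      ∀ (u : Vec d → Vec d) (g : Vec d → Mat d), IsSobolev (ENNReal.ofReal p) u g →
      ∀ l : ℝ, 1 ≤ l →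
        0 ≤ ∫ x, excess p c₀ W (Fb x) (g x - Fb x) * cutoff l (g x) ∂(volQ d)
          + C₀ * ∫ x, V p (u x - ub x) ^ 2 ∂(volQ d)
          + C * l ^ (p - 1) * (∫ x, max (‖u x‖ - l / 8) 0 ∂(volQ d)
            + ∫ x, max (‖g x‖ - l / 8) 0 ∂(volQ d)) := by
  obtain ⟨δ, hδ, hδ'⟩ := truncated_garding_smooth hW hqc hc₀ hp hR
  obtain ⟨M, hM0, hM⟩ := hW.abs_excess_le hp hc₀ hR
  refine ⟨δ, hδ, fun r hr => ?_⟩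
  obtain ⟨C₀, C, hC₀, hC, key⟩ := hδ' r hr
  refine ⟨C₀, C, hC₀, hC, fun Fb ub hFb hub hub0 u g hu l hl => ?_⟩
  have hl0 : 0 < l := by linarith
  obtain ⟨ns, hns, hconv⟩ := exists_subseq_conv_tendsto_ae (hu.integrable_grad hp)
  set k : ℕ → Vec d → ℝ := fun n => approxId d (ns n) with hk
  have hker : ∀ n, IsKernel (k n) := fun n => isKernel_approxId _
  have iub := hub.integrable hp
  have iFb := hub.integrable_grad hp
  have iu := hu.integrable hp
  have ig := hu.integrable_grad hp
  have hB : ∀ n x, ‖conv (k n) Fb x‖ ≤ R := fun n => (hker n).norm_conv_le iFb hFb.bound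
  set T : ℝ := C₀ * ∫ x, V p (u x - ub x) ^ 2 ∂(volQ d)
          + C * l ^ (p - 1) * (∫ x, max (‖u x‖ - l / 8) 0 ∂(volQ d)
            + ∫ x, max (‖g x‖ - l / 8) 0 ∂(volQ d)) with hT
  have imax : ∀ {E : Type} [NormedAddCommGroup E] {f : Vec d → E}, Integrable f (volQ d) →
      Integrable (fun x => max (‖f x‖ - l / 8) 0) (volQ d) := fun hf =>
    (hf.norm.sub (integrable_const _)).sup (integrable_const 0)
  -- The smooth inequality for the mollified maps. The last two terms are convex functionals of the
  -- maps, and mollification does not increase them.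
  have step : ∀ n, 0 ≤ ∫ x, excess p c₀ W (Fb x) (conv (k n) g x - conv (k n) Fb x)
      * cutoff l (conv (k n) g x) ∂(volQ d) + T := fun n => by
    have hw := hu.conv hp (hker n).test
    have hb := hub.conv hp (hker n).test
    have h1 := key Fb hFb _ _ _ _ hw hb
      (by rw [QCGarding.integral_conv (hker n) iub, hub0]) (hB n) l hl
    have h2 : ∫ x, V p (conv (k n) u x - conv (k n) ub x) ^ 2 ∂(volQ d)
        ≤ ∫ x, V p (u x - ub x) ^ 2 ∂(volQ d) := by
      have := (hker n).integral_map_conv_le (convexOn_V_sq hp) (continuous_V_sq hp)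
        (iu.sub iub) (integrable_V_sq_of_memLp hp (hu.memLp.sub hub.memLp))
      simp only [Pi.sub_def, conv_sub (hker n).test iu iub] at this
      exact this
    have h3 : ∫ x, max (‖conv (k n) u x‖ + ‖conv (k n) g x‖ - l / 4) 0 ∂(volQ d)
        ≤ ∫ x, max (‖u x‖ - l / 8) 0 ∂(volQ d) + ∫ x, max (‖g x‖ - l / 8) 0 ∂(volQ d) := by
      have a1 := (hker n).integral_map_conv_le (convexOn_max_norm_sub (l / 8)) (by fun_prop) iu
        (imax iu)
      have a2 := (hker n).integral_map_conv_le (convexOn_max_norm_sub (l / 8)) (by fun_prop) ig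
        (imax ig)
      have j1 := imax (conv_integrable (hker n).test iu)
      have j2 := imax (conv_integrable (hker n).test ig)
      refine le_trans ?_ (add_le_add a1 a2)
      rw [← integral_add j1 j2]
      refine integral_mono (((conv_integrable (hker n).test iu).norm.add
        (conv_integrable (hker n).test ig).norm |>.sub (integrable_const _)).sup
        (integrable_const 0)) (j1.add j2) fun x => ?_
      refine max_le ?_ (add_nonneg (le_max_right _ _) (le_max_right _ _))
      have b1 := le_max_left (‖conv (k n) u x‖ - l / 8) 0
      have b2 := le_max_left (‖conv (k n) g x‖ - l / 8) 0
      linarith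
    have h4 := mul_le_mul_of_nonneg_left h2 hC₀
    have h5 := mul_le_mul_of_nonneg_left h3 (by positivity : 0 ≤ C * l ^ (p - 1))
    simp only [hT]
    linarith
  -- the first term converges by dominated convergence, the truncation making it bounded
  have hlim : Tendsto (fun n => ∫ x, excess p c₀ W (Fb x) (conv (k n) g x - conv (k n) Fb x)
      * cutoff l (conv (k n) g x) ∂(volQ d)) atTop
      (𝓝 (∫ x, excess p c₀ W (Fb x) (g x - Fb x) * cutoff l (g x) ∂(volQ d))) := by
    have hEc := hW.continuous_excess (c₀ := c₀) hp
    refine tendsto_integral_of_dominated_convergence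
      (fun _ => M * (2 * (2 + R) ^ p * l ^ p)) (fun n => ?_) (integrable_const _) (fun n => ?_) ?_
    · have c1 := conv_continuous (hker n).test ig
      have c2 := conv_continuous (hker n).test iFb
      exact ((hEc.comp (hFb.continuous.prodMk (c1.sub c2))).mul
        ((continuous_cutoff l).comp c1)).aestronglyMeasurable
    · refine ae_of_all _ fun x => ?_
      rw [Real.norm_eq_abs, abs_mul]
      rcases le_total ‖conv (k n) g x‖ (2 * l) with h3 | h3
      · have a3 : V p (conv (k n) g x - conv (k n) Fb x) ^ 2 ≤ 2 * (2 + R) ^ p * l ^ p := by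
          refine V_sq_le_of_norm_le hp (by linarith) hl ?_
          refine (norm_sub_le _ _).trans ?_
          linarith [hB n x, le_mul_of_one_le_right hR hl]
        calc _ ≤ |excess p c₀ W (Fb x) (conv (k n) g x - conv (k n) Fb x)| * 1 :=
              mul_le_mul_of_nonneg_left (abs_cutoff_le_one _ _) (abs_nonneg _)
          _ ≤ M * V p (conv (k n) g x - conv (k n) Fb x) ^ 2 := by
              rw [mul_one]; exact hM _ _ (hFb.bound x)
          _ ≤ _ := mul_le_mul_of_nonneg_left a3 hM0
      · rw [cutoff_eq_zero hl0 h3, abs_zero, mul_zero]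
        positivity
    · filter_upwards [hconv, ae_restrict_mem (measurableSet_Q d)] with x hx hxQ
      have h1 : Tendsto (fun n => conv (k n) Fb x) atTop (𝓝 (Fb x)) :=
        (tendsto_conv_approxId iFb hxQ hFb.continuous.continuousAt).comp hns.tendsto_atTop
      have h2 : Tendsto (fun n => (Fb x, conv (k n) g x - conv (k n) Fb x)) atTop
          (𝓝 (Fb x, g x - Fb x)) := tendsto_const_nhds.prodMk_nhds (hx.sub h1)
      exact ((hEc.tendsto _).comp h2).mul (((continuous_cutoff l).tendsto _).comp hx)
  have := ge_of_tendsto (hlim.add_const T) (Eventually.of_forall step)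
  rw [hT] at this
  linarith

end TruncatedGarding

/-! ### Compactness in time -/

section TimeCompactness

/-- The radii `1 / (n + 1)` of the mollifiers in time. -/
def timeRadius (n : ℕ) : ℝ := 1 / ((n : ℝ) + 1)

theorem timeRadius_pos (n : ℕ) : 0 < timeRadius n := by unfold timeRadius; positivity

theorem timeRadius_anti {n m : ℕ} (h : n ≤ m) : timeRadius m ≤ timeRadius n := by
  have : (n : ℝ) ≤ m := Nat.cast_le.2 h
  unfold timeRadius
  gcongr

theorem tendsto_timeRadius : Tendsto timeRadius atTop (𝓝 0) :=
  tendsto_one_div_add_atTop_nhds_zero_nat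

/-- The bump functions behind the mollifiers in time. -/
def timeBump (n : ℕ) : ContDiffBump (0 : ℝ) :=
  ⟨timeRadius n / 2, timeRadius n, half_pos (timeRadius_pos n), half_lt_self (timeRadius_pos n)⟩

/-- The mollifiers in time. -/
def mollifier (n : ℕ) : ℝ → ℝ := (timeBump n).normed volume

theorem contDiff_mollifier (n : ℕ) : ContDiff ℝ ∞ (mollifier n) :=
  (timeBump n).contDiff_normed

theorem continuous_mollifier (n : ℕ) : Continuous (mollifier n) := (contDiff_mollifier n).continuous

theorem mollifier_nonneg (n : ℕ) (s : ℝ) : 0 ≤ mollifier n s := (timeBump n).nonneg_normed s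

theorem mollifier_eq_zero {n : ℕ} {s : ℝ} (h : timeRadius n ≤ |s|) : mollifier n s = 0 := by
  by_contra hn
  have : s ∈ Function.support (mollifier n) := hn
  rw [mollifier, (timeBump n).support_normed_eq, mem_ball_zero_iff, Real.norm_eq_abs] at this
  exact absurd this (not_lt.2 h)

theorem hasCompactSupport_mollifier (n : ℕ) : HasCompactSupport (mollifier n) :=
  (timeBump n).hasCompactSupport_normed

theorem integral_mollifier (n : ℕ) : ∫ s, mollifier n s = 1 := (timeBump n).integral_normed

theorem integrable_mollifier (n : ℕ) : Integrable (mollifier n) :=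
  (continuous_mollifier n).integrable_of_hasCompactSupport (hasCompactSupport_mollifier n)

/-- The primitive of the difference of two mollifiers. -/
def mollifierPrimitive (n m : ℕ) (s : ℝ) : ℝ :=
  ∫ r in (-timeRadius n)..s, (mollifier n r - mollifier m r)

theorem hasDerivAt_mollifierPrimitive (n m : ℕ) (s : ℝ) :
    HasDerivAt (mollifierPrimitive n m) (mollifier n s - mollifier m s) s := by
  have hc : Continuous fun r => mollifier n r - mollifier m r :=
    (continuous_mollifier n).sub (continuous_mollifier m)
  exact intervalIntegral.integral_hasDerivAt_right (hc.intervalIntegrable _ _)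
    (hc.stronglyMeasurableAtFilter _ _) hc.continuousAt

theorem contDiff_mollifierPrimitive (n m : ℕ) : ContDiff ℝ ∞ (mollifierPrimitive n m) := by
  refine contDiff_infty_iff_deriv.2
    ⟨fun s => (hasDerivAt_mollifierPrimitive n m s).differentiableAt, ?_⟩
  rw [show deriv (mollifierPrimitive n m) = fun s => mollifier n s - mollifier m s from
    funext fun s => (hasDerivAt_mollifierPrimitive n m s).deriv]
  exact (contDiff_mollifier n).sub (contDiff_mollifier m)

theorem mollifierPrimitive_eq_zero {n m : ℕ} (hnm : n ≤ m) {s : ℝ} (hs : timeRadius n ≤ |s|) :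
    mollifierPrimitive n m s = 0 := by
  have hz : ∀ r, timeRadius n ≤ |r| → mollifier n r - mollifier m r = 0 := fun r hr => by
    rw [mollifier_eq_zero hr, mollifier_eq_zero ((timeRadius_anti hnm).trans hr), sub_zero]
  have hn := timeRadius_pos n
  rcases le_abs.1 hs with h | h
  · rw [mollifierPrimitive, intervalIntegral.integral_of_le (by linarith),
      setIntegral_eq_integral_of_forall_compl_eq_zero fun r hr => hz r ?_,
      integral_sub (integrable_mollifier n) (integrable_mollifier m), integral_mollifier,
      integral_mollifier, sub_self]
    rw [mem_Ioc, not_and_or, not_lt, not_le] at hr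
    rcases hr with h1 | h1
    · exact le_abs.2 (Or.inr (by linarith))
    · exact le_abs.2 (Or.inl (by linarith))
  · rw [mollifierPrimitive, intervalIntegral.integral_congr (g := fun _ => (0 : ℝ)) fun r hr => ?_,
      intervalIntegral.integral_zero]
    rw [uIcc_of_ge (by linarith), mem_Icc] at hr
    exact hz r (le_abs.2 (Or.inr (by linarith [hr.2])))

theorem abs_mollifierPrimitive_le (n m : ℕ) (s : ℝ) : |mollifierPrimitive n m s| ≤ 2 := by
  have hi := (integrable_mollifier n).sub (integrable_mollifier m)
  calc |mollifierPrimitive n m s|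
      ≤ ∫ r in uIoc (-timeRadius n) s, ‖mollifier n r - mollifier m r‖ :=
        intervalIntegral.norm_integral_le_integral_norm_uIoc
          (f := fun r => mollifier n r - mollifier m r)
    _ ≤ ∫ r, ‖mollifier n r - mollifier m r‖ :=
        setIntegral_le_integral hi.norm (ae_of_all _ fun _ => norm_nonneg _)
    _ ≤ ∫ r, (mollifier n r + mollifier m r) := by
        refine integral_mono hi.norm ((integrable_mollifier n).add (integrable_mollifier m))
          fun r => (norm_sub_le _ _).trans ?_
        rw [Real.norm_of_nonneg (mollifier_nonneg n r), Real.norm_of_nonneg (mollifier_nonneg m r)]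
    _ = 2 := by
        rw [integral_add (integrable_mollifier n) (integrable_mollifier m), integral_mollifier,
          integral_mollifier]
        norm_num

/-- `f` has a distributional time derivative on `(0,T)` bounded by `L`. -/
def HasBddTimeDeriv (T L : ℝ) (f : ℝ → ℝ) : Prop :=
  ∃ h : ℝ → ℝ, AEStronglyMeasurable h (volT T) ∧ (∀ᵐ t ∂(volT T), |h t| ≤ L) ∧
    ∀ η : ℝ → ℝ, ContDiff ℝ ∞ η → HasCompactSupport η → tsupport η ⊆ Ioo 0 T →
      ∫ t, deriv η t * f t ∂(volT T) = -∫ t, η t * h t ∂(volT T)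

variable {T L : ℝ}

theorem integrable_mollifier_mul {f : ℝ → ℝ} (hf : Integrable f (volT T)) (n : ℕ) (t : ℝ) :
    Integrable (fun s => mollifier n (t - s) * f s) (volT T) := by
  obtain ⟨C, hC⟩ := (hasCompactSupport_mollifier n).exists_bound_of_continuous
    (continuous_mollifier n)
  exact hf.bdd_mul ((continuous_mollifier n).comp (by fun_prop)).aestronglyMeasurable
    (ae_of_all _ fun s => hC (t - s))

/-- Mollifications at the scales `1/(n+1)` and `1/(m+1)` differ by `O(1/(n+1))`: the difference of
the two mollifiers is the derivative of a bounded function of small support, which is admissible in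
the definition of the time derivative. -/
theorem HasBddTimeDeriv.abs_mollify_sub_le {f : ℝ → ℝ} (h : HasBddTimeDeriv T L f) (hL : 0 ≤ L)
    (hf : Integrable f (volT T)) {n m : ℕ} (hnm : n ≤ m) {t : ℝ}
    (ht : Metric.closedBall t (timeRadius n) ⊆ Ioo 0 T) :
    |∫ s, mollifier n (t - s) * f s ∂(volT T) - ∫ s, mollifier m (t - s) * f s ∂(volT T)|
      ≤ 4 * L * timeRadius n := by
  obtain ⟨h', -, hb, heq⟩ := h
  set η : ℝ → ℝ := fun s => mollifierPrimitive n m (t - s) with hη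
  have hη0 : ∀ s, s ∉ Metric.closedBall t (timeRadius n) → η s = 0 := fun s hs => by
    refine mollifierPrimitive_eq_zero hnm ?_
    rw [Metric.mem_closedBall, Real.dist_eq, not_le, abs_sub_comm] at hs
    exact hs.le
  have hsupp : tsupport η ⊆ Metric.closedBall t (timeRadius n) :=
    closure_minimal (fun s hs => by
      by_contra hn
      exact hs (hη0 s hn)) Metric.isClosed_closedBall
  have hder : ∀ s, deriv η s = -(mollifier n (t - s) - mollifier m (t - s)) := fun s => by
    have h1 : HasDerivAt (fun s : ℝ => t - s) (-1) s := by
      simpa using (hasDerivAt_id s).const_sub t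
    have h2 := (hasDerivAt_mollifierPrimitive n m (t - s)).comp s h1
    rw [mul_neg_one] at h2
    exact h2.deriv
  have key := heq η ((contDiff_mollifierPrimitive n m).comp (by fun_prop))
    ((isCompact_closedBall _ _).of_isClosed_subset (isClosed_tsupport _) hsupp) (hsupp.trans ht)
  have e : ∫ s, deriv η s * f s ∂(volT T)
      = -(∫ s, mollifier n (t - s) * f s ∂(volT T) - ∫ s, mollifier m (t - s) * f s ∂(volT T)) := by
    rw [← integral_sub (integrable_mollifier_mul hf n t) (integrable_mollifier_mul hf m t),
      ← integral_neg]
    refine integral_congr_ae (ae_of_all _ fun s => ?_)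
    simp only [hder]
    ring
  rw [e, neg_inj] at key
  rw [key]
  have hmb : MeasurableSet (Metric.closedBall t (timeRadius n)) := measurableSet_closedBall
  have hfin : volume (Metric.closedBall t (timeRadius n)) ≠ ⊤ := measure_closedBall_lt_top.ne
  have hind : Integrable ((Metric.closedBall t (timeRadius n)).indicator fun _ => 2 * L) :=
    (integrable_indicator_iff hmb).2 (integrableOn_const hfin)
  calc |∫ s, η s * h' s ∂(volT T)|
      ≤ ∫ s, (Metric.closedBall t (timeRadius n)).indicator (fun _ => 2 * L) s ∂(volT T) := by
        rw [← Real.norm_eq_abs]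
        refine norm_integral_le_of_norm_le hind.restrict ?_
        filter_upwards [hb] with s hs
        by_cases h1 : s ∈ Metric.closedBall t (timeRadius n)
        · rw [indicator_of_mem h1, norm_mul]
          exact mul_le_mul (abs_mollifierPrimitive_le n m _) hs (norm_nonneg _) zero_le_two
        · rw [indicator_of_notMem h1, hη0 s h1, zero_mul, norm_zero]
    _ ≤ ∫ s, (Metric.closedBall t (timeRadius n)).indicator (fun _ => 2 * L) s :=
        setIntegral_le_integral hind
          (ae_of_all _ fun s => indicator_nonneg (fun _ _ => by positivity) s)
    _ = _ := by
        rw [integral_indicator hmb, setIntegral_const, smul_eq_mul, measureReal_def,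
          Real.volume_closedBall, ENNReal.toReal_ofReal (by linarith [timeRadius_pos n])]
        ring

/-- Lebesgue's differentiation theorem on `(0,T)`. -/
theorem tendsto_mollify {f : ℝ → ℝ} (hf : Integrable f (volT T)) :
    ∀ᵐ t ∂(volT T), Tendsto (fun n => ∫ s, mollifier n (t - s) * f s ∂(volT T)) atTop
      (𝓝 (f t)) := by
  have hI : Integrable ((Ioo 0 T).indicator f) := (integrable_indicator_iff measurableSet_Ioo).2 hf
  have h := ContDiffBump.ae_convolution_tendsto_right_of_locallyIntegrable (μ := volume)
    (φ := timeBump) (K := 2) (l := atTop) tendsto_timeRadius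
    (Eventually.of_forall fun n => by
      change timeRadius n ≤ 2 * (timeRadius n / 2); linarith) hI.locallyIntegrable
  have h2 := ae_restrict_of_ae (s := Ioo 0 T) h
  filter_upwards [h2, ae_restrict_mem measurableSet_Ioo] with t ht htI
  rw [indicator_of_mem htI] at ht
  refine ht.congr fun n => ?_
  rw [convolution_eq_swap, volT, ← integral_indicator measurableSet_Ioo]
  refine integral_congr_ae (ae_of_all _ fun s => ?_)
  simp only [ContinuousLinearMap.lsmul_apply, smul_eq_mul]
  by_cases hs : s ∈ Ioo 0 T
  · rw [indicator_of_mem hs, indicator_of_mem hs]; rfl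
  · rw [indicator_of_notMem hs, indicator_of_notMem hs, mul_zero]

/-- Weak convergence of functions of time with uniformly bounded time derivatives is pointwise
almost everywhere: the functions are uniformly close to their mollifications, and these converge. -/
theorem tendsto_ae_of_hasBddTimeDeriv {f : ℕ → ℝ → ℝ} {F : ℝ → ℝ} (hL : 0 ≤ L)
    (hf : ∀ k, Integrable (f k) (volT T)) (hF : Integrable F (volT T))
    (hd : ∀ k, HasBddTimeDeriv T L (f k))
    (hw : ∀ b : ℝ → ℝ, Continuous b → HasCompactSupport b →
      Tendsto (fun k => ∫ t, b t * f k t ∂(volT T)) atTop (𝓝 (∫ t, b t * F t ∂(volT T)))) :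
    ∀ᵐ t ∂(volT T), Tendsto (fun k => f k t) atTop (𝓝 (F t)) := by
  filter_upwards [tendsto_mollify hF, ae_all_iff.2 fun k => tendsto_mollify (hf k),
    ae_restrict_mem measurableSet_Ioo] with t h1 h2 ht
  rw [Metric.tendsto_atTop]
  intro ε hε
  obtain ⟨a, ha, hball⟩ := Metric.isOpen_iff.1 isOpen_Ioo t ht
  have e1 : ∀ᶠ n in atTop, timeRadius n < a := tendsto_timeRadius.eventually_lt_const ha
  have e2 : ∀ᶠ n in atTop, 4 * L * timeRadius n < ε / 3 := by
    have : Tendsto (fun n => 4 * L * timeRadius n) atTop (𝓝 (4 * L * 0)) :=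
      tendsto_timeRadius.const_mul _
    rw [mul_zero] at this
    exact this.eventually_lt_const (by positivity)
  have e3 := (Metric.tendsto_nhds.1 h1) (ε / 3) (by positivity)
  obtain ⟨n, hn1, hn2, hn3⟩ := (e1.and (e2.and e3)).exists
  have hsub : Metric.closedBall t (timeRadius n) ⊆ Ioo 0 T :=
    (Metric.closedBall_subset_ball hn1).trans hball
  -- let `m → ∞` in the estimate for the difference of two mollifications
  have hk : ∀ k, |∫ s, mollifier n (t - s) * f k s ∂(volT T) - f k t| ≤ 4 * L * timeRadius n :=
    fun k => by
      have := ((h2 k).const_sub (∫ s, mollifier n (t - s) * f k s ∂(volT T))).abs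
      refine le_of_tendsto this ?_
      filter_upwards [eventually_ge_atTop n] with m hm
      exact (hd k).abs_mollify_sub_le hL (hf k) hm hsub
  have hc : HasCompactSupport fun s => mollifier n (t - s) := by
    have := (hasCompactSupport_mollifier n).comp_homeomorph (Homeomorph.subLeft t)
    exact this
  have h4 := hw (fun s => mollifier n (t - s)) ((continuous_mollifier n).comp (by fun_prop)) hc
  obtain ⟨N, hN⟩ := Metric.tendsto_atTop.1 h4 (ε / 3) (by positivity)
  refine ⟨N, fun k hkN => ?_⟩
  have h5 := hN k hkN
  have h6 := hk k
  rw [Real.dist_eq] at h5 hn3 ⊢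
  calc |f k t - F t|
      = |-(∫ s, mollifier n (t - s) * f k s ∂(volT T) - f k t)
        + (∫ s, mollifier n (t - s) * f k s ∂(volT T) - ∫ s, mollifier n (t - s) * F s ∂(volT T))
        + (∫ s, mollifier n (t - s) * F s ∂(volT T) - F t)| := by congr 1; ring
    _ ≤ |-(∫ s, mollifier n (t - s) * f k s ∂(volT T) - f k t)|
        + |∫ s, mollifier n (t - s) * f k s ∂(volT T) - ∫ s, mollifier n (t - s) * F s ∂(volT T)|
        + |∫ s, mollifier n (t - s) * F s ∂(volT T) - F t| := abs_add_three _ _ _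
    _ < ε := by rw [abs_neg]; linarith

end TimeCompactness

/-! ### Compactness in space -/

section SpaceCompactness

variable {d : ℕ} {p : ℝ}

theorem norm_le_one_add_V_sq {E : Type*} [NormedAddCommGroup E] (p : ℝ) (a : E) :
    ‖a‖ ≤ 1 + V p a ^ 2 := by
  have := norm_sq_le_V_sq p a
  nlinarith [sq_nonneg (‖a‖ - 1)]

theorem integral_norm_le_one_add {E : Type*} [NormedAddCommGroup E] {f : Vec d → E}
    (hf : Integrable f (volQ d)) (hV : Integrable (fun x => V p (f x) ^ 2) (volQ d)) {A : ℝ}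
    (hA : ∫ x, V p (f x) ^ 2 ∂(volQ d) ≤ A) : ∫ x, ‖f x‖ ∂(volQ d) ≤ 1 + A := by
  calc ∫ x, ‖f x‖ ∂(volQ d) ≤ ∫ x, (1 + V p (f x) ^ 2) ∂(volQ d) :=
        integral_mono hf.norm ((integrable_const _).add hV) fun x => norm_le_one_add_V_sq p _
    _ = 1 + ∫ x, V p (f x) ^ 2 ∂(volQ d) := by
        rw [integral_add (integrable_const _) hV]; simp
    _ ≤ _ := by linarith

theorem norm_conv_le_mul {E : Type*} [NormedAddCommGroup E] [NormedSpace ℝ E] {K : Vec d → ℝ}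
    {C : ℝ} (hC : ∀ x, |K x| ≤ C) {f : Vec d → E} (hf : Integrable f (volQ d)) (x : Vec d) :
    ‖conv K f x‖ ≤ C * ∫ y, ‖f y‖ ∂(volQ d) := by
  rw [conv, ← integral_const_mul]
  refine norm_integral_le_of_norm_le (hf.norm.const_mul C) (ae_of_all _ fun y => ?_)
  rw [norm_smul]
  exact mul_le_mul_of_nonneg_right (hC _) (norm_nonneg _)

/-- Sobolev maps of bounded energy and zero average are close in the energy norm as soon as the
mollifications of their gradients are close: a compactness argument of Rellich type. -/
theorem tendsto_integral_V_sq_sub {ι : Type*} {l : Filter ι} [l.IsCountablyGenerated]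
    (hp : 2 ≤ p) {u u' : ι → Vec d → Vec d} {g g' : ι → Vec d → Mat d} {A : ℝ}
    (hu : ∀ i, IsSobolev (ENNReal.ofReal p) (u i) (g i))
    (hu' : ∀ i, IsSobolev (ENNReal.ofReal p) (u' i) (g' i))
    (h0 : ∀ i, ∫ x, u i x ∂(volQ d) = 0) (h0' : ∀ i, ∫ x, u' i x ∂(volQ d) = 0)
    (hA : ∀ i, ∫ x, V p (g i x) ^ 2 ∂(volQ d) ≤ A)
    (hA' : ∀ i, ∫ x, V p (g' i x) ^ 2 ∂(volQ d) ≤ A)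
    (hc : ∀ n x, Tendsto (fun i => conv (approxId d n) (g i) x - conv (approxId d n) (g' i) x) l
      (𝓝 0)) :
    Tendsto (fun i => ∫ x, V p (u i x - u' i x) ^ 2 ∂(volQ d)) l (𝓝 0) := by
  set P : ℝ := 2 ^ p with hP
  have hP0 : 0 < P := by positivity
  set κ := kernelModulus p (fun _ : Vec d => (1 : ℝ)) with hκ
  have hκ0 : 0 ≤ κ := kernelModulus_nonneg isKernel_one
  set ε : ℕ → ℝ := fun n => kernelModulus p (approxId d n) with hε
  have hε0 : ∀ n, 0 ≤ ε n := fun n => kernelModulus_nonneg (isKernel_approxId n)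
  set B : ℕ → ι → ℝ := fun n i => ∫ x, V p (conv (approxId d n) (g i) x
    - conv (approxId d n) (g' i) x) ^ 2 ∂(volQ d) with hB
  have iV : ∀ {E : Type} [NormedAddCommGroup E] {f : Vec d → E},
      MemLp f (ENNReal.ofReal p) (volQ d) → Integrable (fun x => V p (f x) ^ 2) (volQ d) :=
    fun hf => integrable_V_sq_of_memLp hp hf
  have hBt : ∀ n, Tendsto (B n) l (𝓝 0) := fun n => by
    obtain ⟨C, hC0, hC⟩ := (isKernel_approxId (d := d) n).test.exists_bound
    have hb : ∀ i x, ‖conv (approxId d n) (g i) x‖ ≤ C * (1 + A) := fun i x =>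
      (norm_conv_le_mul hC ((hu i).integrable_grad hp) x).trans (mul_le_mul_of_nonneg_left
        (integral_norm_le_one_add ((hu i).integrable_grad hp) (iV (hu i).memLp_grad) (hA i)) hC0)
    have hb' : ∀ i x, ‖conv (approxId d n) (g' i) x‖ ≤ C * (1 + A) := fun i x =>
      (norm_conv_le_mul hC ((hu' i).integrable_grad hp) x).trans (mul_le_mul_of_nonneg_left
        (integral_norm_le_one_add ((hu' i).integrable_grad hp) (iV (hu' i).memLp_grad) (hA' i)) hC0)
    have h1 : Tendsto (B n) l (𝓝 (∫ _x : Vec d, (0 : ℝ) ∂(volQ d))) := by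
      refine tendsto_integral_filter_of_dominated_convergence
        (fun _ => V p (C * (1 + A) + C * (1 + A)) ^ 2) (Eventually.of_forall fun i => ?_)
        (Eventually.of_forall fun i => ae_of_all _ fun x => ?_) (integrable_const _)
        (ae_of_all _ fun x => ?_)
      · exact ((continuous_V_sq hp).comp
          ((conv_continuous (isKernel_approxId n).test ((hu i).integrable_grad hp)).sub
            (conv_continuous (isKernel_approxId n).test
              ((hu' i).integrable_grad hp)))).aestronglyMeasurable
      · rw [Real.norm_of_nonneg (V_sq_nonneg _ _)]
        refine V_sq_mono hp ?_
        have h2 := (norm_sub_le _ _).trans (add_le_add (hb i x) (hb' i x))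
        exact h2.trans (le_abs_self _)
      · have h2 := ((continuous_V_sq (E := Mat d) hp).tendsto 0).comp (hc n x)
        rw [V_sq_zero hp] at h2
        exact h2
    simpa using h1
  -- `u - u'` is split by mollifying both maps at scale `n`; the mollified difference is controlled
  -- by its gradient through Poincaré's inequality
  have key : ∀ n i, ∫ x, V p (u i x - u' i x) ^ 2 ∂(volQ d)
      ≤ (P + P ^ 2) * (ε n * A) + P ^ 2 * (κ * B n i) := fun n i => by
    have hK := isKernel_approxId (d := d) n
    set K := approxId d n
    have hw := (hu i).conv hp hK.test
    have hw' := (hu' i).conv hp hK.test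
    have iu := (hu i).integrable hp
    have iu' := (hu' i).integrable hp
    have a1 := (IsSobolev.integral_V_sq_sub_conv_le hp (hu i) hK).trans
      (mul_le_mul_of_nonneg_left (hA i) (hε0 n))
    have a2 := (IsSobolev.integral_V_sq_sub_conv_le hp (hu' i) hK).trans
      (mul_le_mul_of_nonneg_left (hA' i) (hε0 n))
    have hz : ∫ x, (conv K (u i) x - conv K (u' i) x) ∂(volQ d) = 0 := by
      rw [integral_sub (conv_integrable hK.test iu) (conv_integrable hK.test iu'),
        QCGarding.integral_conv hK iu, QCGarding.integral_conv hK iu', h0, h0', sub_zero]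
    have a3 := (hw.sub hw').poincare hp hz
    have mK : ∀ {w D}, IsC1Periodic w D → MemLp w (ENNReal.ofReal p) (volQ d) := fun h =>
      memLp_of_integrable_V_sq hp h.continuous.aestronglyMeasurable (h.integrable_V_sq hp)
    have i1 := iV ((hu i).memLp.sub (mK hw))
    have i2 := iV ((mK hw).sub (mK hw'))
    have i3 := iV ((hu' i).memLp.sub (mK hw'))
    have i0 := iV ((hu i).memLp.sub (hu' i).memLp)
    simp only [Pi.sub_apply] at i0 i1 i2 i3
    have hpt : ∀ x, V p (u i x - u' i x) ^ 2 ≤ P * V p (u i x - conv K (u i) x) ^ 2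
        + (P ^ 2 * V p (conv K (u i) x - conv K (u' i) x) ^ 2
          + P ^ 2 * V p (u' i x - conv K (u' i) x) ^ 2) := fun x => by
      have b1 := V_sq_add_le hp (u i x - conv K (u i) x) (conv K (u i) x - u' i x)
      have b2 := V_sq_sub_le hp (conv K (u i) x - conv K (u' i) x) (u' i x - conv K (u' i) x)
      rw [show conv K (u i) x - conv K (u' i) x - (u' i x - conv K (u' i) x)
        = conv K (u i) x - u' i x by abel] at b2
      rw [show u i x - conv K (u i) x + (conv K (u i) x - u' i x) = u i x - u' i x by abel] at b1
      have b3 := mul_le_mul_of_nonneg_left b2 hP0.le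
      rw [← hP] at b1 b3
      nlinarith
    have hint := integral_mono i0 ((i1.const_mul P).add
      ((i2.const_mul (P ^ 2)).add (i3.const_mul (P ^ 2)))) hpt
    have e23 : Integrable (fun x => P ^ 2 * V p (conv K (u i) x - conv K (u' i) x) ^ 2
          + P ^ 2 * V p (u' i x - conv K (u' i) x) ^ 2) (volQ d) :=
      (i2.const_mul (P ^ 2)).add (i3.const_mul (P ^ 2))
    simp only [Pi.add_apply] at hint
    rw [integral_add (i1.const_mul P) e23, integral_add (i2.const_mul _) (i3.const_mul _),
      integral_const_mul, integral_const_mul, integral_const_mul] at hint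
    have c1 := mul_le_mul_of_nonneg_left a1 hP0.le
    have c2 := mul_le_mul_of_nonneg_left a2 (by positivity : 0 ≤ P ^ 2)
    have c3 := mul_le_mul_of_nonneg_left a3 (by positivity : 0 ≤ P ^ 2)
    simp only [hB]
    linarith
  -- first `n` is chosen large, then `i`
  rw [Metric.tendsto_nhds]
  intro r hr
  have e1 : Tendsto (fun n => (P + P ^ 2) * (ε n * A)) atTop (𝓝 ((P + P ^ 2) * (0 * A))) :=
    ((tendsto_kernelModulus hp).mul_const A).const_mul _
  rw [zero_mul, mul_zero] at e1
  obtain ⟨n, hn⟩ := (e1.eventually_lt_const (half_pos hr)).exists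
  have e2 : Tendsto (fun i => P ^ 2 * (κ * B n i)) l (𝓝 (P ^ 2 * (κ * 0))) :=
    ((hBt n).const_mul κ).const_mul _
  rw [mul_zero, mul_zero] at e2
  filter_upwards [e2.eventually_lt_const (half_pos hr)] with i hi
  rw [Real.dist_eq, sub_zero, abs_of_nonneg (integral_nonneg fun _ => V_sq_nonneg _ _)]
  linarith [key n i]

/-- Lower semicontinuity of the energy under convergence of all mollifications. -/
theorem integral_V_sq_le_of_tendsto_conv {E : Type*} [NormedAddCommGroup E] [NormedSpace ℝ E]
    [CompleteSpace E] (hp : 2 ≤ p) {f : ℕ → Vec d → E} {f' : Vec d → E} {A : ℝ}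
    (hf : ∀ k, Integrable (f k) (volQ d)) (hf' : Integrable f' (volQ d))
    (hV : ∀ k, Integrable (fun x => V p (f k x) ^ 2) (volQ d))
    (hA : ∀ k, ∫ x, V p (f k x) ^ 2 ∂(volQ d) ≤ A)
    (hc : ∀ n x, Tendsto (fun k => conv (approxId d n) (f k) x) atTop
      (𝓝 (conv (approxId d n) f' x))) :
    Integrable (fun x => V p (f' x) ^ 2) (volQ d) ∧ ∫ x, V p (f' x) ^ 2 ∂(volQ d) ≤ A := by
  have hVc : Continuous fun y : E => V p y ^ 2 := continuous_V_sq hp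
  have iK : ∀ n {h : Vec d → E}, Integrable h (volQ d) →
      Integrable (fun x => V p (conv (approxId d n) h x) ^ 2) (volQ d) := fun n h hh =>
    ((conv_periodic (isKernel_approxId n).test.2 h).comp fun y => V p y ^ 2).integrable
      (hVc.comp (conv_continuous (isKernel_approxId n).test hh))
  have h1 : ∀ n, ∫ x, V p (conv (approxId d n) f' x) ^ 2 ∂(volQ d) ≤ A := fun n =>
    (integrable_and_integral_le_of_tendsto (fun k => iK n (hf k))
      (fun k => ae_of_all _ fun x => V_sq_nonneg _ _)
      (ae_of_all _ fun x => (hVc.tendsto _).comp (hc n x)) fun k =>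
        ((isKernel_approxId n).integral_map_conv_le (convexOn_V_sq hp) hVc (hf k) (hV k)).trans
          (hA k)).2
  obtain ⟨ns, -, hns⟩ := exists_subseq_conv_tendsto_ae hf'
  refine integrable_and_integral_le_of_tendsto (fun k => iK (ns k) hf')
    (fun k => ae_of_all _ fun x => V_sq_nonneg _ _) ?_ fun k => h1 _
  filter_upwards [hns] with x hx
  exact (hVc.tendsto _).comp hx

theorem IsC1Periodic.isWeakDeriv {w : Vec d → Vec d} {D : Vec d → Mat d} (h : IsC1Periodic w D)
    (i j : Fin d) : IsWeakDeriv j (fun x => w x i) (fun x => D x (i, j)) := by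
  have hder : ∀ x, HasFDerivAt (fun x => w x i)
      ((EuclideanSpace.proj (𝕜 := ℝ) i).comp (act d (D x))) x := fun x =>
    (EuclideanSpace.proj (𝕜 := ℝ) i).hasFDerivAt.comp x (h.hasFDerivAt x)
  have hC : ContDiff ℝ 1 fun x => w x i := by
    refine contDiff_one_iff_fderiv.2 ⟨fun x => (hder x).differentiableAt, ?_⟩
    rw [show fderiv ℝ (fun x => w x i) = fun x => (EuclideanSpace.proj (𝕜 := ℝ) i).comp
      (act d (D x)) from funext fun x => (hder x).fderiv]
    exact continuous_const.clm_comp ((act d).continuous.comp h.continuous_grad)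
  have key := isWeakDeriv_of_contDiff hC (h.periodic.comp fun y => y i) j
  have e : partialD j (fun x => w x i) = fun x => D x (i, j) := funext fun x => by
    rw [partialD, (hder x).fderiv]
    exact act_single _ _ _
  rwa [e] at key

/-- Weak gradients are preserved by convergence of all mollifications. -/
theorem isWeakDeriv_of_tendsto_conv (hp : 2 ≤ p) {u : ℕ → Vec d → Vec d} {g : ℕ → Vec d → Mat d}
    {u' : Vec d → Vec d} {g' : Vec d → Mat d} {A : ℝ}
    (hu : ∀ k, IsSobolev (ENNReal.ofReal p) (u k) (g k)) (hu' : Integrable u' (volQ d))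
    (hg' : Integrable g' (volQ d)) (hA : ∀ k, ∫ x, V p (u k x) ^ 2 ∂(volQ d) ≤ A)
    (hA' : ∀ k, ∫ x, V p (g k x) ^ 2 ∂(volQ d) ≤ A)
    (hcu : ∀ n x, Tendsto (fun k => conv (approxId d n) (u k) x) atTop
      (𝓝 (conv (approxId d n) u' x)))
    (hcg : ∀ n x, Tendsto (fun k => conv (approxId d n) (g k) x) atTop
      (𝓝 (conv (approxId d n) g' x))) (i j : Fin d) :
    IsWeakDeriv j (fun x => u' x i) (fun x => g' x (i, j)) := fun φ hφ => by
  obtain ⟨Cφ, hCφ0, hCφ⟩ := hφ.exists_bound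
  have hpc := hφ.partialD_continuous j
  obtain ⟨Cp, hCp0, hCp⟩ := (hφ.2.partialD j).exists_bound hpc
  -- passing to the limit `k → ∞` in a mollified pairing
  have lim1 : ∀ {ι : Type} [Fintype ι] (a : ι) {f : ℕ → Vec d → EuclideanSpace ℝ ι}
      {f' : Vec d → EuclideanSpace ℝ ι} {ψ : Vec d → ℝ} {C : ℝ}, Continuous ψ →
      (∀ x, |ψ x| ≤ C) → 0 ≤ C → (∀ k, Integrable (f k) (volQ d)) →
      (∀ k, ∫ x, ‖f k x‖ ∂(volQ d) ≤ 1 + A) → ∀ n,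
      (∀ x, Tendsto (fun k => conv (approxId d n) (f k) x) atTop
        (𝓝 (conv (approxId d n) f' x))) →
      Tendsto (fun k => ∫ x, conv (approxId d n) (f k) x a * ψ x ∂(volQ d)) atTop
        (𝓝 (∫ x, conv (approxId d n) f' x a * ψ x ∂(volQ d))) := by
    intro ι _ a f f' ψ C hψ hC hC0 hf hfA n hlim
    obtain ⟨B, hB0, hB⟩ := (isKernel_approxId (d := d) n).test.exists_bound
    refine tendsto_integral_of_dominated_convergence (fun _ => B * (1 + A) * C) (fun k => ?_)
      (integrable_const _) (fun k => ae_of_all _ fun x => ?_) (ae_of_all _ fun x => ?_)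
    · have hcc := conv_continuous (isKernel_approxId n).test (hf k)
      exact (((EuclideanSpace.proj (𝕜 := ℝ) a).continuous.comp hcc).mul hψ).aestronglyMeasurable
    · rw [norm_mul]
      refine mul_le_mul ((PiLp.norm_apply_le _ a).trans ((norm_conv_le_mul hB (hf k) x).trans
        (mul_le_mul_of_nonneg_left (hfA k) hB0))) (hC x) (norm_nonneg _) ?_
      exact mul_nonneg hB0 ((integral_nonneg fun _ => norm_nonneg _).trans (hfA k))
    · exact (((EuclideanSpace.proj (𝕜 := ℝ) a).continuous.tendsto _).comp (hlim x)).mul_const _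
  -- passing to the limit `n → ∞`
  have lim2 : ∀ {ι : Type} [Fintype ι] (a : ι) {f' : Vec d → EuclideanSpace ℝ ι} {ψ : Vec d → ℝ}
      {C : ℝ}, Continuous ψ → (∀ x, |ψ x| ≤ C) → 0 ≤ C → Integrable f' (volQ d) →
      Tendsto (fun n => ∫ x, conv (approxId d n) f' x a * ψ x ∂(volQ d)) atTop
        (𝓝 (∫ x, f' x a * ψ x ∂(volQ d))) := by
    intro ι _ a f' ψ C hψ hC hC0 hf'
    rw [tendsto_iff_norm_sub_tendsto_zero]
    have h1 := (tendsto_integral_norm_conv_sub hf').mul_const C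
    rw [zero_mul] at h1
    refine squeeze_zero (fun n => norm_nonneg _) (fun n => ?_) h1
    have ic := conv_integrable (isKernel_approxId (d := d) n).test hf'
    rw [← integral_sub (integrable_mul_continuous (integrable_apply ic a) hψ)
      (integrable_mul_continuous (integrable_apply hf' a) hψ), ← integral_mul_const]
    refine norm_integral_le_of_norm_le ((ic.sub hf').norm.mul_const C) (ae_of_all _ fun x => ?_)
    rw [← sub_mul, norm_mul]
    refine mul_le_mul ?_ (hC x) (norm_nonneg _) (norm_nonneg _)
    exact PiLp.norm_apply_le (conv (approxId d n) f' x - f' x) a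
  have iu : ∀ k, ∫ x, ‖u k x‖ ∂(volQ d) ≤ 1 + A := fun k => integral_norm_le_one_add
    ((hu k).integrable hp) (integrable_V_sq_of_memLp hp (hu k).memLp) (hA k)
  have ig : ∀ k, ∫ x, ‖g k x‖ ∂(volQ d) ≤ 1 + A := fun k => integral_norm_le_one_add
    ((hu k).integrable_grad hp) (integrable_V_sq_of_memLp hp (hu k).memLp_grad) (hA' k)
  have h1 : ∀ n, ∫ x, conv (approxId d n) u' x i * partialD j φ x ∂(volQ d)
      = -∫ x, conv (approxId d n) g' x (i, j) * φ x ∂(volQ d) := fun n => by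
    have a1 := lim1 i hpc hCp hCp0 (fun k => (hu k).integrable hp) iu n (hcu n)
    have a2 := lim1 (i, j) hφ.continuous hCφ hCφ0 (fun k => (hu k).integrable_grad hp) ig n (hcg n)
    refine tendsto_nhds_unique a1 (a2.neg.congr fun k => ?_)
    exact (((hu k).conv hp (isKernel_approxId n).test).isWeakDeriv i j φ hφ).symm
  have a1 := lim2 i hpc hCp hCp0 hu'
  have a2 := lim2 (i, j) hφ.continuous hCφ hCφ0 hg'
  exact tendsto_nhds_unique a1 (a2.neg.congr fun n => (h1 n).symm)

theorem IsTest.exists_lipschitz {K : Vec d → ℝ} (hK : IsTest K) :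
    ∃ L : ℝ, 0 ≤ L ∧ ∀ x y, |K x - K y| ≤ L * ‖x - y‖ := by
  have hp : IsPeriodic (fderiv ℝ K) := fun i x => by
    rw [← fderiv_comp_add_right]
    congr 1
    funext z
    exact hK.2 i z
  obtain ⟨L, hL0, hL⟩ := hp.exists_bound (hK.1.continuous_fderiv (by simp))
  exact ⟨L, hL0, fun x y => convex_univ.norm_image_sub_le_of_norm_fderiv_le
    (fun z _ => hK.1.differentiable (by simp) z) (fun z _ => hL z) (mem_univ y) (mem_univ x)⟩

/-- Mollifications of a sequence that is bounded in `L¹` converge everywhere if they converge on a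
dense set. -/
theorem tendsto_conv_of_dense {E : Type*} [NormedAddCommGroup E] [NormedSpace ℝ E]
    {K : Vec d → ℝ} (hK : IsTest K) {f : ℕ → Vec d → E} {f' : Vec d → E} {A : ℝ}
    (hf : ∀ k, Integrable (f k) (volQ d)) (hf' : Integrable f' (volQ d))
    (hA : ∀ k, ∫ x, ‖f k x‖ ∂(volQ d) ≤ A)
    (h : ∀ m, Tendsto (fun k => conv K (f k) (TopologicalSpace.denseSeq (Vec d) m)) atTop
      (𝓝 (conv K f' (TopologicalSpace.denseSeq (Vec d) m)))) (x : Vec d) :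
    Tendsto (fun k => conv K (f k) x) atTop (𝓝 (conv K f' x)) := by
  obtain ⟨L, hL0, hL⟩ := hK.exists_lipschitz
  have hA0 : 0 ≤ A := (integral_nonneg fun _ => norm_nonneg _).trans (hA 0)
  have hlip : ∀ k, LipschitzWith (L * A).toNNReal (conv K (f k)) := fun k =>
    LipschitzWith.of_dist_le_mul fun x y => by
      rw [Real.coe_toNNReal _ (by positivity), dist_eq_norm, dist_eq_norm, conv, conv,
        ← integral_sub (hK.integrable_smul (hf k) x) (hK.integrable_smul (hf k) y)]
      calc _ ≤ ∫ z, L * ‖x - y‖ * ‖f k z‖ ∂(volQ d) := by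
            refine norm_integral_le_of_norm_le ((hf k).norm.const_mul _) (ae_of_all _ fun z => ?_)
            rw [← sub_smul, norm_smul]
            refine mul_le_mul_of_nonneg_right ?_ (norm_nonneg _)
            have := hL (x - z) (y - z)
            rwa [sub_sub_sub_cancel_right] at this
        _ = L * ‖x - y‖ * ∫ z, ‖f k z‖ ∂(volQ d) := integral_const_mul _ _
        _ ≤ L * ‖x - y‖ * A := mul_le_mul_of_nonneg_left (hA k) (by positivity)
        _ = _ := by ring
  have heq : Equicontinuous fun k => conv K (f k) :=
    (LipschitzWith.uniformEquicontinuous _ _ hlip).equicontinuous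
  have hcl := heq.isClosed_setOfPred_tendsto (l := atTop) (conv_continuous hK hf')
  have hsub : range (TopologicalSpace.denseSeq (Vec d))
      ⊆ {x | Tendsto (fun k => conv K (f k) x) atTop (𝓝 (conv K f' x))} := by
    rintro _ ⟨m, rfl⟩; exact h m
  exact hcl.closure_subset_iff.2 hsub (TopologicalSpace.denseRange_denseSeq (Vec d) x)

end SpaceCompactness

/-! ### The sequence of gradients and the centre of mass -/

section Sequence

variable {d : ℕ} {p T A : ℝ}

/-- A map with zero average and energy at most `A`, together with its gradient. -/
structure IsEnergySlice (p A : ℝ) (u : Vec d → Vec d) (g : Vec d → Mat d) : Prop where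
  sobolev : IsSobolev (ENNReal.ofReal p) u g
  zero_mean : ∫ x, u x ∂(volQ d) = 0
  energy : ∫ x, V p (u x) ^ 2 ∂(volQ d) ≤ A
  energy_grad : ∫ x, V p (g x) ^ 2 ∂(volQ d) ≤ A

instance finiteVolT (T : ℝ) : IsFiniteMeasure (volT T) := ⟨by
  rw [volT, Measure.restrict_apply_univ]; exact measure_Ioo_lt_top⟩

instance finiteVolQT (d : ℕ) (T : ℝ) : IsFiniteMeasure (volQT d T) := by
  unfold volQT; infer_instance

theorem integral_V_sq_le_of_eLpNorm_le {E : Type*} [NormedAddCommGroup E] (hp : 2 ≤ p)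
    {f : Vec d → E} (hf : MemLp f (ENNReal.ofReal p) (volQ d)) {M : ℝ≥0}
    (hM : eLpNorm f (ENNReal.ofReal p) (volQ d) ≤ M) :
    ∫ x, V p (f x) ^ 2 ∂(volQ d) ≤ 2 * (1 + (M : ℝ) ^ p) := by
  have hp0 : 0 < p := by linarith
  have hpn : ENNReal.ofReal p ≠ 0 := by simp [hp0]
  have h1 := hf.eLpNorm_eq_integral_rpow_norm hpn ENNReal.ofReal_ne_top
  rw [h1, ENNReal.toReal_ofReal hp0.le, ENNReal.ofReal_le_iff_le_toReal (by simp)] at hM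
  have hI : 0 ≤ ∫ x, ‖f x‖ ^ p ∂(volQ d) := integral_nonneg fun _ => by positivity
  have h2 : ∫ x, ‖f x‖ ^ p ∂(volQ d) ≤ (M : ℝ) ^ p := by
    have := Real.rpow_le_rpow (by positivity) hM hp0.le
    rwa [← Real.rpow_mul hI, inv_mul_cancel₀ hp0.ne', Real.rpow_one, ENNReal.coe_toReal] at this
  have h3 := hf.integrable_norm_rpow hpn ENNReal.ofReal_ne_top
  rw [ENNReal.toReal_ofReal hp0.le] at h3
  calc ∫ x, V p (f x) ^ 2 ∂(volQ d) ≤ ∫ x, 2 * (1 + ‖f x‖ ^ p) ∂(volQ d) :=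
        integral_mono (integrable_V_sq_of_memLp hp hf) (((integrable_const _).add h3).const_mul 2)
          fun x => V_sq_le hp _
    _ = 2 * (1 + ∫ x, ‖f x‖ ^ p ∂(volQ d)) := by
        rw [integral_const_mul, integral_add (integrable_const _) h3]; simp
    _ ≤ _ := by linarith

theorem IsBddGradientSeq.exists_energy_bound {y : ℕ → ℝ → Vec d → Vec d}
    {F : ℕ → ℝ → Vec d → Mat d} (h : IsBddGradientSeq p T y F) (hp : 2 ≤ p) :
    ∃ A : ℝ, 0 ≤ A ∧ ∀ᵐ t ∂(volT T), ∀ k, IsEnergySlice p A (y k t) (F k t) := by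
  obtain ⟨M, hM⟩ := h.bound_W1p
  refine ⟨2 * (1 + (M : ℝ) ^ p), by positivity, ae_all_iff.2 fun k => ?_⟩
  filter_upwards [h.sobolev k, h.zero_mean k, hM k] with t h1 h2 h3
  exact ⟨h1, h2, integral_V_sq_le_of_eLpNorm_le hp h1.memLp (le_self_add.trans h3),
    integral_V_sq_le_of_eLpNorm_le hp h1.memLp_grad (le_add_self.trans h3)⟩

theorem integrable_uncurry {E : Type*} [NormedAddCommGroup E] {f : ℝ → Vec d → E} {B : ℝ}
    (hf : AEStronglyMeasurable (Function.uncurry f) (volQT d T))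
    (h : ∀ᵐ t ∂(volT T), Integrable (f t) (volQ d) ∧ ∫ x, ‖f t x‖ ∂(volQ d) ≤ B) :
    Integrable (Function.uncurry f) (volQT d T) := by
  rw [volQT, integrable_prod_iff hf]
  refine ⟨h.mono fun t ht => ht.1, Integrable.of_bound hf.norm.integral_prod_right' B ?_⟩
  filter_upwards [h] with t ht
  rw [Real.norm_of_nonneg (integral_nonneg fun _ => norm_nonneg _)]
  exact ht.2

theorem IsEnergySlice.integrable_V_sq_grad {u : Vec d → Vec d} {g : Vec d → Mat d}
    (h : IsEnergySlice p A u g) (hp : 2 ≤ p) : Integrable (fun x => V p (g x) ^ 2) (volQ d) :=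
  integrable_V_sq_of_memLp hp h.sobolev.memLp_grad

theorem IsEnergySlice.integrable_V_sq {u : Vec d → Vec d} {g : Vec d → Mat d}
    (h : IsEnergySlice p A u g) (hp : 2 ≤ p) : Integrable (fun x => V p (u x) ^ 2) (volQ d) :=
  integrable_V_sq_of_memLp hp h.sobolev.memLp

theorem IsEnergySlice.integral_norm_le {u : Vec d → Vec d} {g : Vec d → Mat d}
    (h : IsEnergySlice p A u g) (hp : 2 ≤ p) : ∫ x, ‖u x‖ ∂(volQ d) ≤ 1 + A :=
  integral_norm_le_one_add (h.sobolev.integrable hp) (h.integrable_V_sq hp) h.energy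

theorem IsEnergySlice.integral_norm_grad_le {u : Vec d → Vec d} {g : Vec d → Mat d}
    (h : IsEnergySlice p A u g) (hp : 2 ≤ p) : ∫ x, ‖g x‖ ∂(volQ d) ≤ 1 + A :=
  integral_norm_le_one_add (h.sobolev.integrable_grad hp) (h.integrable_V_sq_grad hp) h.energy_grad

/-- Continuous functions of at most linear growth belong to `C_p`. -/
theorem isCq_of_abs_le (hp : 2 ≤ p) {g : Mat d → ℝ} (hg : Continuous g) {C : ℝ}
    (h : ∀ ξ, |g ξ| ≤ C * (1 + ‖ξ‖)) : IsCq p g := by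
  refine ⟨hg, ?_⟩
  have hC0 : 0 ≤ C := by
    have := (abs_nonneg _).trans (h 0)
    simpa using this
  have hn : Tendsto (fun ξ : Mat d => ‖ξ‖) (cocompact (Mat d)) atTop := tendsto_norm_cocompact_atTop
  have h1 : Tendsto (fun ξ : Mat d => 2 * C * ‖ξ‖⁻¹) (cocompact (Mat d)) (𝓝 (2 * C * 0)) :=
    (tendsto_inv_atTop_zero.comp hn).const_mul _
  rw [mul_zero] at h1
  refine squeeze_zero_norm' ?_ h1
  filter_upwards [hn.eventually_ge_atTop 1] with ξ hξ
  have h0 : 0 < ‖ξ‖ := by linarith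
  have h2 : ‖ξ‖ ^ 2 ≤ ‖ξ‖ ^ p := by
    calc ‖ξ‖ ^ 2 = ‖ξ‖ ^ (2 : ℝ) := by norm_cast
      _ ≤ _ := Real.rpow_le_rpow_of_exponent_le hξ hp
  rw [norm_div, Real.norm_eq_abs, Real.norm_of_nonneg (by positivity)]
  calc |g ξ| / ‖ξ‖ ^ p ≤ C * (1 + ‖ξ‖) / ‖ξ‖ ^ 2 := by
        gcongr
        exact h ξ
    _ ≤ C * (‖ξ‖ + ‖ξ‖) / ‖ξ‖ ^ 2 := by gcongr
    _ = _ := by field_simp; ring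

/-- The centre of mass of a family of measures. -/
def barycentre (ν : ℝ → Vec d → Measure (Mat d)) (t : ℝ) (x : Vec d) : Mat d :=
  ∫ ξ, ξ ∂(ν t x)

variable {y : ℕ → ℝ → Vec d → Vec d} {F : ℕ → ℝ → Vec d → Mat d}
  {ν : ℝ → Vec d → Measure (Mat d)}

theorem isCq_apply (hp : 2 ≤ p) (ij : Fin d × Fin d) : IsCq p fun ξ : Mat d => ξ ij :=
  isCq_of_abs_le (C := 1) hp (EuclideanSpace.proj (𝕜 := ℝ) ij).continuous fun ξ => by
    have := PiLp.norm_apply_le ξ ij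
    rw [Real.norm_eq_abs] at this
    linarith

theorem Generates.barycentre_apply (h : Generates p T F ν) (hp : 2 ≤ p) :
    ∀ᵐ z ∂(volQT d T), ∀ ij, barycentre ν z.1 z.2 ij = ∫ ξ, ξ ij ∂(ν z.1 z.2) := by
  filter_upwards [ae_all_iff.2 fun ij => (h _ (isCq_apply hp ij)).1] with z hz ij
  exact integral_apply (integrable_piLp_iff.2 hz) ij

theorem Generates.integrable_barycentre (h : Generates p T F ν) (hp : 2 ≤ p) :
    Integrable (Function.uncurry (barycentre ν)) (volQT d T) := by
  refine integrable_piLp_iff.2 fun ij => (h _ (isCq_apply hp ij)).2.1.congr ?_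
  filter_upwards [h.barycentre_apply hp] with z hz
  exact (hz ij).symm

/-- Smooth periodic functions of zero average are elements of `H¹₀`. -/
theorem IsTest.exists_H10 {ψ : Vec d → ℝ} (hψ : IsTest ψ) (h0 : ∫ x, ψ x ∂(volQ d) = 0) :
    ∃ Ψ : H10 d, (fun x => Ψ.1.fst x) =ᵐ[volQ d] ψ := by
  have m1 : MemLp ψ 2 (volQ d) := (memLp_top_of_continuous hψ.continuous).mono_exponent le_top
  set g : Vec d → Vec d := fun x => WithLp.toLp 2 fun j => partialD j ψ x with hg
  have m2 : MemLp g 2 (volQ d) := memLp_piLp_iff.2 fun j =>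
    (memLp_top_of_continuous (hψ.partialD_continuous j)).mono_exponent le_top
  have e1 := m1.coeFn_toLp
  have e2 := m2.coeFn_toLp
  refine ⟨⟨WithLp.toLp 2 (m1.toLp ψ, m2.toLp g), ?_, fun j φ hφ => ?_⟩, e1⟩
  · exact (integral_congr_ae e1).trans h0
  · have := isWeakDeriv_of_isTest hψ j φ hφ
    have a1 : ∫ x, (m1.toLp ψ) x * partialD j φ x ∂(volQ d)
        = ∫ x, ψ x * partialD j φ x ∂(volQ d) := by
      refine integral_congr_ae ?_
      filter_upwards [e1] with x hx
      rw [hx]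
    have a2 : ∫ x, (m2.toLp g) x j * φ x ∂(volQ d) = ∫ x, partialD j ψ x * φ x ∂(volQ d) := by
      refine integral_congr_ae ?_
      filter_upwards [e2] with x hx
      rw [hx]
    exact a1.trans (this.trans (by rw [← a2]; rfl))

/-- The pairing with a smooth function of a function of zero average has a bounded time derivative,
if the function has one in `H⁻¹`. -/
theorem IsTest.hasBddTimeDeriv {ψ : Vec d → ℝ} (hψ : IsTest ψ) (M : ℝ) :
    ∃ L : ℝ, 0 ≤ L ∧ ∀ (f : ℝ → Vec d → ℝ) (h : ℝ → HMinusOne d), IsTimeDeriv T M f h →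
      (∀ᵐ t ∂(volT T), Integrable (f t) (volQ d) ∧ ∫ x, f t x ∂(volQ d) = 0) →
      HasBddTimeDeriv T L fun t => ∫ x, f t x * ψ x ∂(volQ d) := by
  set c := ∫ x, ψ x ∂(volQ d) with hc
  have hi : Integrable ψ (volQ d) := hψ.2.integrable hψ.continuous
  -- subtracting its average from `ψ` does not change the pairing and makes it an element of `H¹₀`
  have hψ' : IsTest fun x => ψ x - c :=
    ⟨hψ.1.sub contDiff_const, fun i x => by simp only [hψ.2 i]⟩
  obtain ⟨Ψ, hΨ⟩ := hψ'.exists_H10 (by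
    rw [integral_sub hi (integrable_const _), ← hc]; simp)
  refine ⟨|M| * ‖Ψ‖, by positivity, fun f h hf hf0 => ⟨fun t => h t Ψ, ?_, ?_, ?_⟩⟩
  · exact (ContinuousLinearMap.apply ℝ ℝ Ψ).continuous.comp_aestronglyMeasurable hf.meas
  · filter_upwards [hf.bound] with t ht
    refine ((h t).le_opNorm Ψ).trans ?_
    exact mul_le_mul_of_nonneg_right (ht.trans (le_abs_self M)) (norm_nonneg _)
  · intro η h1 h2 h3
    rw [← hf.eq η h1 h2 h3 Ψ]
    refine integral_congr_ae ?_
    filter_upwards [hf0] with t ht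
    have e : ∫ x, f t x * Ψ.1.fst x ∂(volQ d) = ∫ x, f t x * ψ x ∂(volQ d) := by
      have e1 : ∫ x, f t x * Ψ.1.fst x ∂(volQ d) = ∫ x, (f t x * ψ x - f t x * c) ∂(volQ d) := by
        refine integral_congr_ae ?_
        filter_upwards [hΨ] with x hx
        rw [hx]; ring
      rw [e1, integral_sub (integrable_mul_continuous ht.1 hψ.continuous) (ht.1.mul_const c),
        integral_mul_const, ht.2, zero_mul, sub_zero]
    simp only [e]

theorem IsSobolev.integral_grad_eq_zero {u : Vec d → Vec d} {g : Vec d → Mat d} (hp : 2 ≤ p)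
    (h : IsSobolev (ENNReal.ofReal p) u g) (ij : Fin d × Fin d) :
    Integrable (fun x => g x ij) (volQ d) ∧ ∫ x, g x ij ∂(volQ d) = 0 :=
  ⟨integrable_apply (h.integrable_grad hp) ij, (h.weak_deriv ij.1 ij.2).integral_eq_zero⟩

/-- For almost every time the gradients converge weakly on the time slice. -/
theorem ae_tendsto_integral_mul (hp : 2 ≤ p) (hF : IsBddGradientSeq p T y F)
    (hν : Generates p T F ν) {ψ : Vec d → ℝ} (hψ : IsTest ψ) (ij : Fin d × Fin d) :
    ∀ᵐ t ∂(volT T), Tendsto (fun k => ∫ x, F k t x ij * ψ x ∂(volQ d)) atTop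
      (𝓝 (∫ x, barycentre ν t x ij * ψ x ∂(volQ d))) := by
  obtain ⟨A, hA0, hA⟩ := hF.exists_energy_bound hp
  obtain ⟨M, hM⟩ := hF.bound_dt
  obtain ⟨L, hL0, hL⟩ := hψ.hasBddTimeDeriv (T := T) M
  obtain ⟨C, hC0, hC⟩ := hψ.exists_bound
  have iF : ∀ k, Integrable (Function.uncurry (F k)) (volQT d T) := fun k =>
    integrable_uncurry (B := 1 + A) (hF.meas_grad k) <| hA.mono fun t ht =>
      ⟨(ht k).sobolev.integrable_grad hp, (ht k).integral_norm_grad_le hp⟩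
  have iB := hν.integrable_barycentre hp
  have hψm : AEStronglyMeasurable (fun z : ℝ × Vec d => ψ z.2) (volQT d T) :=
    (hψ.continuous.comp continuous_snd).aestronglyMeasurable
  have iψ : ∀ {f : ℝ → Vec d → Mat d}, Integrable (Function.uncurry f) (volQT d T) →
      Integrable (fun z : ℝ × Vec d => f z.1 z.2 ij * ψ z.2) (volQT d T) := fun hf =>
    (integrable_apply hf ij).mul_bdd (c := C) hψm (ae_of_all _ fun z => hC _)
  refine tendsto_ae_of_hasBddTimeDeriv hL0 (fun k => (iψ (iF k)).integral_prod_left)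
    (iψ iB).integral_prod_left (fun k => ?_) fun b hb hbc => ?_
  · obtain ⟨h, hh⟩ := hM k ij.1 ij.2
    exact hL _ h hh (hA.mono fun t ht => (ht k).sobolev.integral_grad_eq_zero hp ij)
  · obtain ⟨Cb, hCb⟩ := hbc.exists_bound_of_continuous hb
    have hbm : MemLp (fun z : ℝ × Vec d => b z.1 * ψ z.2) ∞ (volQT d T) := by
      refine memLp_top_of_bound
        ((hb.comp continuous_fst).mul (hψ.continuous.comp continuous_snd)).aestronglyMeasurable
        (Cb * C) (ae_of_all _ fun z => ?_)
      rw [norm_mul]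
      exact mul_le_mul (hCb _) (hC _) (norm_nonneg _) ((norm_nonneg _).trans (hCb z.1))
    have key := (hν _ (isCq_apply hp ij)).2.2 _ hbm
    have e : ∀ {f : ℝ → Vec d → Mat d}, Integrable (Function.uncurry f) (volQT d T) →
        ∫ z, f z.1 z.2 ij * (b z.1 * ψ z.2) ∂(volQT d T)
          = ∫ t, b t * ∫ x, f t x ij * ψ x ∂(volQ d) ∂(volT T) := fun {f} hf => by
      have hi : Integrable (fun z : ℝ × Vec d => f z.1 z.2 ij * (b z.1 * ψ z.2)) (volQT d T) :=
        (integrable_apply hf ij).mul_bdd (c := Cb * C) hbm.1 (ae_of_all _ fun z => by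
          rw [norm_mul]
          exact mul_le_mul (hCb _) (hC _) (norm_nonneg _) ((norm_nonneg _).trans (hCb z.1)))
      rw [volQT, integral_prod _ hi]
      refine integral_congr_ae (ae_of_all _ fun t => ?_)
      simp only
      rw [← integral_const_mul]
      refine integral_congr_ae (ae_of_all _ fun x => ?_)
      simp only
      ring
    have e' : ∫ z, (∫ ξ, ξ ij ∂(ν z.1 z.2)) * (b z.1 * ψ z.2) ∂(volQT d T)
        = ∫ z, barycentre ν z.1 z.2 ij * (b z.1 * ψ z.2) ∂(volQT d T) := by
      refine integral_congr_ae ?_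
      filter_upwards [hν.barycentre_apply hp] with z hz
      rw [hz ij]
    rw [e', e iB] at key
    exact key.congr fun k => e (iF k)

theorem ae_integrable_barycentre (hp : 2 ≤ p) (hν : Generates p T F ν) :
    ∀ᵐ t ∂(volT T), Integrable (barycentre ν t) (volQ d) := by
  have := hν.integrable_barycentre hp
  rw [volQT] at this
  exact this.prod_right_ae

/-- For almost every time all mollifications of the gradients converge. -/
theorem ae_tendsto_conv (hp : 2 ≤ p) (hF : IsBddGradientSeq p T y F) (hν : Generates p T F ν) :
    ∀ᵐ t ∂(volT T), ∀ n x, Tendsto (fun k => conv (approxId d n) (F k t) x) atTop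
      (𝓝 (conv (approxId d n) (barycentre ν t) x)) := by
  obtain ⟨A, hA0, hA⟩ := hF.exists_energy_bound hp
  have h1 : ∀ᵐ t ∂(volT T), ∀ (n m : ℕ) (ij : Fin d × Fin d),
      Tendsto (fun k => ∫ x, F k t x ij *
          approxId d n (TopologicalSpace.denseSeq (Vec d) m - x) ∂(volQ d)) atTop
        (𝓝 (∫ x, barycentre ν t x ij *
          approxId d n (TopologicalSpace.denseSeq (Vec d) m - x) ∂(volQ d))) :=
    ae_all_iff.2 fun n => ae_all_iff.2 fun m => ae_all_iff.2 fun ij =>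
      ae_tendsto_integral_mul hp hF hν ((isKernel_approxId n).test.comp_const_sub _) ij
  filter_upwards [hA, h1, ae_integrable_barycentre hp hν] with t h2 h3 h4 n x
  have hK := (isKernel_approxId (d := d) n).test
  refine tendsto_conv_of_dense hK (fun k => (h2 k).sobolev.integrable_grad hp) h4
    (fun k => (h2 k).integral_norm_grad_le hp) (fun m => ?_) x
  set x₀ := TopologicalSpace.denseSeq (Vec d) m
  have hpi : Tendsto (fun k => WithLp.ofLp (conv (approxId d n) (F k t) x₀)) atTop
      (𝓝 (WithLp.ofLp (conv (approxId d n) (barycentre ν t) x₀))) := by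
    refine tendsto_pi_nhds.2 fun ij => ?_
    have h5 := h3 n m ij
    have e : ∀ {f : Vec d → Mat d}, Integrable f (volQ d) → conv (approxId d n) f x₀ ij
        = ∫ x, f x ij * approxId d n (x₀ - x) ∂(volQ d) := fun hf => by
      rw [conv_const_apply hK hf]
      simp only [mul_comm]
    rw [e h4]
    exact h5.congr fun k => (e ((h2 k).sobolev.integrable_grad hp)).symm
  exact ((PiLp.continuous_toLp 2 _).tendsto _).comp hpi

theorem integral_norm_le_sqrt {f : Vec d → Vec d} (hf : Integrable f (volQ d))
    (hV : Integrable (fun x => V p (f x) ^ 2) (volQ d)) :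
    ∫ x, ‖f x‖ ∂(volQ d) ≤ Real.sqrt (∫ x, V p (f x) ^ 2 ∂(volQ d)) := by
  refine Real.le_sqrt_of_sq_le ?_
  have i2 : Integrable (fun x => ‖f x‖ ^ 2) (volQ d) :=
    hV.mono' (hf.1.norm.pow 2) (ae_of_all _ fun x => by
      rw [Real.norm_of_nonneg (by positivity)]; exact norm_sq_le_V_sq p _)
  set a := ∫ x, ‖f x‖ ∂(volQ d) with ha
  have h1 : 0 ≤ ∫ x, (‖f x‖ - a) ^ 2 ∂(volQ d) := integral_nonneg fun _ => sq_nonneg _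
  have e : ∀ x, (‖f x‖ - a) ^ 2 = ‖f x‖ ^ 2 - 2 * a * ‖f x‖ + a ^ 2 := fun x => by ring
  have i3 : Integrable (fun x => ‖f x‖ ^ 2 - 2 * a * ‖f x‖) (volQ d) :=
    i2.sub (hf.norm.const_mul _)
  simp only [e] at h1
  rw [integral_add i3 (integrable_const _), integral_sub i2 (hf.norm.const_mul _),
    integral_const_mul, ← ha] at h1
  have h2 : ∫ _x : Vec d, a ^ 2 ∂(volQ d) = a ^ 2 := by simp
  have h3 : ∫ x, ‖f x‖ ^ 2 ∂(volQ d) ≤ ∫ x, V p (f x) ^ 2 ∂(volQ d) :=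
    integral_mono i2 hV fun x => norm_sq_le_V_sq p _
  rw [h2] at h1
  nlinarith

/-- The generating maps converge strongly, for almost every time, to any potential of the centre of
mass. -/
theorem ae_tendsto_of_potential (hp : 2 ≤ p) (hF : IsBddGradientSeq p T y F)
    (hν : Generates p T F ν) {y' : ℝ → Vec d → Vec d} (hy : IsCentreOfMassPotential p T ν y') :
    ∀ᵐ t ∂(volT T), Tendsto (fun k => ∫ x, V p (y k t x - y' t x) ^ 2 ∂(volQ d)) atTop
      (𝓝 0) := by
  obtain ⟨A, -, hA⟩ := hF.exists_energy_bound hp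
  filter_upwards [hA, ae_tendsto_conv hp hF hν, hy.sobolev, hy.zero_mean] with t h1 h2 h3 h4
  have h3' : IsSobolev (ENNReal.ofReal p) (y' t) (barycentre ν t) := h3
  refine tendsto_integral_V_sq_sub (u' := fun _ => y' t) (g' := fun _ => barycentre ν t)
    (A := max A (∫ x, V p (barycentre ν t x) ^ 2 ∂(volQ d))) hp (fun k => (h1 k).sobolev)
    (fun _ => h3') (fun k => (h1 k).zero_mean) (fun _ => h4)
    (fun k => (h1 k).energy_grad.trans (le_max_left _ _)) (fun _ => le_max_right _ _)
    fun n x => ?_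
  have := (h2 n x).sub_const (conv (approxId d n) (barycentre ν t) x)
  rwa [sub_self] at this

/-- The generating maps have a strong limit in `L¹`. -/
theorem exists_strong_limit (hp : 2 ≤ p) (hF : IsBddGradientSeq p T y F)
    (hν : Generates p T F ν) :
    ∃ (y' : ℝ → Vec d → Vec d) (ks : ℕ → ℕ), Integrable (Function.uncurry y') (volQT d T) ∧
      StrictMono ks ∧ ∀ᵐ t ∂(volT T),
        Tendsto (fun k => ∫ x, ‖y (ks k) t x - y' t x‖ ∂(volQ d)) atTop (𝓝 0) := by
  obtain ⟨A, hA0, hA⟩ := hF.exists_energy_bound hp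
  have iy : ∀ k, Integrable (Function.uncurry (y k)) (volQT d T) := fun k =>
    integrable_uncurry (B := 1 + A) (hF.meas k) <| hA.mono fun t ht =>
      ⟨(ht k).sobolev.integrable hp, (ht k).integral_norm_le hp⟩
  -- on almost every time slice the sequence is Cauchy
  have hpair : ∀ᵐ t ∂(volT T), Tendsto (fun q : ℕ × ℕ => ∫ x, ‖y q.1 t x - y q.2 t x‖ ∂(volQ d))
      (atTop ×ˢ atTop) (𝓝 0) := by
    filter_upwards [hA, ae_tendsto_conv hp hF hν] with t h1 h2
    have h3 := tendsto_integral_V_sq_sub (l := atTop ×ˢ atTop) (u := fun q : ℕ × ℕ => y q.1 t)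
      (u' := fun q : ℕ × ℕ => y q.2 t) (g := fun q : ℕ × ℕ => F q.1 t)
      (g' := fun q : ℕ × ℕ => F q.2 t) (A := A) hp (fun q => (h1 q.1).sobolev)
      (fun q => (h1 q.2).sobolev) (fun q => (h1 q.1).zero_mean) (fun q => (h1 q.2).zero_mean)
      (fun q => (h1 q.1).energy_grad) (fun q => (h1 q.2).energy_grad) fun n x => by
        have := ((h2 n x).comp tendsto_fst).sub ((h2 n x).comp (tendsto_snd (f := atTop (α := ℕ))))
        rwa [sub_self] at this
    have h4 := h3.sqrt
    rw [Real.sqrt_zero] at h4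
    refine squeeze_zero (fun q => integral_nonneg fun _ => norm_nonneg _) (fun q => ?_) h4
    have i1 := (h1 q.1).sobolev
    have i2 := (h1 q.2).sobolev
    exact integral_norm_le_sqrt ((i1.integrable hp).sub (i2.integrable hp))
      (integrable_V_sq_of_memLp hp (i1.memLp.sub i2.memLp))
  have hint : Tendsto (fun q : ℕ × ℕ => ∫ z, ‖y q.1 z.1 z.2 - y q.2 z.1 z.2‖ ∂(volQT d T))
      (atTop ×ˢ atTop) (𝓝 0) := by
    have e : ∀ q : ℕ × ℕ, ∫ z, ‖y q.1 z.1 z.2 - y q.2 z.1 z.2‖ ∂(volQT d T)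
        = ∫ t, ∫ x, ‖y q.1 t x - y q.2 t x‖ ∂(volQ d) ∂(volT T) := fun q => by
      rw [volQT]
      exact integral_prod _ ((iy q.1).sub (iy q.2)).norm
    simp only [e]
    have e0 : (0 : ℝ) = ∫ _t, (0 : ℝ) ∂(volT T) := by simp
    rw [e0]
    refine tendsto_integral_filter_of_dominated_convergence (fun _ => (1 + A) + (1 + A))
      (Eventually.of_forall fun q => ?_) (Eventually.of_forall fun q => ?_) (integrable_const _)
      hpair
    · exact ((iy q.1).sub (iy q.2)).1.norm.integral_prod_right'
    · filter_upwards [hA] with t ht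
      rw [Real.norm_of_nonneg (integral_nonneg fun _ => norm_nonneg _)]
      have i1 := ((ht q.1).sobolev.integrable hp).norm
      have i2 := ((ht q.2).sobolev.integrable hp).norm
      calc ∫ x, ‖y q.1 t x - y q.2 t x‖ ∂(volQ d)
          ≤ ∫ x, (‖y q.1 t x‖ + ‖y q.2 t x‖) ∂(volQ d) :=
            integral_mono (((ht q.1).sobolev.integrable hp).sub
              ((ht q.2).sobolev.integrable hp)).norm (i1.add i2) fun x => norm_sub_le _ _
        _ ≤ _ := by
            rw [integral_add i1 i2]
            exact add_le_add ((ht q.1).integral_norm_le hp) ((ht q.2).integral_norm_le hp)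
  -- hence it converges in `L¹` of the cylinder, whose limit is jointly measurable
  set Y : ℕ → (ℝ × Vec d) →₁[volQT d T] Vec d := fun k => (iy k).toL1 _ with hY
  have hcauchy : CauchySeq Y := by
    rw [cauchySeq_iff_tendsto, tendsto_uniformity_iff_dist_tendsto_zero, ← prod_atTop_atTop_eq]
    refine hint.congr fun q => ?_
    rw [Prod.map_fst, Prod.map_snd, dist_eq_norm, hY]
    simp only
    rw [← Integrable.toL1_sub, L1.norm_of_fun_eq_integral_norm]
    rfl
  obtain ⟨Z, hZ⟩ := cauchySeq_tendsto_of_complete hcauchy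
  have iZ : Integrable (fun z => Z z) (volQT d T) := L1.integrable_coeFn Z
  have hlim : Tendsto (fun k => ∫ z, ‖y k z.1 z.2 - Z z‖ ∂(volQT d T)) atTop (𝓝 0) := by
    rw [tendsto_iff_norm_sub_tendsto_zero] at hZ
    refine hZ.congr fun k => ?_
    rw [L1.norm_eq_integral_norm]
    refine integral_congr_ae ?_
    filter_upwards [Lp.coeFn_sub (Y k) Z, (iy k).coeFn_toL1] with z h1 h2
    rw [h1, Pi.sub_apply, h2]
    rfl
  have islice : ∀ k, Integrable (fun t => ∫ x, ‖y k t x - Z (t, x)‖ ∂(volQ d)) (volT T) :=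
    fun k => ((iy k).sub iZ).norm.integral_prod_left
  have hlim' : Tendsto (fun k => ∫ t, ‖∫ x, ‖y k t x - Z (t, x)‖ ∂(volQ d) - 0‖ ∂(volT T)) atTop
      (𝓝 0) := by
    refine hlim.congr fun k => ?_
    refine (integral_prod (μ := volT T) (ν := volQ d) (fun z => ‖y k z.1 z.2 - Z z‖)
      ((iy k).sub iZ).norm).trans ?_
    refine integral_congr_ae (ae_of_all _ fun t => ?_)
    simp only [sub_zero]
    rw [Real.norm_of_nonneg (integral_nonneg fun _ => norm_nonneg _)]
  obtain ⟨ks, hks, hae⟩ := exists_subseq_tendsto_ae islice (integrable_const 0) hlim'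
  exact ⟨fun t x => Z (t, x), ks, iZ, hks, hae⟩

/-- The centre of mass is a spatial gradient. -/
theorem exists_potential (hp : 2 ≤ p) (hF : IsBddGradientSeq p T y F) (hν : Generates p T F ν) :
    ∃ y', IsCentreOfMassPotential p T ν y' := by
  obtain ⟨A, hA0, hA⟩ := hF.exists_energy_bound hp
  obtain ⟨y', ks, iy', hks, hlim⟩ := exists_strong_limit hp hF hν
  have isl : ∀ᵐ t ∂(volT T), Integrable (y' t) (volQ d) := by
    have := iy'
    rw [volQT] at this
    exact this.prod_right_ae
  have key : ∀ᵐ t ∂(volT T), IsSobolev (ENNReal.ofReal p) (y' t) (barycentre ν t) ∧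
      ∫ x, y' t x ∂(volQ d) = 0 := by
    filter_upwards [hA, hlim, isl, ae_integrable_barycentre hp hν, ae_tendsto_conv hp hF hν]
      with t h1 h2 h3 h4 h5
    have iu : ∀ k, Integrable (y (ks k) t) (volQ d) := fun k => (h1 _).sobolev.integrable hp
    have ig : ∀ k, Integrable (F (ks k) t) (volQ d) := fun k => (h1 _).sobolev.integrable_grad hp
    have hcg : ∀ n x, Tendsto (fun k => conv (approxId d n) (F (ks k) t) x) atTop
        (𝓝 (conv (approxId d n) (barycentre ν t) x)) := fun n x =>
      (h5 n x).comp hks.tendsto_atTop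
    have hcu : ∀ n x, Tendsto (fun k => conv (approxId d n) (y (ks k) t) x) atTop
        (𝓝 (conv (approxId d n) (y' t) x)) := fun n x => by
      obtain ⟨C, hC0, hC⟩ := (isKernel_approxId (d := d) n).test.exists_bound
      rw [tendsto_iff_norm_sub_tendsto_zero]
      have h6 := h2.const_mul C
      rw [mul_zero] at h6
      refine squeeze_zero (fun _ => norm_nonneg _) (fun k => ?_) h6
      rw [← conv_sub (isKernel_approxId n).test (iu k) h3]
      exact norm_conv_le_mul hC ((iu k).sub h3) x
    have e1 := integral_V_sq_le_of_tendsto_conv hp iu h3 (fun k => (h1 _).integrable_V_sq hp)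
      (fun k => (h1 _).energy) hcu
    have e2 := integral_V_sq_le_of_tendsto_conv hp ig h4 (fun k => (h1 _).integrable_V_sq_grad hp)
      (fun k => (h1 _).energy_grad) hcg
    refine ⟨⟨memLp_of_integrable_V_sq hp h3.1 e1.1, memLp_of_integrable_V_sq hp h4.1 e2.1,
      isWeakDeriv_of_tendsto_conv hp (fun k => (h1 (ks k)).sobolev) h3 h4
        (fun k => (h1 _).energy) (fun k => (h1 _).energy_grad) hcu hcg⟩, ?_⟩
    have h7 : Tendsto (fun k => ‖∫ x, y (ks k) t x ∂(volQ d) - ∫ x, y' t x ∂(volQ d)‖) atTop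
        (𝓝 0) := by
      refine squeeze_zero (fun _ => norm_nonneg _) (fun k => ?_) h2
      rw [← integral_sub (iu k) h3]
      exact norm_integral_le_integral_norm _
    have h8 := tendsto_nhds_unique h7 (tendsto_const_nhds.congr fun k => by
      rw [(h1 (ks k)).zero_mean, zero_sub, norm_neg])
    exact norm_eq_zero.1 h8.symm
  exact ⟨y', iy'.1, key.mono fun t ht => ht.1, key.mono fun t ht => ht.2⟩

end Sequence

/-! ### Passing to the limit with the Young measure -/

section YoungMeasure

variable {d : ℕ} {p T A : ℝ} {y : ℕ → ℝ → Vec d → Vec d} {F : ℕ → ℝ → Vec d → Mat d}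
  {ν : ℝ → Vec d → Measure (Mat d)}

/-- Continuous integrands `Φ(F, ξ)` that vanish for large `ξ`. -/
structure IsTruncated (L : ℝ) (Φ : Mat d → Mat d → ℝ) : Prop where
  continuous : Continuous fun q : Mat d × Mat d => Φ q.1 q.2
  eq_zero : ∀ F ξ, L ≤ ‖ξ‖ → Φ F ξ = 0

variable {L R : ℝ} {Φ : Mat d → Mat d → ℝ}

theorem IsTruncated.exists_bound (h : IsTruncated L Φ) (R : ℝ) :
    ∃ C : ℝ, 0 ≤ C ∧ ∀ F ξ, ‖F‖ ≤ R → |Φ F ξ| ≤ C := by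
  obtain ⟨C, hC⟩ := ((isCompact_closedBall (0 : Mat d) R).prod
    (isCompact_closedBall (0 : Mat d) L)).exists_bound_of_continuousOn h.continuous.continuousOn
  refine ⟨max C 0, le_max_right _ _, fun F ξ hF => ?_⟩
  rcases le_total L ‖ξ‖ with hξ | hξ
  · rw [h.eq_zero F ξ hξ, abs_zero]; exact le_max_right _ _
  · exact (hC (F, ξ) ⟨mem_closedBall_zero_iff.2 hF, mem_closedBall_zero_iff.2 hξ⟩).trans
      (le_max_left _ _)

theorem IsTruncated.isCq (h : IsTruncated L Φ) (hp : 2 ≤ p) (F : Mat d) : IsCq p (Φ F) := by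
  obtain ⟨C, hC0, hC⟩ := h.exists_bound ‖F‖
  refine isCq_of_abs_le (C := C) hp (h.continuous.comp
    (by fun_prop : Continuous fun ξ : Mat d => (F, ξ))) fun ξ => ?_
  exact (hC F ξ le_rfl).trans (le_mul_of_one_le_right hC0 (by linarith [norm_nonneg ξ]))

/-- Up to a uniform error, a truncated integrand depends on its first argument only through the cell
of a finite measurable partition. -/
theorem IsTruncated.exists_partition (h : IsTruncated L Φ) (R : ℝ) {ε : ℝ} (hε : 0 < ε) :
    ∃ (N : ℕ) (e : ℕ → Mat d) (ind : Mat d → ℕ), Measurable ind ∧ (∀ F, ind F < N) ∧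
      ∀ F ξ, ‖F‖ ≤ R → |Φ F ξ - Φ (e (ind F)) ξ| ≤ ε := by
  have huc := ((isCompact_closedBall (0 : Mat d) (R + 1)).prod
    (isCompact_closedBall (0 : Mat d) L)).uniformContinuousOn_of_continuous
    h.continuous.continuousOn
  obtain ⟨δ, hδ, hδ'⟩ := Metric.uniformContinuousOn_iff.1 huc ε hε
  set e := TopologicalSpace.denseSeq (Mat d)
  set r := min δ 1
  have hr : 0 < r := lt_min hδ one_pos
  obtain ⟨t, ht⟩ := (isCompact_closedBall (0 : Mat d) R).elim_finite_subcover
    (fun i => Metric.ball (e i) r) (fun i => Metric.isOpen_ball) fun F _ => by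
      obtain ⟨i, hi⟩ := (TopologicalSpace.denseRange_denseSeq (Mat d)).exists_dist_lt F hr
      exact mem_iUnion.2 ⟨i, hi⟩
  set N := t.sup id
  refine ⟨N + 1, e, SimpleFunc.nearestPtInd e N, (SimpleFunc.nearestPtInd e N).measurable,
    fun F => Nat.lt_succ_of_le (SimpleFunc.nearestPtInd_le e N F), fun F ξ hF => ?_⟩
  rcases le_total L ‖ξ‖ with hξ | hξ
  · rw [h.eq_zero _ ξ hξ, h.eq_zero _ ξ hξ, sub_zero, abs_zero]; exact hε.le
  obtain ⟨i, hit, hi⟩ := mem_iUnion₂.1 (ht (mem_closedBall_zero_iff.2 hF))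
  have h1 : edist (e (SimpleFunc.nearestPtInd e N F)) F ≤ edist (e i) F :=
    SimpleFunc.edist_nearestPt_le e F (Finset.le_sup (f := id) hit)
  have h2 : dist (e (SimpleFunc.nearestPtInd e N F)) F < r := by
    rw [edist_dist, edist_dist, ENNReal.ofReal_le_ofReal_iff dist_nonneg, dist_comm (e i)] at h1
    exact h1.trans_lt hi
  set F' := e (SimpleFunc.nearestPtInd e N F)
  have h3 : ‖F'‖ ≤ R + 1 := by
    calc ‖F'‖ = ‖F + (F' - F)‖ := by congr 1; abel
      _ ≤ ‖F‖ + ‖F' - F‖ := norm_add_le _ _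
      _ ≤ R + 1 := by
          rw [← dist_eq_norm]
          exact add_le_add hF (h2.le.trans (min_le_right _ _))
  have h4 := hδ' (F, ξ) ⟨mem_closedBall_zero_iff.2 (by linarith), mem_closedBall_zero_iff.2 hξ⟩
    (F', ξ) ⟨mem_closedBall_zero_iff.2 h3, mem_closedBall_zero_iff.2 hξ⟩ (by
      rw [Prod.dist_eq, dist_self, dist_comm]
      exact max_lt (h2.trans_le (min_le_left _ _)) hδ)
  rw [Real.dist_eq] at h4
  exact h4.le

theorem IsTruncated.integrable_fibre (h : IsTruncated L Φ) (F : Mat d) (μ : Measure (Mat d))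
    [IsFiniteMeasure μ] : Integrable (Φ F) μ := by
  obtain ⟨C, -, hC⟩ := h.exists_bound ‖F‖
  exact Integrable.of_bound ((h.continuous.comp (by fun_prop :
    Continuous fun ξ : Mat d => (F, ξ))).aestronglyMeasurable) C (ae_of_all _ fun ξ => hC F ξ le_rfl)

variable {B : ℝ × Vec d → Mat d}

/-- The value of a function on the cell of a finite partition, as a finite sum. -/
theorem sum_indicator_index {N i₀ : ℕ} (hi : i₀ < N) (f : ℕ → ℝ) :
    ∑ i ∈ Finset.range N, f i * (if i₀ = i then 1 else 0) = f i₀ := by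
  simp [hi]

/-- Integrability includes the measurability of the left-hand side in `(t,x)`, obtained here by
approximation with sums of products, since weak-`*` measurability only concerns integrands that do
not depend on `(t,x)`. -/
theorem integrable_integral_truncated (hp : 2 ≤ p) (hYM : IsYoungMeasure T ν)
    (hν : Generates p T F ν) (hΦ : IsTruncated L Φ) (hB : Measurable B) (hR : ∀ z, ‖B z‖ ≤ R) :
    Integrable (fun z : ℝ × Vec d => ∫ ξ, Φ (B z) ξ ∂(ν z.1 z.2)) (volQT d T) := by
  obtain ⟨C, hC0, hC⟩ := hΦ.exists_bound R
  have hex : ∀ n : ℕ, ∃ (N : ℕ) (e : ℕ → Mat d) (ind : Mat d → ℕ), Measurable ind ∧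
      (∀ F, ind F < N) ∧ ∀ F ξ, ‖F‖ ≤ R → |Φ F ξ - Φ (e (ind F)) ξ| ≤ 1 / ((n : ℝ) + 1) :=
    fun n => hΦ.exists_partition R (by positivity)
  choose N e ind hm hlt happ using hex
  refine Integrable.of_bound (aestronglyMeasurable_of_tendsto_ae atTop
    (f := fun n z => ∑ i ∈ Finset.range (N n), (∫ ξ, Φ (e n i) ξ ∂(ν z.1 z.2))
      * (if ind n (B z) = i then 1 else 0)) (fun n => ?_) ?_) C ?_
  · refine Finset.aestronglyMeasurable_fun_sum _ fun i _ => ?_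
    refine (hν _ (hΦ.isCq hp (e n i))).2.1.1.mul ?_
    exact (Measurable.ite ((hm n).comp hB (measurableSet_singleton i)) measurable_const
      measurable_const).aestronglyMeasurable
  · filter_upwards [hYM.prob] with z hz
    simp only [sum_indicator_index (hlt _ _)]
    rw [tendsto_iff_norm_sub_tendsto_zero]
    refine squeeze_zero (fun _ => norm_nonneg _) (fun n => ?_)
      (tendsto_one_div_add_atTop_nhds_zero_nat (𝕜 := ℝ))
    rw [← integral_sub (hΦ.integrable_fibre _ _) (hΦ.integrable_fibre _ _)]
    refine (norm_integral_le_of_norm_le_const (C := 1 / ((n : ℝ) + 1))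
      (ae_of_all _ fun ξ => ?_)).trans (by simp)
    rw [← norm_neg, neg_sub]
    exact happ n (B z) ξ (hR z)
  · filter_upwards [hYM.prob] with z hz
    exact (norm_integral_le_of_norm_le_const (ae_of_all _ fun ξ => hC (B z) ξ (hR z))).trans
      (by simp)

theorem integrable_truncated_comp (hΦ : IsTruncated L Φ) (hB : Measurable B)
    (hR : ∀ z, ‖B z‖ ≤ R) {f : ℝ → Vec d → Mat d}
    (hf : AEStronglyMeasurable (Function.uncurry f) (volQT d T)) :
    Integrable (fun z : ℝ × Vec d => Φ (B z) (f z.1 z.2)) (volQT d T) := by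
  obtain ⟨C, hC0, hC⟩ := hΦ.exists_bound R
  exact Integrable.of_bound (hΦ.continuous.comp_aestronglyMeasurable
    (hB.aestronglyMeasurable.prodMk hf)) C (ae_of_all _ fun z => hC _ _ (hR z))

/-- The Young measure gives the weak limits of truncated integrands that depend on a bounded
measurable field. -/
theorem tendsto_integral_truncated (hp : 2 ≤ p) (hYM : IsYoungMeasure T ν)
    (hν : Generates p T F ν)
    (hF : ∀ k, AEStronglyMeasurable (Function.uncurry (F k)) (volQT d T))
    (hΦ : IsTruncated L Φ) (hB : Measurable B)
    (hR : ∀ z, ‖B z‖ ≤ R) {S : Set (ℝ × Vec d)} (hS : MeasurableSet S) :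
    Tendsto (fun k => ∫ z in S, Φ (B z) (F k z.1 z.2) ∂(volQT d T)) atTop
      (𝓝 (∫ z in S, (∫ ξ, Φ (B z) ξ ∂(ν z.1 z.2)) ∂(volQT d T))) := by
  set m := (volQT d T).real S with hm
  rw [Metric.tendsto_nhds]
  intro r hr
  set ε := r / (3 * (m + 1)) with hε
  have hm0 : 0 ≤ m := measureReal_nonneg
  have hε0 : 0 < ε := by positivity
  obtain ⟨N, e, ind, hind, hlt, happ⟩ := hΦ.exists_partition R hε0
  have hbi : ∀ i, MemLp (S.indicator fun z => if ind (B z) = i then (1 : ℝ) else 0) ∞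
      (volQT d T) := fun i => by
    refine memLp_top_of_bound ((Measurable.ite (hind.comp hB (measurableSet_singleton i))
      measurable_const measurable_const).indicator hS).aestronglyMeasurable 1 (ae_of_all _ fun z => ?_)
    by_cases hz : z ∈ S
    · rw [indicator_of_mem hz]; split_ifs <;> simp
    · rw [indicator_of_notMem hz]; simp
  -- with the first argument frozen on each cell, the generating property applies
  have hsum : Tendsto (fun k => ∑ i ∈ Finset.range N, ∫ z, Φ (e i) (F k z.1 z.2)
      * S.indicator (fun z => if ind (B z) = i then (1 : ℝ) else 0) z ∂(volQT d T)) atTop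
      (𝓝 (∑ i ∈ Finset.range N, ∫ z, (∫ ξ, Φ (e i) ξ ∂(ν z.1 z.2))
      * S.indicator (fun z => if ind (B z) = i then (1 : ℝ) else 0) z ∂(volQT d T))) :=
    tendsto_finsetSum _ fun i _ => (hν _ (hΦ.isCq hp (e i))).2.2 _ (hbi i)
  -- the sums are integrals of the approximate integrand
  have hcollect : ∀ {f : ℕ → ℝ × Vec d → ℝ}, (∀ i, Integrable (f i) (volQT d T)) →
      IntegrableOn (fun z => f (ind (B z)) z) S (volQT d T) ∧
      ∑ i ∈ Finset.range N, ∫ z, f i z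
        * S.indicator (fun z => if ind (B z) = i then (1 : ℝ) else 0) z ∂(volQT d T)
      = ∫ z in S, f (ind (B z)) z ∂(volQT d T) := by
    intro f hf
    have hfi : ∀ i, Integrable (fun z => f i z
        * S.indicator (fun z => if ind (B z) = i then (1 : ℝ) else 0) z) (volQT d T) := fun i =>
      (hf i).mul_of_top_left (hbi i)
    have e1 : (fun z => ∑ i ∈ Finset.range N, f i z
        * S.indicator (fun z => if ind (B z) = i then (1 : ℝ) else 0) z)
        = S.indicator fun z => f (ind (B z)) z := by
      funext z
      by_cases hz : z ∈ S
      · simp only [indicator_of_mem hz]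
        exact sum_indicator_index (hlt _) fun i => f i z
      · simp only [indicator_of_notMem hz, mul_zero, Finset.sum_const_zero]
    have e2 := integrable_finsetSum (Finset.range N) fun i _ => hfi i
    rw [e1, integrable_indicator_iff hS] at e2
    refine ⟨e2, ?_⟩
    rw [← integral_finsetSum _ fun i _ => hfi i, e1, integral_indicator hS]
  have hclose : ∀ {a b : ℝ × Vec d → ℝ}, IntegrableOn a S (volQT d T) →
      IntegrableOn b S (volQT d T) → (∀ᵐ z ∂(volQT d T), |a z - b z| ≤ ε) →
      |∫ z in S, a z ∂(volQT d T) - ∫ z in S, b z ∂(volQT d T)| ≤ r / 3 := by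
    intro a b ha hb hab
    rw [← integral_sub ha hb, ← Real.norm_eq_abs]
    refine (norm_setIntegral_le_of_norm_le_const_ae' (C := ε) (measure_lt_top _ _)
      (hab.mono fun z hz _ => hz)).trans ?_
    rw [← hm, hε, div_mul_eq_mul_div, div_le_div_iff₀ (by positivity) (by norm_num)]
    nlinarith
  obtain ⟨i1, e1⟩ := hcollect (f := fun i z => ∫ ξ, Φ (e i) ξ ∂(ν z.1 z.2))
    fun i => (hν _ (hΦ.isCq hp (e i))).2.1
  have c1 := hclose (integrable_integral_truncated hp hYM hν hΦ hB hR).integrableOn i1 (by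
    filter_upwards [hYM.prob] with z hz
    rw [← integral_sub (hΦ.integrable_fibre _ _) (hΦ.integrable_fibre _ _), ← Real.norm_eq_abs]
    exact (norm_integral_le_of_norm_le_const (C := ε)
      (ae_of_all _ fun ξ => happ (B z) ξ (hR z))).trans (by simp))
  filter_upwards [(Metric.tendsto_nhds.1 hsum) (r / 3) (by positivity)] with k hk
  have ik : ∀ i, Integrable (fun z : ℝ × Vec d => Φ (e i) (F k z.1 z.2)) (volQT d T) := fun i =>
    integrable_truncated_comp (R := ‖e i‖) hΦ measurable_const (fun _ => le_rfl) (hF k)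
  obtain ⟨i2, e2⟩ := hcollect ik
  have c2 := hclose (integrable_truncated_comp hΦ hB hR (hF k)).integrableOn i2
    (ae_of_all _ fun z => happ (B z) _ (hR z))
  rw [e1, e2, Real.dist_eq] at hk
  rw [Real.dist_eq]
  rw [abs_le] at c1 c2
  rw [abs_lt] at hk ⊢
  constructor <;> linarith [c1.1, c1.2, c2.1, c2.2, hk.1, hk.2]

/-- The Young measure has finite `p`-th moments. -/
theorem integrable_moment (hp : 2 ≤ p) (hF : IsBddGradientSeq p T y F) (hYM : IsYoungMeasure T ν)
    (hν : Generates p T F ν) :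
    (∀ᵐ z ∂(volQT d T), Integrable (fun ξ => ‖ξ‖ ^ p) (ν z.1 z.2)) ∧
      Integrable (fun z : ℝ × Vec d => ∫ ξ, ‖ξ‖ ^ p ∂(ν z.1 z.2)) (volQT d T) := by
  obtain ⟨A, hA0, hA⟩ := hF.exists_energy_bound hp
  have hp0 : 0 < p := by linarith
  have hpc : Continuous fun ξ : Mat d => ‖ξ‖ ^ p := by
    exact continuous_norm.rpow_const fun _ => Or.inr hp0.le
  set g : ℕ → Mat d → ℝ := fun n ξ => min (‖ξ‖ ^ p) n with hg
  have hgc : ∀ n, Continuous (g n) := fun n => hpc.min continuous_const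
  have hg0 : ∀ n ξ, 0 ≤ g n ξ := fun n ξ => le_min (by positivity) (Nat.cast_nonneg n)
  have hgn : ∀ n ξ, g n ξ ≤ n := fun n ξ => min_le_right _ _
  have hgp : ∀ n ξ, g n ξ ≤ ‖ξ‖ ^ p := fun n ξ => min_le_left _ _
  have hCq : ∀ n, IsCq p (g n) := fun n => isCq_of_abs_le (C := n) hp (hgc n) fun ξ => by
    rw [abs_of_nonneg (hg0 n ξ)]
    exact (hgn n ξ).trans (le_mul_of_one_le_right (Nat.cast_nonneg n) (by linarith [norm_nonneg ξ]))
  set m : ℕ → ℝ × Vec d → ℝ := fun n z => ∫ ξ, g n ξ ∂(ν z.1 z.2) with hm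
  have im : ∀ n, Integrable (m n) (volQT d T) := fun n => (hν _ (hCq n)).2.1
  have hm0 : ∀ n z, 0 ≤ m n z := fun n z => integral_nonneg fun ξ => hg0 n ξ
  set K : ℝ := ∫ _t, A ∂(volT T) with hK
  -- `g n` is an admissible test function, so its integral passes to the limit in `k`
  have hbound : ∀ n, ∫ z, m n z ∂(volQT d T) ≤ K := fun n => by
    have h1 := (hν _ (hCq n)).2.2 (fun _ => 1) (memLp_top_const 1)
    simp only [mul_one] at h1
    refine le_of_tendsto h1 (Eventually.of_forall fun k => ?_)
    have ig : Integrable (fun z : ℝ × Vec d => g n (F k z.1 z.2)) (volQT d T) :=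
      Integrable.of_bound ((hgc n).comp_aestronglyMeasurable (hF.meas_grad k)) n
        (ae_of_all _ fun z => by rw [Real.norm_of_nonneg (hg0 n _)]; exact hgn n _)
    rw [volQT] at ig
    rw [volQT, integral_prod _ ig]
    refine integral_mono_ae ig.integral_prod_left (integrable_const A) ?_
    filter_upwards [hA, ig.prod_right_ae] with t ht hi
    exact (integral_mono hi ((ht k).integrable_V_sq_grad hp) fun x =>
      (hgp n _).trans (norm_rpow_le_V_sq p _)).trans (ht k).energy_grad
  -- monotone convergence in `n`, in the fibres and on the cylinder
  have hlim : ∀ ξ : Mat d, Tendsto (fun n => g n ξ) atTop (𝓝 (‖ξ‖ ^ p)) := fun ξ => by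
    refine tendsto_const_nhds.congr' ?_
    obtain ⟨n₀, hn₀⟩ := exists_nat_ge (‖ξ‖ ^ p)
    filter_upwards [eventually_ge_atTop n₀] with n hn
    exact (min_eq_left (hn₀.trans (Nat.cast_le.2 hn))).symm
  have hmono : ∀ ξ : Mat d, Monotone fun n => ENNReal.ofReal (g n ξ) := fun ξ a b hab =>
    ENNReal.ofReal_le_ofReal (min_le_min_left _ (Nat.cast_le.2 hab))
  have hfib : ∀ᵐ z ∂(volQT d T), ∀ n, ENNReal.ofReal (m n z)
      = ∫⁻ ξ, ENNReal.ofReal (g n ξ) ∂(ν z.1 z.2) := by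
    filter_upwards [hYM.prob] with z hz n
    exact ofReal_integral_eq_lintegral_ofReal (Integrable.of_bound (hgc n).aestronglyMeasurable n
      (ae_of_all _ fun ξ => by rw [Real.norm_of_nonneg (hg0 n _)]; exact hgn n _))
      (ae_of_all _ fun ξ => hg0 n ξ)
  have hmz : ∀ᵐ z ∂(volQT d T), Monotone fun n => ENNReal.ofReal (m n z) := by
    filter_upwards [hfib] with z hz a b hab
    simp only [hz]
    exact lintegral_mono fun ξ => hmono ξ hab
  have htz : ∀ z : ℝ × Vec d, Tendsto (fun n => ∫⁻ ξ, ENNReal.ofReal (g n ξ) ∂(ν z.1 z.2)) atTop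
      (𝓝 (∫⁻ ξ, ENNReal.ofReal (‖ξ‖ ^ p) ∂(ν z.1 z.2))) := fun z =>
    lintegral_tendsto_of_tendsto_of_monotone
      (fun n => (hgc n).measurable.ennreal_ofReal.aemeasurable)
      (ae_of_all _ fun ξ => hmono ξ)
      (ae_of_all _ fun ξ => (ENNReal.continuous_ofReal.tendsto _).comp (hlim ξ))
  have hglob := lintegral_tendsto_of_tendsto_of_monotone
    (F := fun z : ℝ × Vec d => ∫⁻ ξ, ENNReal.ofReal (‖ξ‖ ^ p) ∂(ν z.1 z.2))
    (fun n => (im n).1.aemeasurable.ennreal_ofReal) hmz (by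
      filter_upwards [hfib] with z hz
      simp only [hz]
      exact htz z)
  have hfin : ∫⁻ z, (∫⁻ ξ, ENNReal.ofReal (‖ξ‖ ^ p) ∂(ν z.1 z.2)) ∂(volQT d T)
      ≤ ENNReal.ofReal K := by
    refine le_of_tendsto hglob (Eventually.of_forall fun n => ?_)
    rw [← ofReal_integral_eq_lintegral_ofReal (im n) (ae_of_all _ (hm0 n))]
    exact ENNReal.ofReal_le_ofReal (hbound n)
  have hmeas : AEMeasurable (fun z : ℝ × Vec d => ∫⁻ ξ, ENNReal.ofReal (‖ξ‖ ^ p) ∂(ν z.1 z.2))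
      (volQT d T) := by
    refine aemeasurable_of_tendsto_metrizable_ae atTop
      (f := fun n z => ENNReal.ofReal (m n z)) (fun n => (im n).1.aemeasurable.ennreal_ofReal) ?_
    filter_upwards [hfib] with z hz
    simp only [hz]
    exact htz z
  have hlt := ae_lt_top' hmeas (hfin.trans_lt ENNReal.ofReal_lt_top).ne
  have hI : ∀ᵐ z ∂(volQT d T), Integrable (fun ξ => ‖ξ‖ ^ p) (ν z.1 z.2) := by
    filter_upwards [hlt] with z hz
    refine ⟨hpc.aestronglyMeasurable, ?_⟩
    rw [hasFiniteIntegral_iff_ofReal (ae_of_all _ fun ξ => by positivity)]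
    exact hz
  refine ⟨hI, (integrable_and_integral_le_of_tendsto im (fun n => ae_of_all _ (hm0 n)) ?_
    hbound).1⟩
  filter_upwards [hI] with z hz
  refine tendsto_integral_of_dominated_convergence (fun ξ => ‖ξ‖ ^ p)
    (fun n => (hgc n).aestronglyMeasurable) hz (fun n => ae_of_all _ fun ξ => ?_)
    (ae_of_all _ hlim)
  rw [Real.norm_of_nonneg (hg0 n ξ)]
  exact hgp n ξ

/-- The average of the cutoffs at the dyadic levels `1, 2, …, 2^(N-1)`. -/
def averagedCutoff (N : ℕ) (ξ : Mat d) : ℝ :=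
  (N : ℝ)⁻¹ * ∑ j ∈ Finset.range N, cutoff ((2 : ℝ) ^ j) ξ

theorem continuous_averagedCutoff (N : ℕ) : Continuous (averagedCutoff N : Mat d → ℝ) :=
  continuous_const.mul (continuous_finsetSum _ fun _ _ => continuous_cutoff _)

theorem abs_averagedCutoff_le_one (N : ℕ) (ξ : Mat d) : |averagedCutoff N ξ| ≤ 1 := by
  rw [averagedCutoff, abs_mul, abs_inv, Nat.abs_cast]
  refine inv_mul_le_one_of_le₀ ?_ (Nat.cast_nonneg N)
  refine (Finset.abs_sum_le_sum_abs _ _).trans ?_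
  exact (Finset.sum_le_card_nsmul _ _ 1 fun j _ => abs_cutoff_le_one _ ξ).trans (by simp)

theorem tendsto_averagedCutoff (ξ : Mat d) :
    Tendsto (fun N => averagedCutoff N ξ) atTop (𝓝 1) := by
  refine Tendsto.cesaro (tendsto_const_nhds.congr' ?_)
  have h := (tendsto_pow_atTop_atTop_of_one_lt (r := (2 : ℝ)) one_lt_two).eventually_ge_atTop ‖ξ‖
  filter_upwards [h] with j hj
  exact (cutoff_eq_one (by positivity) hj).symm

theorem isTruncated_mul_averagedCutoff (hΦ : Continuous fun q : Mat d × Mat d => Φ q.1 q.2)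
    (N : ℕ) : IsTruncated (2 * 2 ^ N) fun F ξ => Φ F ξ * averagedCutoff N ξ where
  continuous := hΦ.mul ((continuous_averagedCutoff N).comp continuous_snd)
  eq_zero F ξ h := by
    rw [averagedCutoff, Finset.sum_eq_zero fun j hj => cutoff_eq_zero (by positivity) ?_, mul_zero,
      mul_zero]
    refine le_trans ?_ h
    gcongr
    · norm_num
    · exact (Finset.mem_range.1 hj).le

/-- Integrands of growth `p` are integrable against the Young measure, and their integrals are the
limits of those of the truncated integrands. -/
theorem integrable_and_tendsto_truncated (hp : 2 ≤ p) (hF : IsBddGradientSeq p T y F)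
    (hYM : IsYoungMeasure T ν) (hν : Generates p T F ν)
    (hΦ : Continuous fun q : Mat d × Mat d => Φ q.1 q.2) {C : ℝ}
    (hC : ∀ F ξ, ‖F‖ ≤ R → |Φ F ξ| ≤ C * (1 + ‖ξ‖ ^ p)) (hB : Measurable B)
    (hR : ∀ z, ‖B z‖ ≤ R) :
    ∀ᵐ t ∂(volT T), (∀ᵐ x ∂(volQ d), Integrable (Φ (B (t, x))) (ν t x)) ∧
      Integrable (fun x => ∫ ξ, Φ (B (t, x)) ξ ∂(ν t x)) (volQ d) ∧
      Tendsto (fun j : ℕ => ∫ x, (∫ ξ, Φ (B (t, x)) ξ * averagedCutoff j ξ ∂(ν t x)) ∂(volQ d))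
        atTop (𝓝 (∫ x, (∫ ξ, Φ (B (t, x)) ξ ∂(ν t x)) ∂(volQ d))) := by
  obtain ⟨hI, hM⟩ := integrable_moment hp hF hYM hν
  set J : ℕ → ℝ × Vec d → ℝ := fun j z =>
    ∫ ξ, Φ (B z) ξ * averagedCutoff j ξ ∂(ν z.1 z.2) with hJ
  have iJ : ∀ j, Integrable (J j) (volQT d T) := fun j =>
    integrable_integral_truncated hp hYM hν (isTruncated_mul_averagedCutoff hΦ j) hB hR
  have hΦc : ∀ F, Continuous (Φ F) := fun F => hΦ.comp (by fun_prop : Continuous fun ξ => (F, ξ))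
  have hz : ∀ᵐ z ∂(volQT d T), Integrable (Φ (B z)) (ν z.1 z.2) ∧
      (∀ j, ‖J j z‖ ≤ C * (1 + ∫ ξ, ‖ξ‖ ^ p ∂(ν z.1 z.2))) ∧
      Tendsto (fun j => J j z) atTop (𝓝 (∫ ξ, Φ (B z) ξ ∂(ν z.1 z.2))) := by
    filter_upwards [hI, hYM.prob] with z h1 h2
    have iC : Integrable (fun ξ => C * (1 + ‖ξ‖ ^ p)) (ν z.1 z.2) :=
      ((integrable_const _).add h1).const_mul C
    have eC : ∫ ξ, C * (1 + ‖ξ‖ ^ p) ∂(ν z.1 z.2) = C * (1 + ∫ ξ, ‖ξ‖ ^ p ∂(ν z.1 z.2)) := by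
      rw [integral_const_mul, integral_add (integrable_const _) h1]; simp
    have hle : ∀ j : ℕ, ∀ ξ, ‖Φ (B z) ξ * averagedCutoff j ξ‖ ≤ C * (1 + ‖ξ‖ ^ p) :=
      fun j ξ => by
        rw [norm_mul]
        exact (mul_le_of_le_one_right (norm_nonneg _) (abs_averagedCutoff_le_one _ _)).trans
          (hC _ _ (hR z))
    refine ⟨iC.mono' (hΦc _).aestronglyMeasurable (ae_of_all _ fun ξ => hC _ _ (hR z)),
      fun j => ?_, ?_⟩
    · rw [← eC]
      exact norm_integral_le_of_norm_le iC (ae_of_all _ (hle j))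
    · refine tendsto_integral_of_dominated_convergence _ (fun j => ?_) iC
        (fun j => ae_of_all _ (hle j)) (ae_of_all _ fun ξ => ?_)
      · exact ((hΦc _).mul (continuous_averagedCutoff _)).aestronglyMeasurable
      · have := (tendsto_averagedCutoff ξ).const_mul (Φ (B z) ξ)
        rwa [mul_one] at this
  have h1 : ∀ᵐ t ∂(volT T), ∀ᵐ x ∂(volQ d), Integrable (Φ (B (t, x))) (ν t x) ∧
      (∀ j, ‖J j (t, x)‖ ≤ C * (1 + ∫ ξ, ‖ξ‖ ^ p ∂(ν t x))) ∧
      Tendsto (fun j => J j (t, x)) atTop (𝓝 (∫ ξ, Φ (B (t, x)) ξ ∂(ν t x))) :=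
    Measure.ae_ae_of_ae_prod hz
  have h2 : ∀ᵐ t ∂(volT T), Integrable (fun x => ∫ ξ, ‖ξ‖ ^ p ∂(ν t x)) (volQ d) := by
    rw [volQT] at hM
    exact hM.prod_right_ae
  have h3 : ∀ᵐ t ∂(volT T), ∀ j, Integrable (fun x => J j (t, x)) (volQ d) :=
    ae_all_iff.2 fun j => by
      have := iJ j
      rw [volQT] at this
      exact this.prod_right_ae
  filter_upwards [h1, h2, h3] with t a1 a2 a3
  have iD : Integrable (fun x => C * (1 + ∫ ξ, ‖ξ‖ ^ p ∂(ν t x))) (volQ d) :=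
    ((integrable_const _).add a2).const_mul C
  refine ⟨a1.mono fun x hx => hx.1, ?_, ?_⟩
  · refine iD.mono' (aestronglyMeasurable_of_tendsto_ae atTop (fun j => (a3 j).1)
      (a1.mono fun x hx => hx.2.2)) ?_
    filter_upwards [a1] with x hx
    exact le_of_tendsto hx.2.2.norm (Eventually.of_forall hx.2.1)
  · exact tendsto_integral_of_dominated_convergence _ (fun j => (a3 j).1) iD
      (fun j => a1.mono fun x hx => hx.2.1 j) (a1.mono fun x hx => hx.2.2)

end YoungMeasure

/-! ### The inequality for the Young measure -/

section Background

variable {d : ℕ} {p T : ℝ} {ybar : ℝ → Vec d → Vec d} {Fbar : ℝ → Vec d → Mat d}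

/-- The background gradient, extended from `[0,T]` to all times by its values at the end points. -/
def clampTime (T : ℝ) (Fbar : ℝ → Vec d → Mat d) (z : ℝ × Vec d) : Mat d :=
  Fbar (max 0 (min z.1 T)) z.2

theorem clampTime_of_mem {t : ℝ} (ht : t ∈ Ioo 0 T) (x : Vec d) :
    clampTime T Fbar (t, x) = Fbar t x := by
  rw [clampTime, min_eq_left ht.2.le, max_eq_right ht.1.le]

theorem max_min_mem_Icc (hT : 0 < T) (t : ℝ) : max 0 (min t T) ∈ Icc 0 T :=
  ⟨le_max_left _ _, max_le hT.le (min_le_right _ _)⟩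

theorem IsContinuousGradient.continuous_clampTime (h : IsContinuousGradient p T ybar Fbar)
    (hT : 0 < T) : Continuous (clampTime T Fbar) := by
  refine h.continuous.comp_continuous
    (by fun_prop : Continuous fun z : ℝ × Vec d => (max 0 (min z.1 T), z.2))
    fun z => ⟨max_min_mem_Icc hT z.1, mem_univ _⟩

/-- By periodicity and compactness the background is bounded and uniformly continuous in space,
uniformly in time. -/
theorem IsContinuousGradient.exists_isBackground (h : IsContinuousGradient p T ybar Fbar)
    (hT : 0 < T) :
    ∃ R : ℝ, 0 ≤ R ∧ ∀ δ : ℝ, 0 < δ → ∃ r : ℝ, 0 < r ∧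
      ∀ t, IsBackground R r δ fun x => clampTime T Fbar (t, x) := by
  have hK : IsCompact (Icc 0 T ×ˢ Metric.closedBall (0 : Vec d) (Real.sqrt d + 1)) :=
    isCompact_Icc.prod (isCompact_closedBall _ _)
  have hc := h.continuous.mono (prod_mono_right (subset_univ _) :
    Icc 0 T ×ˢ Metric.closedBall (0 : Vec d) (Real.sqrt d + 1) ⊆ Icc 0 T ×ˢ univ)
  have hper : ∀ t, IsPeriodic fun x => clampTime T Fbar (t, x) := fun t =>
    h.periodic _ (max_min_mem_Icc hT t)
  have hred : ∀ x : Vec d, ∃ v ∈ Submodule.span ℤ (Set.range (stdBasis d)),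
      ‖x + v‖ ≤ Real.sqrt d := fun x => by
    obtain ⟨v, hv, hx⟩ := exists_mem_fundamentalDomain x
    exact ⟨v, hv, norm_le_sqrt_of_abs_le fun i => by
      rw [abs_of_nonneg (hx i).1]; exact (hx i).2.le⟩
  obtain ⟨R, hR⟩ := hK.exists_bound_of_continuousOn hc
  have hR' : ∀ t x, ‖clampTime T Fbar (t, x)‖ ≤ R := fun t x => by
    obtain ⟨v, hv, hx⟩ := hred x
    have e := (hper t).lattice hv x
    rw [← e]
    exact hR (max 0 (min t T), x + v)
      ⟨max_min_mem_Icc hT t, mem_closedBall_zero_iff.2 (by linarith)⟩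
  refine ⟨R, (norm_nonneg _).trans (hR' 0 0), fun δ hδ => ?_⟩
  obtain ⟨r, hr, hr'⟩ := Metric.uniformContinuousOn_iff.1
    (hK.uniformContinuousOn_of_continuous hc) δ hδ
  refine ⟨min (r / 2) 1, by positivity, fun t => ⟨(h.continuous_clampTime hT).comp (by fun_prop),
    hper t, hR' t, fun x y hxy => ?_⟩⟩
  obtain ⟨v, hv, hx⟩ := hred x
  have e1 := (hper t).lattice hv x
  have e2 := (hper t).lattice hv y
  rw [← e1, ← e2]
  have hxy1 : ‖x - y‖ ≤ 1 := hxy.trans (min_le_right _ _)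
  have hxy2 : ‖x - y‖ ≤ r / 2 := hxy.trans (min_le_left _ _)
  have hy : ‖y + v‖ ≤ Real.sqrt d + 1 := by
    calc ‖y + v‖ = ‖(x + v) - (x - y)‖ := by congr 1; abel
      _ ≤ ‖x + v‖ + ‖x - y‖ := norm_sub_le _ _
      _ ≤ _ := add_le_add hx hxy1
  have := hr' (max 0 (min t T), x + v)
    ⟨max_min_mem_Icc hT t, mem_closedBall_zero_iff.2 (by linarith)⟩ (max 0 (min t T), y + v)
    ⟨max_min_mem_Icc hT t, mem_closedBall_zero_iff.2 hy⟩ (by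
      rw [Prod.dist_eq, dist_self, dist_eq_norm, add_sub_add_right_eq_sub]
      exact max_lt hr (by linarith))
  rw [dist_eq_norm] at this
  exact this.le

end Background

section Conclusion

variable {d : ℕ} {p c₀ T : ℝ} {W : Mat d → ℝ}

/-- At the dyadic levels `l`, the tails `l^(p-1) (s - l/8)₊` add up to no more than a multiple of
`s^p`, so that their averages over `N` levels tend to zero. -/
theorem sum_dyadic_tail_le (hp : 2 ≤ p) {s : ℝ} (hs : 0 ≤ s) (n : ℕ) :
    ∑ j ∈ Finset.range n, ((2 : ℝ) ^ j) ^ (p - 1) * max (s - 2 ^ j / 8) 0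
      ≤ 2 * 8 ^ (p - 1) * s ^ p := by
  have hgeo : ∀ m : ℕ, ∑ j ∈ Finset.range m, ((2 : ℝ) ^ j) ^ (p - 1) ≤ ((2 : ℝ) ^ m) ^ (p - 1) := by
    intro m
    induction m with
    | zero => simp
    | succ m ih =>
      have h2 : (2 : ℝ) ≤ 2 ^ (p - 1) := by
        calc (2 : ℝ) = 2 ^ (1 : ℝ) := (Real.rpow_one 2).symm
          _ ≤ _ := Real.rpow_le_rpow_of_exponent_le (by norm_num) (by linarith)
      have h3 : (0 : ℝ) ≤ ((2 : ℝ) ^ m) ^ (p - 1) := by positivity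
      rw [Finset.sum_range_succ, pow_succ, Real.mul_rpow (by positivity) (by norm_num)]
      nlinarith
  induction n with
  | zero => simp; positivity
  | succ n ih =>
    -- The term of index `n` vanishes once `2 ^ n ≥ 8 s`; otherwise all tails are at most `s`, and
    -- the geometric sum of their weights is of order `(8 s) ^ (p - 1)`.
    rcases le_or_gt (8 * s) (2 ^ n) with h | h
    · rw [Finset.sum_range_succ, max_eq_right (by linarith), mul_zero, add_zero]
      exact ih
    · have hs0 : 0 < s := by
        have : (0 : ℝ) < 2 ^ n := by positivity
        linarith
      calc ∑ j ∈ Finset.range (n + 1), ((2 : ℝ) ^ j) ^ (p - 1) * max (s - 2 ^ j / 8) 0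
          ≤ ∑ j ∈ Finset.range (n + 1), ((2 : ℝ) ^ j) ^ (p - 1) * s :=
            Finset.sum_le_sum fun j _ => mul_le_mul_of_nonneg_left (max_le (by
              have : (0 : ℝ) < 2 ^ j := by positivity
              linarith) hs) (by positivity)
        _ = (∑ j ∈ Finset.range n, ((2 : ℝ) ^ j) ^ (p - 1) + ((2 : ℝ) ^ n) ^ (p - 1)) * s := by
            rw [← Finset.sum_mul, Finset.sum_range_succ]
        _ ≤ (2 * (8 * s) ^ (p - 1)) * s := by
            refine mul_le_mul_of_nonneg_right ?_ hs
            have h1 : ((2 : ℝ) ^ n) ^ (p - 1) ≤ (8 * s) ^ (p - 1) :=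
              Real.rpow_le_rpow (by positivity) h.le (by linarith)
            linarith [hgeo n]
        _ = 2 * 8 ^ (p - 1) * s ^ p := by
            have e : s ^ p = s ^ (p - 1) * s := by
              rw [← Real.rpow_add_one hs0.ne', sub_add_cancel]
            rw [Real.mul_rpow (by norm_num) hs, e]; ring

/-- The integrated form of the dyadic tail estimate: the weighted tails of a function over all
dyadic levels are controlled by its energy, independently of the number of levels. -/
theorem sum_dyadic_integral_tail_le {E : Type*} [NormedAddCommGroup E] (hp : 2 ≤ p)
    {f : Vec d → E} (hf : MemLp f (ENNReal.ofReal p) (volQ d)) {A : ℝ}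
    (hA : ∫ x, V p (f x) ^ 2 ∂(volQ d) ≤ A) (n : ℕ) :
    ∑ j ∈ Finset.range n, ((2 : ℝ) ^ j) ^ (p - 1) * ∫ x, max (‖f x‖ - 2 ^ j / 8) 0 ∂(volQ d)
      ≤ 2 * 8 ^ (p - 1) * A := by
  have hi := hf.integrable (one_le_ofReal hp)
  have hV := integrable_V_sq_of_memLp hp hf
  have hj : ∀ j : ℕ, Integrable (fun x => ((2 : ℝ) ^ j) ^ (p - 1) * max (‖f x‖ - 2 ^ j / 8) 0)
      (volQ d) := fun j =>
    ((hi.norm.sub (integrable_const ((2 : ℝ) ^ j / 8))).sup (integrable_const 0)).const_mul _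
  calc ∑ j ∈ Finset.range n, ((2 : ℝ) ^ j) ^ (p - 1) * ∫ x, max (‖f x‖ - 2 ^ j / 8) 0 ∂(volQ d)
      = ∫ x, ∑ j ∈ Finset.range n, ((2 : ℝ) ^ j) ^ (p - 1) * max (‖f x‖ - 2 ^ j / 8) 0 ∂(volQ d) := by
        rw [integral_finsetSum _ fun j _ => hj j]
        exact Finset.sum_congr rfl fun j _ => (integral_const_mul _ _).symm
    _ ≤ ∫ x, 2 * 8 ^ (p - 1) * V p (f x) ^ 2 ∂(volQ d) :=
        integral_mono (integrable_finsetSum _ fun j _ => hj j) (hV.const_mul _) fun x =>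
          (sum_dyadic_tail_le hp (norm_nonneg _) n).trans
            (mul_le_mul_of_nonneg_left (norm_rpow_le_V_sq p _) (by positivity))
    _ ≤ 2 * 8 ^ (p - 1) * A := by
        rw [integral_const_mul]
        exact mul_le_mul_of_nonneg_left hA (by positivity)

/-- The truncated Gårding inequality, averaged over dyadic levels: the concentration terms are
controlled by the energy divided by the number of levels. -/
theorem averaged_garding (hW : IsIntegrand p W) (hqc : QuasiconvexWith p c₀ W)
    (hc₀ : 0 < c₀) (hp : 2 ≤ p) {R : ℝ} (hR : 0 ≤ R) :
    ∃ δ : ℝ, 0 < δ ∧ ∀ r : ℝ, 0 < r → ∃ C₀ C : ℝ, 0 ≤ C₀ ∧ 0 ≤ C ∧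
      ∀ (Fb : Vec d → Mat d) (ub : Vec d → Vec d), IsBackground R r δ Fb →
        IsSobolev (ENNReal.ofReal p) ub Fb → ∫ x, ub x ∂(volQ d) = 0 →
      ∀ (A : ℝ) (u : Vec d → Vec d) (g : Vec d → Mat d), IsEnergySlice p A u g →
      ∀ N : ℕ, 0 < N →
        0 ≤ ∫ x, excess p c₀ W (Fb x) (g x - Fb x) * averagedCutoff N (g x) ∂(volQ d)
          + C₀ * ∫ x, V p (u x - ub x) ^ 2 ∂(volQ d) + C * A * (N : ℝ)⁻¹ := by
  obtain ⟨δ, hδ, key⟩ := truncated_garding hW hqc hc₀ hp hR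
  refine ⟨δ, hδ, fun r hr => ?_⟩
  obtain ⟨C₀, C, hC₀, hC, key⟩ := key r hr
  refine ⟨C₀, C * (4 * 8 ^ (p - 1)), hC₀, by positivity, fun Fb ub hFb hub hub0 A u g hug N hN => ?_⟩
  have hN' : (0 : ℝ) < N := Nat.cast_pos.2 hN
  have hgm := hug.sobolev.memLp_grad.1
  have iE : ∀ j : ℕ, Integrable (fun x => excess p c₀ W (Fb x) (g x - Fb x)
      * cutoff ((2 : ℝ) ^ j) (g x)) (volQ d) := fun j => by
    obtain ⟨M, hM0, hM⟩ := hW.abs_excess_le hp hc₀ hR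
    have i1 : Integrable (fun x => M * V p (g x - Fb x) ^ 2) (volQ d) :=
      (integrable_V_sq_of_memLp hp (hug.sobolev.memLp_grad.sub hub.memLp_grad)).const_mul M
    refine i1.mono' (((hW.continuous_excess hp).comp_aestronglyMeasurable
      (hFb.continuous.aestronglyMeasurable.prodMk
        (hgm.sub hFb.continuous.aestronglyMeasurable))).mul
      ((continuous_cutoff _).comp_aestronglyMeasurable hgm)) (ae_of_all _ fun x => ?_)
    rw [norm_mul]
    exact (mul_le_of_le_one_right (norm_nonneg _) (abs_cutoff_le_one _ _)).trans
      (hM _ _ (hFb.bound x))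
  have hE : ∫ x, excess p c₀ W (Fb x) (g x - Fb x) * averagedCutoff N (g x) ∂(volQ d)
      = (N : ℝ)⁻¹ * ∑ j ∈ Finset.range N,
        ∫ x, excess p c₀ W (Fb x) (g x - Fb x) * cutoff ((2 : ℝ) ^ j) (g x) ∂(volQ d) := by
    rw [← integral_finsetSum _ fun j _ => iE j, ← integral_const_mul]
    refine integral_congr_ae (ae_of_all _ fun x => ?_)
    simp only [averagedCutoff, ← Finset.mul_sum]
    ring
  have hsum := Finset.sum_nonneg fun j (_ : j ∈ Finset.range N) =>
    key Fb ub hFb hub hub0 u g hug.sobolev ((2 : ℝ) ^ j) (one_le_pow₀ (by norm_num))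
  simp only [Finset.sum_add_distrib, Finset.sum_const, Finset.card_range, nsmul_eq_mul, mul_add,
    mul_assoc, ← Finset.mul_sum] at hsum
  have t1 := sum_dyadic_integral_tail_le hp hug.sobolev.memLp hug.energy N
  have t2 := sum_dyadic_integral_tail_le hp hug.sobolev.memLp_grad hug.energy_grad N
  rw [hE]
  set S := ∑ j ∈ Finset.range N,
    ∫ x, excess p c₀ W (Fb x) (g x - Fb x) * cutoff ((2 : ℝ) ^ j) (g x) ∂(volQ d)
  set D := ∫ x, V p (u x - ub x) ^ 2 ∂(volQ d)
  have h3 : 0 ≤ S + N * (C₀ * D) + C * (4 * 8 ^ (p - 1)) * A := by nlinarith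
  calc 0 ≤ (N : ℝ)⁻¹ * (S + N * (C₀ * D) + C * (4 * 8 ^ (p - 1)) * A) := by positivity
    _ = _ := by field_simp

/-- A lower bound, valid for every member of a bounded sequence, passes to the weak limit; the lower
bound itself need not be measurable. -/
theorem ae_le_of_tendsto_setIntegral {α : Type*} [MeasurableSpace α] {μ : Measure α}
    [IsFiniteMeasure μ] {f : ℕ → α → ℝ} {g h : α → ℝ} {B : ℝ}
    (hf : ∀ k, AEStronglyMeasurable (f k) μ) (hB : ∀ᵐ t ∂μ, ∀ k, |f k t| ≤ B)
    (hg : Integrable g μ) (hlim : ∀ S, MeasurableSet S →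
      Tendsto (fun k => ∫ t in S, f k t ∂μ) atTop (𝓝 (∫ t in S, g t ∂μ)))
    (hle : ∀ᵐ t ∂μ, ∀ k, h t ≤ f k t) : ∀ᵐ t ∂μ, h t ≤ g t := by
  -- the infimum over `k` is a measurable function between `h` and every `f k`
  set m : α → ℝ := fun t => ⨅ k, f k t with hm
  have hbdd : ∀ t, (∀ k, |f k t| ≤ B) → BddBelow (range fun k => f k t) := fun t ht =>
    ⟨-B, by rintro _ ⟨k, rfl⟩; exact (abs_le.1 (ht k)).1⟩
  have hmm : AEMeasurable m μ := AEMeasurable.iInf fun k => (hf k).aemeasurable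
  have him : Integrable m μ := by
    refine Integrable.of_bound hmm.aestronglyMeasurable B (hB.mono fun t ht => ?_)
    exact abs_le.2 ⟨le_ciInf fun k => (abs_le.1 (ht k)).1,
      (ciInf_le (hbdd t ht) 0).trans (abs_le.1 (ht 0)).2⟩
  have hif : ∀ k, Integrable (f k) μ := fun k =>
    Integrable.of_bound (hf k) B (hB.mono fun t ht => ht k)
  have hmg : m ≤ᵐ[μ] g := ae_le_of_forall_setIntegral_le him hg fun S hS _ =>
    ge_of_tendsto (hlim S hS) (Eventually.of_forall fun k =>
      integral_mono_ae him.integrableOn (hif k).integrableOn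
        (ae_restrict_of_ae (hB.mono fun t ht => ciInf_le (hbdd t ht) k)))
  filter_upwards [hmg, hle] with t h1 h2
  exact (le_ciInf h2).trans h1

variable {ybar : ℝ → Vec d → Vec d} {Fbar : ℝ → Vec d → Mat d}
  {yk : ℕ → ℝ → Vec d → Vec d} {F : ℕ → ℝ → Vec d → Mat d} {ν : ℝ → Vec d → Measure (Mat d)}
  {y : ℝ → Vec d → Vec d}

/-- The distance of the sequence to its strong limit is measurable and bounded in time. -/
theorem energy_sub_potential (hp : 2 ≤ p) (hF : IsBddGradientSeq p T yk F)
    (hν : Generates p T F ν) (hy : IsCentreOfMassPotential p T ν y) :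
    (∀ k, AEStronglyMeasurable (fun t => ∫ x, V p (yk k t x - y t x) ^ 2 ∂(volQ d)) (volT T)) ∧
      ∃ B : ℝ, ∀ᵐ t ∂(volT T), ∀ k, ∫ x, V p (yk k t x - y t x) ^ 2 ∂(volQ d) ≤ B := by
  obtain ⟨A, hA0, hA⟩ := hF.exists_energy_bound hp
  refine ⟨fun k => ?_, 2 ^ p * (A + 2 ^ p * A), ?_⟩
  · have h1 : AEStronglyMeasurable (fun z : ℝ × Vec d => V p (yk k z.1 z.2 - y z.1 z.2) ^ 2)
        (volQT d T) := (continuous_V_sq hp).comp_aestronglyMeasurable ((hF.meas k).sub hy.meas)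
    rw [volQT] at h1
    exact h1.integral_prod_right'
  · filter_upwards [hA, hy.sobolev, ae_tendsto_of_potential hp hF hν hy] with t h1 h2 h3 k
    have iy := integrable_V_sq_of_memLp hp h2.memLp
    have ik := fun k => (h1 k).integrable_V_sq hp
    have id' : ∀ k, Integrable (fun x => V p (yk k t x - y t x) ^ 2) (volQ d) := fun k =>
      integrable_V_sq_of_memLp hp ((h1 k).sobolev.memLp.sub h2.memLp)
    have h4 : ∫ x, V p (y t x) ^ 2 ∂(volQ d) ≤ 2 ^ p * A := by
      have h5 : Tendsto (fun k => 2 ^ p * (A + ∫ x, V p (yk k t x - y t x) ^ 2 ∂(volQ d))) atTop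
          (𝓝 (2 ^ p * (A + 0))) := (h3.const_add A).const_mul _
      rw [add_zero] at h5
      refine ge_of_tendsto h5 (Eventually.of_forall fun k => ?_)
      calc ∫ x, V p (y t x) ^ 2 ∂(volQ d)
          ≤ ∫ x, 2 ^ p * (V p (yk k t x) ^ 2 + V p (yk k t x - y t x) ^ 2) ∂(volQ d) :=
            integral_mono iy (((ik k).add (id' k)).const_mul _) fun x => by
              have := V_sq_sub_le hp (yk k t x) (yk k t x - y t x)
              rwa [sub_sub_cancel] at this
        _ ≤ _ := by
            rw [integral_const_mul, integral_add (ik k) (id' k)]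
            exact mul_le_mul_of_nonneg_left (add_le_add_left (h1 k).energy _) (by positivity)
    calc ∫ x, V p (yk k t x - y t x) ^ 2 ∂(volQ d)
        ≤ ∫ x, 2 ^ p * (V p (yk k t x) ^ 2 + V p (y t x) ^ 2) ∂(volQ d) :=
          integral_mono (id' k) (((ik k).add iy).const_mul _) fun x => V_sq_sub_le hp _ _
      _ ≤ _ := by
          rw [integral_const_mul, integral_add (ik k) iy]
          exact mul_le_mul_of_nonneg_left (add_le_add (h1 k).energy h4) (by positivity)

/-- A function of growth `V(ξ - F)²` has growth `1 + |ξ|^p`, locally uniformly in `F`. -/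
theorem V_sq_sub_le_one_add (hp : 2 ≤ p) {R : ℝ} {F : Mat d} (hF : ‖F‖ ≤ R)
    (ξ : Mat d) : V p (ξ - F) ^ 2 ≤ 2 ^ p * (2 + V p R ^ 2) * (1 + ‖ξ‖ ^ p) := by
  have h1 : V p F ^ 2 ≤ V p R ^ 2 := V_sq_mono hp (hF.trans (le_abs_self R))
  have h2 : V p ξ ^ 2 + V p F ^ 2 ≤ (2 + V p R ^ 2) * (1 + ‖ξ‖ ^ p) := by
    have h3 := V_sq_le hp ξ
    have h4 : 0 ≤ V p R ^ 2 * ‖ξ‖ ^ p := mul_nonneg (sq_nonneg _) (by positivity)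
    linarith
  calc V p (ξ - F) ^ 2 ≤ 2 ^ p * (V p ξ ^ 2 + V p F ^ 2) := V_sq_sub_le hp _ _
    _ ≤ 2 ^ p * ((2 + V p R ^ 2) * (1 + ‖ξ‖ ^ p)) := mul_le_mul_of_nonneg_left h2 (by positivity)
    _ = _ := by ring

theorem continuous_comp_sub {H : Mat d → Mat d → ℝ}
    (hH : Continuous fun q : Mat d × Mat d => H q.1 q.2) :
    Continuous fun q : Mat d × Mat d => H q.1 (q.2 - q.1) :=
  hH.comp (by fun_prop : Continuous fun q : Mat d × Mat d => (q.1, q.2 - q.1))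

/-- The Gårding inequality for the Young measure, tested with truncated integrands. -/
theorem garding_truncated_youngMeasure (hW : IsIntegrand p W) (hp : 2 ≤ p) {R r δ C₀ C : ℝ}
    (hC₀ : 0 ≤ C₀)
    (key : ∀ (Fb : Vec d → Mat d) (ub : Vec d → Vec d), IsBackground R r δ Fb →
        IsSobolev (ENNReal.ofReal p) ub Fb → ∫ x, ub x ∂(volQ d) = 0 →
      ∀ (A : ℝ) (u : Vec d → Vec d) (g : Vec d → Mat d), IsEnergySlice p A u g →
      ∀ N : ℕ, 0 < N →
        0 ≤ ∫ x, excess p c₀ W (Fb x) (g x - Fb x) * averagedCutoff N (g x) ∂(volQ d)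
          + C₀ * ∫ x, V p (u x - ub x) ^ 2 ∂(volQ d) + C * A * (N : ℝ)⁻¹)
    (hT : 0 < T) (hbar : IsContinuousGradient p T ybar Fbar)
    (hback : ∀ t, IsBackground R r δ fun x => clampTime T Fbar (t, x))
    (hF : IsBddGradientSeq p T yk F) (hYM : IsYoungMeasure T ν)
    (hν : Generates p T F ν) (hy : IsCentreOfMassPotential p T ν y) {A : ℝ}
    (hA : ∀ᵐ t ∂(volT T), ∀ k, IsEnergySlice p A (yk k t) (F k t)) {N : ℕ} (hN : 0 < N) :
    ∀ᵐ t ∂(volT T),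
      -(C₀ * 2 ^ p * ∫ x, V p (y t x - ybar t x) ^ 2 ∂(volQ d) + C * A * (N : ℝ)⁻¹)
        ≤ ∫ x, (∫ ξ, excess p c₀ W (clampTime T Fbar (t, x)) (ξ - clampTime T Fbar (t, x))
          * averagedCutoff N ξ ∂(ν t x)) ∂(volQ d) := by
  set B : ℝ × Vec d → Mat d := clampTime T Fbar with hB
  set Ψ : Mat d → Mat d → ℝ := fun F ξ => excess p c₀ W F (ξ - F) * averagedCutoff N ξ with hΨ
  have hΨt : IsTruncated (2 * 2 ^ N) Ψ :=
    isTruncated_mul_averagedCutoff (continuous_comp_sub (hW.continuous_excess hp)) N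
  have hBm : Measurable B := (hbar.continuous_clampTime hT).measurable
  have hBR : ∀ z, ‖B z‖ ≤ R := fun z => (hback z.1).bound z.2
  obtain ⟨M, hM0, hM⟩ := hΨt.exists_bound R
  set e : ℕ → ℝ → ℝ := fun k t => ∫ x, V p (yk k t x - y t x) ^ 2 ∂(volQ d) with he
  obtain ⟨hem, B', hB'⟩ := energy_sub_potential hp hF hν hy
  have he0 : ∀ k t, 0 ≤ e k t := fun k t => integral_nonneg fun x => sq_nonneg _
  have hie : ∀ k, Integrable (e k) (volT T) := fun k =>
    Integrable.of_bound (hem k) B' (hB'.mono fun t ht => by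
      rw [Real.norm_of_nonneg (he0 k t)]; exact ht k)
  have hiΨ : ∀ k, Integrable (fun z : ℝ × Vec d => Ψ (B z) (F k z.1 z.2))
      ((volT T).prod (volQ d)) := fun k => integrable_truncated_comp hΨt hBm hBR (hF.meas_grad k)
  have hiν : Integrable (fun z : ℝ × Vec d => ∫ ξ, Ψ (B z) ξ ∂(ν z.1 z.2))
      ((volT T).prod (volQ d)) := integrable_integral_truncated hp hYM hν hΨt hBm hBR
  set I : ℕ → ℝ → ℝ := fun k t => ∫ x, Ψ (B (t, x)) (F k t x) ∂(volQ d) with hI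
  have hiI : ∀ k, Integrable (I k) (volT T) := fun k => (hiΨ k).integral_prod_left
  -- The inequality holds for every member of the sequence with `yk - ybar` in place of `y - ybar`;
  -- the difference is estimated by `e k`, which tends to zero.
  refine ae_le_of_tendsto_setIntegral (f := fun k t => I k t + C₀ * 2 ^ p * e k t)
    (B := M + C₀ * 2 ^ p * B') (fun k => ((hiI k).add ((hie k).const_mul _)).1) ?_
    hiν.integral_prod_left ?_ ?_
  · filter_upwards [hB'] with t ht k
    have h1 : |I k t| ≤ M := by
      have := norm_integral_le_of_norm_le_const (μ := volQ d) (C := M)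
        (f := fun x => Ψ (B (t, x)) (F k t x)) (ae_of_all _ fun x => hM (B (t, x)) (F k t x) (hBR _))
      simpa [hI] using this
    have h2 : |C₀ * 2 ^ p * e k t| ≤ C₀ * 2 ^ p * B' := by
      rw [abs_of_nonneg (mul_nonneg (by positivity) (he0 k t))]
      exact mul_le_mul_of_nonneg_left (ht k) (by positivity)
    exact (abs_add_le _ _).trans (add_le_add h1 h2)
  · intro S hS
    have h1 := tendsto_integral_truncated hp hYM hν hF.meas_grad hΨt hBm hBR
      (hS.prod MeasurableSet.univ)
    have e1 : ∀ k, ∫ z in S ×ˢ univ, Ψ (B z) (F k z.1 z.2) ∂(volQT d T)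
        = ∫ t in S, I k t ∂(volT T) := fun k => by
      have := setIntegral_prod (μ := volT T) (ν := volQ d) (s := S) (t := univ) _
        (hiΨ k).integrableOn
      rwa [Measure.restrict_univ] at this
    have e2 : ∫ z in S ×ˢ univ, (∫ ξ, Ψ (B z) ξ ∂(ν z.1 z.2)) ∂(volQT d T)
        = ∫ t in S, (∫ x, (∫ ξ, Ψ (B (t, x)) ξ ∂(ν t x)) ∂(volQ d)) ∂(volT T) := by
      have := setIntegral_prod (μ := volT T) (ν := volQ d) (s := S) (t := univ) _
        hiν.integrableOn
      rwa [Measure.restrict_univ] at this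
    simp only [e1] at h1
    rw [e2] at h1
    have h2 : Tendsto (fun k => ∫ t in S, e k t ∂(volT T)) atTop (𝓝 (∫ _t in S, 0 ∂(volT T))) := by
      refine tendsto_integral_of_dominated_convergence (fun _ => B')
        (fun k => (hem k).restrict) (integrable_const _) (fun k => ?_) ?_
      · exact ae_restrict_of_ae (hB'.mono fun t ht => by
          rw [Real.norm_of_nonneg (he0 k t)]; exact ht k)
      · exact ae_restrict_of_ae (ae_tendsto_of_potential hp hF hν hy)
    have h3 := h1.add (h2.const_mul (C₀ * 2 ^ p))
    rw [integral_zero, mul_zero, add_zero] at h3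
    refine h3.congr fun k => ?_
    rw [integral_add (hiI k).integrableOn ((hie k).const_mul _).integrableOn, integral_const_mul]
  · have hmem : ∀ᵐ t ∂(volT T), t ∈ Ioo 0 T := ae_restrict_mem measurableSet_Ioo
    filter_upwards [hA, hmem, hy.sobolev] with t h1 ht h2 k
    have hcl : (fun x => B (t, x)) = Fbar t := funext fun x => clampTime_of_mem ht x
    have htI : t ∈ Icc 0 T := Ioo_subset_Icc_self ht
    have hs : IsSobolev (ENNReal.ofReal p) (ybar t) fun x => B (t, x) := by
      rw [hcl]; exact hbar.sobolev t htI
    have h3 := key _ (ybar t) (hback t) hs (hbar.zero_mean t htI) A (yk k t) (F k t) (h1 k) N hN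
    have i1 : Integrable (fun x => V p (yk k t x - y t x) ^ 2) (volQ d) :=
      integrable_V_sq_of_memLp hp ((h1 k).sobolev.memLp.sub h2.memLp)
    have i2 : Integrable (fun x => V p (y t x - ybar t x) ^ 2) (volQ d) :=
      integrable_V_sq_of_memLp hp (h2.memLp.sub hs.memLp)
    have h4 : ∫ x, V p (yk k t x - ybar t x) ^ 2 ∂(volQ d)
        ≤ 2 ^ p * (e k t + ∫ x, V p (y t x - ybar t x) ^ 2 ∂(volQ d)) := by
      calc ∫ x, V p (yk k t x - ybar t x) ^ 2 ∂(volQ d)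
          ≤ ∫ x, 2 ^ p * (V p (yk k t x - y t x) ^ 2 + V p (y t x - ybar t x) ^ 2) ∂(volQ d) :=
            integral_mono (integrable_V_sq_of_memLp hp ((h1 k).sobolev.memLp.sub hs.memLp))
              ((i1.add i2).const_mul _) fun x => by
                have := V_sq_add_le hp (yk k t x - y t x) (y t x - ybar t x)
                rwa [sub_add_sub_cancel] at this
        _ = _ := by rw [integral_const_mul, integral_add i1 i2]
    have h5 := mul_le_mul_of_nonneg_left h4 hC₀
    have h6 : (∫ x, excess p c₀ W (B (t, x)) (F k t x - B (t, x)) * averagedCutoff N (F k t x)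
        ∂(volQ d)) = I k t := rfl
    rw [h6] at h3
    linarith

/-- The Gårding inequality for Young measures. At a fixed number `N` of dyadic levels the averaged
inequality holds for almost every time with an error `O(1/N)`; as `N → ∞` the truncation and the
error disappear. -/
theorem exists_gardingBoundAt (hW : IsIntegrand p W) (hqc : QuasiconvexWith p c₀ W)
    (hc₀ : 0 < c₀) (hp : 2 ≤ p) (hT : 0 < T) (hbar : IsContinuousGradient p T ybar Fbar) :
    ∃ C₁ C₀ : ℝ, 0 < C₁ ∧ 0 < C₀ ∧
      ∀ (ν : ℝ → Vec d → Measure (Mat d)) (yk : ℕ → ℝ → Vec d → Vec d)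
        (F : ℕ → ℝ → Vec d → Mat d), IsYoungMeasure T ν → IsBddGradientSeq p T yk F →
        Generates p T F ν → ∀ y, IsCentreOfMassPotential p T ν y →
          ∀ᵐ t ∂(volT T), GardingBoundAt p W ybar Fbar ν y C₁ C₀ t := by
  obtain ⟨R, hR0, hR⟩ := hbar.exists_isBackground hT
  obtain ⟨δ, hδ, key⟩ := averaged_garding hW hqc hc₀ hp hR0
  obtain ⟨r, hr, hback⟩ := hR δ hδ
  obtain ⟨C₀, C, hC₀, hC, key⟩ := key r hr
  obtain ⟨M, hM0, hM⟩ := hW.abs_G_le hp hR0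
  -- `+ 1` only makes the constant positive
  refine ⟨2 / c₀, C₀ * 2 ^ p + 1, by positivity, by positivity, fun ν yk F hYM hF hν y hy => ?_⟩
  obtain ⟨A, hA0, hA⟩ := hF.exists_energy_bound hp
  set B : ℝ × Vec d → Mat d := clampTime T Fbar with hB
  have hBm : Measurable B := (hbar.continuous_clampTime hT).measurable
  have hBR : ∀ z, ‖B z‖ ≤ R := fun z => (hback z.1).bound z.2
  have hVc : Continuous fun q : Mat d × Mat d => V p (q.2 - q.1) ^ 2 :=
    (continuous_V_sq hp).comp (continuous_snd.sub continuous_fst)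
  set K : ℝ := 2 ^ p * (2 + V p R ^ 2) with hK
  have hGK : ∀ F ξ : Mat d, ‖F‖ ≤ R → |G W F (ξ - F)| ≤ M * K * (1 + ‖ξ‖ ^ p) :=
    fun F ξ hF => (hM F _ hF).trans <| by
      rw [mul_assoc]; exact mul_le_mul_of_nonneg_left (V_sq_sub_le_one_add hp hF ξ) hM0
  have hVK : ∀ F ξ : Mat d, ‖F‖ ≤ R → |V p (ξ - F) ^ 2| ≤ K * (1 + ‖ξ‖ ^ p) :=
    fun F ξ hF => by rw [abs_of_nonneg (sq_nonneg _)]; exact V_sq_sub_le_one_add hp hF ξ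
  obtain ⟨M', hM'0, hM'⟩ := hW.abs_excess_le hp hc₀ hR0
  have hEK : ∀ F ξ : Mat d, ‖F‖ ≤ R →
      |excess p c₀ W F (ξ - F)| ≤ M' * K * (1 + ‖ξ‖ ^ p) :=
    fun F ξ hF => (hM' F _ hF).trans <| by
      rw [mul_assoc]; exact mul_le_mul_of_nonneg_left (V_sq_sub_le_one_add hp hF ξ) hM'0
  have aG := integrable_and_tendsto_truncated (Φ := fun F ξ => G W F (ξ - F)) hp hF hYM hν
    (continuous_comp_sub hW.continuous_G) hGK hBm hBR
  have aV := integrable_and_tendsto_truncated (Φ := fun F ξ => V p (ξ - F) ^ 2) hp hF hYM hν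
    hVc hVK hBm hBR
  have aE := integrable_and_tendsto_truncated (Φ := fun F ξ => excess p c₀ W F (ξ - F)) hp hF hYM
    hν (continuous_comp_sub (hW.continuous_excess hp)) hEK hBm hBR
  have aN : ∀ᵐ t ∂(volT T), ∀ N : ℕ,
      -(C₀ * 2 ^ p * ∫ x, V p (y t x - ybar t x) ^ 2 ∂(volQ d) + C * A * ((N + 1 : ℕ) : ℝ)⁻¹)
        ≤ ∫ x, (∫ ξ, excess p c₀ W (B (t, x)) (ξ - B (t, x))
          * averagedCutoff (N + 1) ξ ∂(ν t x)) ∂(volQ d) :=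
    ae_all_iff.2 fun N => garding_truncated_youngMeasure hW hp hC₀ key hT hbar hback hF hYM hν hy
      hA N.succ_pos
  have hmem : ∀ᵐ t ∂(volT T), t ∈ Ioo 0 T := ae_restrict_mem measurableSet_Ioo
  filter_upwards [aG, aV, aE, aN, hmem, hy.sobolev] with t hG hV hE hN ht hs
  have hcl : ∀ x, B (t, x) = Fbar t x := clampTime_of_mem ht
  simp only [hcl] at hG hV hE hN
  have iy := integrable_V_sq_of_memLp hp
    (hs.memLp.sub (hbar.sobolev t (Ioo_subset_Icc_self ht)).memLp)
  refine ⟨hV.1, hV.2.1, hG.1, hG.2.1, iy, ?_⟩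
  have l1 := (tendsto_add_atTop_iff_nat 1).2 hE.2.2
  have l2 : Tendsto (fun N : ℕ => ((N + 1 : ℕ) : ℝ)⁻¹) atTop (𝓝 0) :=
    (tendsto_add_atTop_iff_nat 1).2 tendsto_inv_atTop_nhds_zero_nat
  have l3 := ((l2.const_mul (C * A)).const_add
    (C₀ * 2 ^ p * ∫ x, V p (y t x - ybar t x) ^ 2 ∂(volQ d))).neg
  rw [mul_zero, add_zero] at l3
  -- the limit `N → ∞`
  have h1 := le_of_tendsto_of_tendsto' l3 l1 hN
  have h2 : ∫ x, (∫ ξ, excess p c₀ W (Fbar t x) (ξ - Fbar t x) ∂(ν t x)) ∂(volQ d)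
      = 2 / c₀ * ∫ x, (∫ ξ, G W (Fbar t x) (ξ - Fbar t x) ∂(ν t x)) ∂(volQ d)
        - ∫ x, (∫ ξ, V p (ξ - Fbar t x) ^ 2 ∂(ν t x)) ∂(volQ d) := by
    rw [← integral_const_mul, ← integral_sub (hG.2.1.const_mul _) hV.2.1]
    refine integral_congr_ae ?_
    filter_upwards [hG.1, hV.1] with x hx1 hx2
    rw [← integral_const_mul, ← integral_sub (hx1.const_mul _) hx2]
    rfl
  have h3 : 0 ≤ ∫ x, V p (y t x - ybar t x) ^ 2 ∂(volQ d) := integral_nonneg fun x => sq_nonneg _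
  linarith

end Conclusion

end QCGarding

end

theorem theorem2 (d : ℕ) (hd : 1 ≤ d) (p : ℝ) (hp : 2 ≤ p) (T : ℝ) (hT : 0 < T)
    (W : QCGarding.Mat d → ℝ) (hW : ContDiff ℝ 2 W)
    (hqc : QCGarding.StronglyQuasiconvex p W)
    (hgrowth : ∃ c : ℝ, ∀ ξ, |W ξ| ≤ c * (1 + ‖ξ‖ ^ p))
    (ybar : ℝ → QCGarding.Vec d → QCGarding.Vec d)
    (Fbar : ℝ → QCGarding.Vec d → QCGarding.Mat d)
    (hbar : QCGarding.IsContinuousGradient p T ybar Fbar) :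
    ∃ C₁ C₀ : ℝ, 0 < C₁ ∧ 0 < C₀ ∧
      ∀ (ν : ℝ → QCGarding.Vec d → MeasureTheory.Measure (QCGarding.Mat d))
        (yk : ℕ → ℝ → QCGarding.Vec d → QCGarding.Vec d)
        (Fk : ℕ → ℝ → QCGarding.Vec d → QCGarding.Mat d),
        QCGarding.IsYoungMeasure T ν →
        QCGarding.IsBddGradientSeq p T yk Fk →
        QCGarding.Generates p T Fk ν →
        (∃ y, QCGarding.IsCentreOfMassPotential p T ν y) ∧
        ∀ y, QCGarding.IsCentreOfMassPotential p T ν y →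
          ∀ᵐ t₀ ∂(MeasureTheory.volume.restrict (Set.Ioo 0 T)),
            QCGarding.GardingBoundAt p W ybar Fbar ν y C₁ C₀ t₀ := by
  obtain ⟨c₀, hc₀, hqc⟩ := hqc
  obtain ⟨c, hc⟩ := hgrowth
  have hW' : QCGarding.IsIntegrand p W :=
    ⟨hW, ⟨max c 0, le_max_right _ _, fun ξ => (hc ξ).trans
      (mul_le_mul_of_nonneg_right (le_max_left _ _) (by positivity))⟩,
      QCGarding.QuasiconvexWith.convexOn_line hc₀ hp hW.continuous hqc⟩
  obtain ⟨C₁, C₀, hC₁, hC₀, h⟩ := QCGarding.exists_gardingBoundAt hW' hqc hc₀ hp hT hbar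
  exact ⟨C₁, C₀, hC₁, hC₀, fun ν yk Fk hYM hF hν =>
    ⟨QCGarding.exists_potential hp hF hν, h ν yk Fk hYM hF hν⟩⟩
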